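/- **Setting.** Let $0<r_0<r_w$, $A>0$, $\gamma>1$, $\varepsilon>0$, $\delta>0$. Let $p\in C^{2,1}([0,r_0])$ be an admissible pressure: $p\ge 0$ on $[0,r_0]$ with $p(r)=0$ iff $r=r_0$; $-\int_0^r x^2p'(x)\,dx\ge 0$ on $[0,r_0]$; $p'\le 0$ near $r_0$; and $\lim_{r\to r_0^-}p/p'=0$. Put $B_\theta(r)=\big(-\tfrac{2}{r^2}\int_0^r x^2p'(x)\,dx\big)^{1/2}$, $\widehat B_\theta(r)=B_\theta(r_0)r_0/r$, $\rho=(p/A)^{1/\gamma}$. For $m,k\in\mathbb Z$, viscosities $a,b\ge0$ and real functions $(\xi,\eta,\zeta)$ on $(0,r_0)$ let $$D^{a,b}=\int_0^{r_0}\Big\{a\Big[\tfrac29\big(-2\xi'+\tfrac{\xi}{r}+\tfrac{m\zeta}{r}-k\eta\big)^2+\tfrac29\big(\xi'-\tfrac{2\xi}{r}-\tfrac{2m\zeta}{r}-k\eta\big)^2+\tfrac29\big(\xi'+\tfrac{\xi}{r}+\tfrac{m\zeta}{r}+2k\eta\big)^2+\big(-\zeta'+\tfrac{\zeta}{r}+\tfrac{m\xi}{r}\big)^2+(\eta'+k\xi)^2+\big(\tfrac{m\eta}{r}-k\zeta\big)^2\Big]+b\big(\xi'+\tfrac{\xi}{r}+\tfrac{m\zeta}{r}-k\eta\big)^2\Big\}r\,dr,$$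 $\mathcal J=2\pi^2\int_0^{r_0}\rho(\xi^2+\eta^2+\zeta^2)\,r\,dr$, and let $X_k$ (for $m=0$), resp. $Y_{m,k}$ (for $m\ne0$), be the completion of $\{(\xi,\eta,\zeta)\in C^\infty([0,r_0])^3:\xi(0)=\zeta(0)=0\}$, resp. of the same set with also $\eta(0)=0$, in the norm whose square is $D^{1,1}$ with the factors $\tfrac29$ replaced by $1$, plus $\int_0^{r_0}\rho(\xi^2+\eta^2+\zeta^2)\,r\,dr$. For $s>0$ set $$E_{0,k}(\cdot;s)=2\pi^2\int_0^{r_0}\Big\{\tfrac{2p'\xi^2}{r}+B_\theta^2\big[k\eta-\tfrac1r((r\xi)'-2\xi)\big]^2+\gamma p\big[\tfrac1r(r\xi)'-k\eta\big]^2\Big\}r\,dr+2\pi^2D^{s\varepsilon,s\delta},$$ and, for $m\neq0$, $$\begin{aligned}E_{m,k}(\cdot,\widehat Q_r;s)=\;&2\pi^2\int_0^{r_0}\Big\{(m^2+k^2r^2)\Big[\tfrac{B_\theta}{r}\eta+\tfrac{-kB_\theta(r\xi)'+2kB_\theta\xi}{m^2+k^2r^2}\Big]^2+\gamma p\big[\tfrac1r(r\xi)'-k\eta+\tfrac{m\zeta}{r}\big]^2\Big\}r\,dr+2\pi^2D^{s\varepsilon,s\delta}\\&+2\pi^2\int_0^{r_0}\tfrac{m^2B_\theta^2}{r(m^2+k^2r^2)}(\xi-r\xi')^2dr+2\pi^2\int_0^{r_0}\big[2p'+\tfrac{m^2B_\theta^2}{r}\big]\xi^2dr\\&+2\pi^2\int_{r_0}^{r_w}\Big[\widehat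 Q_r^2+\tfrac{1}{m^2+k^2r^2}|(r\widehat Q_r)'|^2\Big]r\,dr.\end{aligned}$$ Let $\lambda(s)=\inf E_{0,k}(\cdot;s)/\mathcal J$ over the nonzero elements of $X_k$ if $m=0$; if $m\ne0$ let $\lambda(s)=\inf E_{m,k}(\cdot;s)$ over the set $\mathcal A_2$ of all $((\xi,\eta,\zeta),\widehat Q_r)\in Y_{m,k}\times H^1(r_0,r_w)$ with $\mathcal J=1$, $m\widehat B_\theta\xi=r\widehat Q_r$ at $r_0$ and $\widehat Q_r(r_w)=0$. **Original problem.** A *solution of the linearized viscous problem in the mode* $(m,k)$ is a classical solution $(\xi,\eta,\zeta)(t,r)$ on $(0,r_0]$ and $\widehat Q_r(t,r)$ on $[r_0,r_w]$, $C^2$ in $r$, of $L(\xi,\eta,\zeta)^T+V(\xi_t,\eta_t,\zeta_t)^T=\rho(\xi_{tt},\eta_{tt},\zeta_{tt})^T$ on $(0,r_0)$, where $$L=\begin{pmatrix}\frac{d}{dr}\frac{\gamma p+B_\theta^2}{r}\frac{d}{dr}r-\frac{m^2}{r^2}B_\theta^2-r\big(\frac{B_\theta^2}{r^2}\big)'&-\frac{d}{dr}k(\gamma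 p+B_\theta^2)-\frac{2kB_\theta^2}{r}&\frac{d}{dr}\frac mr\gamma p\\ \frac{k(\gamma p+B_\theta^2)}{r}\frac{d}{dr}r-\frac{2kB_\theta^2}{r}&-k^2(\gamma p+B_\theta^2)-\frac{m^2}{r^2}B_\theta^2&\frac{mk}{r}\gamma p\\-\frac{m\gamma p}{r^2}\frac{d}{dr}r&\frac{mk}{r}\gamma p&-\frac{m^2}{r^2}\gamma p\end{pmatrix},$$ and $V$ has the entries, with $\kappa=\frac{4\varepsilon}3+\delta$ and $\sigma=\frac\varepsilon3+\delta$: $V_{11}=\kappa\frac{d^2}{dr^2}+\kappa\frac d{dr}\frac1r-\varepsilon(\frac{m^2}{r^2}+k^2)$, $V_{12}=-\sigma k\frac d{dr}$, $V_{13}=\sigma\frac d{dr}\frac mr-\frac{2\varepsilon m}{r^2}$, $V_{21}=\sigma k\frac d{dr}+\sigma\frac kr$, $V_{22}=\varepsilon\frac{d^2}{dr^2}+\frac\varepsilon r\frac d{dr}-\varepsilon\frac{m^2}{r^2}-\kappa k^2$, $V_{23}=V_{32}=\sigma\frac{mk}r$, $V_{31}=-\sigma\frac mr\frac d{dr}-(\frac{7\varepsilon}3+\delta)\frac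 m{r^2}$, $V_{33}=\varepsilon\frac{d^2}{dr^2}+\varepsilon\frac d{dr}\frac1r-\kappa\frac{m^2}{r^2}-\varepsilon k^2$; of $\big[\frac{r}{m^2+k^2r^2}(r\widehat Q_r)'\big]'=\widehat Q_r$ on $(r_0,r_w)$; of $\widehat Q_r(r_w)=0$; and, at $r=r_0$, of $m\widehat B_\theta\xi=r\widehat Q_r$, $\ \varepsilon(-\zeta_t'r+m\xi_t+\zeta_t)=0$, $\ \varepsilon(\eta_t'r+k\xi_tr)=0$ and $$B_\theta^2\xi-B_\theta^2\xi'r+kB_\theta^2\eta r-\widehat B_\theta\widehat Q_\theta r-2\varepsilon\xi_t'r-(\delta-\tfrac23\varepsilon)\big(\xi_t'r+\xi_t+m\zeta_t-k\eta_tr\big)=0,\qquad \widehat Q_\theta=-\tfrac{m}{m^2+k^2r^2}(r\widehat Q_r)'.$$ **Statement.** Let $\mathcal S=\{s>0:\lambda(s)<0\}$ and $\mu(s)=\sqrt{-\lambda(s)}$ for $s\in\mathcal S$. 1. Let $m=0$ and $k\neq0$. Then $\lambda(s)$ is finite for every $s>0$; $\lambda$ is locally Lipschitz (hence continuous) and strictly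 increasing on $(0,\infty)$; there are $C_2>0$ and $C$ with $\lambda(s)\ge -C+C_2s$ for all $s>0$; and there is a unique $s\in\mathcal S$ with $s=\mu(s)$. 2. Let $m\neq0$ and $k\in\mathbb Z$. Then $\lambda(s)$ is finite for every $s>0$; $\lambda$ is locally Lipschitz (hence continuous) and strictly increasing on $(0,\infty)$; if $(|m|,k)\ne(1,0)$ there are $C_3>0$ and $C$ with $\lambda(s)\ge -C+C_3s$ for all $s>0$; and if $\mathcal S\neq\emptyset$, there is a unique $s\in\mathcal S$ with $s=\mu(s)$. 3. Let $m\ne0$ and suppose $2p'(r^*)+m^2B_\theta^2(r^*)/r^*<0$ for some $r^*\in(0,r_0)$. Then there is $K$ such that for every $k\in\mathbb Z$ with $|k|\ge K$ there is a unique $s\in\mathcal S$ with $s=\mu(s)$. 4. In cases 1 and 2, if $s\in\mathcal S$ and $s=\mu(s)$, there is $(\xi,\eta,\zeta)\in X_k$ with $\mathcal J=1$ and $E_{0,k}(\xi,\eta,\zeta;s)=\lambda(s)$ (with $\widehat Q_r=0$), resp. $((\xi,\eta,\zeta),\widehat Q_r)\in\mathcal A_2$ with $E_{m,k}(\xi,\eta,\zeta,\widehat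 Q_r;s)=\lambda(s)$, such that $e^{st}(\xi,\eta,\zeta)(r)$, $e^{st}\widehat Q_r(r)$ is a solution of the linearized viscous problem in the mode $(m,k)$, i.e. a growing mode with rate $\mu=s$. -/

import Mathlib

open Set Filter Topology MeasureTheory
open scoped ContDiff ENNReal

noncomputable section

namespace ZPinch

/-- The data of a viscous `z`-pinch: plasma radius `r₀`, wall radius `R`, entropy constant `A`,
adiabatic exponent `γ`, dynamic viscosity `ε`, bulk viscosity `δ`, equilibrium pressure `p`
(only its values on `[0, r₀]` matter). The conditions on them are in `Data.Admissible`. -/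
structure Data where
  r₀ : ℝ
  R : ℝ
  A : ℝ
  γ : ℝ
  ε : ℝ
  δ : ℝ
  p : ℝ → ℝ

/-- A displacement profile: the three real radial functions `(ξ, η, ζ)`. -/
structure Profile where
  ξ : ℝ → ℝ
  η : ℝ → ℝ
  ζ : ℝ → ℝ

namespace Profile

/-- Difference of two profiles. -/
def sub (u v : Profile) : Profile :=
  ⟨fun r => u.ξ r - v.ξ r, fun r => u.η r - v.η r, fun r => u.ζ r - v.ζ r⟩

/-- Multiple of a profile by a real number. -/
def scale (c : ℝ) (u : Profile) : Profile :=
  ⟨fun r => c * u.ξ r, fun r => c * u.η r, fun r => c * u.ζ r⟩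

/-- Time derivative, at fixed radius, of a time dependent profile. -/
def dt (u : ℝ → Profile) (t : ℝ) : Profile :=
  ⟨fun r => deriv (fun τ => (u τ).ξ r) t, fun r => deriv (fun τ => (u τ).η r) t,
    fun r => deriv (fun τ => (u τ).ζ r) t⟩

end Profile

namespace Data

/-! ### The equilibrium -/

/-- `p'` on `[0, r₀]` (one-sided at the end points). -/
def dp (d : Data) (r : ℝ) : ℝ := derivWithin d.p (Icc 0 d.r₀) r

/-- The azimuthal magnetic field `B_θ(r) = (-(2/r²) ∫₀^r x² p'(x) dx)^{1/2}` of the plasma. -/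
def B (d : Data) (r : ℝ) : ℝ := √(-(2 / r ^ 2) * ∫ x in (0 : ℝ)..r, x ^ 2 * d.dp x)

/-- The azimuthal magnetic field `B̂_θ(r) = B_θ(r₀) r₀ / r` of the vacuum. -/
def Bhat (d : Data) (r : ℝ) : ℝ := d.B d.r₀ * d.r₀ / r

/-- The equilibrium density `ρ = (p/A)^{1/γ}`. -/
def rho (d : Data) (r : ℝ) : ℝ := (d.p r / d.A) ^ (1 / d.γ)

/-- Standing assumptions on the constants, and admissibility of the pressure: `p ∈ C^{2,1}([0,r₀])`,
`p ≥ 0` with equality exactly at `r₀`, `-∫₀^r x² p' dx ≥ 0`, `p' ≤ 0` near `r₀`, and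
`p/p' → 0` at `r₀` (written as `p = o(p')`, which includes that `p'` does not vanish just below
`r₀`). -/
structure Admissible (d : Data) : Prop where
  r₀_pos : 0 < d.r₀
  r₀_lt_R : d.r₀ < d.R
  A_pos : 0 < d.A
  one_lt_γ : 1 < d.γ
  ε_pos : 0 < d.ε
  δ_pos : 0 < d.δ
  p_contDiff : ContDiffOn ℝ 2 d.p (Icc 0 d.r₀)
  p_lipschitz : ∃ K, LipschitzOnWith K (iteratedDerivWithin 2 d.p (Icc 0 d.r₀)) (Icc 0 d.r₀)
  p_nonneg : ∀ r ∈ Icc 0 d.r₀, 0 ≤ d.p r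
  p_zero_iff : ∀ r ∈ Icc 0 d.r₀, (d.p r = 0 ↔ r = d.r₀)
  integral_nonneg : ∀ r ∈ Icc 0 d.r₀, 0 ≤ -∫ x in (0 : ℝ)..r, x ^ 2 * d.dp x
  dp_nonpos : ∃ κ, 0 < κ ∧ κ < d.r₀ ∧ ∀ r ∈ Ioc (d.r₀ - κ) d.r₀, d.dp r ≤ 0
  p_littleO : d.p =o[𝓝[<] d.r₀] d.dp

/-! ### The function spaces -/

/-- Integrand of the squared norm of the weighted Sobolev space with mode numbers `m, k`. -/
def normDensity (d : Data) (m k : ℤ) (u : Profile) (r : ℝ) : ℝ :=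
  ((-2 * deriv u.ξ r + u.ξ r / r + m / r * u.ζ r - k * u.η r) ^ 2
    + (deriv u.ξ r - 2 * u.ξ r / r - 2 * m / r * u.ζ r - k * u.η r) ^ 2
    + (deriv u.ξ r + u.ξ r / r + m / r * u.ζ r + 2 * k * u.η r) ^ 2
    + (-deriv u.ζ r + u.ζ r / r + m / r * u.ξ r) ^ 2
    + (deriv u.η r + k * u.ξ r) ^ 2
    + (m / r * u.η r - k * u.ζ r) ^ 2) * r
  + (deriv u.ξ r + u.ξ r / r + m / r * u.ζ r - k * u.η r) ^ 2 * r
  + d.rho r * (u.ξ r ^ 2 + u.η r ^ 2 + u.ζ r ^ 2) * r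

/-- The squared norm, with values in `[0, ∞]`. -/
def normSq (d : Data) (m k : ℤ) (u : Profile) : ℝ≥0∞ :=
  ∫⁻ r in Ioo 0 d.r₀, ENNReal.ofReal (d.normDensity m k u r)

/-- `f` is absolutely continuous on every `[a, r₀]`, `0 < a < r₀`. -/
def LocAC (d : Data) (f : ℝ → ℝ) : Prop :=
  ∀ a ∈ Ioo 0 d.r₀, AbsolutelyContinuousOnInterval f a d.r₀

/-- The smooth profiles whose completion is the space for `m = 0`:
`(ξ, η, ζ) ∈ C^∞([0,r₀])³` with `ξ(0) = ζ(0) = 0`. -/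
def CoreX (φ : Profile) : Prop :=
  ContDiff ℝ ∞ φ.ξ ∧ ContDiff ℝ ∞ φ.η ∧ ContDiff ℝ ∞ φ.ζ ∧ φ.ξ 0 = 0 ∧ φ.ζ 0 = 0

/-- The smooth profiles whose completion is the space for `m ≠ 0`:
`(ξ, η, ζ) ∈ C^∞([0,r₀])³` with `ξ(0) = η(0) = ζ(0) = 0`. -/
def CoreY (φ : Profile) : Prop :=
  ContDiff ℝ ∞ φ.ξ ∧ ContDiff ℝ ∞ φ.η ∧ ContDiff ℝ ∞ φ.ζ ∧ φ.ξ 0 = 0 ∧ φ.η 0 = 0 ∧ φ.ζ 0 = 0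

/-- The completion of a class of smooth profiles with respect to the norm `normSq`, realised as a
space of functions. The norm controls `ξ, η, ζ` and their weak derivatives in `L²(a, b)` for all
`0 < a < b < r₀`, and the derivatives even in `L²(a, r₀)`; hence every element of the completion
has a unique representative on `(0, r₀]` that is absolutely continuous on each `[a, r₀]`, and the
elements are exactly the norm limits of smooth profiles of the class. -/
def MemCompletion (d : Data) (core : Profile → Prop) (m k : ℤ) (u : Profile) : Prop :=
  d.LocAC u.ξ ∧ d.LocAC u.η ∧ d.LocAC u.ζ ∧
    ∀ e : ℝ≥0∞, 0 < e → ∃ φ : Profile, core φ ∧ d.normSq m k (u.sub φ) < e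

/-- The space `X_k` (used for `m = 0`). -/
def MemX (d : Data) (k : ℤ) (u : Profile) : Prop := d.MemCompletion CoreX 0 k u

/-- The space `Y_{m,k}` (used for `m ≠ 0`). -/
def MemY (d : Data) (m k : ℤ) (u : Profile) : Prop := d.MemCompletion CoreY m k u

/-- The Sobolev space `H¹(r₀, R)` (continuous representatives on `[r₀, R]`). -/
def MemH1Vac (d : Data) (Q : ℝ → ℝ) : Prop :=
  AbsolutelyContinuousOnInterval Q d.r₀ d.R ∧
    MemLp Q 2 (volume.restrict (Ioo d.r₀ d.R)) ∧
    MemLp (deriv Q) 2 (volume.restrict (Ioo d.r₀ d.R))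

/-! ### The energies -/

/-- Integrand of the viscous dissipation with viscosities `a` (dynamic) and `b` (bulk). -/
def viscDensity (a b : ℝ) (m k : ℤ) (u : Profile) (r : ℝ) : ℝ :=
  a * (2 / 9 * (-2 * deriv u.ξ r + u.ξ r / r + m / r * u.ζ r - k * u.η r) ^ 2
    + 2 / 9 * (deriv u.ξ r - 2 * u.ξ r / r - 2 * m / r * u.ζ r - k * u.η r) ^ 2
    + 2 / 9 * (deriv u.ξ r + u.ξ r / r + m / r * u.ζ r + 2 * k * u.η r) ^ 2
    + (-deriv u.ζ r + u.ζ r / r + m / r * u.ξ r) ^ 2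
    + (deriv u.η r + k * u.ξ r) ^ 2
    + (m / r * u.η r - k * u.ζ r) ^ 2) * r
  + b * (deriv u.ξ r + u.ξ r / r + m / r * u.ζ r - k * u.η r) ^ 2 * r

/-- `𝒥(ξ, η, ζ) = 2π² ∫₀^{r₀} ρ (ξ² + η² + ζ²) r dr`. -/
def J (d : Data) (u : Profile) : ℝ :=
  2 * Real.pi ^ 2 *
    ∫ r in Ioo 0 d.r₀, d.rho r * (u.ξ r ^ 2 + u.η r ^ 2 + u.ζ r ^ 2) * r

/-- The modified energy `E_{0,k}(ξ, η, ζ; s)`, with viscosities `s ε` and `s δ`. -/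
def E0 (d : Data) (k : ℤ) (s : ℝ) (u : Profile) : ℝ :=
  2 * Real.pi ^ 2 *
      (∫ r in Ioo 0 d.r₀,
        (2 * d.dp r * u.ξ r ^ 2 / r
          + d.B r ^ 2 * (k * u.η r - 1 / r * (deriv (fun x => x * u.ξ x) r - 2 * u.ξ r)) ^ 2
          + d.γ * d.p r * (1 / r * deriv (fun x => x * u.ξ x) r - k * u.η r) ^ 2) * r)
    + 2 * Real.pi ^ 2 * ∫ r in Ioo 0 d.r₀, viscDensity (s * d.ε) (s * d.δ) 0 k u r

/-- The modified energy `E_{m,k}(ξ, η, ζ, Q̂_r; s)` for `m ≠ 0`, with viscosities `s ε`, `s δ`. -/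
def Em (d : Data) (m k : ℤ) (s : ℝ) (u : Profile) (Q : ℝ → ℝ) : ℝ :=
  2 * Real.pi ^ 2 *
      (∫ r in Ioo 0 d.r₀,
        ((m ^ 2 + k ^ 2 * r ^ 2)
            * (d.B r / r * u.η r
                + (-k * d.B r * deriv (fun x => x * u.ξ x) r + 2 * k * d.B r * u.ξ r)
                    / (m ^ 2 + k ^ 2 * r ^ 2)) ^ 2
          + d.γ * d.p r
            * (1 / r * deriv (fun x => x * u.ξ x) r - k * u.η r + m * u.ζ r / r) ^ 2) * r)
    + 2 * Real.pi ^ 2 * (∫ r in Ioo 0 d.r₀, viscDensity (s * d.ε) (s * d.δ) m k u r)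
    + 2 * Real.pi ^ 2 *
      (∫ r in Ioo 0 d.r₀,
        m ^ 2 * d.B r ^ 2 / (r * (m ^ 2 + k ^ 2 * r ^ 2)) * (u.ξ r - r * deriv u.ξ r) ^ 2)
    + 2 * Real.pi ^ 2 *
      (∫ r in Ioo 0 d.r₀, (2 * d.dp r + m ^ 2 * d.B r ^ 2 / r) * u.ξ r ^ 2)
    + 2 * Real.pi ^ 2 *
      (∫ r in Ioo d.r₀ d.R,
        (Q r ^ 2 + 1 / (m ^ 2 + k ^ 2 * r ^ 2) * deriv (fun x => x * Q x) r ^ 2) * r)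

/-! ### The eigenvalue `λ(s)` of the modified problem -/

/-- The values of `E_{0,k}(·; s) / 𝒥` on the nonzero elements of `X_k`. -/
def quotients0 (d : Data) (k : ℤ) (s : ℝ) : Set ℝ :=
  {x | ∃ u : Profile, d.MemX k u ∧ d.J u ≠ 0 ∧ x = d.E0 k s u / d.J u}

/-- `λ(s) = inf E_{0,k}(·; s) / 𝒥` over `X_k`. -/
def lam0 (d : Data) (k : ℤ) (s : ℝ) : ℝ := sInf (d.quotients0 k s)

/-- The constraint set `𝒜₂` for `m ≠ 0`. -/
def MemA2 (d : Data) (m k : ℤ) (u : Profile) (Q : ℝ → ℝ) : Prop :=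
  d.MemY m k u ∧ d.MemH1Vac Q ∧ d.J u = 1 ∧
    m * d.Bhat d.r₀ * u.ξ d.r₀ = d.r₀ * Q d.r₀ ∧ Q d.R = 0

/-- The values of `E_{m,k}(·; s)` on `𝒜₂`. -/
def energies (d : Data) (m k : ℤ) (s : ℝ) : Set ℝ :=
  {x | ∃ (u : Profile) (Q : ℝ → ℝ), d.MemA2 m k u Q ∧ x = d.Em m k s u Q}

/-- `λ(s) = inf E_{m,k}(·; s)` over `𝒜₂`, for `m ≠ 0`. -/
def lam (d : Data) (m k : ℤ) (s : ℝ) : ℝ := sInf (d.energies m k s)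

/-! ### The original viscous problem, for one Fourier mode `e^{i(mθ + kz)}` -/

/-- First row of the ideal (inviscid) force operator. -/
def ideal1 (d : Data) (m k : ℤ) (u : Profile) (r : ℝ) : ℝ :=
  deriv (fun x => (d.γ * d.p x + d.B x ^ 2) / x * deriv (fun y => y * u.ξ y) x) r
    - m ^ 2 / r ^ 2 * d.B r ^ 2 * u.ξ r
    - r * deriv (fun x => d.B x ^ 2 / x ^ 2) r * u.ξ r
    - deriv (fun x => k * (d.γ * d.p x + d.B x ^ 2) * u.η x) r
    - 2 * k * d.B r ^ 2 / r * u.η r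
    + deriv (fun x => m / x * (d.γ * d.p x) * u.ζ x) r

/-- Second row of the ideal force operator. -/
def ideal2 (d : Data) (m k : ℤ) (u : Profile) (r : ℝ) : ℝ :=
  k * (d.γ * d.p r + d.B r ^ 2) / r * deriv (fun x => x * u.ξ x) r
    - 2 * k * d.B r ^ 2 / r * u.ξ r
    - (k ^ 2 * (d.γ * d.p r + d.B r ^ 2) + m ^ 2 / r ^ 2 * d.B r ^ 2) * u.η r
    + m * k / r * (d.γ * d.p r) * u.ζ r

/-- Third row of the ideal force operator. -/
def ideal3 (d : Data) (m k : ℤ) (u : Profile) (r : ℝ) : ℝ :=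
  -(m * (d.γ * d.p r) / r ^ 2) * deriv (fun x => x * u.ξ x) r
    + m * k / r * (d.γ * d.p r) * u.η r
    - m ^ 2 / r ^ 2 * (d.γ * d.p r) * u.ζ r

/-- First row of the viscous operator with viscosities `a` (dynamic) and `b` (bulk). -/
def visc1 (a b : ℝ) (m k : ℤ) (v : Profile) (r : ℝ) : ℝ :=
  (4 * a / 3 + b) * deriv (deriv v.ξ) r + (4 * a / 3 + b) * deriv (fun x => v.ξ x / x) r
    - a * (m ^ 2 / r ^ 2 + k ^ 2) * v.ξ r
    - (a / 3 + b) * k * deriv v.η r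
    + (a / 3 + b) * deriv (fun x => m / x * v.ζ x) r - 2 * a * m / r ^ 2 * v.ζ r

/-- Second row of the viscous operator. -/
def visc2 (a b : ℝ) (m k : ℤ) (v : Profile) (r : ℝ) : ℝ :=
  (a / 3 + b) * k * deriv v.ξ r + (a / 3 + b) * (k / r) * v.ξ r
    + a * deriv (deriv v.η) r + a / r * deriv v.η r
    - a * (m ^ 2 / r ^ 2) * v.η r - (4 * a / 3 + b) * k ^ 2 * v.η r
    + (a / 3 + b) * (m * k / r) * v.ζ r

/-- Third row of the viscous operator. -/
def visc3 (a b : ℝ) (m k : ℤ) (v : Profile) (r : ℝ) : ℝ :=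
  -((a / 3 + b) * (m / r)) * deriv v.ξ r - (7 * a / 3 + b) * (m / r ^ 2) * v.ξ r
    + (a / 3 + b) * (m * k / r) * v.η r
    + a * deriv (deriv v.ζ) r + a * deriv (fun x => v.ζ x / x) r
    - (4 * a / 3 + b) * (m ^ 2 / r ^ 2) * v.ζ r - a * k ^ 2 * v.ζ r

/-- The profile is twice continuously differentiable on `(0, r₀]`. -/
def C2Profile (d : Data) (u : Profile) : Prop :=
  ContDiffOn ℝ 2 u.ξ (Ioc 0 d.r₀) ∧ ContDiffOn ℝ 2 u.η (Ioc 0 d.r₀) ∧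
    ContDiffOn ℝ 2 u.ζ (Ioc 0 d.r₀)

/-- One-sided derivative at the interface `r₀`, taken from the plasma. -/
def dIn (d : Data) (f : ℝ → ℝ) : ℝ := derivWithin f (Ioc 0 d.r₀) d.r₀

/-- `Q̂_θ = -m/(m² + k² r²) (r Q̂_r)'` at the interface, the derivative being taken from the
vacuum. -/
def QthetaAtInterface (d : Data) (m k : ℤ) (Q : ℝ → ℝ) : ℝ :=
  -(m / (m ^ 2 + k ^ 2 * d.r₀ ^ 2)) * derivWithin (fun x => x * Q x) (Icc d.r₀ d.R) d.r₀

/-- `(u, Q)` is a classical solution, on all of time, of the linearized viscous plasma-vacuum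
problem for the Fourier mode `e^{i(mθ + kz)}`: the displacement profile is `u t = (ξ, η, ζ)(t, ·)`,
the radial vacuum field is `Q t = Q̂_r(t, ·)`, and the viscous terms act on the velocity `u_t`. -/
structure IsModeSolution (d : Data) (m k : ℤ) (u : ℝ → Profile) (Q : ℝ → ℝ → ℝ) : Prop where
  /-- regularity in space of displacement, velocity and vacuum field -/
  reg_u : ∀ t, d.C2Profile (u t)
  reg_v : ∀ t, d.C2Profile (Profile.dt u t)
  reg_Q : ∀ t, ContDiffOn ℝ 2 (Q t) (Icc d.r₀ d.R)
  /-- regularity in time -/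
  reg_t : ∀ r ∈ Ioc 0 d.r₀, ContDiff ℝ 2 (fun t => (u t).ξ r) ∧
    ContDiff ℝ 2 (fun t => (u t).η r) ∧ ContDiff ℝ 2 (fun t => (u t).ζ r)
  /-- the momentum equations in the plasma -/
  eq1 : ∀ t, ∀ r ∈ Ioo 0 d.r₀,
    d.ideal1 m k (u t) r + visc1 d.ε d.δ m k (Profile.dt u t) r
      = d.rho r * (Profile.dt (Profile.dt u) t).ξ r
  eq2 : ∀ t, ∀ r ∈ Ioo 0 d.r₀,
    d.ideal2 m k (u t) r + visc2 d.ε d.δ m k (Profile.dt u t) r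
      = d.rho r * (Profile.dt (Profile.dt u) t).η r
  eq3 : ∀ t, ∀ r ∈ Ioo 0 d.r₀,
    d.ideal3 m k (u t) r + visc3 d.ε d.δ m k (Profile.dt u t) r
      = d.rho r * (Profile.dt (Profile.dt u) t).ζ r
  /-- the vacuum equation -/
  eqQ : ∀ t, ∀ r ∈ Ioo d.r₀ d.R,
    deriv (fun x => x / (m ^ 2 + k ^ 2 * x ^ 2) * deriv (fun y => y * Q t y) x) r - Q t r = 0
  /-- the condition at the perfectly conducting wall -/
  wall : ∀ t, Q t d.R = 0
  /-- continuity of the normal magnetic field at the interface -/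
  normal : ∀ t, m * d.Bhat d.r₀ * (u t).ξ d.r₀ = d.r₀ * Q t d.r₀
  /-- the three components of the stress balance at the interface -/
  stress1 : ∀ t,
    d.B d.r₀ ^ 2 * (u t).ξ d.r₀ - d.B d.r₀ ^ 2 * d.dIn (u t).ξ * d.r₀
      + k * d.B d.r₀ ^ 2 * (u t).η d.r₀ * d.r₀
      - d.Bhat d.r₀ * d.QthetaAtInterface m k (Q t) * d.r₀
      - d.ε * (2 * d.dIn (Profile.dt u t).ξ * d.r₀)
      - (d.δ - 2 / 3 * d.ε) * (d.dIn (Profile.dt u t).ξ * d.r₀ + (Profile.dt u t).ξ d.r₀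
          + m * (Profile.dt u t).ζ d.r₀ - k * (Profile.dt u t).η d.r₀ * d.r₀) = 0
  stress2 : ∀ t,
    d.ε * (-d.dIn (Profile.dt u t).ζ * d.r₀ + m * (Profile.dt u t).ξ d.r₀
      + (Profile.dt u t).ζ d.r₀) = 0
  stress3 : ∀ t,
    d.ε * (d.dIn (Profile.dt u t).η * d.r₀ + k * (Profile.dt u t).ξ d.r₀ * d.r₀) = 0

end Data

/-- `s` lies in `𝒮 = λ⁻¹((-∞, 0)) ⊆ (0, ∞)` and `s = μ(s) = √(-λ(s))`. -/
def IsFixedRate (lam : ℝ → ℝ) (s : ℝ) : Prop := 0 < s ∧ lam s < 0 ∧ s = √(-lam s)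

end ZPinch

end

/-! ### Locally absolutely continuous functions on `(0, R]` and a Hardy inequality. -/

namespace ZPinch

/-! For a fixed mode the modified energy is a linear pencil `I + s D` on the constraint `J = 1`: `I`
is the ideal energy including the vacuum, `D` the viscous dissipation. Once the minimum `λ(s)` is
known to be attained, the spectral statements are elementary. As an infimum of affine functions of
`s`, `λ` is concave, hence locally Lipschitz. A minimizer at `t` is a competitor at `s < t`, which
gives strict monotonicity as soon as minimizers dissipate. Then `s² + λ(s)` is continuous and
strictly increasing, positive for large `s` because `λ` is bounded below, and negative for small `s`
if `λ` is negative somewhere; its only zero is the fixed point `s = √(-λ(s))`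
(`existsUnique_isFixedRate`). The factor `e^{st}` turns `V u_t` into `s V u` and `ρ u_tt` into `s² ρ
u = -λ ρ u`, so a minimizer at the fixed point is a growing mode (`ELSystem.isModeSolution`).

Minimizers exist for three reasons. First, `D + J` controls the norm, and although `ρ` vanishes at
`r₀`, the inequality `hardy` recovers unweighted `L²` bounds of the profile and of `r` times its
derivative (`exists_energy_le`). So bounded sequences have `J`-Cauchy subsequences, and the trace
`ξ(r₀)` is controlled. Second, `I ≥ -C J` (`exists_lower_bound`). The term `2p'ξ²` is not dominated
by `ρξ²` near `r₀`; it is removed by subtracting `(Sξ²)'`, whose integral is zero, with `S = 2p`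
near the interface and `S = -B²` near the axis. What is left is absorbed by the squares in the
energy, by `p ≤ Cρ`, or by `B² = O(r)`. Third, the parallelogram identity makes minimizing sequences
converge strongly (`GoodCore.exists_minimizer`).

For `m ≠ 0` the vacuum field is eliminated first. Given its value at the interface, its least energy
is computed by a linear ODE and equals `τ ξ(r₀)²` with `τ ≥ 0` (`exists_vacuum`,
`exists_isVacuumWeight`). Both cases thus become one problem with a boundary weight `τ`, which is
`0` for `m = 0`.

Vanishing dissipation forces `|m| = 1`, `k = 0` and a rigid translation (`rigid`). A minimizing
translation would satisfy the natural boundary condition, which then reads `τ = B(r₀)²`; the wall at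
finite distance excludes this value (`VacuumPair.v_a_ne`). In all other modes `D` has a positive
minimum on `J = 1`, whence the linear lower bound for `λ`.

Minimizers are classical up to `r₀`: the lemma of du Bois-Reymond gives the Euler–Lagrange equations
in integrated form together with the natural boundary conditions, and viscosity allows them to be
solved for all three derivatives (`GoodCore.exists_ELSystem`). Negativity of `λ` comes from explicit
trial profiles (`exists_neg_of_m_eq_zero`, `exists_neg_of_local`). -/

/-- `f` is absolutely continuous on `[a, R]` for every `a ∈ (0, R)`. -/
def LAC (R : ℝ) (f : ℝ → ℝ) : Prop :=
  ∀ a ∈ Ioo 0 R, AbsolutelyContinuousOnInterval f a R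

/-- Lebesgue measure on `(0, R)`. -/
noncomputable abbrev vol (R : ℝ) : Measure ℝ := volume.restrict (Ioo 0 R)

namespace LAC

variable {R : ℝ} {f g : ℝ → ℝ}

lemma add (hf : LAC R f) (hg : LAC R g) : LAC R (fun r => f r + g r) :=
  fun a ha => (hf a ha).fun_add (hg a ha)

lemma sub (hf : LAC R f) (hg : LAC R g) : LAC R (fun r => f r - g r) :=
  fun a ha => (hf a ha).fun_sub (hg a ha)

lemma mul (hf : LAC R f) (hg : LAC R g) : LAC R (fun r => f r * g r) :=
  fun a ha => (hf a ha).fun_mul (hg a ha)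

lemma of_contDiffOn (hf : ContDiffOn ℝ 1 f (Ioc 0 R)) : LAC R f := by
  intro a ha
  refine (hf.mono ?_).absolutelyContinuousOnInterval
  rw [uIcc_of_le ha.2.le]
  exact fun x hx => ⟨ha.1.trans_le hx.1, hx.2⟩

lemma const_mul (c : ℝ) (hf : LAC R f) : LAC R (fun r => c * f r) :=
  (of_contDiffOn contDiffOn_const).mul hf

lemma ac (hf : LAC R f) {a b : ℝ} (ha : 0 < a) (hb : b ≤ R) (hab : a ≤ b) :
    AbsolutelyContinuousOnInterval f a b := by
  rcases eq_or_lt_of_le (hab.trans hb) with h | h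
  · have : a = b := le_antisymm hab (h ▸ hb)
    subst this
    refine LipschitzOnWith.absolutelyContinuousOnInterval (K := 0) ?_
    rw [uIcc_self]
    exact LipschitzOnWith.of_dist_le_mul (by simp)
  · refine (hf a ⟨ha, h⟩).mono ?_
    rw [uIcc_of_le hab, uIcc_of_le h.le]
    exact Icc_subset_Icc_right hb

lemma continuousOn (hf : LAC R f) : ContinuousOn f (Ioc 0 R) := by
  intro x hx
  have h2 : x / 2 ∈ Ioo 0 R := ⟨by linarith [hx.1], by linarith [hx.1, hx.2]⟩
  have := (hf _ h2).continuousOn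
  rw [uIcc_of_le h2.2.le] at this
  have hx' : ContinuousWithinAt f (Icc (x / 2) R) x := this x ⟨by linarith [hx.1], hx.2⟩
  refine hx'.mono_of_mem_nhdsWithin ?_
  have : Ioi (x / 2) ∈ 𝓝[Ioc 0 R] x := mem_nhdsWithin_of_mem_nhds (Ioi_mem_nhds (by linarith [hx.1]))
  filter_upwards [this, self_mem_nhdsWithin] with y hy hy'
  exact ⟨(mem_Ioi.1 hy).le, hy'.2⟩

lemma aestronglyMeasurable (hf : LAC R f) : AEStronglyMeasurable f (vol R) :=
  (hf.continuousOn.mono Ioo_subset_Ioc_self).aestronglyMeasurable measurableSet_Ioo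

/-- Countably many intervals `[R/(n+2), R]` exhaust `(0, R)`; the shift by `2` keeps the left end
strictly below `R` also for `n = 0`. -/
lemma ae_differentiableAt (hf : LAC R f) : ∀ᵐ r ∂(vol R), DifferentiableAt ℝ f r := by
  rw [ae_restrict_iff' measurableSet_Ioo]
  have : ∀ n : ℕ, ∀ᵐ r : ℝ, r ∈ Icc (R / (n + 2)) R → 0 < R → DifferentiableAt ℝ f r := by
    intro n
    by_cases hR : 0 < R
    · have h2 : R / (n + 2) ∈ Ioo 0 R := by
        refine ⟨by positivity, ?_⟩
        rw [div_lt_iff₀ (by positivity)]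
        nlinarith [(Nat.cast_nonneg n : (0 : ℝ) ≤ n)]
      have := (hf _ h2).ae_differentiableAt
      rw [uIcc_of_le h2.2.le] at this
      filter_upwards [this] with r hr h _ using hr h
    · exact Eventually.of_forall fun _ _ h => absurd h hR
  filter_upwards [ae_all_iff.2 this] with r hr hr'
  obtain ⟨n, hn⟩ := exists_nat_gt (R / r)
  refine hr n ⟨?_, hr'.2.le⟩ (hr'.1.trans hr'.2)
  rw [div_lt_iff₀ hr'.1] at hn
  rw [div_le_iff₀ (by positivity)]
  nlinarith [hr'.1]

lemma integral_deriv (hf : LAC R f) {a b : ℝ} (ha : 0 < a) (hab : a ≤ b) (hb : b ≤ R) :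
    ∫ r in a..b, deriv f r = f b - f a :=
  (hf.ac ha hb hab).integral_deriv_eq_sub

lemma intervalIntegrable_deriv (hf : LAC R f) {a b : ℝ} (ha : 0 < a) (hab : a ≤ b) (hb : b ≤ R) :
    IntervalIntegrable (deriv f) volume a b :=
  (hf.ac ha hb hab).intervalIntegrable_deriv

end LAC

section Tools

variable {R : ℝ}

lemma ae_Ioo_of_vol {P : ℝ → Prop} (h : ∀ᵐ r ∂(vol R), P r) {a b : ℝ} (ha : 0 ≤ a) (hb : b ≤ R) :
    ∀ᵐ r ∂(volume.restrict (Ioo a b)), P r :=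
  ae_restrict_of_ae_restrict_of_subset (Ioo_subset_Ioo ha hb) h

lemma integral_congr_vol {f g : ℝ → ℝ} (h : ∀ᵐ r ∂(vol R), f r = g r) {a b : ℝ} (ha : 0 ≤ a)
    (hab : a ≤ b) (hb : b ≤ R) : ∫ r in a..b, f r = ∫ r in a..b, g r := by
  rw [intervalIntegral.integral_of_le hab, intervalIntegral.integral_of_le hab,
    integral_Ioc_eq_integral_Ioo, integral_Ioc_eq_integral_Ioo]
  exact integral_congr_ae (ae_Ioo_of_vol h ha hb)

lemma integral_mono_vol {f g : ℝ → ℝ} {a b : ℝ} (ha : 0 ≤ a) (hab : a ≤ b) (hb : b ≤ R)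
    (hf : IntervalIntegrable f volume a b) (hg : IntervalIntegrable g volume a b)
    (h : ∀ᵐ r ∂(vol R), f r ≤ g r) : ∫ r in a..b, f r ≤ ∫ r in a..b, g r := by
  rw [intervalIntegral.integral_of_le hab, intervalIntegral.integral_of_le hab,
    integral_Ioc_eq_integral_Ioo, integral_Ioc_eq_integral_Ioo]
  rw [intervalIntegrable_iff_integrableOn_Ioo_of_le hab] at hf hg
  exact integral_mono_ae hf hg (ae_Ioo_of_vol h ha hb)

lemma intervalIntegrable_of_vol {f : ℝ → ℝ} (hf : Integrable f (vol R)) {a b : ℝ} (ha : 0 ≤ a)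
    (hab : a ≤ b) (hb : b ≤ R) : IntervalIntegrable f volume a b := by
  rw [intervalIntegrable_iff_integrableOn_Ioo_of_le hab]
  exact IntegrableOn.mono_set hf (Ioo_subset_Ioo ha hb)

lemma intervalIntegral_le_vol {f : ℝ → ℝ} (hf : Integrable f (vol R)) (h0 : ∀ᵐ r ∂(vol R), 0 ≤ f r)
    {a b : ℝ} (ha : 0 ≤ a) (hab : a ≤ b) (hb : b ≤ R) :
    ∫ r in a..b, f r ≤ ∫ r in Ioo 0 R, f r := by
  rw [intervalIntegral.integral_of_le hab, integral_Ioc_eq_integral_Ioo]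
  exact setIntegral_mono_set hf h0 (Ioo_subset_Ioo ha hb).eventuallyLE

/-- A nonnegative function whose integrals over `(a, R)` are bounded is integrable. -/
lemma integrable_of_bounded {f : ℝ → ℝ} (hR : 0 < R) {K : ℝ} (h0 : ∀ r, 0 ≤ f r)
    (hf : ∀ a ∈ Ioo 0 R, IntervalIntegrable f volume a R)
    (hK : ∀ a ∈ Ioo 0 R, ∫ r in a..R, f r ≤ K) :
    Integrable f (vol R) ∧ ∫ r in Ioo 0 R, f r ≤ K := by
  have hmem : ∀ n : ℕ, R / (n + 2) ∈ Ioo 0 R := fun n => by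
    refine ⟨by positivity, ?_⟩
    rw [div_lt_iff₀ (by positivity)]
    nlinarith [(Nat.cast_nonneg n : (0 : ℝ) ≤ n)]
  have hlim : Tendsto (fun n : ℕ => R / ((n : ℝ) + 2)) atTop (𝓝 0) :=
    Tendsto.div_atTop tendsto_const_nhds
      (tendsto_atTop_add_const_right _ _ tendsto_natCast_atTop_atTop)
  have hI : IntegrableOn f (Ioc 0 R) := by
    refine integrableOn_Ioc_of_intervalIntegral_norm_bounded_left (l := atTop) (I := K)
      (a := fun n : ℕ => R / ((n : ℝ) + 2)) (fun n => ?_) hlim (Eventually.of_forall fun n => ?_)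
    · exact (intervalIntegrable_iff_integrableOn_Ioc_of_le (hmem n).2.le).1 (hf _ (hmem n))
    · have := hK _ (hmem n)
      rw [intervalIntegral.integral_of_le (hmem n).2.le] at this
      simpa [abs_of_nonneg (h0 _)] using this
  refine ⟨hI.mono_set Ioo_subset_Ioc_self, ?_⟩
  rw [← integral_Ioc_eq_integral_Ioo, ← intervalIntegral.integral_of_le hR.le]
  have hc : Tendsto (fun n : ℕ => ∫ r in (R / ((n : ℝ) + 2))..R, f r) atTop
      (𝓝 (∫ r in (0 : ℝ)..R, f r)) := by
    have hi : IntegrableOn f (uIcc 0 R) := by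
      rw [uIcc_of_le hR.le, integrableOn_Icc_iff_integrableOn_Ioc]; exact hI
    have := intervalIntegral.continuousOn_primitive_interval_left hi
    have h2 := (this 0 (by simp)).tendsto
    refine h2.comp (tendsto_nhdsWithin_iff.2 ⟨hlim, Eventually.of_forall fun n => ?_⟩)
    rw [uIcc_of_le hR.le]
    exact Ioo_subset_Icc_self (hmem n)
  exact le_of_tendsto' hc fun n => hK _ (hmem n)

lemma LAC.sub_le {G h : ℝ → ℝ} (hG : LAC R G) {a b : ℝ} (ha : 0 < a) (hab : a ≤ b) (hb : b ≤ R)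
    (hh : IntervalIntegrable h volume a b) (hle : ∀ᵐ r ∂(vol R), deriv G r ≤ h r) :
    G b - G a ≤ ∫ r in a..b, h r := by
  rw [← hG.integral_deriv ha hab hb]
  exact integral_mono_vol ha.le hab hb (hG.intervalIntegrable_deriv ha hab hb) hh hle

lemma LAC.le_sub {G h : ℝ → ℝ} (hG : LAC R G) {a b : ℝ} (ha : 0 < a) (hab : a ≤ b) (hb : b ≤ R)
    (hh : IntervalIntegrable h volume a b) (hle : ∀ᵐ r ∂(vol R), h r ≤ deriv G r) :
    ∫ r in a..b, h r ≤ G b - G a := by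
  rw [← hG.integral_deriv ha hab hb]
  exact integral_mono_vol ha.le hab hb hh (hG.intervalIntegrable_deriv ha hab hb) hle

lemma LAC.intervalIntegrable_sq {f : ℝ → ℝ} (hf : LAC R f) {a b : ℝ} (ha : 0 < a) (hab : a ≤ b)
    (hb : b ≤ R) : IntervalIntegrable (fun r => f r ^ 2) volume a b := by
  refine ContinuousOn.intervalIntegrable ?_
  rw [uIcc_of_le hab]
  exact (hf.continuousOn.mono fun x hx => ⟨ha.trans_le hx.1, hx.2.trans hb⟩).pow 2

/-- A Hardy type inequality for solutions of `r f' = A f + g`, `0 ≤ A ≤ 1`. -/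
lemma hardy (hR : 0 < R) {f g : ℝ → ℝ} (hf : LAC R f) {A : ℝ} (hA0 : 0 ≤ A) (hA1 : A ≤ 1)
    (hg : Integrable (fun r => g r ^ 2) (vol R))
    (he : ∀ᵐ r ∂(vol R), r * deriv f r = A * f r + g r) :
    Integrable (fun r => f r ^ 2) (vol R) ∧
      ∫ r in Ioo 0 R, f r ^ 2 ≤
        1024 * ((∫ r in Ioo 0 R, g r ^ 2) + ∫ r in (R / 4)..(R / 2), f r ^ 2) := by
  set G := ∫ r in Ioo 0 R, g r ^ 2 with hGdef
  set M := ∫ r in (R / 4)..(R / 2), f r ^ 2 with hM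
  have hd := hf.ae_differentiableAt
  have hG0 : 0 ≤ G := integral_nonneg fun r => sq_nonneg _
  have hM0 : 0 ≤ M := intervalIntegral.integral_nonneg (by linarith) fun r _ => sq_nonneg _
  have hgn : ∀ᵐ r ∂(vol R), 0 ≤ g r ^ 2 := Eventually.of_forall fun r => sq_nonneg _
  have hff : LAC R (fun r => f r * f r) := hf.mul hf
  have hmem : ∀ᵐ r ∂(vol R), r ∈ Ioo 0 R := ae_restrict_mem measurableSet_Ioo
  -- The derivative of `f² / r³` is `((2A - 3) f² + 2 f g) / r⁴`, at most `g² / r⁴` since `A ≤ 1`.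
  -- Integrating from `x` to `R` bounds the value at `R` by a value in the middle; `64 = 4³` and
  -- `256 = 4⁴` come from `x ≥ R/4`.
  have step1 : ∀ x ∈ Icc (R / 4) (R / 2), f R ^ 2 ≤ 64 * f x ^ 2 + 256 / R * G := by
    intro x hx
    have hx0 : 0 < x := by linarith [hx.1]
    have hxR : x ≤ R := by linarith [hx.2]
    have hpow : LAC R (fun r : ℝ => (r ^ 3)⁻¹) := LAC.of_contDiffOn
      ((contDiffOn_id.pow 3).inv fun r hr => (pow_pos hr.1 3).ne')
    have key : (f R * f R) * (R ^ 3)⁻¹ - (f x * f x) * (x ^ 3)⁻¹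
        ≤ ∫ r in x..R, (x ^ 4)⁻¹ * g r ^ 2 := by
      have hax : x < R := by linarith [hx.2]
      have := ((hf.ac hx0 le_rfl hxR).fun_mul (hf.ac hx0 le_rfl hxR)).fun_mul
        (hpow.ac hx0 le_rfl hxR)
      rw [← this.integral_deriv_eq_sub, intervalIntegral.integral_of_le hxR,
        intervalIntegral.integral_of_le hxR,
        integral_Ioc_eq_integral_Ioo, integral_Ioc_eq_integral_Ioo]
      have hi := this.intervalIntegrable_deriv
      rw [intervalIntegrable_iff_integrableOn_Ioo_of_le hxR] at hi
      refine integral_mono_ae hi ((IntegrableOn.mono_set hg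
        (Ioo_subset_Ioo hx0.le le_rfl)).const_mul _) ?_
      filter_upwards [ae_Ioo_of_vol hd hx0.le le_rfl, ae_Ioo_of_vol he hx0.le le_rfl,
        ae_restrict_mem measurableSet_Ioo] with r hr1 hr2 hr3
      have hr0 : 0 < r := hx0.trans hr3.1
      have h1 := hr1.hasDerivAt
      have h2 : HasDerivAt (fun r : ℝ => (r ^ 3)⁻¹) (-(3 * r ^ 2) / (r ^ 3) ^ 2) r := by
        simpa using (hasDerivAt_pow 3 r).fun_inv (pow_pos hr0 3).ne'
      rw [((h1.fun_mul h1).fun_mul h2).deriv]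
      have e : (deriv f r * f r + f r * deriv f r) * (r ^ 3)⁻¹
          + f r * f r * (-(3 * r ^ 2) / (r ^ 3) ^ 2)
          = (2 * f r * (r * deriv f r) - 3 * f r ^ 2) * (r ^ 4)⁻¹ := by
        field_simp; ring
      rw [e, hr2]
      have h3 : 2 * f r * (A * f r + g r) - 3 * f r ^ 2 ≤ g r ^ 2 := by
        nlinarith [sq_nonneg (f r - g r), sq_nonneg (f r)]
      have h4 : (r ^ 4)⁻¹ ≤ (x ^ 4)⁻¹ := by
        have := hr3.1.le
        gcongr
      calc _ ≤ g r ^ 2 * (r ^ 4)⁻¹ := by gcongr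
        _ ≤ g r ^ 2 * (x ^ 4)⁻¹ := by gcongr
        _ = _ := mul_comm _ _
    have k2 : ∫ r in x..R, (x ^ 4)⁻¹ * g r ^ 2 ≤ (x ^ 4)⁻¹ * G := by
      rw [intervalIntegral.integral_const_mul]
      exact mul_le_mul_of_nonneg_left (intervalIntegral_le_vol hg hgn hx0.le hxR le_rfl)
        (by positivity)
    have k3 : (x ^ 4)⁻¹ ≤ 256 / R ^ 4 := by
      rw [inv_le_comm₀ (by positivity) (by positivity), inv_div]
      calc R ^ 4 / 256 = (R / 4) ^ 4 := by ring
        _ ≤ x ^ 4 := by have := hx.1; gcongr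
    have k4 : (x ^ 3)⁻¹ ≤ 64 / R ^ 3 := by
      rw [inv_le_comm₀ (by positivity) (by positivity), inv_div]
      calc R ^ 3 / 64 = (R / 4) ^ 3 := by ring
        _ ≤ x ^ 3 := by have := hx.1; gcongr
    have k5 : (f R * f R) * (R ^ 3)⁻¹ ≤ f x ^ 2 * (64 / R ^ 3) + 256 / R ^ 4 * G := by
      have a1 : f x ^ 2 * (x ^ 3)⁻¹ ≤ f x ^ 2 * (64 / R ^ 3) := by gcongr
      have a2 : (x ^ 4)⁻¹ * G ≤ 256 / R ^ 4 * G := by gcongr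
      nlinarith
    have := mul_le_mul_of_nonneg_left k5 (pow_pos hR 3).le
    calc f R ^ 2 = R ^ 3 * ((f R * f R) * (R ^ 3)⁻¹) := by field_simp
      _ ≤ _ := this
      _ = _ := by field_simp
  -- The previous bound, averaged over `x`, replaces the pointwise value by the middle integral `M`.
  have step1' : R * f R ^ 2 ≤ 256 * (M + G) := by
    have h1 : ∫ _ in (R / 4)..(R / 2), f R ^ 2
        ≤ ∫ x in (R / 4)..(R / 2), (64 * f x ^ 2 + 256 / R * G) := by
      refine intervalIntegral.integral_mono_on (by linarith) (by simp) ?_ step1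
      exact ((hf.intervalIntegrable_sq (by linarith) (by linarith) (by linarith)).const_mul _).add
        (by simp)
    rw [intervalIntegral.integral_add ((hf.intervalIntegrable_sq (by linarith) (by linarith)
      (by linarith)).const_mul _) (by simp), intervalIntegral.integral_const_mul] at h1
    simp only [intervalIntegral.integral_const, smul_eq_mul] at h1
    have h2 : (R / 2 - R / 4) * (256 / R * G) = 64 * G := by field_simp; ring
    rw [h2] at h1
    nlinarith
  -- Here `A ≥ 0` enters: `(r f²)' = (1 + 2A) f² + 2 f g ≥ f²/2 - 2 g²`. The boundary term at `a`
  -- has the favourable sign, so the bound is uniform in `a`.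
  have step2 : ∀ a ∈ Ioo 0 R, ∫ r in a..R, f r ^ 2 ≤ 1024 * (G + M) := by
    intro a ha
    have hid : LAC R (fun r : ℝ => r) := LAC.of_contDiffOn contDiffOn_id
    have hI1 := hf.intervalIntegrable_sq ha.1 ha.2.le le_rfl
    have hI2 := intervalIntegrable_of_vol hg ha.1.le ha.2.le le_rfl
    have h1 := (hid.mul hff).le_sub ha.1 ha.2.le le_rfl
      (h := fun r => (1 / 2) * f r ^ 2 - 2 * g r ^ 2) ((hI1.const_mul _).sub (hI2.const_mul _)) (by
        filter_upwards [hd, he] with r hr1 hr2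
        have h1 := hr1.hasDerivAt
        rw [((hasDerivAt_id' r).fun_mul (h1.fun_mul h1)).deriv]
        have e : 1 * (f r * f r) + r * (deriv f r * f r + f r * deriv f r)
            = f r ^ 2 + 2 * f r * (r * deriv f r) := by ring
        rw [e, hr2]
        nlinarith [sq_nonneg (f r + 2 * g r), sq_nonneg (f r)])
    rw [intervalIntegral.integral_sub (hI1.const_mul _) (hI2.const_mul _),
      intervalIntegral.integral_const_mul, intervalIntegral.integral_const_mul] at h1
    have h2 := intervalIntegral_le_vol hg hgn ha.1.le ha.2.le le_rfl
    have h3 : 0 ≤ a * (f a * f a) := mul_nonneg ha.1.le (mul_self_nonneg _)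
    nlinarith
  exact integrable_of_bounded hR (fun r => sq_nonneg _)
    (fun a ha => hf.intervalIntegrable_sq ha.1 ha.2.le le_rfl) step2

end Tools

end ZPinch

/-! ### Functions with finite `∫ f² + (r f')²`: pointwise bounds, compactness, completeness. -/

namespace ZPinch

section EnergySpace

variable {R : ℝ}

lemma LAC.sub_le_of_Ioo {G h : ℝ → ℝ} (hG : LAC R G) {a b : ℝ} (ha : 0 < a) (hab : a ≤ b)
    (hb : b ≤ R) (hh : IntervalIntegrable h volume a b)
    (hle : ∀ᵐ r ∂(vol R), r ∈ Ioo a b → deriv G r ≤ h r) : G b - G a ≤ ∫ r in a..b, h r := by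
  rw [← hG.integral_deriv ha hab hb, intervalIntegral.integral_of_le hab,
    intervalIntegral.integral_of_le hab, integral_Ioc_eq_integral_Ioo, integral_Ioc_eq_integral_Ioo]
  have hi := hG.intervalIntegrable_deriv ha hab hb
  rw [intervalIntegrable_iff_integrableOn_Ioo_of_le hab] at hi hh
  refine integral_mono_ae hi hh ?_
  filter_upwards [ae_Ioo_of_vol hle ha.le hb, ae_restrict_mem measurableSet_Ioo] with r hr hr'
    using hr hr'

lemma deriv_const_mul_real (c : ℝ) (f : ℝ → ℝ) (r : ℝ) :
    deriv (fun x => c * f x) r = c * deriv f r :=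
  deriv_const_mul_field c

/-- Functions on `(0, R]` with `∫ f² + (r f')² < ∞`. -/
structure Energetic (R : ℝ) (f : ℝ → ℝ) : Prop where
  lac : LAC R f
  sq : Integrable (fun r => f r ^ 2) (vol R)
  deriv_sq : Integrable (fun r => (r * deriv f r) ^ 2) (vol R)

/-- The energy `∫ f² + (r f')²`. -/
noncomputable def energy (R : ℝ) (f : ℝ → ℝ) : ℝ :=
  ∫ r in Ioo 0 R, (f r ^ 2 + (r * deriv f r) ^ 2)

lemma energy_nonneg (f : ℝ → ℝ) : 0 ≤ energy R f := integral_nonneg fun _ => by positivity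

namespace Energetic

variable {f g : ℝ → ℝ}

lemma integrable (hf : Energetic R f) : Integrable (fun r => f r ^ 2 + (r * deriv f r) ^ 2) (vol R) :=
  hf.sq.add hf.deriv_sq

lemma integral_sq_le (hf : Energetic R f) : ∫ r in Ioo 0 R, f r ^ 2 ≤ energy R f :=
  integral_mono hf.sq hf.integrable fun r => by simpa using sq_nonneg _

lemma const_mul (hf : Energetic R f) (c : ℝ) : Energetic R (fun r => c * f r) where
  lac := hf.lac.const_mul c
  sq := by simpa [mul_pow] using hf.sq.const_mul (c ^ 2)
  deriv_sq := by
    refine (hf.deriv_sq.const_mul (c ^ 2)).congr (Eventually.of_forall fun r => ?_)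
    simp only [deriv_const_mul_real]
    ring

lemma sub (hf : Energetic R f) (hg : Energetic R g) : Energetic R (fun r => f r - g r) where
  lac := hf.lac.sub hg.lac
  sq := by
    refine ((hf.sq.add hg.sq).const_mul 2).mono' (hf.lac.sub hg.lac |>.aestronglyMeasurable.pow 2)
      (Eventually.of_forall fun r => ?_)
    rw [Real.norm_of_nonneg (sq_nonneg _)]
    simp only [Pi.add_apply]
    nlinarith [sq_nonneg (f r + g r)]
  deriv_sq := by
    refine ((hf.deriv_sq.add hg.deriv_sq).const_mul 2).mono'
      ((measurable_id.mul (measurable_deriv _)).pow_const 2).aestronglyMeasurable ?_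
    filter_upwards [hf.lac.ae_differentiableAt, hg.lac.ae_differentiableAt] with r h1 h2
    rw [Real.norm_of_nonneg (sq_nonneg _), deriv_fun_sub h1 h2]
    simp only [Pi.add_apply]
    nlinarith [sq_nonneg (r * deriv f r + r * deriv g r)]

/-- The derivative of `r f²` is `f² + 2 f (r f')`, at most twice the energy density in absolute
value. -/
lemma mul_sq_sub_le (hf : Energetic R f) {x y : ℝ} (hx : x ∈ Ioc 0 R) (hy : y ∈ Ioc 0 R) :
    x * (f x * f x) - y * (f y * f y) ≤ 2 * energy R f := by
  have hid : LAC R (fun r : ℝ => r) := LAC.of_contDiffOn contDiffOn_id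
  have hG := hid.mul (hf.lac.mul hf.lac)
  have hd : ∀ᵐ r ∂(vol R), deriv (fun r => r * (f r * f r)) r
      = f r ^ 2 + 2 * f r * (r * deriv f r) := by
    filter_upwards [hf.lac.ae_differentiableAt] with r hr1
    have h1 := hr1.hasDerivAt
    rw [((hasDerivAt_id' r).fun_mul (h1.fun_mul h1)).deriv]
    ring
  have hI := hf.integrable.const_mul 2
  have h0 : ∀ᵐ r ∂(vol R), 0 ≤ 2 * (f r ^ 2 + (r * deriv f r) ^ 2) :=
    Eventually.of_forall fun r => by positivity
  have hE : ∫ r in Ioo 0 R, 2 * (f r ^ 2 + (r * deriv f r) ^ 2) = 2 * energy R f :=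
    integral_const_mul _ _
  rcases le_total y x with h | h
  · refine (hG.sub_le hy.1 h hx.2 (intervalIntegrable_of_vol hI hy.1.le h hx.2) ?_).trans
      ((intervalIntegral_le_vol hI h0 hy.1.le h hx.2).trans hE.le)
    filter_upwards [hd] with r hr
    rw [hr]
    nlinarith [sq_nonneg (f r - r * deriv f r), sq_nonneg (r * deriv f r), sq_nonneg (f r)]
  · have := hG.le_sub hx.1 h hy.2 (h := fun r => -(2 * (f r ^ 2 + (r * deriv f r) ^ 2)))
      (intervalIntegrable_of_vol hI hx.1.le h hy.2).neg (by
        filter_upwards [hd] with r hr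
        rw [hr]
        nlinarith [sq_nonneg (f r + r * deriv f r), sq_nonneg (r * deriv f r), sq_nonneg (f r)])
    rw [intervalIntegral.integral_neg] at this
    have h2 := (intervalIntegral_le_vol hI h0 hx.1.le h hy.2).trans hE.le
    linarith

/-- Average of the preceding oscillation bound over `y`. It serves both as a trace estimate at `R`
and as a bound on the growth of `f` at the axis. -/
lemma mul_sq_le (hR : 0 < R) (hf : Energetic R f) {x : ℝ} (hx : x ∈ Ioc 0 R) :
    x * f x ^ 2 ≤ 3 * energy R f := by
  have hc : Integrable (fun _ : ℝ => x * f x ^ 2) (vol R) := integrable_const _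
  have hc' : Integrable (fun _ : ℝ => 2 * energy R f) (vol R) := integrable_const _
  have h1 : ∫ _ in Ioo 0 R, x * f x ^ 2 ≤ ∫ y in Ioo 0 R, (R * f y ^ 2 + 2 * energy R f) := by
    refine setIntegral_mono_on hc ((hf.sq.const_mul R).add hc') measurableSet_Ioo fun y hy => ?_
    have := hf.mul_sq_sub_le hx (Ioo_subset_Ioc_self hy)
    have h2 : y * (f y * f y) ≤ R * (f y * f y) := by have := hy.2.le; gcongr; exact mul_self_nonneg _
    nlinarith
  rw [integral_add (hf.sq.const_mul R) hc', integral_const_mul R (fun y => f y ^ 2)] at h1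
  simp only [integral_const, smul_eq_mul, measureReal_restrict_apply_univ, Real.volume_real_Ioo_of_le hR.le,
    sub_zero] at h1
  have := hf.integral_sq_le
  have h3 : R * (x * f x ^ 2) ≤ R * (3 * energy R f) := by
    have h4 := mul_le_mul_of_nonneg_left this hR.le
    linarith
  exact le_of_mul_le_mul_left h3 hR

/-- Hölder continuity of order `1/2` away from the axis, in the form given by Young's inequality
with a free parameter `t` in place of Cauchy–Schwarz. -/
lemma sub_le (hf : Energetic R f) {a x y t : ℝ} (ha : 0 < a) (hx : a ≤ x) (hxy : x ≤ y) (hy : y ≤ R)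
    (ht : 0 < t) : |f y - f x| ≤ (t * (y - x) + energy R f / t) / (2 * a) := by
  have hx0 : 0 < x := ha.trans_le hx
  have key : ∀ g : ℝ → ℝ, Energetic R g → energy R g = energy R f →
      g y - g x ≤ (t * (y - x) + energy R f / t) / (2 * a) := by
    intro g hg he
    have hI : IntervalIntegrable (fun r => (t + (r * deriv g r) ^ 2 / t) / (2 * a)) volume x y :=
      ((intervalIntegrable_const).add ((intervalIntegrable_of_vol hg.deriv_sq hx0.le hxy hy).div_const
        t)).div_const _
    refine (hg.lac.sub_le_of_Ioo hx0 hxy hy hI ?_).trans ?_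
    · refine Eventually.of_forall fun r hr => ?_
      have hr0 : 0 < r := hx0.trans hr.1
      rw [le_div_iff₀ (by positivity)]
      rcases le_total (deriv g r) 0 with h | h
      · have : 0 ≤ t + (r * deriv g r) ^ 2 / t := by positivity
        nlinarith
      · have h1 : a * deriv g r ≤ r * deriv g r := by have := hr.1; gcongr; linarith
        have h2 : 2 * (r * deriv g r) ≤ t + (r * deriv g r) ^ 2 / t := by
          rw [← sub_nonneg]
          have : t + (r * deriv g r) ^ 2 / t - 2 * (r * deriv g r) = (t - r * deriv g r) ^ 2 / t := by
            field_simp; ring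
          rw [this]; positivity
        nlinarith
    · rw [intervalIntegral.integral_div, intervalIntegral.integral_add intervalIntegrable_const
        ((intervalIntegrable_of_vol hg.deriv_sq hx0.le hxy hy).div_const t),
        intervalIntegral.integral_div]
      simp only [intervalIntegral.integral_const, smul_eq_mul]
      have h1 := intervalIntegral_le_vol hg.deriv_sq (Eventually.of_forall fun r => sq_nonneg _)
        hx0.le hxy hy
      have h2 : ∫ r in Ioo 0 R, (r * deriv g r) ^ 2 ≤ energy R f := by
        rw [← he]
        exact integral_mono hg.deriv_sq hg.integrable fun r => by simpa using sq_nonneg _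
      have h3 := h1.trans h2
      rw [mul_comm (y - x) t]
      gcongr
  rw [abs_le']
  refine ⟨key f hf rfl, ?_⟩
  have := key (fun r => (-1) * f r) (hf.const_mul (-1)) (by
    unfold energy
    simp only [deriv_const_mul_real]
    congr 1; ext r; ring)
  linarith

end Energetic

/-- An Arzelà–Ascoli argument: Tychonoff's theorem gives convergence at rational points, and the
uniform modulus of continuity of `Energetic.sub_le` extends it to every point of `(0, R]`. -/
lemma exists_subseq_tendsto (hR : 0 < R) {f : ℕ → ℝ → ℝ} (hf : ∀ n, Energetic R (f n)) {H : ℝ}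
    (hH : ∀ n, energy R (f n) ≤ H) :
    ∃ φ : ℕ → ℕ, StrictMono φ ∧ ∃ g : ℝ → ℝ, ∀ x ∈ Ioc 0 R,
      Tendsto (fun n => f (φ n) x) atTop (𝓝 (g x)) := by
  have hH0 : 0 ≤ H := (energy_nonneg _).trans (hH 0)
  let M : ℚ → ℝ := fun q => √(3 * H / q)
  -- The value `0` at rationals outside `(0, R]` lets the compact product be indexed by all of `ℚ`.
  let X : ℕ → ℚ → ℝ := fun n q => if (q : ℝ) ∈ Ioc 0 R then f n q else 0
  have hX : ∀ n, X n ∈ Set.pi univ fun q => Icc (-M q) (M q) := by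
    intro n q _
    by_cases hq : (q : ℝ) ∈ Ioc 0 R
    · have h1 := (hf n).mul_sq_le hR hq
      have h2 : f n q ^ 2 ≤ 3 * H / q := by
        rw [le_div_iff₀ hq.1]
        nlinarith [hH n]
      simp only [X, hq, if_true, M]
      exact abs_le.1 (Real.abs_le_sqrt h2)
    · simp only [X, hq, if_false]
      exact ⟨neg_nonpos.2 (Real.sqrt_nonneg _), Real.sqrt_nonneg _⟩
  obtain ⟨Y, -, φ, hφ, hlim⟩ := (isCompact_univ_pi fun q => isCompact_Icc).tendsto_subseq hX
  rw [tendsto_pi_nhds] at hlim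
  refine ⟨φ, hφ, ?_⟩
  have hc : ∀ x ∈ Ioc 0 R, ∃ l, Tendsto (fun n => f (φ n) x) atTop (𝓝 l) := by
    intro x hx
    refine cauchySeq_tendsto_of_complete (Metric.cauchySeq_iff.2 fun ε hε => ?_)
    -- First `t` is taken large enough to make the energy term of the modulus small, then `q` close
    -- enough to `x` to make the length term small; `q ≥ x/2` fixes the distance from the axis.
    obtain ⟨t, ht, ht2⟩ : ∃ t : ℝ, 0 < t ∧ H / t / x ≤ ε / 8 := by
      refine ⟨8 * (H + 1) / (ε * x), by have := hx.1; positivity, ?_⟩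
      have := hx.1
      rw [div_div, div_le_iff₀ (by positivity)]
      field_simp
      linarith
    have hx1 := hx.1
    obtain ⟨q, hq1, hq2⟩ := exists_rat_btwn (show max (x / 2) (x - ε * x / (8 * t)) < x from
      max_lt (by linarith) (by have : 0 < ε * x / (8 * t) := by positivity
                               linarith))
    have hqx : x / 2 ≤ q := ((le_max_left _ _).trans_lt hq1).le
    have hqx' : x - q ≤ ε * x / (8 * t) := by linarith [(le_max_right _ _).trans_lt hq1]
    have hqm : (q : ℝ) ∈ Ioc 0 R := ⟨by linarith, by linarith [hx.2]⟩
    have hclose : ∀ n, |f n x - f n q| ≤ ε / 4 := by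
      intro n
      refine ((hf n).sub_le (a := x / 2) (by linarith) hqx hq2.le hx.2 ht).trans ?_
      have h1 : energy R (f n) / t ≤ H / t := by have := hH n; gcongr
      have h2 : t * (x - q) ≤ ε * x / 8 := by
        calc t * (x - q) ≤ t * (ε * x / (8 * t)) := by gcongr
          _ = _ := by field_simp
      rw [div_le_iff₀ hx1] at ht2
      rw [div_le_iff₀ (by linarith)]
      linarith
    have hcq := (hlim q).cauchySeq
    obtain ⟨N, hN⟩ := Metric.cauchySeq_iff.1 hcq (ε / 4) (by linarith)
    refine ⟨N, fun n hn l hl => ?_⟩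
    have h1 := hN n hn l hl
    simp only [Function.comp, X, hqm, if_true, Real.dist_eq] at h1
    have h2 := hclose (φ n)
    have h3 := hclose (φ l)
    rw [Real.dist_eq]
    rw [abs_lt] at *
    rw [abs_le] at *
    constructor <;> linarith [h1.1, h1.2, h2.1, h2.2, h3.1, h3.2]
  choose! g hg using hc
  exact ⟨g, hg⟩

lemma norm_toLp_sq {μ : Measure ℝ} {g : ℝ → ℝ} (hg : MemLp g 2 μ) :
    ‖hg.toLp g‖ ^ 2 = ∫ r, g r ^ 2 ∂μ := by
  rw [← real_inner_self_eq_norm_sq, L2.inner_def]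
  refine integral_congr_ae ?_
  filter_upwards [hg.coeFn_toLp] with r hr
  rw [hr]
  simp [sq]

lemma Energetic.memLp {f : ℝ → ℝ} (hf : Energetic R f) : MemLp (fun r => r * deriv f r) 2 (vol R) :=
  (memLp_two_iff_integrable_sq
    (measurable_id.mul (measurable_deriv f)).aestronglyMeasurable).2 hf.deriv_sq

/-- Completeness of the energy space. -/
lemma exists_limit (hR : 0 < R) {f : ℕ → ℝ → ℝ} (hf : ∀ n, Energetic R (f n))
    (hc : ∀ ε > 0, ∃ N, ∀ n ≥ N, ∀ l ≥ N, energy R (fun r => f n r - f l r) ≤ ε) :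
    ∃ g, LAC R g ∧ (∀ x ∈ Ioc 0 R, Tendsto (fun n => f n x) atTop (𝓝 (g x))) ∧
      ∃ φ : ℕ → ℕ, StrictMono φ ∧
        ∀ᵐ r ∂(vol R), Tendsto (fun n => deriv (f (φ n)) r) atTop (𝓝 (deriv g r)) := by
  let F : ℕ → Lp ℝ 2 (vol R) := fun n => (hf n).memLp.toLp _
  have hFd : ∀ n l, ‖F n - F l‖ ^ 2 ≤ energy R (fun r => f n r - f l r) := by
    intro n l
    rw [← MemLp.toLp_sub, norm_toLp_sq]
    refine integral_mono_ae ((memLp_two_iff_integrable_sq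
      ((hf n).memLp.sub (hf l).memLp).1).1 ((hf n).memLp.sub (hf l).memLp))
      ((hf n).sub (hf l)).integrable ?_
    filter_upwards [(hf n).lac.ae_differentiableAt, (hf l).lac.ae_differentiableAt] with r h1 h2
    simp only [Pi.sub_apply]
    rw [deriv_fun_sub h1 h2]
    nlinarith [sq_nonneg (f n r - f l r)]
  have hF : CauchySeq F := by
    refine Metric.cauchySeq_iff.2 fun ε hε => ?_
    obtain ⟨N, hN⟩ := hc ((ε / 2) ^ 2) (by positivity)
    refine ⟨N, fun n hn l hl => ?_⟩
    rw [dist_eq_norm]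
    have := (hFd n l).trans (hN n hn l hl)
    have := abs_le_of_sq_le_sq this (by positivity)
    linarith [(abs_le.1 this).2, this]
  obtain ⟨G, hG⟩ := cauchySeq_tendsto_of_complete hF
  have hGm : MemLp G 2 (vol R) := Lp.memLp G
  have hGi : Integrable (fun r => G r ^ 2) (vol R) := (memLp_two_iff_integrable_sq hGm.1).1 hGm
  have hGint : ∀ a ∈ Ioo 0 R, IntervalIntegrable (fun r => G r / r) volume a R := by
    intro a ha
    have h1 := intervalIntegrable_of_vol (hGm.integrable one_le_two) ha.1.le ha.2.le le_rfl
    simp only [div_eq_mul_inv]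
    refine h1.mul_continuousOn (continuousOn_id.inv₀ fun x hx => ?_)
    rw [uIcc_of_le ha.2.le] at hx
    exact (ha.1.trans_le hx.1).ne'
  have hpt : ∀ x ∈ Ioc 0 R, CauchySeq fun n => f n x := by
    intro x hx
    refine Metric.cauchySeq_iff.2 fun ε hε => ?_
    have hx1 := hx.1
    obtain ⟨N, hN⟩ := hc ((ε / 2) ^ 2 * x / 3) (by positivity)
    refine ⟨N, fun n hn l hl => ?_⟩
    have h1 := ((hf n).sub (hf l)).mul_sq_le hR hx
    have h2 := hN n hn l hl
    have h3 : (f n x - f l x) ^ 2 ≤ (ε / 2) ^ 2 := by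
      refine le_of_mul_le_mul_left ?_ hx1
      linarith
    rw [Real.dist_eq]
    linarith [abs_le_of_sq_le_sq h3 (by positivity), abs_le.2 (abs_le_of_sq_le_sq' h3 (by positivity))]
  obtain ⟨c, hcl⟩ := cauchySeq_tendsto_of_complete (hpt R ⟨hR, le_rfl⟩)
  -- The constant is fixed at `R`, where `f n R` converges to `c`; integrating from `R` keeps away
  -- from the axis, where `G / r` need not be integrable.
  let g : ℝ → ℝ := fun x => c + ∫ r in R..x, G r / r
  have hg : LAC R g := by
    intro a ha
    exact (LipschitzOnWith.absolutelyContinuousOnInterval (K := 0)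
      ((LipschitzWith.const c).lipschitzOnWith)).fun_add
      ((hGint a ha).absolutelyContinuousOnInterval_intervalIntegral (by simp))
  have hdg : ∀ᵐ r ∂(vol R), deriv g r = G r / r := by
    have hn : ∀ n : ℕ, ∀ᵐ r : ℝ, r ∈ Icc (R / (n + 2)) R → deriv g r = G r / r := by
      intro n
      have h2 : R / (n + 2) ∈ Ioo 0 R := by
        refine ⟨by positivity, ?_⟩
        rw [div_lt_iff₀ (by positivity)]
        nlinarith [(Nat.cast_nonneg n : (0 : ℝ) ≤ n)]
      filter_upwards [(hGint _ h2).ae_hasDerivAt_integral] with r hr hr'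
      rw [uIcc_of_le h2.2.le] at hr
      exact ((hr hr' R ⟨h2.2.le, le_rfl⟩).const_add c).deriv
    rw [ae_restrict_iff' measurableSet_Ioo]
    filter_upwards [ae_all_iff.2 hn] with r hr hr'
    obtain ⟨n, hn⟩ := exists_nat_gt (R / r)
    refine hr n ⟨?_, hr'.2.le⟩
    rw [div_lt_iff₀ hr'.1] at hn
    rw [div_le_iff₀ (by positivity)]
    nlinarith [hr'.1]
  refine ⟨g, hg, fun x hx => ?_, ?_⟩
  · have hx1 := hx.1
    have hkey : ∀ n, ∀ t > 0, |f n R - f n x - ∫ r in x..R, G r / r|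
        ≤ (t * (R - x) + ‖F n - G‖ ^ 2 / t) / (2 * x) := by
      intro n t ht
      have hi1 := (hf n).lac.intervalIntegrable_deriv hx.1 hx.2 le_rfl
      have hi2 : IntervalIntegrable (fun r => G r / r) volume x R := by
        rcases eq_or_lt_of_le hx.2 with rfl | h
        · simp
        · exact hGint x ⟨hx.1, h⟩
      rw [← (hf n).lac.integral_deriv hx.1 hx.2 le_rfl, ← intervalIntegral.integral_sub hi1 hi2]
      refine (intervalIntegral.abs_integral_le_integral_abs hx.2).trans ?_
      have hm : MemLp (fun r => r * deriv (f n) r - G r) 2 (vol R) := (hf n).memLp.sub hGm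
      have hmi : Integrable (fun r => (r * deriv (f n) r - G r) ^ 2) (vol R) :=
        (memLp_two_iff_integrable_sq hm.1).1 hm
      have hn2 : ‖F n - G‖ ^ 2 = ∫ r in Ioo 0 R, (r * deriv (f n) r - G r) ^ 2 := by
        have e : F n - G = hm.toLp _ := by
          conv_lhs => rw [← Lp.toLp_coeFn G hGm]
          rw [← MemLp.toLp_sub]; rfl
        rw [e, norm_toLp_sq]
      have hI : IntervalIntegrable (fun r => (t + (r * deriv (f n) r - G r) ^ 2 / t) / (2 * x))
          volume x R := ((intervalIntegrable_const).add
            ((intervalIntegrable_of_vol hmi hx1.le hx.2 le_rfl).div_const t)).div_const _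
      refine (intervalIntegral.integral_mono_on hx.2 (hi1.sub hi2).abs hI fun r hr => ?_).trans ?_
      · have hr0 : 0 < r := hx1.trans_le hr.1
        rw [le_div_iff₀ (by positivity)]
        have e : deriv (f n) r - G r / r = (r * deriv (f n) r - G r) / r := by field_simp
        rw [e, abs_div, abs_of_pos hr0]
        set A := |r * deriv (f n) r - G r| with hA
        have hA2 : (r * deriv (f n) r - G r) ^ 2 = A ^ 2 := (sq_abs _).symm
        rw [hA2]
        have hA0 : 0 ≤ A := abs_nonneg _
        have h1 : A / r * x ≤ A := by
          rw [div_mul_eq_mul_div, div_le_iff₀ hr0]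
          have := hr.1
          gcongr
        have h2 : 2 * A ≤ t + A ^ 2 / t := by
          rw [← sub_nonneg]
          have : t + A ^ 2 / t - 2 * A = (t - A) ^ 2 / t := by field_simp; ring
          rw [this]; positivity
        linarith
      · rw [intervalIntegral.integral_div, intervalIntegral.integral_add intervalIntegrable_const
          ((intervalIntegrable_of_vol hmi hx1.le hx.2 le_rfl).div_const t),
          intervalIntegral.integral_div, hn2]
        simp only [intervalIntegral.integral_const, smul_eq_mul]
        have h1 := intervalIntegral_le_vol hmi (Eventually.of_forall fun r => sq_nonneg _)
          hx1.le hx.2 le_rfl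
        rw [mul_comm (R - x) t]
        gcongr
    have hFG : Tendsto (fun n => ‖F n - G‖ ^ 2) atTop (𝓝 0) := by
      have := (tendsto_iff_norm_sub_tendsto_zero.1 hG).pow 2
      simpa using this
    have h0 : Tendsto (fun n => f n R - f n x - ∫ r in x..R, G r / r) atTop (𝓝 0) := by
      rw [Metric.tendsto_atTop]
      intro ε hε
      have ht : 0 < ε * x / (R - x + 1) := by
        have : 0 < R - x + 1 := by linarith [hx.2]
        positivity
      set t := ε * x / (R - x + 1) with htd
      obtain ⟨N, hN⟩ := Metric.tendsto_atTop.1 hFG (t * (ε * x / 2)) (by positivity)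
      refine ⟨N, fun n hn => ?_⟩
      have h1 := hN n hn
      rw [Real.dist_eq, sub_zero, abs_of_nonneg (by positivity)] at h1
      rw [Real.dist_eq, sub_zero]
      refine (hkey n t ht).trans_lt ?_
      rw [div_lt_iff₀ (by positivity)]
      have h2 : t * (R - x) < ε * x := by
        have h3 : 0 < R - x + 1 := by linarith [hx.2]
        rw [htd, div_mul_eq_mul_div, div_lt_iff₀ h3]
        have : 0 < ε * x := by positivity
        nlinarith
      have h3 : ‖F n - G‖ ^ 2 / t < ε * x / 2 := by
        rw [div_lt_iff₀ ht]; linarith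
      nlinarith [mul_pos hε hx1]
    have h1 := (hcl.sub h0).sub_const (∫ r in x..R, G r / r)
    have e : c - 0 - ∫ r in x..R, G r / r = g x := by
      simp only [g]
      rw [intervalIntegral.integral_symm R x]; ring
    rw [e] at h1
    refine h1.congr fun n => ?_
    ring
  · have hm : TendstoInMeasure (vol R) (fun n => (F n : ℝ → ℝ)) atTop G :=
      tendstoInMeasure_of_tendsto_Lp hG
    obtain ⟨φ, hφ, hae⟩ := hm.exists_seq_tendsto_ae
    refine ⟨φ, hφ, ?_⟩
    have hco : ∀ᵐ r ∂(vol R), ∀ n, F n r = r * deriv (f n) r :=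
      ae_all_iff.2 fun n => (hf n).memLp.coeFn_toLp
    filter_upwards [hae, hco, hdg, ae_restrict_mem measurableSet_Ioo] with r h1 h2 h3 h4
    rw [h3]
    refine (h1.div_const r).congr fun n => ?_
    rw [h2, mul_div_cancel_left₀ _ h4.1.ne']

end EnergySpace

end ZPinch

/-! ### The equilibrium near the axis and near the interface. -/

namespace ZPinch

namespace Data.Admissible

variable {d : Data} (hd : d.Admissible)
include hd

lemma continuousOn_p : ContinuousOn d.p (Icc 0 d.r₀) := hd.p_contDiff.continuousOn

lemma contDiffOn_dp : ContDiffOn ℝ 1 d.dp (Icc 0 d.r₀) :=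
  hd.p_contDiff.derivWithin (uniqueDiffOn_Icc hd.r₀_pos) le_rfl

lemma continuousOn_dp : ContinuousOn d.dp (Icc 0 d.r₀) := hd.contDiffOn_dp.continuousOn

lemma hasDerivWithinAt_p {r : ℝ} (hr : r ∈ Icc 0 d.r₀) :
    HasDerivWithinAt d.p (d.dp r) (Icc 0 d.r₀) r :=
  (hd.p_contDiff.differentiableOn (by norm_num) r hr).hasDerivWithinAt

lemma hasDerivAt_p {r : ℝ} (hr : r ∈ Ioo 0 d.r₀) : HasDerivAt d.p (d.dp r) r :=
  (hd.hasDerivWithinAt_p (Ioo_subset_Icc_self hr)).hasDerivAt (Icc_mem_nhds hr.1 hr.2)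

lemma p_r₀ : d.p d.r₀ = 0 := (hd.p_zero_iff _ ⟨hd.r₀_pos.le, le_rfl⟩).2 rfl

lemma p_pos {r : ℝ} (hr : r ∈ Ico 0 d.r₀) : 0 < d.p r := by
  refine lt_of_le_of_ne (hd.p_nonneg r (Ico_subset_Icc_self hr)) fun h => ?_
  exact hr.2.ne ((hd.p_zero_iff r (Ico_subset_Icc_self hr)).1 h.symm)

lemma exists_dp_bound : ∃ C, 0 < C ∧ ∀ r ∈ Icc 0 d.r₀, |d.dp r| ≤ C := by
  obtain ⟨C, hC⟩ := isCompact_Icc.exists_bound_of_continuousOn hd.continuousOn_dp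
  exact ⟨max C 1, by positivity, fun r hr => (hC r hr).trans (le_max_left _ _)⟩

lemma exists_p_bound : ∃ C, 0 < C ∧ ∀ r ∈ Icc 0 d.r₀, d.p r ≤ C := by
  obtain ⟨C, hC⟩ := isCompact_Icc.exists_bound_of_continuousOn hd.continuousOn_p
  exact ⟨max C 1, by positivity, fun r hr => (le_abs_self _).trans ((hC r hr).trans (le_max_left _ _))⟩

lemma continuousOn_sq_mul_dp : ContinuousOn (fun x => x ^ 2 * d.dp x) (Icc 0 d.r₀) :=
  (continuousOn_id.pow 2).mul hd.continuousOn_dp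

lemma B_sq {r : ℝ} (hr : r ∈ Icc 0 d.r₀) :
    d.B r ^ 2 = -(2 / r ^ 2) * ∫ x in (0 : ℝ)..r, x ^ 2 * d.dp x := by
  have := hd.integral_nonneg r hr
  exact Real.sq_sqrt (by rw [neg_mul, ← mul_neg]; positivity)

/-- Since `p'` is bounded, the integral of `x² p'` is `O(r³)`. The resulting `B² = O(r)` is what
makes `B² / r` a bounded coefficient at the axis. -/
lemma exists_B_sq_le : ∃ C, 0 < C ∧ ∀ r ∈ Icc 0 d.r₀, d.B r ^ 2 ≤ C * r := by
  obtain ⟨C, hC0, hC⟩ := hd.exists_dp_bound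
  refine ⟨2 * C, by positivity, fun r hr => ?_⟩
  rcases eq_or_lt_of_le hr.1 with h | h
  · subst h
    rw [hd.B_sq hr]
    simp
  have h1 : ‖∫ x in (0 : ℝ)..r, x ^ 2 * d.dp x‖ ≤ (r ^ 2 * C) * |r - 0| := by
    refine intervalIntegral.norm_integral_le_of_norm_le_const fun x hx => ?_
    rw [uIoc_of_le h.le] at hx
    rw [norm_mul, Real.norm_eq_abs, Real.norm_eq_abs, abs_of_nonneg (sq_nonneg x)]
    have := hC x ⟨hx.1.le, hx.2.trans hr.2⟩
    have h2 : x ^ 2 ≤ r ^ 2 := by have := hx.1; have := hx.2; gcongr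
    gcongr
  rw [sub_zero, abs_of_pos h, Real.norm_eq_abs] at h1
  have h2 := (abs_le.1 h1).1
  rw [hd.B_sq hr]
  calc -(2 / r ^ 2) * ∫ x in (0 : ℝ)..r, x ^ 2 * d.dp x
      = 2 / r ^ 2 * (-∫ x in (0 : ℝ)..r, x ^ 2 * d.dp x) := by ring
    _ ≤ 2 / r ^ 2 * (r ^ 2 * C * r) := by gcongr; linarith
    _ = 2 * C * r := by field_simp

/-- This is the radial force balance of the equilibrium, `2p' + (B²)' + 2B²/r = 0`. -/
lemma hasDerivWithinAt_B_sq {r : ℝ} (hr : r ∈ Ioc 0 d.r₀) :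
    HasDerivWithinAt (fun x => d.B x ^ 2) (-2 * d.dp r - 2 * d.B r ^ 2 / r) (Ioc 0 d.r₀) r := by
  have hr' : r ∈ Icc 0 d.r₀ := Ioc_subset_Icc_self hr
  have hi : HasDerivWithinAt (fun y => ∫ x in (0 : ℝ)..y, x ^ 2 * d.dp x) (r ^ 2 * d.dp r)
      (Icc 0 d.r₀) r := by
    have : Fact (r ∈ Icc 0 d.r₀) := ⟨hr'⟩
    refine intervalIntegral.integral_hasDerivWithinAt_right ?_
      (hd.continuousOn_sq_mul_dp.stronglyMeasurableAtFilter_nhdsWithin measurableSet_Icc r)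
      (hd.continuousOn_sq_mul_dp r hr')
    refine (hd.continuousOn_sq_mul_dp.mono ?_).intervalIntegrable
    rw [uIcc_of_le hr.1.le]
    exact Icc_subset_Icc_right hr.2
  have hp : HasDerivAt (fun x : ℝ => -(2 / x ^ 2)) (4 / r ^ 3) r := by
    have h1 := (((hasDerivAt_pow 2 r).fun_inv (pow_pos hr.1 2).ne').const_mul 2).fun_neg
    have hr0 := hr.1.ne'
    refine (h1.congr_deriv ?_).congr_of_eventuallyEq (Eventually.of_forall fun x => ?_)
    · field_simp; norm_num; ring
    · simp [div_eq_mul_inv]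
  have h2 := (hp.hasDerivWithinAt (s := Ioc 0 d.r₀)).fun_mul (hi.mono Ioc_subset_Icc_self)
  refine (h2.congr_deriv ?_).congr (fun x hx => hd.B_sq (Ioc_subset_Icc_self hx)) (hd.B_sq hr')
  rw [hd.B_sq hr']
  have hr0 := hr.1.ne'
  field_simp
  ring

lemma hasDerivAt_B_sq {r : ℝ} (hr : r ∈ Ioo 0 d.r₀) :
    HasDerivAt (fun x => d.B x ^ 2) (-2 * d.dp r - 2 * d.B r ^ 2 / r) r :=
  (hd.hasDerivWithinAt_B_sq (Ioo_subset_Ioc_self hr)).hasDerivAt (Ioc_mem_nhds hr.1 hr.2)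

lemma continuousOn_B_sq : ContinuousOn (fun x => d.B x ^ 2) (Ioc 0 d.r₀) :=
  fun _ hr => (hd.hasDerivWithinAt_B_sq hr).continuousWithinAt

lemma contDiffOn_B_sq : ContDiffOn ℝ 1 (fun x => d.B x ^ 2) (Ioc 0 d.r₀) := by
  have hu : UniqueDiffOn ℝ (Ioc 0 d.r₀) := uniqueDiffOn_Ioc 0 d.r₀
  rw [show (1 : WithTop ℕ∞) = 0 + 1 from rfl, contDiffOn_succ_iff_derivWithin hu]
  refine ⟨fun r hr => (hd.hasDerivWithinAt_B_sq hr).differentiableWithinAt, by simp, ?_⟩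
  rw [contDiffOn_zero]
  refine ContinuousOn.congr (f := fun r => -2 * d.dp r - 2 * d.B r ^ 2 / r) ?_
    fun r hr => (hd.hasDerivWithinAt_B_sq hr).derivWithin (hu r hr)
  exact ((hd.continuousOn_dp.mono Ioc_subset_Icc_self).const_mul _ |>.sub
    ((hd.continuousOn_B_sq.const_mul 2).div continuousOn_id fun r hr => hr.1.ne'))

lemma contDiffOn_p : ContDiffOn ℝ 1 d.p (Ioc 0 d.r₀) :=
  (hd.p_contDiff.of_le (by norm_num)).mono Ioc_subset_Icc_self

/-- Admissibility only gives `≥ 0`. Strictness comes from integrating `(r² p)'`: since `r² p`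
vanishes at both ends, `-∫ x² p' = ∫ 2 x p > 0`. -/
lemma B_sq_r₀_pos : 0 < d.B d.r₀ ^ 2 := by
  have hR := hd.r₀_pos
  have hRm : d.r₀ ∈ Icc 0 d.r₀ := ⟨hR.le, le_rfl⟩
  have hc1 : ContinuousOn (fun x => 2 * x * d.p x) (Icc 0 d.r₀) :=
    (continuousOn_const.mul continuousOn_id).mul hd.continuousOn_p
  have hi1 : IntervalIntegrable (fun x => 2 * x * d.p x) volume 0 d.r₀ :=
    (hc1.mono (by rw [uIcc_of_le hR.le])).intervalIntegrable
  have hi2 : IntervalIntegrable (fun x => x ^ 2 * d.dp x) volume 0 d.r₀ :=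
    (hd.continuousOn_sq_mul_dp.mono (by rw [uIcc_of_le hR.le])).intervalIntegrable
  have h := intervalIntegral.integral_eq_sub_of_hasDerivAt_of_le hR.le
    (f := fun x => x ^ 2 * d.p x) (f' := fun x => 2 * x * d.p x + x ^ 2 * d.dp x)
    ((continuousOn_id.pow 2).mul hd.continuousOn_p) (fun x hx => by
      simpa using (hasDerivAt_pow 2 x).fun_mul (hd.hasDerivAt_p hx)) (hi1.add hi2)
  rw [intervalIntegral.integral_add hi1 hi2, hd.p_r₀] at h
  have hpos : 0 < ∫ x in (0 : ℝ)..d.r₀, 2 * x * d.p x :=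
    intervalIntegral.intervalIntegral_pos_of_pos_on hi1
      (fun x hx => by have := hd.p_pos (Ioo_subset_Ico_self hx); have := hx.1; positivity) hR
  rw [hd.B_sq hRm, neg_mul, ← mul_neg]
  have : 0 < -∫ x in (0 : ℝ)..d.r₀, x ^ 2 * d.dp x := by
    simp at h; linarith
  positivity

lemma γ_pos : 0 < d.γ := zero_lt_one.trans hd.one_lt_γ

lemma continuousOn_rho : ContinuousOn d.rho (Icc 0 d.r₀) :=
  (hd.continuousOn_p.div_const _).rpow_const fun _ _ => Or.inr (by have := hd.γ_pos; positivity)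

lemma rho_nonneg {r : ℝ} (hr : r ∈ Icc 0 d.r₀) : 0 ≤ d.rho r :=
  Real.rpow_nonneg (div_nonneg (hd.p_nonneg r hr) hd.A_pos.le) _

lemma rho_pos {r : ℝ} (hr : r ∈ Ico 0 d.r₀) : 0 < d.rho r :=
  Real.rpow_pos_of_pos (div_pos (hd.p_pos hr) hd.A_pos) _

lemma exists_rho_bound : ∃ C, 0 < C ∧ ∀ r ∈ Icc 0 d.r₀, d.rho r ≤ C := by
  obtain ⟨C, hC⟩ := isCompact_Icc.exists_bound_of_continuousOn hd.continuousOn_rho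
  exact ⟨max C 1, by positivity, fun r hr => (le_abs_self _).trans ((hC r hr).trans (le_max_left _ _))⟩

lemma exists_rho_lower {a : ℝ} (ha : a < d.r₀) :
    ∃ c, 0 < c ∧ ∀ r ∈ Icc 0 a, c ≤ d.rho r := by
  by_cases h : 0 ≤ a
  · have hs : Icc 0 a ⊆ Icc 0 d.r₀ := Icc_subset_Icc_right ha.le
    obtain ⟨x, hx, hmin⟩ := isCompact_Icc.exists_isMinOn (nonempty_Icc.2 h)
      (hd.continuousOn_rho.mono hs)
    exact ⟨d.rho x, hd.rho_pos ⟨hx.1, hx.2.trans_lt ha⟩, fun r hr => hmin hr⟩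
  · exact ⟨1, one_pos, fun r hr => absurd (hr.1.trans hr.2) h⟩

/-- Because `γ > 1`, `p / A` is `ρ` times the nonnegative power `1 - 1/γ` of the bounded quantity `p
/ A`. Terms carrying a factor `p` can therefore be charged to `J`. -/
lemma exists_p_le_rho : ∃ C, 0 < C ∧ ∀ r ∈ Icc 0 d.r₀, d.p r ≤ C * d.rho r := by
  obtain ⟨C, hC0, hC⟩ := hd.exists_p_bound
  have hA := hd.A_pos
  have hγ := hd.γ_pos
  have he : 0 ≤ 1 - 1 / d.γ := by
    rw [sub_nonneg, div_le_one hγ]; exact hd.one_lt_γ.le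
  refine ⟨d.A * (C / d.A) ^ (1 - 1 / d.γ), by positivity, fun r hr => ?_⟩
  have h0 := div_nonneg (hd.p_nonneg r hr) hA.le
  have h1 : d.p r / d.A = (d.p r / d.A) ^ (1 - 1 / d.γ) * d.rho r := by
    rw [Data.rho, ← Real.rpow_add_of_nonneg h0 he (by positivity)]
    simp
  calc d.p r = d.A * (d.p r / d.A) := by field_simp
    _ = d.A * ((d.p r / d.A) ^ (1 - 1 / d.γ) * d.rho r) := by rw [← h1]
    _ ≤ d.A * ((C / d.A) ^ (1 - 1 / d.γ) * d.rho r) := by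
        have := hC r hr
        have := hd.rho_nonneg hr
        gcongr
    _ = _ := by ring

/-- Near `r₀` the sign condition and `p = o(p')` combine; `p > 0` there excludes zeros of `p'`. This
is the source of instability for `m = 0`. -/
lemma eventually_p_lt {e : ℝ} (he : 0 < e) : ∃ a ∈ Ioo 0 d.r₀, ∀ r ∈ Ioo a d.r₀,
    d.dp r < 0 ∧ d.p r ≤ e * (-d.dp r) := by
  obtain ⟨κ, hκ0, hκR, hκ⟩ := hd.dp_nonpos
  have h1 := hd.p_littleO.bound he
  have h2 : ∀ᶠ r in 𝓝[<] d.r₀, r ∈ Ioo (d.r₀ - κ) d.r₀ :=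
    Ioo_mem_nhdsLT (by linarith)
  obtain ⟨a, ha, hsub⟩ := (mem_nhdsLT_iff_exists_Ioo_subset' (by linarith : d.r₀ - 1 < d.r₀)).1
    (h1.and h2)
  have ha' : a < d.r₀ := ha
  refine ⟨max a (d.r₀ / 2), ⟨lt_max_of_lt_right (by linarith [hd.r₀_pos]),
    max_lt ha' (by linarith [hd.r₀_pos])⟩, fun r hr => ?_⟩
  have hra : a < r := (le_max_left _ _).trans_lt hr.1
  have hr0 : 0 < r := by linarith [(le_max_right a (d.r₀ / 2)).trans_lt hr.1, hd.r₀_pos]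
  obtain ⟨h3, h4⟩ := hsub ⟨hra, hr.2⟩
  have h5 := hκ r (Ioo_subset_Ioc_self h4)
  have h6 := hd.p_pos ⟨hr0.le, hr.2⟩
  rw [Real.norm_eq_abs, Real.norm_eq_abs, abs_of_pos h6, abs_of_nonpos h5] at h3
  refine ⟨lt_of_le_of_ne h5 fun h => ?_, h3⟩
  rw [h] at h3
  simp at h3
  linarith

end Data.Admissible

end ZPinch

/-! ### The linear forms behind all energies, and control of profiles by the norm. -/

namespace ZPinch

/-- Linear combination `a u + b v` of profiles. -/
def Profile.comb (a b : ℝ) (u v : Profile) : Profile :=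
  ⟨fun r => a * u.ξ r + b * v.ξ r, fun r => a * u.η r + b * v.η r, fun r => a * u.ζ r + b * v.ζ r⟩

lemma Profile.sub_eq_comb (u v : Profile) : u.sub v = Profile.comb 1 (-1) u v := by
  simp [Profile.sub, Profile.comb, sub_eq_add_neg]

/-- The linear forms whose squares make up all the energy densities: the strain components of
the dissipation, the divergence, the profile itself, and `k r η + ξ - r ξ'`. -/
noncomputable def ell (m k : ℤ) (u : Profile) (r : ℝ) : Fin 11 → ℝ :=
  ![-2 * deriv u.ξ r + u.ξ r / r + m / r * u.ζ r - k * u.η r,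
    deriv u.ξ r - 2 * u.ξ r / r - 2 * m / r * u.ζ r - k * u.η r,
    deriv u.ξ r + u.ξ r / r + m / r * u.ζ r + 2 * k * u.η r,
    -deriv u.ζ r + u.ζ r / r + m / r * u.ξ r,
    deriv u.η r + k * u.ξ r,
    m / r * u.η r - k * u.ζ r,
    deriv u.ξ r + u.ξ r / r + m / r * u.ζ r - k * u.η r,
    u.ξ r, u.η r, u.ζ r,
    k * r * u.η r + u.ξ r - r * deriv u.ξ r]

/-- The weights for which all `∫ wtᵢ ℓᵢ²` are controlled by the norm. -/
def wt (r : ℝ) : Fin 11 → ℝ := ![r, r, r, r, r, r, r, 1, 1, 1, 1]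

/-- Coefficients bounded by the weights. -/
structure Adm (R : ℝ) (c : Fin 11 → ℝ → ℝ) : Prop where
  meas : ∀ i, AEStronglyMeasurable (c i) (vol R)
  bdd : ∃ C, 0 ≤ C ∧ ∀ i, ∀ r ∈ Ioo 0 R, |c i r| ≤ C * wt r i

/-- The bilinear form `∫ ∑ cᵢ ℓᵢ(u) ℓᵢ(v)`. -/
noncomputable def qf (R : ℝ) (m k : ℤ) (c : Fin 11 → ℝ → ℝ) (u v : Profile) : ℝ :=
  ∫ r in Ioo 0 R, ∑ i, c i r * (ell m k u r i * ell m k v r i)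

/-- Coefficients of the norm. -/
noncomputable def cN (d : Data) : Fin 11 → ℝ → ℝ :=
  ![fun r => r, fun r => r, fun r => r, fun r => r, fun r => r, fun r => r, fun r => r,
    fun r => d.rho r * r, fun r => d.rho r * r, fun r => d.rho r * r, fun _ => 0]

/-- Locally absolutely continuous profiles of finite norm. -/
structure FiniteNorm (d : Data) (m k : ℤ) (u : Profile) : Prop where
  lac_ξ : LAC d.r₀ u.ξ
  lac_η : LAC d.r₀ u.η
  lac_ζ : LAC d.r₀ u.ζ
  int : Integrable (d.normDensity m k u) (vol d.r₀)

/-- The squared norm, as a real number. -/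
noncomputable def nrm (d : Data) (m k : ℤ) (u : Profile) : ℝ :=
  ∫ r in Ioo 0 d.r₀, d.normDensity m k u r

section

variable {d : Data} {m k : ℤ} {u v : Profile}

lemma normDensity_eq (r : ℝ) :
    d.normDensity m k u r = ∑ i, cN d i r * (ell m k u r i * ell m k u r i) := by
  simp only [Data.normDensity, cN, ell, Fin.sum_univ_succ, Fin.sum_univ_zero]
  simp
  ring

lemma normDensity_nonneg (hd : d.Admissible) {r : ℝ} (hr : r ∈ Ioo 0 d.r₀) :
    0 ≤ d.normDensity m k u r := by
  have h1 := hd.rho_nonneg (Ioo_subset_Icc_self hr)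
  have h2 := hr.1
  unfold Data.normDensity
  positivity

lemma ae_normDensity_nonneg (hd : d.Admissible) :
    ∀ᵐ r ∂(vol d.r₀), 0 ≤ d.normDensity m k u r :=
  (ae_restrict_mem measurableSet_Ioo).mono fun _ hr => normDensity_nonneg hd hr

lemma nrm_nonneg (hd : d.Admissible) : 0 ≤ nrm d m k u :=
  integral_nonneg_of_ae (ae_normDensity_nonneg hd)

lemma Adm.cN (hd : d.Admissible) : Adm d.r₀ (cN d) := by
  obtain ⟨C, hC0, hC⟩ := hd.exists_rho_bound
  have hR := hd.r₀_pos
  refine ⟨fun i => ?_, max 1 (C * d.r₀), by positivity, fun i r hr => ?_⟩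
  · have h1 : AEStronglyMeasurable (fun r => d.rho r * r) (vol d.r₀) :=
      ((hd.continuousOn_rho.mono Ioo_subset_Icc_self).mul continuousOn_id).aestronglyMeasurable
        measurableSet_Ioo
    have h2 : AEStronglyMeasurable (fun r : ℝ => r) (vol d.r₀) :=
      measurable_id.aestronglyMeasurable
    fin_cases i <;> first | exact h1 | exact h2 | exact aestronglyMeasurable_const
  · have h0 := hr.1
    have h1 : |r| ≤ max 1 (C * d.r₀) * r := by
      rw [abs_of_pos h0]
      nlinarith [le_max_left 1 (C * d.r₀)]
    have h2 : |d.rho r * r| ≤ max 1 (C * d.r₀) * 1 := by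
      rw [abs_of_nonneg (mul_nonneg (hd.rho_nonneg (Ioo_subset_Icc_self hr)) h0.le), mul_one]
      refine le_trans ?_ (le_max_right _ _)
      have h3 := hC r (Ioo_subset_Icc_self hr)
      have h4 := hr.2.le
      gcongr
    have h3 : |(0 : ℝ)| ≤ max 1 (C * d.r₀) * 1 := by
      rw [abs_zero]; positivity
    fin_cases i <;> first | exact h1 | exact h2 | exact h3

namespace FiniteNorm

lemma aemeasurable_ell (hu : FiniteNorm d m k u) (i : Fin 11) :
    AEMeasurable (fun r => ell m k u r i) (vol d.r₀) := by
  have h1 : AEMeasurable u.ξ (vol d.r₀) := hu.lac_ξ.aestronglyMeasurable.aemeasurable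
  have h2 : AEMeasurable u.η (vol d.r₀) := hu.lac_η.aestronglyMeasurable.aemeasurable
  have h3 : AEMeasurable u.ζ (vol d.r₀) := hu.lac_ζ.aestronglyMeasurable.aemeasurable
  have h4 : Measurable (deriv u.ξ) := measurable_deriv _
  have h5 : Measurable (deriv u.η) := measurable_deriv _
  have h6 : Measurable (deriv u.ζ) := measurable_deriv _
  fin_cases i <;> simp [ell] <;> fun_prop

end FiniteNorm

lemma ae_ell_comb {R : ℝ} (hu1 : LAC R u.ξ) (hu2 : LAC R u.η) (hu3 : LAC R u.ζ)
    (hv1 : LAC R v.ξ) (hv2 : LAC R v.η) (hv3 : LAC R v.ζ) (a b : ℝ) :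
    ∀ᵐ r ∂(vol R), ∀ i, ell m k (Profile.comb a b u v) r i
      = a * ell m k u r i + b * ell m k v r i := by
  filter_upwards [hu1.ae_differentiableAt, hu2.ae_differentiableAt, hu3.ae_differentiableAt,
    hv1.ae_differentiableAt, hv2.ae_differentiableAt, hv3.ae_differentiableAt]
    with r a1 a2 a3 b1 b2 b3 i
  have e1 : deriv (fun r => a * u.ξ r + b * v.ξ r) r = a * deriv u.ξ r + b * deriv v.ξ r :=
    ((a1.hasDerivAt.const_mul a).fun_add (b1.hasDerivAt.const_mul b)).deriv
  have e2 : deriv (fun r => a * u.η r + b * v.η r) r = a * deriv u.η r + b * deriv v.η r :=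
    ((a2.hasDerivAt.const_mul a).fun_add (b2.hasDerivAt.const_mul b)).deriv
  have e3 : deriv (fun r => a * u.ζ r + b * v.ζ r) r = a * deriv u.ζ r + b * deriv v.ζ r :=
    ((a3.hasDerivAt.const_mul a).fun_add (b3.hasDerivAt.const_mul b)).deriv
  fin_cases i <;> simp [ell, Profile.comb, e1, e2, e3] <;> ring

lemma normDensity_le_of_ell (hd : d.Admissible) {w : Profile} {a b r : ℝ} (hr : r ∈ Ioo 0 d.r₀)
    (h : ∀ i, ell m k w r i = a * ell m k u r i + b * ell m k v r i) :
    d.normDensity m k w r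
      ≤ 2 * a ^ 2 * d.normDensity m k u r + 2 * b ^ 2 * d.normDensity m k v r := by
  simp only [normDensity_eq, Finset.mul_sum, ← Finset.sum_add_distrib]
  refine Finset.sum_le_sum fun i _ => ?_
  have hc : 0 ≤ cN d i r := by
    have h1 : 0 ≤ d.rho r * r := mul_nonneg (hd.rho_nonneg (Ioo_subset_Icc_self hr)) hr.1.le
    have h2 := hr.1.le
    fin_cases i <;> first | exact h1 | exact h2 | exact le_rfl
  rw [h i]
  nlinarith [mul_nonneg hc (sq_nonneg (a * ell m k u r i - b * ell m k v r i))]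

lemma FiniteNorm.comb (hd : d.Admissible) (hu : FiniteNorm d m k u) (hv : FiniteNorm d m k v)
    (a b : ℝ) : FiniteNorm d m k (Profile.comb a b u v) ∧
      nrm d m k (Profile.comb a b u v) ≤ 2 * a ^ 2 * nrm d m k u + 2 * b ^ 2 * nrm d m k v := by
  have hl1 := (hu.lac_ξ.const_mul a).add (hv.lac_ξ.const_mul b)
  have hl2 := (hu.lac_η.const_mul a).add (hv.lac_η.const_mul b)
  have hl3 := (hu.lac_ζ.const_mul a).add (hv.lac_ζ.const_mul b)
  have hle : ∀ᵐ r ∂(vol d.r₀), d.normDensity m k (Profile.comb a b u v) r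
      ≤ 2 * a ^ 2 * d.normDensity m k u r + 2 * b ^ 2 * d.normDensity m k v r := by
    filter_upwards [ae_ell_comb (m := m) (k := k) hu.lac_ξ hu.lac_η hu.lac_ζ hv.lac_ξ hv.lac_η
      hv.lac_ζ a b, ae_restrict_mem measurableSet_Ioo] with r h1 h2
    exact normDensity_le_of_ell hd h2 h1
  have hI := (hu.int.const_mul (2 * a ^ 2)).add (hv.int.const_mul (2 * b ^ 2))
  have hmeas : AEStronglyMeasurable (d.normDensity m k (Profile.comb a b u v)) (vol d.r₀) := by
    have h1 : AEMeasurable (Profile.comb a b u v).ξ (vol d.r₀) := hl1.aestronglyMeasurable.aemeasurable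
    have h2 : AEMeasurable (Profile.comb a b u v).η (vol d.r₀) := hl2.aestronglyMeasurable.aemeasurable
    have h3 : AEMeasurable (Profile.comb a b u v).ζ (vol d.r₀) := hl3.aestronglyMeasurable.aemeasurable
    have h4 : Measurable (deriv (Profile.comb a b u v).ξ) := measurable_deriv _
    have h5 : Measurable (deriv (Profile.comb a b u v).η) := measurable_deriv _
    have h6 : Measurable (deriv (Profile.comb a b u v).ζ) := measurable_deriv _
    have h7 : AEMeasurable d.rho (vol d.r₀) :=
      ((hd.continuousOn_rho.mono Ioo_subset_Icc_self).aestronglyMeasurable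
        measurableSet_Ioo).aemeasurable
    refine AEMeasurable.aestronglyMeasurable ?_
    unfold Data.normDensity
    fun_prop
  have hint : Integrable (d.normDensity m k (Profile.comb a b u v)) (vol d.r₀) := by
    refine hI.mono' hmeas ?_
    filter_upwards [hle, ae_normDensity_nonneg (m := m) (k := k) (u := Profile.comb a b u v) hd]
      with r h1 h2
    rw [Real.norm_of_nonneg h2]
    exact h1
  refine ⟨⟨hl1, hl2, hl3, hint⟩, ?_⟩
  have := integral_mono_ae hint hI hle
  rw [show (fun r => 2 * a ^ 2 * d.normDensity m k u r) + (fun r => 2 * b ^ 2 * d.normDensity m k v r)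
    = fun r => 2 * a ^ 2 * d.normDensity m k u r + 2 * b ^ 2 * d.normDensity m k v r from rfl,
    integral_add (hu.int.const_mul (2 * a ^ 2)) (hv.int.const_mul (2 * b ^ 2)),
    integral_const_mul, integral_const_mul] at this
  exact this

lemma normSq_eq (hd : d.Admissible) (hu : FiniteNorm d m k u) :
    d.normSq m k u = ENNReal.ofReal (nrm d m k u) := by
  rw [nrm, ofReal_integral_eq_lintegral_ofReal hu.int (ae_normDensity_nonneg hd)]
  rfl

lemma FiniteNorm.of_normSq (hd : d.Admissible) (h1 : LAC d.r₀ u.ξ) (h2 : LAC d.r₀ u.η)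
    (h3 : LAC d.r₀ u.ζ) (h : d.normSq m k u < ⊤) : FiniteNorm d m k u := by
  refine ⟨h1, h2, h3, ?_, ?_⟩
  · have h1 : AEMeasurable u.ξ (vol d.r₀) := h1.aestronglyMeasurable.aemeasurable
    have h2 : AEMeasurable u.η (vol d.r₀) := h2.aestronglyMeasurable.aemeasurable
    have h3 : AEMeasurable u.ζ (vol d.r₀) := h3.aestronglyMeasurable.aemeasurable
    have h4 : Measurable (deriv u.ξ) := measurable_deriv _
    have h5 : Measurable (deriv u.η) := measurable_deriv _
    have h6 : Measurable (deriv u.ζ) := measurable_deriv _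
    have h7 : AEMeasurable d.rho (vol d.r₀) :=
      ((hd.continuousOn_rho.mono Ioo_subset_Icc_self).aestronglyMeasurable
        measurableSet_Ioo).aemeasurable
    refine AEMeasurable.aestronglyMeasurable ?_
    unfold Data.normDensity
    fun_prop
  · rwa [hasFiniteIntegral_iff_ofReal (ae_normDensity_nonneg hd)]

lemma sub_sq_le_two (a b : ℝ) : (a - b) ^ 2 ≤ 2 * a ^ 2 + 2 * b ^ 2 := by
  nlinarith [sq_nonneg (a + b)]

lemma add_sq_le_two (a b : ℝ) : (a + b) ^ 2 ≤ 2 * a ^ 2 + 2 * b ^ 2 := by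
  nlinarith [sq_nonneg (a - b)]

/-- Control of the middle part of a component by the norm. -/
lemma exists_middle_le (hd : d.Admissible) (m k : ℤ) : ∃ L, 0 < L ∧ ∀ u, FiniteNorm d m k u →
    ∀ f : ℝ → ℝ, LAC d.r₀ f →
      (∀ r ∈ Ioo 0 d.r₀, d.rho r * f r ^ 2 * r ≤ d.normDensity m k u r) →
      ∫ r in (d.r₀ / 4)..(d.r₀ / 2), f r ^ 2 ≤ L * nrm d m k u := by
  have hR := hd.r₀_pos
  set R := d.r₀ with hRd
  obtain ⟨c, hc0, hc⟩ := hd.exists_rho_lower (show R / 2 < d.r₀ by linarith)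
  -- On `[R/4, R/2]` the weight `ρ r` is at least `c R / 4`, the inverse of `L`.
  set L : ℝ := 4 / (c * R) with hL
  have hL0 : 0 < L := by positivity
  refine ⟨L, hL0, ?_⟩
  intro u hu f hf hle
  have hI := hu.int.const_mul L
  have h1 : ∫ r in (R / 4)..(R / 2), f r ^ 2
      ≤ ∫ r in (R / 4)..(R / 2), L * d.normDensity m k u r := by
    refine intervalIntegral.integral_mono_on (by linarith)
      (hf.intervalIntegrable_sq (by linarith) (by linarith) (by linarith))
      (intervalIntegrable_of_vol hI (by linarith) (by linarith) (by linarith)) fun r hr => ?_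
    have h2 := hle r ⟨by linarith [hr.1], by linarith [hr.2]⟩
    have h3 := hc r ⟨by linarith [hr.1], hr.2⟩
    have h4 : c * (R / 4) * f r ^ 2 ≤ d.rho r * f r ^ 2 * r := by
      have h5 : c * (R / 4) ≤ d.rho r * r := by
        have := hr.1
        have : 0 < R / 4 := by positivity
        have := hc0.le.trans h3
        gcongr
      nlinarith [mul_le_mul_of_nonneg_right h5 (sq_nonneg (f r))]
    calc f r ^ 2 = L * (c * (R / 4) * f r ^ 2) := by rw [hL]; field_simp
      _ ≤ L * d.normDensity m k u r := by have := h4.trans h2; gcongr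
  refine h1.trans ((intervalIntegral_le_vol hI ?_ (by linarith) (by linarith) (by linarith)).trans
    (integral_const_mul _ _).le)
  filter_upwards [ae_normDensity_nonneg (m := m) (k := k) (u := u) hd] with r hr
  positivity

lemma FiniteNorm.integral_sq_le (hu : FiniteNorm d m k u) {g : ℝ → ℝ}
    (hg : AEMeasurable g (vol d.r₀)) {C : ℝ}
    (hle : ∀ᵐ r ∂(vol d.r₀), g r ^ 2 ≤ C * d.normDensity m k u r) :
    Integrable (fun r => g r ^ 2) (vol d.r₀) ∧
      ∫ r in Ioo 0 d.r₀, g r ^ 2 ≤ C * nrm d m k u := by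
  have hI := hu.int.const_mul C
  have h1 : Integrable (fun r => g r ^ 2) (vol d.r₀) := by
    refine hI.mono' (hg.pow_const 2).aestronglyMeasurable ?_
    filter_upwards [hle] with r hr
    rwa [Real.norm_of_nonneg (sq_nonneg _)]
  exact ⟨h1, (integral_mono_ae h1 hI hle).trans (integral_const_mul _ _).le⟩

lemma integral_sq_le_add {R : ℝ} {g₁ g₂ g : ℝ → ℝ} {a b A B : ℝ}
    (i1 : Integrable (fun r => g₁ r ^ 2) (vol R)) (i2 : Integrable (fun r => g₂ r ^ 2) (vol R))
    (h1 : ∫ r in Ioo 0 R, g₁ r ^ 2 ≤ A) (h2 : ∫ r in Ioo 0 R, g₂ r ^ 2 ≤ B)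
    (ha : 0 ≤ a) (hb : 0 ≤ b) (hg : AEMeasurable g (vol R))
    (hle : ∀ r ∈ Ioo 0 R, g r ^ 2 ≤ a * g₁ r ^ 2 + b * g₂ r ^ 2) :
    Integrable (fun r => g r ^ 2) (vol R) ∧ ∫ r in Ioo 0 R, g r ^ 2 ≤ a * A + b * B := by
  have hI := (i1.const_mul (a)).add (i2.const_mul (b))
  have hle' : ∀ᵐ r ∂(vol R), g r ^ 2 ≤ a * g₁ r ^ 2 + b * g₂ r ^ 2 :=
    (ae_restrict_mem measurableSet_Ioo).mono hle
  have h3 : Integrable (fun r => g r ^ 2) (vol R) := by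
    refine hI.mono' (hg.pow_const 2).aestronglyMeasurable ?_
    filter_upwards [hle'] with r hr
    rwa [Real.norm_of_nonneg (sq_nonneg _)]
  refine ⟨h3, (integral_mono_ae h3 hI hle').trans ?_⟩
  rw [show (fun r => a * g₁ r ^ 2) + (fun r => b * g₂ r ^ 2)
    = fun r => a * g₁ r ^ 2 + b * g₂ r ^ 2 from rfl,
    integral_add (i1.const_mul (a)) (i2.const_mul (b)),
    integral_const_mul, integral_const_mul]
  gcongr
set_option maxHeartbeats 1000000 in
/-- The norm controls the profile without a weight at `r₀`, and `r` times its derivative. -/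
lemma exists_energy_le (hd : d.Admissible) (m k : ℤ) : ∃ K, 0 < K ∧ ∀ u, FiniteNorm d m k u →
    (Energetic d.r₀ u.ξ ∧ Energetic d.r₀ u.η ∧ Energetic d.r₀ u.ζ) ∧
      energy d.r₀ u.ξ ≤ K * nrm d m k u ∧ energy d.r₀ u.η ≤ K * nrm d m k u ∧
      energy d.r₀ u.ζ ≤ K * nrm d m k u := by
  have hR := hd.r₀_pos
  set R := d.r₀ with hRd
  obtain ⟨L, hL0, hmid⟩ := exists_middle_le hd m k
  rw [← hRd] at hmid
  set K1 := 1024 * (R + L) with hK1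
  set G2 := 2 * R + 2 * (k * R : ℝ) ^ 2 * K1 with hG2
  set K2 := 1024 * (G2 + L) with hK2
  set G3 := 2 * R + 2 * (m : ℝ) ^ 2 * K1 with hG3
  set K3 := 1024 * (G3 + L) with hK3
  have hK10 : 0 < K1 := by positivity
  have hG20 : 0 < G2 := by positivity
  have hG30 : 0 < G3 := by positivity
  refine ⟨(K1 + R) + (K2 + G2) + (K3 + (2 * K3 + 2 * G3)), by positivity, fun u hu => ?_⟩
  have hN := nrm_nonneg (m := m) (k := k) (u := u) hd
  have m1 : AEMeasurable u.ξ (vol R) := hu.lac_ξ.aestronglyMeasurable.aemeasurable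
  have m2 : AEMeasurable u.η (vol R) := hu.lac_η.aestronglyMeasurable.aemeasurable
  have m3 : AEMeasurable u.ζ (vol R) := hu.lac_ζ.aestronglyMeasurable.aemeasurable
  have m4 : Measurable (deriv u.ξ) := measurable_deriv _
  have m5 : Measurable (deriv u.η) := measurable_deriv _
  have m6 : Measurable (deriv u.ζ) := measurable_deriv _
  have rn : ∀ r ∈ Ioo 0 R, 0 ≤ d.rho r * r := fun r hr =>
    mul_nonneg (hd.rho_nonneg (Ioo_subset_Icc_self hr)) hr.1.le
  have sum_nn : ∀ r ∈ Ioo 0 R, ∀ i, 0 ≤ cN d i r * (ell m k u r i * ell m k u r i) := by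
    intro r hr i
    refine mul_nonneg ?_ (mul_self_nonneg _)
    have h1 := rn r hr
    have h2 := hr.1.le
    fin_cases i <;> first | exact h1 | exact h2 | exact le_rfl
  have single : ∀ r ∈ Ioo 0 R, ∀ i, cN d i r * (ell m k u r i * ell m k u r i)
      ≤ d.normDensity m k u r := by
    intro r hr i
    rw [normDensity_eq]
    exact Finset.single_le_sum (fun i _ => sum_nn r hr i) (Finset.mem_univ i)
  -- the radial component
  have e1 : ∀ᵐ r ∂(vol R), (r * deriv u.ξ r) ^ 2 ≤ R * d.normDensity m k u r := by
    filter_upwards [ae_restrict_mem measurableSet_Ioo] with r hr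
    have h0 := single r hr 0
    have h6 := single r hr 6
    simp [cN, ell] at h0 h6
    have hr0 := hr.1
    have hN0 := normDensity_nonneg (m := m) (k := k) (u := u) hd hr
    have h7 : r * deriv u.ξ r ^ 2 ≤ d.normDensity m k u r := by
      set X := deriv u.ξ r
      set Y := u.ξ r / r + m / r * u.ζ r - k * u.η r
      have h0' : r * (-2 * X + Y) ^ 2 ≤ d.normDensity m k u r := by
        refine le_trans (le_of_eq ?_) h0; simp only [Y]; ring
      have h6' : r * (X + Y) ^ 2 ≤ d.normDensity m k u r := by
        refine le_trans (le_of_eq ?_) h6; simp only [Y]; ring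
      -- The derivative is isolated by `3X = (X + Y) - (-2X + Y)`, that is, by comparing the first
      -- strain form with the divergence.
      have : X ^ 2 ≤ 2 / 9 * ((-2 * X + Y) ^ 2 + (X + Y) ^ 2) := by
        nlinarith [sq_nonneg ((-2 * X + Y) + (X + Y))]
      nlinarith
    calc (r * deriv u.ξ r) ^ 2 = r * (r * deriv u.ξ r ^ 2) := by ring
      _ ≤ R * d.normDensity m k u r := by
        have := hr.2.le
        gcongr
  obtain ⟨i1, b1⟩ := hu.integral_sq_le (by fun_prop) e1
  obtain ⟨i2, b2⟩ := hardy hR hu.lac_ξ (A := 0) le_rfl zero_le_one i1 (by simp)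
  have b3 := hmid u hu u.ξ hu.lac_ξ fun r hr => by
    have := single r hr 7; simp [cN, ell] at this; linarith
  have c1 : ∫ r in Ioo 0 R, u.ξ r ^ 2 ≤ K1 * nrm d m k u := by
    rw [hK1]; linarith
  -- the axial component
  have e2 : ∀ᵐ r ∂(vol R), (r * (deriv u.η r + k * u.ξ r)) ^ 2 ≤ R * d.normDensity m k u r := by
    filter_upwards [ae_restrict_mem measurableSet_Ioo] with r hr
    have h4 := single r hr 4
    simp [cN, ell] at h4
    have hN0 := normDensity_nonneg (m := m) (k := k) (u := u) hd hr
    calc (r * (deriv u.η r + k * u.ξ r)) ^ 2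
        = r * (r * ((deriv u.η r + k * u.ξ r) * (deriv u.η r + k * u.ξ r))) := by ring
      _ ≤ R * d.normDensity m k u r := by
        have := hr.2.le
        have := hr.1
        have : 0 ≤ r * ((deriv u.η r + k * u.ξ r) * (deriv u.η r + k * u.ξ r)) := by
          have := mul_self_nonneg (deriv u.η r + k * u.ξ r); positivity
        gcongr
  obtain ⟨i3, b4⟩ := hu.integral_sq_le (by fun_prop) e2
  obtain ⟨i4, b5⟩ := integral_sq_le_add (a := 2) (b := 2 * (k * R : ℝ) ^ 2)
    (g := fun r => r * deriv u.η r) i3 i2 b4 c1 (by positivity) (by positivity) (by fun_prop)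
    (fun r hr => by
      have h3 : (k * r * u.ξ r) ^ 2 ≤ (k * R) ^ 2 * u.ξ r ^ 2 := by
        rw [mul_pow, mul_pow, mul_pow]
        have := hr.1.le; have := hr.2.le
        gcongr
      have h4 := sub_sq_le_two (r * (deriv u.η r + k * u.ξ r)) (k * r * u.ξ r)
      rw [show r * (deriv u.η r + k * u.ξ r) - k * r * u.ξ r = r * deriv u.η r by ring] at h4
      linarith)
  have b5' : ∫ r in Ioo 0 R, (r * deriv u.η r) ^ 2 ≤ G2 * nrm d m k u := by
    refine b5.trans (le_of_eq ?_)
    rw [hG2]; ring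
  obtain ⟨i5, b6⟩ := hardy hR hu.lac_η (A := 0) le_rfl zero_le_one i4 (by simp)
  have b7 := hmid u hu u.η hu.lac_η fun r hr => by
    have := single r hr 8; simp [cN, ell] at this; linarith
  have c2 : ∫ r in Ioo 0 R, u.η r ^ 2 ≤ K2 * nrm d m k u := by
    rw [hK2]; linarith
  -- the azimuthal component
  have e3 : ∀ᵐ r ∂(vol R), (r * (-deriv u.ζ r + u.ζ r / r + m / r * u.ξ r)) ^ 2
      ≤ R * d.normDensity m k u r := by
    filter_upwards [ae_restrict_mem measurableSet_Ioo] with r hr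
    have h4 := single r hr 3
    simp [cN, ell] at h4
    set Z := -deriv u.ζ r + u.ζ r / r + m / r * u.ξ r
    calc (r * Z) ^ 2 = r * (r * (Z * Z)) := by ring
      _ ≤ R * d.normDensity m k u r := by
        have := hr.2.le
        have := hr.1
        have : 0 ≤ r * (Z * Z) := by
          have := mul_self_nonneg Z; positivity
        gcongr
  obtain ⟨i6, b8⟩ := hu.integral_sq_le (by fun_prop) e3
  obtain ⟨i7, b9⟩ := integral_sq_le_add (a := 2) (b := 2 * (m : ℝ) ^ 2)
    (g := fun r => m * u.ξ r - r * (-deriv u.ζ r + u.ζ r / r + m / r * u.ξ r))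
    i6 i2 b8 c1 (by positivity) (by positivity) (by fun_prop) (fun r hr => by
      have h4 := sub_sq_le_two (m * u.ξ r) (r * (-deriv u.ζ r + u.ζ r / r + m / r * u.ξ r))
      rw [mul_pow (m : ℝ)] at h4
      linarith)
  have b9' : ∫ r in Ioo 0 R, (m * u.ξ r - r * (-deriv u.ζ r + u.ζ r / r + m / r * u.ξ r)) ^ 2
      ≤ G3 * nrm d m k u := by
    refine b9.trans (le_of_eq ?_)
    rw [hG3]; ring
  have heq : ∀ᵐ r ∂(vol R), r * deriv u.ζ r
      = 1 * u.ζ r + (m * u.ξ r - r * (-deriv u.ζ r + u.ζ r / r + m / r * u.ξ r)) := by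
    filter_upwards [ae_restrict_mem measurableSet_Ioo] with r hr
    have := hr.1.ne'
    field_simp
    ring
  -- The norm controls `ζ` through `-ζ' + ζ/r + mξ/r` only, so `r ζ' = ζ + g` with the bound on `ξ`
  -- already contained in `g`. This is the extreme exponent `A = 1` admitted by `hardy`; `ξ` and `η`
  -- use `A = 0`.
  obtain ⟨i8, b10⟩ := hardy hR hu.lac_ζ (A := 1) zero_le_one le_rfl i7 heq
  have b11 := hmid u hu u.ζ hu.lac_ζ fun r hr => by
    have := single r hr 9; simp [cN, ell] at this; linarith
  have c3 : ∫ r in Ioo 0 R, u.ζ r ^ 2 ≤ K3 * nrm d m k u := by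
    rw [hK3]; linarith
  obtain ⟨i9, b12⟩ := integral_sq_le_add (a := 2) (b := 2) (g := fun r => r * deriv u.ζ r)
    i8 i7 c3 b9' (by positivity) (by positivity) (by fun_prop) (fun r hr => by
      have h3 : r * deriv u.ζ r
        = u.ζ r + (m * u.ξ r - r * (-deriv u.ζ r + u.ζ r / r + m / r * u.ξ r)) := by
        have := hr.1.ne'
        field_simp
        ring
      rw [h3]
      exact add_sq_le_two _ _)
  have b12' : ∫ r in Ioo 0 R, (r * deriv u.ζ r) ^ 2 ≤ (2 * K3 + 2 * G3) * nrm d m k u :=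
    b12.trans (le_of_eq (by ring))
  have pK3 : 0 < K3 := by positivity
  have pK2 : 0 < K2 := by positivity
  refine ⟨⟨⟨hu.lac_ξ, i2, i1⟩, ⟨hu.lac_η, i5, i4⟩, ⟨hu.lac_ζ, i8, i9⟩⟩, ?_, ?_, ?_⟩
  · rw [energy, integral_add i2 i1]
    refine (add_le_add c1 b1).trans (le_trans (le_of_eq (add_mul _ _ _).symm) ?_)
    exact mul_le_mul_of_nonneg_right (by linarith) hN
  · rw [energy, integral_add i5 i4]
    refine (add_le_add c2 b5').trans (le_trans (le_of_eq (add_mul _ _ _).symm) ?_)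
    exact mul_le_mul_of_nonneg_right (by linarith) hN
  · rw [energy, integral_add i8 i9]
    refine (add_le_add c3 b12').trans (le_trans (le_of_eq (add_mul _ _ _).symm) ?_)
    exact mul_le_mul_of_nonneg_right (by linarith) hN

end

end ZPinch

/-! ### Bounded quadratic forms: norm, constraint, dissipation and ideal energy. -/

namespace ZPinch

variable {d : Data} {m k : ℤ} {u v : Profile}

lemma integrable_of_aemeasurable_sq_le {R : ℝ} {f F : ℝ → ℝ} (hf : AEMeasurable f (vol R))
    (hF : Integrable F (vol R)) (hle : ∀ᵐ r ∂(vol R), |f r| ≤ F r) : Integrable f (vol R) :=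
  hF.mono' hf.aestronglyMeasurable hle

/-- All weighted squares `∫ wtᵢ ℓᵢ(u)²` are controlled by the norm. -/
lemma exists_weighted_le (hd : d.Admissible) (m k : ℤ) : ∃ K, 0 < K ∧ ∀ u, FiniteNorm d m k u →
    Integrable (fun r => ∑ i, wt r i * (ell m k u r i * ell m k u r i)) (vol d.r₀) ∧
      ∫ r in Ioo 0 d.r₀, ∑ i, wt r i * (ell m k u r i * ell m k u r i) ≤ K * nrm d m k u := by
  obtain ⟨K, hK, hE⟩ := exists_energy_le hd m k
  set A : ℝ := 5 + 3 * (k * d.r₀) ^ 2 with hA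
  have hA0 : 5 ≤ A := by rw [hA]; linarith [sq_nonneg (k * d.r₀ : ℝ)]
  refine ⟨1 + 3 * A * K, by positivity, fun u hu => ?_⟩
  obtain ⟨⟨h1, h2, h3⟩, b1, b2, b3⟩ := hE u hu
  have hI : Integrable (fun r => d.normDensity m k u r + A * ((u.ξ r ^ 2 + (r * deriv u.ξ r) ^ 2)
      + (u.η r ^ 2 + (r * deriv u.η r) ^ 2) + (u.ζ r ^ 2 + (r * deriv u.ζ r) ^ 2))) (vol d.r₀) :=
    hu.int.add (((h1.integrable.add h2.integrable).add h3.integrable).const_mul A)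
  have hle : ∀ᵐ r ∂(vol d.r₀), ∑ i, wt r i * (ell m k u r i * ell m k u r i)
      ≤ d.normDensity m k u r + A * ((u.ξ r ^ 2 + (r * deriv u.ξ r) ^ 2)
      + (u.η r ^ 2 + (r * deriv u.η r) ^ 2) + (u.ζ r ^ 2 + (r * deriv u.ζ r) ^ 2)) := by
    filter_upwards [ae_restrict_mem measurableSet_Ioo] with r hr
    have hρ := mul_nonneg (hd.rho_nonneg (Ioo_subset_Icc_self hr)) hr.1.le
    have e : ∑ i, wt r i * (ell m k u r i * ell m k u r i)
        = (d.normDensity m k u r - d.rho r * r * (u.ξ r ^ 2 + u.η r ^ 2 + u.ζ r ^ 2))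
          + (u.ξ r ^ 2 + u.η r ^ 2 + u.ζ r ^ 2
            + (k * r * u.η r + (u.ξ r - r * deriv u.ξ r)) ^ 2) := by
      simp only [Data.normDensity, wt, ell, Fin.sum_univ_succ, Fin.sum_univ_zero]
      simp
      ring
    have h4 : (k * r * u.η r + (u.ξ r - r * deriv u.ξ r)) ^ 2
        ≤ 2 * (k * d.r₀) ^ 2 * u.η r ^ 2 + 2 * (2 * u.ξ r ^ 2 + 2 * (r * deriv u.ξ r) ^ 2) := by
      refine (add_sq_le_two _ _).trans ?_
      have h5 := sub_sq_le_two (u.ξ r) (r * deriv u.ξ r)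
      have h6 : (k * r * u.η r : ℝ) ^ 2 ≤ (k * d.r₀) ^ 2 * u.η r ^ 2 := by
        rw [mul_pow, mul_pow, mul_pow]
        have := hr.1.le; have := hr.2.le
        gcongr
      linarith
    rw [e]
    have h7 : 0 ≤ d.rho r * r * (u.ξ r ^ 2 + u.η r ^ 2 + u.ζ r ^ 2) := by positivity
    set x := u.ξ r ^ 2
    set y := u.η r ^ 2
    set z := u.ζ r ^ 2
    set x' := (r * deriv u.ξ r) ^ 2
    set q := (k * d.r₀ : ℝ) ^ 2
    have hx : 0 ≤ x := sq_nonneg _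
    have hy : 0 ≤ y := sq_nonneg _
    have hz : 0 ≤ z := sq_nonneg _
    have hx' : 0 ≤ x' := sq_nonneg _
    have hy' : 0 ≤ (r * deriv u.η r) ^ 2 := sq_nonneg _
    have hz' : 0 ≤ (r * deriv u.ζ r) ^ 2 := sq_nonneg _
    have hq : 0 ≤ q := sq_nonneg _
    have a1 : 5 * x ≤ A * x := by nlinarith
    have a2 : 4 * x' ≤ A * x' := by nlinarith
    have a3 : (1 + 2 * q) * y ≤ A * y := by rw [hA]; nlinarith
    have a4 : 1 * z ≤ A * z := by nlinarith
    have a5 : 0 ≤ A * (r * deriv u.η r) ^ 2 := by positivity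
    have a6 : 0 ≤ A * (r * deriv u.ζ r) ^ 2 := by positivity
    have a7 : 2 * q * y = 2 * (q * y) := by ring
    have a8 : A * ((x + x') + (y + (r * deriv u.η r) ^ 2) + (z + (r * deriv u.ζ r) ^ 2))
        = A * x + A * x' + A * y + A * (r * deriv u.η r) ^ 2 + A * z
          + A * (r * deriv u.ζ r) ^ 2 := by ring
    rw [a8]
    linarith
  have h0 : ∀ᵐ r ∂(vol d.r₀), 0 ≤ ∑ i, wt r i * (ell m k u r i * ell m k u r i) := by
    filter_upwards [ae_restrict_mem measurableSet_Ioo] with r hr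
    refine Finset.sum_nonneg fun i _ => mul_nonneg ?_ (mul_self_nonneg _)
    have h1 := hr.1.le
    fin_cases i <;> first | exact h1 | exact zero_le_one
  have hm : AEMeasurable (fun r => ∑ i, wt r i * (ell m k u r i * ell m k u r i)) (vol d.r₀) := by
    refine Finset.aemeasurable_fun_sum _ fun i _ => ?_
    refine AEMeasurable.mul ?_ ((hu.aemeasurable_ell i).mul (hu.aemeasurable_ell i))
    fin_cases i <;> first | exact measurable_id.aemeasurable | exact aemeasurable_const
  have hint : Integrable (fun r => ∑ i, wt r i * (ell m k u r i * ell m k u r i)) (vol d.r₀) := by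
    refine integrable_of_aemeasurable_sq_le hm hI ?_
    filter_upwards [hle, h0] with r h1 h2
    rwa [abs_of_nonneg h2]
  refine ⟨hint, (integral_mono_ae hint hI hle).trans ?_⟩
  have i12 : Integrable (fun r => (u.ξ r ^ 2 + (r * deriv u.ξ r) ^ 2)
      + (u.η r ^ 2 + (r * deriv u.η r) ^ 2)) (vol d.r₀) := h1.integrable.add h2.integrable
  have i123 : Integrable (fun r => A * ((u.ξ r ^ 2 + (r * deriv u.ξ r) ^ 2)
      + (u.η r ^ 2 + (r * deriv u.η r) ^ 2) + (u.ζ r ^ 2 + (r * deriv u.ζ r) ^ 2))) (vol d.r₀) :=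
    (i12.add h3.integrable).const_mul A
  rw [integral_add hu.int i123, integral_const_mul, integral_add i12 h3.integrable,
    integral_add h1.integrable h2.integrable]
  change nrm d m k u + A * (energy d.r₀ u.ξ + energy d.r₀ u.η + energy d.r₀ u.ζ) ≤ _
  have : A * (energy d.r₀ u.ξ + energy d.r₀ u.η + energy d.r₀ u.ζ) ≤ A * (3 * (K * nrm d m k u)) := by
    have : 0 ≤ A := by linarith
    gcongr
    linarith
  linarith

variable {c c' : Fin 11 → ℝ → ℝ}

lemma wt_nonneg {r : ℝ} (hr : 0 ≤ r) (i : Fin 11) : 0 ≤ wt r i := by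
  fin_cases i <;> first | exact hr | exact zero_le_one

lemma Adm.integrable (hc : Adm d.r₀ c) (hd : d.Admissible) (hu : FiniteNorm d m k u)
    (hv : FiniteNorm d m k v) :
    Integrable (fun r => ∑ i, c i r * (ell m k u r i * ell m k v r i)) (vol d.r₀) := by
  obtain ⟨C, hC0, hC⟩ := hc.bdd
  obtain ⟨K, -, hK⟩ := exists_weighted_le hd m k
  have hI := ((hK u hu).1.add (hK v hv).1).const_mul C
  refine integrable_of_aemeasurable_sq_le ?_ hI ?_
  · exact Finset.aemeasurable_fun_sum _ fun i _ => (hc.meas i).aemeasurable.mul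
      ((hu.aemeasurable_ell i).mul (hv.aemeasurable_ell i))
  · filter_upwards [ae_restrict_mem measurableSet_Ioo] with r hr
    simp only [Pi.add_apply]
    rw [← Finset.sum_add_distrib, Finset.mul_sum]
    refine (Finset.abs_sum_le_sum_abs _ _).trans (Finset.sum_le_sum fun i _ => ?_)
    rw [abs_mul]
    have h1 := hC i r hr
    have h2 : |ell m k u r i * ell m k v r i|
        ≤ ell m k u r i * ell m k u r i + ell m k v r i * ell m k v r i := by
      rw [abs_le]
      constructor <;> nlinarith [sq_nonneg (ell m k u r i - ell m k v r i),
        sq_nonneg (ell m k u r i + ell m k v r i), sq_nonneg (ell m k u r i),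
        sq_nonneg (ell m k v r i)]
    have h3 := wt_nonneg hr.1.le i
    calc |c i r| * |ell m k u r i * ell m k v r i|
        ≤ (C * wt r i) * (ell m k u r i * ell m k u r i + ell m k v r i * ell m k v r i) := by
          gcongr
      _ = _ := by ring

lemma Adm.add_smul (hc : Adm d.r₀ c) (hc' : Adm d.r₀ c') (s : ℝ) :
    Adm d.r₀ (fun i r => c i r + s * c' i r) := by
  obtain ⟨C, hC0, hC⟩ := hc.bdd
  obtain ⟨C', hC0', hC'⟩ := hc'.bdd
  refine ⟨fun i => (hc.meas i).add ((hc'.meas i).const_mul s), C + |s| * C', by positivity,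
    fun i r hr => ?_⟩
  have h1 := hC i r hr
  have h2 := hC' i r hr
  calc |c i r + s * c' i r| ≤ |c i r| + |s| * |c' i r| := by
        rw [← abs_mul]; exact abs_add_le _ _
    _ ≤ C * wt r i + |s| * (C' * wt r i) := by gcongr
    _ = _ := by ring

lemma qf_add_smul (hd : d.Admissible) (hc : Adm d.r₀ c) (hc' : Adm d.r₀ c') (s : ℝ)
    (hu : FiniteNorm d m k u) (hv : FiniteNorm d m k v) :
    qf d.r₀ m k (fun i r => c i r + s * c' i r) u v = qf d.r₀ m k c u v + s * qf d.r₀ m k c' u v := by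
  rw [qf, qf, qf, ← integral_const_mul,
    ← integral_add (hc.integrable hd hu hv) ((hc'.integrable hd hu hv).const_mul s)]
  congr 1
  ext r
  rw [Finset.mul_sum, ← Finset.sum_add_distrib]
  exact Finset.sum_congr rfl fun i _ => by ring

lemma qf_comb (hd : d.Admissible) (hc : Adm d.r₀ c) (hu : FiniteNorm d m k u)
    (hv : FiniteNorm d m k v) (a b : ℝ) :
    qf d.r₀ m k c (Profile.comb a b u v) (Profile.comb a b u v)
      = a ^ 2 * qf d.r₀ m k c u u + 2 * a * b * qf d.r₀ m k c u v + b ^ 2 * qf d.r₀ m k c v v := by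
  have i1 := (hc.integrable hd hu hu).const_mul (a ^ 2)
  have i2 := (hc.integrable hd hu hv).const_mul (2 * a * b)
  have i3 := (hc.integrable hd hv hv).const_mul (b ^ 2)
  have i12 : Integrable (fun r => a ^ 2 * (∑ i, c i r * (ell m k u r i * ell m k u r i))
      + 2 * a * b * ∑ i, c i r * (ell m k u r i * ell m k v r i)) (vol d.r₀) := i1.add i2
  rw [qf, qf, qf, qf, ← integral_const_mul, ← integral_const_mul, ← integral_const_mul,
    ← integral_add i1 i2, ← integral_add i12 i3]
  refine integral_congr_ae ?_
  filter_upwards [ae_ell_comb (m := m) (k := k) hu.lac_ξ hu.lac_η hu.lac_ζ hv.lac_ξ hv.lac_η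
      hv.lac_ζ a b] with r hr
  rw [Finset.mul_sum, Finset.mul_sum, Finset.mul_sum, ← Finset.sum_add_distrib,
    ← Finset.sum_add_distrib]
  exact Finset.sum_congr rfl fun i _ => by rw [hr i]; ring

lemma exists_qf_le (hd : d.Admissible) (hc : Adm d.r₀ c) (m k : ℤ) :
    ∃ K, 0 ≤ K ∧ ∀ u, FiniteNorm d m k u → |qf d.r₀ m k c u u| ≤ K * nrm d m k u := by
  obtain ⟨C, hC0, hC⟩ := hc.bdd
  obtain ⟨K, hK0, hK⟩ := exists_weighted_le hd m k
  refine ⟨C * K, by positivity, fun u hu => ?_⟩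
  have hI := (hK u hu).1.const_mul C
  calc |qf d.r₀ m k c u u| ≤ ∫ r in Ioo 0 d.r₀, |∑ i, c i r * (ell m k u r i * ell m k u r i)| :=
        abs_integral_le_integral_abs
    _ ≤ ∫ r in Ioo 0 d.r₀, C * ∑ i, wt r i * (ell m k u r i * ell m k u r i) := by
        refine integral_mono_ae (hc.integrable hd hu hu).abs hI ?_
        filter_upwards [ae_restrict_mem measurableSet_Ioo] with r hr
        rw [Finset.mul_sum]
        refine (Finset.abs_sum_le_sum_abs _ _).trans (Finset.sum_le_sum fun i _ => ?_)
        rw [abs_mul, abs_of_nonneg (mul_self_nonneg (ell m k u r i)), ← mul_assoc C]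
        exact mul_le_mul_of_nonneg_right (hC i r hr) (mul_self_nonneg _)
    _ ≤ C * (K * nrm d m k u) := by
        rw [integral_const_mul]
        have := (hK u hu).2
        gcongr
    _ = _ := by ring

lemma nrm_eq_qf : nrm d m k u = qf d.r₀ m k (cN d) u u := by
  simp only [nrm, qf, normDensity_eq]

lemma qf_nonneg (hc : ∀ i, ∀ r ∈ Ioo 0 d.r₀, 0 ≤ c i r) : 0 ≤ qf d.r₀ m k c u u :=
  setIntegral_nonneg measurableSet_Ioo fun r hr =>
    Finset.sum_nonneg fun i _ => mul_nonneg (hc i r hr) (mul_self_nonneg _)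

/-- Coefficients of `∫ ρ (ξ² + η² + ζ²) r`. -/
noncomputable def cJ (d : Data) : Fin 11 → ℝ → ℝ :=
  ![fun _ => 0, fun _ => 0, fun _ => 0, fun _ => 0, fun _ => 0, fun _ => 0, fun _ => 0,
    fun r => d.rho r * r, fun r => d.rho r * r, fun r => d.rho r * r, fun _ => 0]

/-- Coefficients of the viscous dissipation. -/
noncomputable def cD (a b : ℝ) : Fin 11 → ℝ → ℝ :=
  ![fun r => 2 / 9 * a * r, fun r => 2 / 9 * a * r, fun r => 2 / 9 * a * r, fun r => a * r,
    fun r => a * r, fun r => a * r, fun r => b * r, fun _ => 0, fun _ => 0, fun _ => 0, fun _ => 0]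

/-- Coefficients of the ideal energy in the plasma. -/
noncomputable def cI (d : Data) (m : ℤ) : Fin 11 → ℝ → ℝ :=
  ![fun _ => 0, fun _ => 0, fun _ => 0, fun _ => 0, fun _ => 0, fun _ => 0,
    fun r => d.γ * d.p r * r, fun r => 2 * d.dp r + m ^ 2 * d.B r ^ 2 / r,
    fun r => m ^ 2 * d.B r ^ 2 / r, fun _ => 0, fun r => d.B r ^ 2 / r]

lemma Adm.cJ (hd : d.Admissible) : Adm d.r₀ (cJ d) := by
  obtain ⟨C, hC0, hC⟩ := hd.exists_rho_bound
  have hR := hd.r₀_pos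
  refine ⟨fun i => ?_, C * d.r₀, by positivity, fun i r hr => ?_⟩
  · have h1 : AEStronglyMeasurable (fun r => d.rho r * r) (vol d.r₀) :=
      ((hd.continuousOn_rho.mono Ioo_subset_Icc_self).mul continuousOn_id).aestronglyMeasurable
        measurableSet_Ioo
    fin_cases i <;> first | exact h1 | exact aestronglyMeasurable_const
  · have h0 := hr.1
    have h1 : |(0 : ℝ)| ≤ C * d.r₀ * r := by
      rw [abs_zero]; positivity
    have h2 : |d.rho r * r| ≤ C * d.r₀ * 1 := by
      rw [abs_of_nonneg (mul_nonneg (hd.rho_nonneg (Ioo_subset_Icc_self hr)) h0.le), mul_one]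
      have h3 := hC r (Ioo_subset_Icc_self hr)
      have h4 := hr.2.le
      gcongr
    have h3 : |(0 : ℝ)| ≤ C * d.r₀ * 1 := by
      rw [abs_zero]; positivity
    fin_cases i <;> first | exact h1 | exact h2 | exact h3

lemma Adm.cD (d : Data) {a b : ℝ} (ha : 0 ≤ a) (hb : 0 ≤ b) : Adm d.r₀ (cD a b) := by
  refine ⟨fun i => ?_, a + b, by positivity, fun i r hr => ?_⟩
  · have h1 : ∀ e : ℝ, AEStronglyMeasurable (fun r => e * r) (vol d.r₀) := fun e =>
      (measurable_id.const_mul e).aestronglyMeasurable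
    fin_cases i <;> first | exact h1 _ | exact aestronglyMeasurable_const
  · have h0 := hr.1
    have h1 : |2 / 9 * a * r| ≤ (a + b) * r := by
      rw [abs_of_nonneg (by positivity)]; gcongr; linarith
    have h2 : |a * r| ≤ (a + b) * r := by
      rw [abs_of_nonneg (by positivity)]; gcongr; linarith
    have h3 : |b * r| ≤ (a + b) * r := by
      rw [abs_of_nonneg (by positivity)]; gcongr; linarith
    have h4 : |(0 : ℝ)| ≤ (a + b) * 1 := by
      rw [abs_zero]; positivity
    fin_cases i <;> first | exact h1 | exact h2 | exact h3 | exact h4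

/-- The only coefficients singular in appearance are multiples of `B² / r`, and these are bounded by
`exists_B_sq_le`; so the weight `1` suffices for the undifferentiated forms and for `k r η + ξ - r
ξ'`. -/
lemma Adm.cI (hd : d.Admissible) (m : ℤ) : Adm d.r₀ (cI d m) := by
  obtain ⟨P, hP0, hP⟩ := hd.exists_p_bound
  obtain ⟨Q, hQ0, hQ⟩ := hd.exists_dp_bound
  obtain ⟨C, hC0, hC⟩ := hd.exists_B_sq_le
  have hγ := hd.γ_pos
  have hB : ContinuousOn (fun r => d.B r ^ 2 / r) (Ioo 0 d.r₀) :=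
    (hd.continuousOn_B_sq.mono Ioo_subset_Ioc_self).div continuousOn_id fun r hr => hr.1.ne'
  have hmB : ContinuousOn (fun r => (m : ℝ) ^ 2 * d.B r ^ 2 / r) (Ioo 0 d.r₀) :=
    ((hd.continuousOn_B_sq.mono Ioo_subset_Ioc_self).const_mul _).div continuousOn_id
      fun r hr => hr.1.ne'
  refine ⟨fun i => ?_, d.γ * P + 2 * Q + m ^ 2 * C + C, by positivity, fun i r hr => ?_⟩
  · have h1 : AEStronglyMeasurable (fun r => d.γ * d.p r * r) (vol d.r₀) :=
      (((hd.continuousOn_p.mono Ioo_subset_Icc_self).const_mul _).mul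
        continuousOn_id).aestronglyMeasurable measurableSet_Ioo
    have h2 : AEStronglyMeasurable (fun r => 2 * d.dp r + m ^ 2 * d.B r ^ 2 / r) (vol d.r₀) :=
      (((hd.continuousOn_dp.mono Ioo_subset_Icc_self).const_mul _).add hmB).aestronglyMeasurable
        measurableSet_Ioo
    have h3 := hB.aestronglyMeasurable (μ := volume) measurableSet_Ioo
    have h4 := hmB.aestronglyMeasurable (μ := volume) measurableSet_Ioo
    fin_cases i <;> first | exact h1 | exact h2 | exact h3 | exact h4 | exact aestronglyMeasurable_const
  · have h0 := hr.1
    have hr' := Ioo_subset_Icc_self hr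
    have a1 : 0 ≤ d.B r ^ 2 / r := by positivity
    have a2 : d.B r ^ 2 / r ≤ C := by rw [div_le_iff₀ h0]; exact hC r hr'
    have a3 : (m : ℝ) ^ 2 * d.B r ^ 2 / r ≤ m ^ 2 * C := by rw [mul_div_assoc]; gcongr
    have a4 : 0 ≤ (m : ℝ) ^ 2 * d.B r ^ 2 / r := by positivity
    have a5 : 0 ≤ (m : ℝ) ^ 2 * C := by positivity
    have a6 : 0 ≤ d.γ * P := by positivity
    have h1 : |d.γ * d.p r * r| ≤ (d.γ * P + 2 * Q + m ^ 2 * C + C) * r := by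
      have := hd.p_nonneg r hr'
      rw [abs_of_nonneg (by positivity)]
      have := hP r hr'
      have : d.γ * d.p r ≤ d.γ * P := by gcongr
      gcongr
      linarith
    have h2 : |2 * d.dp r + m ^ 2 * d.B r ^ 2 / r| ≤ (d.γ * P + 2 * Q + m ^ 2 * C + C) * 1 := by
      have := abs_le.1 (hQ r hr')
      rw [abs_le]
      constructor <;> linarith [this.1, this.2]
    have h3 : |d.B r ^ 2 / r| ≤ (d.γ * P + 2 * Q + m ^ 2 * C + C) * 1 := by
      rw [abs_of_nonneg a1]; linarith
    have h4 : |(m : ℝ) ^ 2 * d.B r ^ 2 / r| ≤ (d.γ * P + 2 * Q + m ^ 2 * C + C) * 1 := by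
      rw [abs_of_nonneg a4]; linarith
    have h5 : |(0 : ℝ)| ≤ (d.γ * P + 2 * Q + m ^ 2 * C + C) * 1 := by
      rw [abs_zero]; linarith
    have h6 : |(0 : ℝ)| ≤ (d.γ * P + 2 * Q + m ^ 2 * C + C) * r := by
      rw [abs_zero]; positivity
    fin_cases i <;> first | exact h1 | exact h2 | exact h3 | exact h4 | exact h5 | exact h6

lemma qf_le_qf (hd : d.Admissible) (hc : Adm d.r₀ c) (hc' : Adm d.r₀ c')
    (hle : ∀ i, ∀ r ∈ Ioo 0 d.r₀, c i r ≤ c' i r) (hu : FiniteNorm d m k u) :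
    qf d.r₀ m k c u u ≤ qf d.r₀ m k c' u u :=
  setIntegral_mono_on (hc.integrable hd hu hu) (hc'.integrable hd hu hu) measurableSet_Ioo
    fun r hr => Finset.sum_le_sum fun i _ =>
      mul_le_mul_of_nonneg_right (hle i r hr) (mul_self_nonneg _)

lemma Adm.const_mul (hc : Adm d.r₀ c) (s : ℝ) : Adm d.r₀ (fun i r => s * c i r) := by
  obtain ⟨C, hC0, hC⟩ := hc.bdd
  refine ⟨fun i => (hc.meas i).const_mul s, |s| * C, by positivity, fun i r hr => ?_⟩
  rw [abs_mul, mul_assoc]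
  have := hC i r hr
  gcongr

lemma qf_const_mul (s : ℝ) :
    qf d.r₀ m k (fun i r => s * c i r) u v = s * qf d.r₀ m k c u v := by
  rw [qf, qf, ← integral_const_mul]
  congr 1
  ext r
  rw [Finset.mul_sum]
  exact Finset.sum_congr rfl fun i _ => by ring

lemma qf_cJ_nonneg (hd : d.Admissible) : 0 ≤ qf d.r₀ m k (cJ d) u u := by
  refine qf_nonneg fun i r hr => ?_
  have h1 := mul_nonneg (hd.rho_nonneg (Ioo_subset_Icc_self hr)) hr.1.le
  fin_cases i <;> first | exact h1 | exact le_rfl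

lemma qf_cD_nonneg {a b : ℝ} (ha : 0 ≤ a) (hb : 0 ≤ b) : 0 ≤ qf d.r₀ m k (cD a b) u u := by
  refine qf_nonneg fun i r hr => ?_
  have h1 : 0 ≤ 2 / 9 * a * r := by have := hr.1; positivity
  have h2 : 0 ≤ a * r := by have := hr.1; positivity
  have h3 : 0 ≤ b * r := by have := hr.1; positivity
  fin_cases i <;> first | exact h1 | exact h2 | exact h3 | exact le_rfl

/-- The dissipation and `J` control the norm. -/
lemma exists_nrm_le (hd : d.Admissible) {a b : ℝ} (ha : 0 < a) (hb : 0 < b) (m k : ℤ) :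
    ∃ κ, 0 < κ ∧ ∀ u, FiniteNorm d m k u →
      κ * nrm d m k u ≤ qf d.r₀ m k (cD a b) u u + qf d.r₀ m k (cJ d) u u := by
  -- The smallest of the ratios between the coefficients of `D + J` and those of the norm.
  set κ := min (min (2 / 9 * a) b) 1 with hκ
  have k1 : κ ≤ 2 / 9 * a := (min_le_left _ _).trans (min_le_left _ _)
  have k2 : κ ≤ b := (min_le_left _ _).trans (min_le_right _ _)
  have k3 : κ ≤ 1 := min_le_right _ _
  have k0 : 0 < κ := lt_min (lt_min (by positivity) hb) one_pos
  refine ⟨κ, k0, fun u hu => ?_⟩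
  have h := qf_add_smul (m := m) (k := k) hd (Adm.cD d ha.le hb.le) (Adm.cJ hd) 1 hu hu
  rw [one_mul] at h
  rw [← h, nrm_eq_qf, ← qf_const_mul]
  refine qf_le_qf hd ((Adm.cN hd).const_mul κ) ((Adm.cD d ha.le hb.le).add_smul (Adm.cJ hd) 1)
    (fun i r hr => ?_) hu
  have h0 := hr.1
  have hρ := mul_nonneg (hd.rho_nonneg (Ioo_subset_Icc_self hr)) hr.1.le
  have e1 : κ * r ≤ 2 / 9 * a * r + 1 * 0 := by nlinarith
  have e2 : κ * r ≤ a * r + 1 * 0 := by nlinarith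
  have e3 : κ * r ≤ b * r + 1 * 0 := by nlinarith
  have e4 : κ * (d.rho r * r) ≤ 0 + 1 * (d.rho r * r) := by nlinarith
  have e5 : κ * 0 ≤ 0 + 1 * 0 := by simp
  fin_cases i <;> first | exact e1 | exact e2 | exact e3 | exact e4 | exact e5

end ZPinch

/-! ### The ideal energy is bounded below by a multiple of `J`. -/

namespace ZPinch

/-- The fundamental theorem of calculus on `(0, R)` for functions which are not too large at `0`. -/
lemma LAC.integral_deriv_of_le {R : ℝ} (hR : 0 < R) {G f : ℝ → ℝ} (hG : LAC R G)
    (hi : Integrable (deriv G) (vol R)) (hf : Integrable f (vol R))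
    (hle : ∀ r ∈ Ioo 0 R, |G r| ≤ r * f r) : ∫ r in Ioo 0 R, deriv G r = G R := by
  have hI : IntervalIntegrable (deriv G) volume 0 R := intervalIntegrable_of_vol hi le_rfl hR.le le_rfl
  have hcont : ContinuousOn (fun a => ∫ r in (0 : ℝ)..a, deriv G r) (Icc 0 R) := by
    have := intervalIntegral.continuousOn_primitive_interval (a := 0) (b := R) (f := deriv G)
      (μ := volume) (by rwa [uIcc_of_le hR.le, integrableOn_Icc_iff_integrableOn_Ioo])
    rwa [uIcc_of_le hR.le] at this
  have ht : Tendsto (fun a => ∫ r in (0 : ℝ)..a, deriv G r) (𝓝[>] 0) (𝓝 0) := by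
    have h0 := (hcont 0 ⟨le_rfl, hR.le⟩).mono_left
      (nhdsWithin_le_of_mem (mem_of_superset (Ioo_mem_nhdsGT hR) Ioo_subset_Icc_self))
    simpa using h0
  have hval : ∀ a ∈ Ioo 0 R, G a = (∫ r in (0 : ℝ)..a, deriv G r) + (G R - ∫ r in (0 : ℝ)..R, deriv G r) := by
    intro a ha
    have h1 := hG.integral_deriv ha.1 ha.2.le le_rfl
    have h2 := intervalIntegral.integral_add_adjacent_intervals
      (intervalIntegrable_of_vol hi le_rfl ha.1.le ha.2.le)
      (intervalIntegrable_of_vol hi ha.1.le ha.2.le le_rfl)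
    linarith
  set L := G R - ∫ r in (0 : ℝ)..R, deriv G r with hL
  have hset : ∫ r in Ioo 0 R, deriv G r = ∫ r in (0 : ℝ)..R, deriv G r := by
    rw [intervalIntegral.integral_of_le hR.le, integral_Ioc_eq_integral_Ioo]
  rw [hset]
  -- Integrability of `G'` gives `G` a limit `L` at the axis. If `L ≠ 0`, then `|G| ≤ r f` makes
  -- `1/r` at most a multiple of `|f|` near `0`, although `1/r` is not integrable there.
  suffices hL0 : L = 0 by linarith
  by_contra hL0
  have hpos : 0 < |L| / 2 := by positivity
  have hev : ∀ᶠ a in 𝓝[>] (0 : ℝ), |∫ r in (0 : ℝ)..a, deriv G r| < |L| / 2 := by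
    have := ht.abs
    rw [abs_zero] at this
    exact this.eventually_lt_const hpos
  obtain ⟨e, he, hsub⟩ := mem_nhdsGT_iff_exists_Ioo_subset.1
    (inter_mem hev (Ioo_mem_nhdsGT hR))
  have he0 : (0 : ℝ) < e := he
  have h1 : ∀ a ∈ Ioo 0 e, a⁻¹ ≤ (2 / |L|) * |f a| := by
    intro a ha
    obtain ⟨h2, h3⟩ := hsub ha
    have h4 := hval a h3
    have h5 : |L| / 2 ≤ |G a| := by
      have h6 : L = G a - ∫ r in (0 : ℝ)..a, deriv G r := by linarith
      have h7 : |L| ≤ |G a| + |∫ r in (0 : ℝ)..a, deriv G r| := by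
        nth_rewrite 1 [h6]; exact abs_sub _ _
      have h8 : |∫ r in (0 : ℝ)..a, deriv G r| < |L| / 2 := h2
      linarith
    have h9 := h5.trans (hle a h3)
    have h10 : |L| / 2 ≤ a * |f a| := h9.trans (mul_le_mul_of_nonneg_left (le_abs_self _) ha.1.le)
    have hLp : 0 < |L| := by positivity
    rw [inv_le_iff_one_le_mul₀ ha.1]
    calc (1 : ℝ) = (2 / |L|) * (|L| / 2) := by field_simp
      _ ≤ (2 / |L|) * (a * |f a|) := by gcongr
      _ = _ := by ring
  have heR : e ≤ R := by
    by_contra h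
    push Not at h
    have : R ∈ Ioo 0 e := ⟨hR, h⟩
    exact absurd (hsub this).2.2 (lt_irrefl _)
  have hinv : IntervalIntegrable (fun x : ℝ => x⁻¹) volume 0 e := by
    rw [intervalIntegrable_iff_integrableOn_Ioo_of_le he0.le]
    have hfe : IntegrableOn (fun a => (2 / |L|) * |f a|) (Ioo 0 e) :=
      IntegrableOn.mono_set (hf.abs.const_mul _) (Ioo_subset_Ioo_right heR)
    refine Integrable.mono' hfe measurable_inv.aestronglyMeasurable ?_
    filter_upwards [ae_restrict_mem measurableSet_Ioo] with a ha
    rw [Real.norm_of_nonneg (inv_nonneg.2 ha.1.le)]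
    exact h1 a ha
  rw [intervalIntegrable_inv_iff] at hinv
  rcases hinv with h | h
  · exact he0.ne h
  · exact h (by rw [uIcc_of_le he0.le]; exact ⟨le_rfl, he0.le⟩)

/-- A smooth transition from `0` on `(-∞, a]` to `1` on `[b, ∞)`. -/
lemma exists_transition {a b : ℝ} (hab : a < b) : ∃ χ : ℝ → ℝ, ContDiff ℝ ∞ χ ∧
    (∀ r ≤ a, χ r = 0) ∧ (∀ r, b ≤ r → χ r = 1) ∧ (∀ r, 0 ≤ χ r ∧ χ r ≤ 1) ∧
    (∀ r < a, deriv χ r = 0) ∧ (∀ r, b < r → deriv χ r = 0) ∧ ∃ C, 0 < C ∧ ∀ r, |deriv χ r| ≤ C := by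
  have hba : 0 < b - a := sub_pos.2 hab
  set χ : ℝ → ℝ := fun r => Real.smoothTransition ((r - a) / (b - a)) with hχ
  have h0 : ∀ r ≤ a, χ r = 0 := fun r hr =>
    Real.smoothTransition.zero_of_nonpos (div_nonpos_of_nonpos_of_nonneg (by linarith) hba.le)
  have h1 : ∀ r, b ≤ r → χ r = 1 := fun r hr =>
    Real.smoothTransition.one_of_one_le (by rw [le_div_iff₀ hba]; linarith)
  have hs : ContDiff ℝ ∞ χ :=
    Real.smoothTransition.contDiff.comp ((contDiff_id.sub contDiff_const).div_const _)
  have d0 : ∀ r < a, deriv χ r = 0 := fun r hr => by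
    have : χ =ᶠ[𝓝 r] fun _ => 0 := by
      filter_upwards [Iio_mem_nhds hr] with x hx using h0 x (le_of_lt hx)
    rw [this.deriv_eq, deriv_const]
  have d1 : ∀ r, b < r → deriv χ r = 0 := fun r hr => by
    have : χ =ᶠ[𝓝 r] fun _ => 1 := by
      filter_upwards [Ioi_mem_nhds hr] with x hx using h1 x (le_of_lt hx)
    rw [this.deriv_eq, deriv_const]
  obtain ⟨C, hC⟩ := (isCompact_Icc (a := a) (b := b)).exists_bound_of_continuousOn
    (hs.continuous_deriv (by norm_num)).continuousOn
  refine ⟨χ, hs, h0, h1, fun r => ⟨Real.smoothTransition.nonneg _, Real.smoothTransition.le_one _⟩,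
    d0, d1, max C 1, by positivity, fun r => ?_⟩
  by_cases hra : r < a
  · rw [d0 r hra, abs_zero]; positivity
  by_cases hrb : b < r
  · rw [d1 r hrb, abs_zero]; positivity
  · exact (hC r ⟨not_lt.1 hra, not_lt.1 hrb⟩).trans (le_max_left _ _)

/-- The estimate away from the axis. As `b` is bounded below, the terms linear in `Y` are absorbed
in `b Y² / r` by completing the square with `w = t₂ - t₃`. The remainder is quadratic in `x, y` with
coefficients `O(ρ r)`; in `w²`, which is of order `(ρ r)²`, one factor `ρ` is replaced by its bound
`Cρ`. -/
lemma outer_bound {b r ρ c C₁ Cρ R κ t₁ t₂ t₃ x y Y : ℝ} (hc : 0 < c) (hb : c ≤ b) (hr : 0 < r)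
    (hrR : r ≤ R) (hρ : 0 ≤ ρ) (hρC : ρ ≤ Cρ) (hC₁ : 0 ≤ C₁) (h1 : t₁ ≤ C₁ * (ρ * r))
    (h20 : 0 ≤ t₂) (h2 : t₂ ≤ C₁ * (ρ * r)) (h30 : 0 ≤ t₃) (h3 : t₃ ≤ C₁ * (ρ * r)) :
    -(C₁ * (2 + |κ| * R + C₁ * Cρ * R ^ 2 / c)) * (ρ * r * (x ^ 2 + y ^ 2))
      ≤ b / r * Y ^ 2 - t₁ * x ^ 2 - t₂ * (x * (x + κ * r * y - Y)) + t₃ * (x * (κ * r * y - Y)) := by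
  have hb0 : 0 < b := hc.trans_le hb
  have hCρ : 0 ≤ Cρ := hρ.trans hρC
  have hR : 0 ≤ R := hr.le.trans hrR
  set g := C₁ * (ρ * r) with hg
  have hg0 : 0 ≤ g := by positivity
  set w := t₂ - t₃ with hw
  have hwg : |w| ≤ g := by rw [abs_le]; constructor <;> linarith
  have e : b / r * Y ^ 2 - t₁ * x ^ 2 - t₂ * (x * (x + κ * r * y - Y)) + t₃ * (x * (κ * r * y - Y))
      = b / r * (Y + w * r / (2 * b) * x) ^ 2 - w ^ 2 * r / (4 * b) * x ^ 2 - (t₁ + t₂) * x ^ 2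
        - w * (κ * r) * (x * y) := by
    rw [hw]; field_simp; ring
  have f0 : 0 ≤ b / r * (Y + w * r / (2 * b) * x) ^ 2 := by positivity
  have f1 : (t₁ + t₂) * x ^ 2 ≤ 2 * g * x ^ 2 :=
    mul_le_mul_of_nonneg_right (by linarith) (sq_nonneg _)
  have f2 : w ^ 2 * r / (4 * b) * x ^ 2 ≤ g * (C₁ * Cρ * R ^ 2 / c) * x ^ 2 := by
    refine mul_le_mul_of_nonneg_right ?_ (sq_nonneg _)
    have h4 : w ^ 2 ≤ g ^ 2 := sq_le_sq' (abs_le.1 hwg).1 (abs_le.1 hwg).2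
    calc w ^ 2 * r / (4 * b) ≤ g ^ 2 * r / (1 * c) := by gcongr; linarith
      _ = g * (C₁ * ρ * r ^ 2 / c) := by rw [hg]; field_simp
      _ ≤ g * (C₁ * Cρ * R ^ 2 / c) := by gcongr
  have f3 : w * (κ * r) * (x * y) ≤ g * (|κ| * R) * (x ^ 2 + y ^ 2) := by
    have h5 : |x * y| ≤ x ^ 2 + y ^ 2 := by
      rw [abs_le]
      constructor <;> nlinarith [sq_nonneg (x - y), sq_nonneg (x + y)]
    calc w * (κ * r) * (x * y) ≤ |w * (κ * r) * (x * y)| := le_abs_self _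
      _ = |w| * (|κ| * r) * |x * y| := by rw [abs_mul, abs_mul, abs_mul, abs_of_pos hr]
      _ ≤ _ := by gcongr
  have f4 : 2 * g * x ^ 2 ≤ 2 * g * (x ^ 2 + y ^ 2) := by
    have := sq_nonneg y; gcongr; linarith
  have f5 : g * (C₁ * Cρ * R ^ 2 / c) * x ^ 2 ≤ g * (C₁ * Cρ * R ^ 2 / c) * (x ^ 2 + y ^ 2) := by
    have := sq_nonneg y
    gcongr; linarith
  rw [e]
  have f6 : -(C₁ * (2 + |κ| * R + C₁ * Cρ * R ^ 2 / c)) * (ρ * r * (x ^ 2 + y ^ 2))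
    = -(2 * g * (x ^ 2 + y ^ 2) + g * (|κ| * R) * (x ^ 2 + y ^ 2)
      + g * (C₁ * Cρ * R ^ 2 / c) * (x ^ 2 + y ^ 2)) := by rw [hg]; ring
  rw [f6]
  linarith

/-- Near the axis, for `m ≠ 0`. -/
lemma inner_bound {b r q κ M x y Y : ℝ} (hr : 0 < r) (hb0 : 0 ≤ b) (hb : b ≤ q * r) (hM : 1 ≤ M) :
    -(|κ| * q) * (r * (x ^ 2 + y ^ 2))
      ≤ b / r * (M * x ^ 2 + M * y ^ 2 + Y ^ 2) + 2 * b / r * (x * (κ * r * y - Y)) := by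
  -- The cross term `-2xY` is completed to `(Y - x)²`, which costs one `x²`; `M = m² ≥ 1` pays for
  -- it. Only the product `xy` with the small factor `b ≤ q r` remains.
  have e : b / r * (M * x ^ 2 + M * y ^ 2 + Y ^ 2) + 2 * b / r * (x * (κ * r * y - Y))
      = b / r * ((M - 1) * x ^ 2 + M * y ^ 2 + (Y - x) ^ 2) + b * (2 * κ * (x * y)) := by
    field_simp; ring
  have f0 : 0 ≤ b / r * ((M - 1) * x ^ 2 + M * y ^ 2 + (Y - x) ^ 2) := by
    have : 0 ≤ M - 1 := by linarith
    positivity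
  have f1 : |2 * κ * (x * y)| ≤ |κ| * (x ^ 2 + y ^ 2) := by
    have h5 : 2 * |x * y| ≤ x ^ 2 + y ^ 2 := by
      rw [abs_mul]; nlinarith [sq_nonneg (|x| - |y|), sq_abs x, sq_abs y]
    calc |2 * κ * (x * y)| = |κ| * (2 * |x * y|) := by
          rw [abs_mul, abs_mul, abs_of_pos (two_pos : (0 : ℝ) < 2)]; ring
      _ ≤ _ := by gcongr
  have f2 : -(|κ| * (x ^ 2 + y ^ 2)) ≤ 2 * κ * (x * y) := (abs_le.1 f1).1
  have f3 : b * (|κ| * (x ^ 2 + y ^ 2)) ≤ q * r * (|κ| * (x ^ 2 + y ^ 2)) := by gcongr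
  have f4 := mul_le_mul_of_nonneg_left f2 hb0
  rw [e]
  linarith

/-- Near the axis, for `m = 0`. -/
lemma inner_bound_zero {b r q κ c P x y Y D : ℝ} (hr : 0 < r) (hb0 : 0 ≤ b) (hb : b ≤ q * r)
    (hc : 0 < c) (hP : c ≤ P) (hY : Y = 2 * x - r * D) :
    -(|κ| * q + q ^ 2 / c) * (r * (x ^ 2 + y ^ 2))
      ≤ b / r * Y ^ 2 + P * r * D ^ 2 + 2 * b / r * (x * (κ * r * y - Y)) := by
  have hP0 := hc.trans_le hP
  -- For `m = 0` there is no `m² x²` to use. Inserting `Y = 2x - rD` cancels the `x²` terms and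
  -- leaves `-2b x D`, which the compression term `P r D²` absorbs at the price `b² x² / (P r)`, of
  -- order `r x²` since `b ≤ q r`.
  have e : b / r * Y ^ 2 + P * r * D ^ 2 + 2 * b / r * (x * (κ * r * y - Y))
      = b * r * D ^ 2 + P * r * (D - b / (P * r) * x) ^ 2 - b ^ 2 / (P * r) * x ^ 2
        + b * (2 * κ * (x * y)) := by
    subst hY; field_simp; ring
  have f0 : 0 ≤ b * r * D ^ 2 + P * r * (D - b / (P * r) * x) ^ 2 := by positivity
  have f1 : |2 * κ * (x * y)| ≤ |κ| * (x ^ 2 + y ^ 2) := by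
    have h5 : 2 * |x * y| ≤ x ^ 2 + y ^ 2 := by
      rw [abs_mul]; nlinarith [sq_nonneg (|x| - |y|), sq_abs x, sq_abs y]
    calc |2 * κ * (x * y)| = |κ| * (2 * |x * y|) := by
          rw [abs_mul, abs_mul, abs_of_pos (two_pos : (0 : ℝ) < 2)]; ring
      _ ≤ _ := by gcongr
  have f2 : -(|κ| * (x ^ 2 + y ^ 2)) ≤ 2 * κ * (x * y) := (abs_le.1 f1).1
  have f3 : b * (|κ| * (x ^ 2 + y ^ 2)) ≤ q * r * (|κ| * (x ^ 2 + y ^ 2)) := by gcongr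
  have f4 := mul_le_mul_of_nonneg_left f2 hb0
  have f5 : b ^ 2 / (P * r) * x ^ 2 ≤ q ^ 2 / c * r * (x ^ 2 + y ^ 2) := by
    have h6 : b ^ 2 / (P * r) ≤ (q * r) ^ 2 / (c * r) := by gcongr
    have h7 : (q * r) ^ 2 / (c * r) = q ^ 2 / c * r := by field_simp
    rw [h7] at h6
    have h8 : x ^ 2 ≤ x ^ 2 + y ^ 2 := by linarith [sq_nonneg y]
    have : 0 ≤ q ^ 2 / c * r := by positivity
    gcongr
  rw [e]
  linarith


variable {d : Data} {m k : ℤ} {u : Profile}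

lemma cI_sum (r : ℝ) : ∑ i, cI d m i r * (ell m k u r i * ell m k u r i)
    = d.γ * d.p r * r * (deriv u.ξ r + u.ξ r / r + m / r * u.ζ r - k * u.η r) ^ 2
      + (2 * d.dp r + m ^ 2 * d.B r ^ 2 / r) * u.ξ r ^ 2 + m ^ 2 * d.B r ^ 2 / r * u.η r ^ 2
      + d.B r ^ 2 / r * (k * r * u.η r + u.ξ r - r * deriv u.ξ r) ^ 2 := by
  simp only [cI, ell, Fin.sum_univ_succ, Fin.sum_univ_zero]
  simp
  ring

lemma cJ_sum (r : ℝ) : ∑ i, cJ d i r * (ell m k u r i * ell m k u r i)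
    = d.rho r * r * (u.ξ r ^ 2 + u.η r ^ 2 + u.ζ r ^ 2) := by
  simp only [cJ, ell, Fin.sum_univ_succ, Fin.sum_univ_zero]
  simp
  ring

lemma exists_B_sq_lower (hd : d.Admissible) : ∃ a ∈ Ioo 0 d.r₀, ∃ c, 0 < c ∧
    ∀ r ∈ Icc a d.r₀, c ≤ d.B r ^ 2 := by
  have hR := hd.r₀_pos
  have hb := hd.B_sq_r₀_pos
  have hc : ContinuousWithinAt (fun x => d.B x ^ 2) (Ioc 0 d.r₀) d.r₀ :=
    hd.continuousOn_B_sq d.r₀ ⟨hR, le_rfl⟩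
  have h1 : ∀ᶠ r in 𝓝[≤] d.r₀, d.B d.r₀ ^ 2 / 2 < d.B r ^ 2 := by
    have h2 : 𝓝[≤] d.r₀ ≤ 𝓝[Ioc 0 d.r₀] d.r₀ :=
      nhdsWithin_le_of_mem (Ioc_mem_nhdsLE hR)
    exact (hc.mono_left h2).eventually_const_lt (by linarith)
  obtain ⟨a, ha, hsub⟩ := (mem_nhdsLE_iff_exists_Ioc_subset' hR).1
    (inter_mem h1 (Ioc_mem_nhdsLE hR))
  have ha' : a < d.r₀ := ha
  have hmem : (max a 0 + d.r₀) / 2 ∈ Ioo 0 d.r₀ := by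
    have h3 : max a 0 < d.r₀ := max_lt ha' hR
    have h4 := le_max_right a 0
    constructor <;> linarith
  refine ⟨_, hmem, d.B d.r₀ ^ 2 / 2, by positivity, fun r hr => ?_⟩
  have h3 : max a 0 < d.r₀ := max_lt ha' hR
  have h4 := le_max_left a 0
  have h5 : r ∈ Ioc a d.r₀ := ⟨by linarith [hr.1], hr.2⟩
  exact le_of_lt (hsub h5).1

set_option maxHeartbeats 1000000 in
/-- The ideal energy in the plasma is bounded below by a multiple of `J`. -/
lemma exists_lower_bound (hd : d.Admissible) (m k : ℤ) : ∃ C, 0 ≤ C ∧ ∀ u, FiniteNorm d m k u →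
    -C * qf d.r₀ m k (cJ d) u u ≤ qf d.r₀ m k (cI d m) u u := by
  have hR := hd.r₀_pos
  have hγ := hd.γ_pos
  obtain ⟨r₁, hr₁, c, hc0, hc⟩ := exists_B_sq_lower hd
  set r₂ := (r₁ + d.r₀) / 2 with hr₂
  have h12 : r₁ < r₂ := by rw [hr₂]; linarith [hr₁.2]
  have h2R : r₂ < d.r₀ := by rw [hr₂]; linarith [hr₁.2]
  obtain ⟨χ, hχ, χ0, χ1, χb, dχ0, dχ1, Cχ, hCχ0, hCχ⟩ := exists_transition h12
  obtain ⟨P, hP0, hP⟩ := hd.exists_p_bound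
  obtain ⟨Q, hQ0, hQ⟩ := hd.exists_dp_bound
  obtain ⟨q, hq0, hq⟩ := hd.exists_B_sq_le
  obtain ⟨Cρ, hCρ0, hCρ⟩ := hd.exists_rho_bound
  obtain ⟨cρ, hcρ0, hcρ⟩ := hd.exists_rho_lower h2R
  obtain ⟨Cp, hCp0, hCp⟩ := hd.exists_p_le_rho
  obtain ⟨cp, hcp0, hcp⟩ : ∃ cp, 0 < cp ∧ ∀ r ∈ Icc 0 r₁, cp ≤ d.p r := by
    obtain ⟨x, hx, hmin⟩ := isCompact_Icc.exists_isMinOn (nonempty_Icc.2 hr₁.1.le)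
      (hd.continuousOn_p.mono (Icc_subset_Icc_right hr₁.2.le))
    exact ⟨d.p x, hd.p_pos ⟨hx.1, hx.2.trans_lt hr₁.2⟩, fun r hr => hmin hr⟩
  -- The term `2p'ξ²` has no sign and is not dominated by `ρξ²` near `r₀`. Subtracting `(Sξ²)'`
  -- changes no integral. Near the interface `S = 2p` cancels `2p'ξ²` and leaves `-4pξξ'`, with `p ≤
  -- Cρ`. Near the axis `S = -B²` replaces it, by the force balance, by `2(B²/r) ξ (rξ' - ξ)`, which
  -- the squares weighted by `B²/r` and the compression term can match.
  set S : ℝ → ℝ := fun r => 2 * χ r * d.p r - (1 - χ r) * d.B r ^ 2 with hS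
  set S' : ℝ → ℝ := fun r => deriv χ r * (2 * d.p r + d.B r ^ 2) + 2 * d.dp r
    + (1 - χ r) * (2 * d.B r ^ 2 / r) with hS'
  have hSd : ∀ r ∈ Ioo 0 d.r₀, HasDerivAt S (S' r) r := by
    intro r hr
    have h1 : HasDerivAt χ (deriv χ r) r := (hχ.differentiable (by norm_num) r).hasDerivAt
    have h2 := ((h1.const_mul 2).fun_mul (hd.hasDerivAt_p hr)).fun_sub
      ((h1.const_sub 1).fun_mul (hd.hasDerivAt_B_sq hr))
    refine h2.congr_deriv ?_
    rw [hS']; ring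
  have hSC : ContDiffOn ℝ 1 S (Ioc 0 d.r₀) :=
    ((contDiffOn_const.mul (hχ.of_le (by exact_mod_cast le_top)).contDiffOn).mul
      hd.contDiffOn_p).sub ((contDiffOn_const.sub (hχ.of_le
        (by exact_mod_cast le_top)).contDiffOn).mul hd.contDiffOn_B_sq)
  have hSL := LAC.of_contDiffOn hSC
  have hbR : ∀ r ∈ Ioo 0 d.r₀, d.B r ^ 2 ≤ q * d.r₀ := fun r hr =>
    (hq r (Ioo_subset_Icc_self hr)).trans (by have := hr.2.le; gcongr)
  set CS := q + (2 * P + q * d.r₀) / r₁ with hCS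
  have hr10 := hr₁.1
  have hCS0 : 0 < CS := by positivity
  have hSb : ∀ r ∈ Ioo 0 d.r₀, |S r| ≤ CS * r := by
    intro r hr
    have hr' := Ioo_subset_Icc_self hr
    have hr0 := hr.1
    have hp := hd.p_nonneg r hr'
    rcases lt_or_ge r r₁ with h | h
    · have e : S r = -d.B r ^ 2 := by simp [hS, χ0 r h.le]
      rw [e, abs_neg, abs_of_nonneg (sq_nonneg _)]
      refine (hq r hr').trans ?_
      have : q ≤ CS := by rw [hCS]; linarith [show 0 < (2 * P + q * d.r₀) / r₁ by positivity]
      gcongr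
    · have h1 : |S r| ≤ 2 * P + q * d.r₀ := by
        have h3 := χb r
        have h4 := hbR r hr
        have h5 := hP r hr'
        have h6 : 0 ≤ 2 * χ r * d.p r := by have := h3.1; positivity
        have h7 : 2 * χ r * d.p r ≤ 2 * 1 * P := by have := h3.2; have := h3.1; gcongr
        have h8 : 0 ≤ (1 - χ r) * d.B r ^ 2 := mul_nonneg (by linarith [h3.2]) (sq_nonneg _)
        have h9 : (1 - χ r) * d.B r ^ 2 ≤ 1 * (q * d.r₀) := by
          have := h3.1; gcongr; linarith
        rw [hS, abs_le]
        constructor <;> simp only <;> linarith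
      calc |S r| ≤ 2 * P + q * d.r₀ := h1
        _ = (2 * P + q * d.r₀) / r₁ * r₁ := by field_simp
        _ ≤ CS * r := by
            gcongr
            rw [hCS]; linarith
  set CS' := Cχ * (2 * P + q * d.r₀) + 2 * Q + 2 * q with hCS'
  have hS'b : ∀ r ∈ Ioo 0 d.r₀, |S' r| ≤ CS' := by
    intro r hr
    have hr' := Ioo_subset_Icc_self hr
    have hr0 := hr.1
    have hp := hd.p_nonneg r hr'
    have h1 : |deriv χ r * (2 * d.p r + d.B r ^ 2)| ≤ Cχ * (2 * P + q * d.r₀) := by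
      rw [abs_mul, abs_of_nonneg (by positivity : 0 ≤ 2 * d.p r + d.B r ^ 2)]
      have := hCχ r; have := hP r hr'; have := hbR r hr
      gcongr
    have h2 : |2 * d.dp r| ≤ 2 * Q := by
      rw [abs_mul, abs_of_pos (two_pos : (0 : ℝ) < 2)]
      have := hQ r hr'
      gcongr
    have h3 : |(1 - χ r) * (2 * d.B r ^ 2 / r)| ≤ 2 * q := by
      have h4 := χb r
      have h5 : 0 ≤ 1 - χ r := by linarith [h4.2]
      rw [abs_of_nonneg (by positivity)]
      have h6 : 2 * d.B r ^ 2 / r ≤ 2 * q := by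
        rw [div_le_iff₀ hr0]; linarith [hq r hr']
      have h7 : 1 - χ r ≤ 1 := by linarith [h4.1]
      calc (1 - χ r) * (2 * d.B r ^ 2 / r) ≤ 1 * (2 * q) := by gcongr
        _ = _ := one_mul _
    calc |S' r| ≤ |deriv χ r * (2 * d.p r + d.B r ^ 2) + 2 * d.dp r|
          + |(1 - χ r) * (2 * d.B r ^ 2 / r)| := abs_add_le _ _
      _ ≤ |deriv χ r * (2 * d.p r + d.B r ^ 2)| + |2 * d.dp r|
          + |(1 - χ r) * (2 * d.B r ^ 2 / r)| := by gcongr; exact abs_add_le _ _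
      _ ≤ CS' := by linarith
  -- pointwise bound
  set C₁ := Cχ * (2 * P + q * d.r₀) / (cρ * r₁) + 4 * Cp / r₁ ^ 2 + 2 * q / (cρ * r₁) with hC₁
  have hC₁0 : 0 ≤ C₁ := by positivity
  set K₁ := C₁ * (2 + |(k : ℝ)| * d.r₀ + C₁ * Cρ * d.r₀ ^ 2 / c) with hK₁
  set K₂ := (|(k : ℝ)| * q + q ^ 2 / (d.γ * cp)) / cρ with hK₂
  have hK₁0 : 0 ≤ K₁ := by positivity
  have hK₂0 : 0 ≤ K₂ := by positivity
  refine ⟨K₁ + K₂, by positivity, fun u hu => ?_⟩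
  obtain ⟨K, -, hE⟩ := exists_energy_le hd m k
  obtain ⟨⟨hξ, -, -⟩, -⟩ := hE u hu
  have hGL : LAC d.r₀ (fun r => S r * (u.ξ r * u.ξ r)) := hSL.mul (hξ.lac.mul hξ.lac)
  have hGd : ∀ᵐ r ∂(vol d.r₀), deriv (fun r => S r * (u.ξ r * u.ξ r)) r
      = S' r * u.ξ r ^ 2 + 2 * S r * u.ξ r * deriv u.ξ r := by
    filter_upwards [hξ.lac.ae_differentiableAt, ae_restrict_mem measurableSet_Ioo] with r h1 h2
    have := (hSd r h2).fun_mul (h1.hasDerivAt.fun_mul h1.hasDerivAt)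
    rw [this.deriv]; ring
  have hGi : Integrable (deriv fun r => S r * (u.ξ r * u.ξ r)) (vol d.r₀) := by
    refine ((hξ.sq.const_mul CS').add (hξ.integrable.const_mul CS)).mono'
      (measurable_deriv _).aestronglyMeasurable ?_
    filter_upwards [hGd, ae_restrict_mem measurableSet_Ioo] with r h1 h2
    rw [h1, Real.norm_eq_abs]
    simp only [Pi.add_apply]
    refine (abs_add_le _ _).trans (add_le_add ?_ ?_)
    · rw [abs_mul, abs_of_nonneg (sq_nonneg (u.ξ r))]
      exact mul_le_mul_of_nonneg_right (hS'b r h2) (sq_nonneg _)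
    · have h3 : |2 * S r * u.ξ r * deriv u.ξ r| = |S r| * (2 * |u.ξ r * deriv u.ξ r|) := by
        rw [abs_mul, abs_mul, abs_mul, abs_mul, abs_of_pos (two_pos : (0 : ℝ) < 2)]; ring
      rw [h3]
      calc |S r| * (2 * |u.ξ r * deriv u.ξ r|) ≤ (CS * r) * (2 * |u.ξ r * deriv u.ξ r|) := by
            have := hSb r h2; gcongr
        _ = CS * (2 * |u.ξ r * (r * deriv u.ξ r)|) := by
            rw [abs_mul, abs_mul, abs_mul, abs_of_pos h2.1]; ring
        _ ≤ CS * (u.ξ r ^ 2 + (r * deriv u.ξ r) ^ 2) := by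
            have : 2 * |u.ξ r * (r * deriv u.ξ r)| ≤ u.ξ r ^ 2 + (r * deriv u.ξ r) ^ 2 := by
              rw [abs_mul]
              nlinarith [sq_nonneg (|u.ξ r| - |r * deriv u.ξ r|), sq_abs (u.ξ r),
                sq_abs (r * deriv u.ξ r)]
            gcongr
  -- No boundary terms: at `r₀` one has `S = 2p = 0`, and at the axis `|S ξ²| ≤ CS r ξ²` with `ξ²`
  -- integrable.
  have hG0 : ∫ r in Ioo 0 d.r₀, deriv (fun r => S r * (u.ξ r * u.ξ r)) r = 0 := by
    rw [hGL.integral_deriv_of_le hR hGi (hξ.sq.const_mul CS) fun r hr => ?_]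
    · simp [hS, hd.p_r₀, χ1 d.r₀ h2R.le]
    · rw [abs_mul, abs_mul_self]
      calc |S r| * (u.ξ r * u.ξ r) ≤ CS * r * (u.ξ r * u.ξ r) :=
            mul_le_mul_of_nonneg_right (hSb r hr) (mul_self_nonneg _)
        _ = _ := by ring
  have hI := (Adm.cI hd m).integrable hd hu hu
  have hJ := (Adm.cJ hd).integrable hd hu hu
  have key : ∀ᵐ r ∂(vol d.r₀), -(K₁ + K₂) * ∑ i, cJ d i r * (ell m k u r i * ell m k u r i)
      ≤ ∑ i, cI d m i r * (ell m k u r i * ell m k u r i)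
        - deriv (fun r => S r * (u.ξ r * u.ξ r)) r := by
    filter_upwards [hGd, ae_restrict_mem measurableSet_Ioo] with r h1 hr
    have hr0 := hr.1
    have hr' := Ioo_subset_Icc_self hr
    have hρ := hd.rho_nonneg hr'
    have hp := hd.p_nonneg r hr'
    rw [h1, cI_sum, cJ_sum]
    set x := u.ξ r
    set y := u.η r
    set z := u.ζ r
    set x' := deriv u.ξ r
    set b := d.B r ^ 2 with hb
    have hb0 : 0 ≤ b := sq_nonneg _
    set D := x' + x / r + m / r * z - k * y with hD
    set Y := k * r * y + x - r * x' with hY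
    set t₁ := deriv χ r * (2 * d.p r + b) with ht₁
    set t₂ := 4 * χ r * d.p r / r with ht₂
    set t₃ := (1 - χ r) * (2 * b / r) with ht₃
    -- The derivative produced by `(Sξ²)'` is eliminated through `r ξ' = k r η + ξ - Y`, so that it
    -- is controlled by the magnetic square `B² Y² / r`.
    have e : d.γ * d.p r * r * D ^ 2 + (2 * d.dp r + m ^ 2 * b / r) * x ^ 2 + m ^ 2 * b / r * y ^ 2
        + b / r * Y ^ 2 - (S' r * x ^ 2 + 2 * S r * x * x')
        = (d.γ * d.p r * r * D ^ 2 + m ^ 2 * b / r * (x ^ 2 + y ^ 2))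
          + (b / r * Y ^ 2 - t₁ * x ^ 2 - t₂ * (x * (x + k * r * y - Y))
            + t₃ * (x * (k * r * y - Y))) := by
      rw [hS, hS', ht₁, ht₂, ht₃, hY]
      simp only
      rw [← hb]
      field_simp
      ring
    rw [e]
    have hnn : 0 ≤ d.rho r * r * (x ^ 2 + y ^ 2) := by positivity
    have hz : d.rho r * r * (x ^ 2 + y ^ 2) ≤ d.rho r * r * (x ^ 2 + y ^ 2 + z ^ 2) := by
      have := sq_nonneg z
      exact mul_le_mul_of_nonneg_left (by linarith) (mul_nonneg hρ hr0.le)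
    have hA : 0 ≤ d.γ * d.p r * r * D ^ 2 + m ^ 2 * b / r * (x ^ 2 + y ^ 2) := by positivity
    have hχr := χb r
    -- Below `r₁` the cutoff is zero and `ρ`, `p` are bounded below; above `r₁` the field `B²` is.
    rcases lt_or_ge r r₁ with hlt | hge
    · have z1 : t₁ = 0 := by rw [ht₁, dχ0 r hlt, zero_mul]
      have z2 : t₂ = 0 := by rw [ht₂, χ0 r hlt.le]; simp
      have z3 : t₃ = 2 * b / r := by rw [ht₃, χ0 r hlt.le]; simp
      have hρc := hcρ r ⟨hr0.le, (hlt.trans h12).le⟩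
      have hpc := hcp r ⟨hr0.le, hlt.le⟩
      have hγp : d.γ * cp ≤ d.γ * d.p r := by gcongr
      have main : -(|(k : ℝ)| * q + q ^ 2 / (d.γ * cp)) * (r * (x ^ 2 + y ^ 2))
          ≤ d.γ * d.p r * r * D ^ 2 + m ^ 2 * b / r * (x ^ 2 + y ^ 2)
            + (b / r * Y ^ 2 + 2 * b / r * (x * (k * r * y - Y))) := by
        by_cases hm : m = 0
        · have hYD : Y = 2 * x - r * D := by
            rw [hY, hD, hm]; push_cast; field_simp; ring
          have := inner_bound_zero (κ := k) (y := y) hr0 hb0 (hq r hr') (by positivity) hγp hYD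
          refine this.trans (le_of_eq ?_)
          rw [hm]; push_cast; ring
        · have hm1 : (1 : ℝ) ≤ (m : ℝ) ^ 2 := by
            have : 1 ≤ m ^ 2 := by have := sq_pos_of_ne_zero hm; lia
            exact_mod_cast this
          have := inner_bound (κ := k) (x := x) (y := y) (Y := Y) hr0 hb0 (hq r hr') hm1
          have h3 : 0 ≤ q ^ 2 / (d.γ * cp) * (r * (x ^ 2 + y ^ 2)) := by positivity
          have h4 : 0 ≤ d.γ * d.p r * r * D ^ 2 := by positivity
          have h5 : m ^ 2 * b / r * (x ^ 2 + y ^ 2) + b / r * Y ^ 2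
            = b / r * (m ^ 2 * x ^ 2 + m ^ 2 * y ^ 2 + Y ^ 2) := by ring
          linarith
      rw [z1, z2, z3]
      have h6 : (|(k : ℝ)| * q + q ^ 2 / (d.γ * cp)) * (r * (x ^ 2 + y ^ 2))
          ≤ K₂ * (d.rho r * r * (x ^ 2 + y ^ 2)) := by
        calc (|(k : ℝ)| * q + q ^ 2 / (d.γ * cp)) * (r * (x ^ 2 + y ^ 2))
            = K₂ * (cρ * r * (x ^ 2 + y ^ 2)) := by rw [hK₂]; field_simp
          _ ≤ _ := by gcongr
      have h7 := mul_le_mul_of_nonneg_left hz hK₂0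
      have h8 : 0 ≤ K₁ * (d.rho r * r * (x ^ 2 + y ^ 2 + z ^ 2)) :=
        mul_nonneg hK₁0 (hnn.trans hz)
      linarith
    · have hpb : d.p r ≤ Cp * d.rho r := hCp r hr'
      have n2 : 0 ≤ t₂ := by rw [ht₂]; have := hχr.1; positivity
      have n3 : 0 ≤ t₃ := by
        rw [ht₃]; have : 0 ≤ 1 - χ r := by linarith [hχr.2]
        positivity
      have hρr : 0 ≤ d.rho r * r := by positivity
      have p1 : 0 ≤ Cχ * (2 * P + q * d.r₀) / (cρ * r₁) * (d.rho r * r) := by positivity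
      have p2 : 0 ≤ 4 * Cp / r₁ ^ 2 * (d.rho r * r) := by positivity
      have p3 : 0 ≤ 2 * q / (cρ * r₁) * (d.rho r * r) := by positivity
      have hC₁e : C₁ * (d.rho r * r) = Cχ * (2 * P + q * d.r₀) / (cρ * r₁) * (d.rho r * r)
        + 4 * Cp / r₁ ^ 2 * (d.rho r * r) + 2 * q / (cρ * r₁) * (d.rho r * r) := by
        rw [hC₁]; ring
      have b1 : t₁ ≤ C₁ * (d.rho r * r) := by
        rcases le_or_gt r r₂ with h | h
        · have hρc := hcρ r ⟨hr0.le, h⟩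
          have h3 : t₁ ≤ Cχ * (2 * P + q * d.r₀) := by
            have := (le_abs_self _).trans (hCχ r); have := hP r hr'; have := hbR r hr
            rw [ht₁]
            gcongr
          have h4 : Cχ * (2 * P + q * d.r₀)
              ≤ Cχ * (2 * P + q * d.r₀) / (cρ * r₁) * (d.rho r * r) := by
            calc Cχ * (2 * P + q * d.r₀)
                = Cχ * (2 * P + q * d.r₀) / (cρ * r₁) * (cρ * r₁) := by field_simp
              _ ≤ _ := by gcongr
          linarith
        · rw [ht₁, dχ1 r h, zero_mul]; positivity
      have b2 : t₂ ≤ C₁ * (d.rho r * r) := by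
        have h3 : t₂ ≤ 4 * Cp / r₁ ^ 2 * (d.rho r * r) := by
          calc t₂ ≤ 4 * 1 * (Cp * d.rho r) / r := by
                rw [ht₂]; have := hχr.2; have := hχr.1; gcongr
            _ = 4 * Cp / r ^ 2 * (d.rho r * r) := by field_simp
            _ ≤ _ := by gcongr
        linarith
      have b3 : t₃ ≤ C₁ * (d.rho r * r) := by
        rcases le_or_gt r r₂ with h | h
        · have hρc := hcρ r ⟨hr0.le, h⟩
          have h3 : t₃ ≤ 2 * q := by
            have h6 : 2 * b / r ≤ 2 * q := by
              rw [div_le_iff₀ hr0]; linarith [hq r hr']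
            have h7 : 1 - χ r ≤ 1 := by linarith [hχr.1]
            calc t₃ ≤ 1 * (2 * q) := by rw [ht₃]; gcongr
              _ = _ := one_mul _
          have h4 : 2 * q ≤ 2 * q / (cρ * r₁) * (d.rho r * r) := by
            calc 2 * q = 2 * q / (cρ * r₁) * (cρ * r₁) := by field_simp
              _ ≤ _ := by gcongr
          linarith
        · rw [ht₃, χ1 r h.le, sub_self, zero_mul]; positivity
      have := outer_bound (κ := k) (x := x) (y := y) (Y := Y) hc0 (hc r ⟨hge, hr.2.le⟩) hr0 hr.2.le
        hρ (hCρ r hr') hC₁0 b1 n2 b2 n3 b3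
      have h7 := mul_le_mul_of_nonneg_left hz hK₁0
      have h8 : 0 ≤ K₂ * (d.rho r * r * (x ^ 2 + y ^ 2 + z ^ 2)) :=
        mul_nonneg hK₂0 (hnn.trans hz)
      linarith
  have := integral_mono_ae (hJ.const_mul _) (hI.sub hGi) key
  rw [integral_const_mul] at this
  have hs : ∫ r in Ioo 0 d.r₀, ((fun r => ∑ i, cI d m i r * (ell m k u r i * ell m k u r i)) -
      deriv (fun r => S r * (u.ξ r * u.ξ r))) r = qf d.r₀ m k (cI d m) u u - 0 := by
    conv_rhs => rw [← hG0]
    exact integral_sub hI hGi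
  rw [hs, sub_zero] at this
  exact this

end ZPinch

/-! ### Smooth profiles and their completions. -/

namespace ZPinch

lemma Profile.ext' {u v : Profile} (h1 : ∀ r, u.ξ r = v.ξ r) (h2 : ∀ r, u.η r = v.η r)
    (h3 : ∀ r, u.ζ r = v.ζ r) : u = v := by
  cases u; cases v
  simp only [Profile.mk.injEq]
  exact ⟨funext h1, funext h2, funext h3⟩

lemma Profile.eq_comb_sub (u v : Profile) : u = Profile.comb 1 1 (u.sub v) v :=
  Profile.ext' (fun r => by simp [Profile.comb, Profile.sub])
    (fun r => by simp [Profile.comb, Profile.sub]) (fun r => by simp [Profile.comb, Profile.sub])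

lemma exists_bound_of_contDiff {f : ℝ → ℝ} (hf : ContDiff ℝ ∞ f) (R : ℝ) : ∃ C, 0 ≤ C ∧
    ∀ r ∈ Icc 0 R, |f r| ≤ C ∧ |deriv f r| ≤ C ∧ (f 0 = 0 → |f r| ≤ C * r) := by
  obtain ⟨C₁, h1⟩ := (isCompact_Icc (a := 0) (b := R)).exists_bound_of_continuousOn
    hf.continuous.continuousOn
  obtain ⟨C₂, h2⟩ := (isCompact_Icc (a := 0) (b := R)).exists_bound_of_continuousOn
    (hf.continuous_deriv (by norm_num)).continuousOn
  refine ⟨max (max C₁ C₂) 0, le_max_right _ _, fun r hr => ⟨?_, ?_, fun h0 => ?_⟩⟩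
  · exact (h1 r hr).trans ((le_max_left _ _).trans (le_max_left _ _))
  · exact (h2 r hr).trans ((le_max_right _ _).trans (le_max_left _ _))
  · have := (convex_Icc 0 R).norm_image_sub_le_of_norm_deriv_le (f := f) (x := 0) (y := r)
      (fun x _ => hf.differentiable (by norm_num) x) h2 ⟨le_rfl, hr.1.trans hr.2⟩ hr
    rw [h0, sub_zero, sub_zero, Real.norm_eq_abs, Real.norm_eq_abs, abs_of_nonneg hr.1] at this
    exact this.trans (mul_le_mul_of_nonneg_right ((le_max_right _ _).trans (le_max_left _ _)) hr.1)

variable {d : Data} {m k : ℤ} {u v : Profile}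

/-- The properties of the classes of smooth profiles that are used. -/
structure GoodCore (d : Data) (m k : ℤ) (core : Profile → Prop) : Prop where
  comb : ∀ φ ψ, core φ → core ψ → ∀ a b, core (Profile.comb a b φ ψ)
  finite : ∀ φ, core φ → FiniteNorm d m k φ
  test : ∀ φ : Profile, ContDiff ℝ ∞ φ.ξ → ContDiff ℝ ∞ φ.η → ContDiff ℝ ∞ φ.ζ →
    φ.ξ 0 = 0 → φ.η 0 = 0 → φ.ζ 0 = 0 → core φ

/-- The factor `6` is the largest sum of absolute coefficients, reached by the second form: `1 + 2 +
2 + 1`. -/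
lemma abs_ell_le {W r : ℝ} (q1 : |deriv u.ξ r| ≤ W) (q2 : |u.ξ r / r| ≤ W)
    (q3 : |(m : ℝ) / r * u.ζ r| ≤ W) (q4 : |(k : ℝ) * u.η r| ≤ W) (q5 : |deriv u.ζ r| ≤ W)
    (q6 : |u.ζ r / r| ≤ W) (q7 : |(m : ℝ) / r * u.ξ r| ≤ W) (q8 : |deriv u.η r| ≤ W)
    (q9 : |(k : ℝ) * u.ξ r| ≤ W) (q10 : |(m : ℝ) / r * u.η r| ≤ W) (q11 : |(k : ℝ) * u.ζ r| ≤ W)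
    (q12 : |u.ξ r| ≤ W) (q13 : |u.η r| ≤ W) (q14 : |u.ζ r| ≤ W) (q15 : |(k : ℝ) * r * u.η r| ≤ W)
    (q16 : |r * deriv u.ξ r| ≤ W) (i : Fin 11) : |ell m k u r i| ≤ 6 * W := by
  have s1 : 2 * u.ξ r / r = 2 * (u.ξ r / r) := by ring
  have s2 : 2 * (m : ℝ) / r * u.ζ r = 2 * (m / r * u.ζ r) := by ring
  have s3 : 2 * (k : ℝ) * u.η r = 2 * (k * u.η r) := by ring
  rw [abs_le] at q1 q2 q3 q4 q5 q6 q7 q8 q9 q10 q11 q12 q13 q14 q15 q16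
  obtain ⟨a1, b1⟩ := q1; obtain ⟨a2, b2⟩ := q2; obtain ⟨a3, b3⟩ := q3; obtain ⟨a4, b4⟩ := q4
  obtain ⟨a5, b5⟩ := q5; obtain ⟨a6, b6⟩ := q6; obtain ⟨a7, b7⟩ := q7; obtain ⟨a8, b8⟩ := q8
  obtain ⟨a9, b9⟩ := q9; obtain ⟨a10, b10⟩ := q10; obtain ⟨a11, b11⟩ := q11
  obtain ⟨a12, b12⟩ := q12; obtain ⟨a13, b13⟩ := q13; obtain ⟨a14, b14⟩ := q14
  obtain ⟨a15, b15⟩ := q15; obtain ⟨a16, b16⟩ := q16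
  have g0 : |-2 * deriv u.ξ r + u.ξ r / r + m / r * u.ζ r - k * u.η r| ≤ 6 * W := by
    rw [abs_le]; constructor <;> linarith
  have g1 : |deriv u.ξ r - 2 * u.ξ r / r - 2 * m / r * u.ζ r - k * u.η r| ≤ 6 * W := by
    rw [s1, s2, abs_le]; constructor <;> linarith
  have g2 : |deriv u.ξ r + u.ξ r / r + m / r * u.ζ r + 2 * k * u.η r| ≤ 6 * W := by
    rw [s3, abs_le]; constructor <;> linarith
  have g3 : |-deriv u.ζ r + u.ζ r / r + m / r * u.ξ r| ≤ 6 * W := by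
    rw [abs_le]; constructor <;> linarith
  have g4 : |deriv u.η r + k * u.ξ r| ≤ 6 * W := by rw [abs_le]; constructor <;> linarith
  have g5 : |m / r * u.η r - k * u.ζ r| ≤ 6 * W := by rw [abs_le]; constructor <;> linarith
  have g6 : |deriv u.ξ r + u.ξ r / r + m / r * u.ζ r - k * u.η r| ≤ 6 * W := by
    rw [abs_le]; constructor <;> linarith
  have g7 : |u.ξ r| ≤ 6 * W := by rw [abs_le]; constructor <;> linarith
  have g8 : |u.η r| ≤ 6 * W := by rw [abs_le]; constructor <;> linarith
  have g9 : |u.ζ r| ≤ 6 * W := by rw [abs_le]; constructor <;> linarith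
  have g10 : |k * r * u.η r + u.ξ r - r * deriv u.ξ r| ≤ 6 * W := by
    rw [abs_le]; constructor <;> linarith
  match i with
  | 0 => exact g0
  | 1 => exact g1
  | 2 => exact g2
  | 3 => exact g3
  | 4 => exact g4
  | 5 => exact g5
  | 6 => exact g6
  | 7 => exact g7
  | 8 => exact g8
  | 9 => exact g9
  | 10 => exact g10

/-- Every quotient by `r` is of a function vanishing at the axis, hence bounded by the mean value
theorem. The component `η` is divided by `r` only together with the factor `m`, so `η(0) = 0` is
needed only for `m ≠ 0`. -/
lemma finiteNorm_of_smooth (hd : d.Admissible) (h1 : ContDiff ℝ ∞ u.ξ) (h2 : ContDiff ℝ ∞ u.η)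
    (h3 : ContDiff ℝ ∞ u.ζ) (z1 : u.ξ 0 = 0) (z2 : m ≠ 0 → u.η 0 = 0) (z3 : u.ζ 0 = 0) :
    FiniteNorm d m k u := by
  have hR := hd.r₀_pos
  obtain ⟨A, hA0, hA⟩ := exists_bound_of_contDiff h1 d.r₀
  obtain ⟨B, hB0, hB⟩ := exists_bound_of_contDiff h2 d.r₀
  obtain ⟨E, hE0, hE⟩ := exists_bound_of_contDiff h3 d.r₀
  obtain ⟨C, hC0, hC⟩ := (Adm.cN hd).bdd
  set T := A + B + E with hT
  set W := (1 + |(m : ℝ)| + |(k : ℝ)|) * T * (1 + d.r₀) with hW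
  have hT0 : 0 ≤ T := by positivity
  have hW0 : 0 ≤ W := by positivity
  have t1 : T ≤ W := by
    rw [hW]; nlinarith [mul_nonneg (abs_nonneg (m : ℝ)) hT0, mul_nonneg (abs_nonneg (k : ℝ)) hT0,
      mul_nonneg hR.le hT0, mul_nonneg hR.le (mul_nonneg (abs_nonneg (m : ℝ)) hT0),
      mul_nonneg hR.le (mul_nonneg (abs_nonneg (k : ℝ)) hT0)]
  have tm : |(m : ℝ)| * T ≤ W := by
    rw [hW]; nlinarith [mul_nonneg (abs_nonneg (m : ℝ)) hT0, mul_nonneg (abs_nonneg (k : ℝ)) hT0,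
      mul_nonneg hR.le hT0, mul_nonneg hR.le (mul_nonneg (abs_nonneg (m : ℝ)) hT0),
      mul_nonneg hR.le (mul_nonneg (abs_nonneg (k : ℝ)) hT0)]
  have tk : |(k : ℝ)| * T ≤ W := by
    rw [hW]; nlinarith [mul_nonneg (abs_nonneg (m : ℝ)) hT0, mul_nonneg (abs_nonneg (k : ℝ)) hT0,
      mul_nonneg hR.le hT0, mul_nonneg hR.le (mul_nonneg (abs_nonneg (m : ℝ)) hT0),
      mul_nonneg hR.le (mul_nonneg (abs_nonneg (k : ℝ)) hT0)]
  have key : ∀ r ∈ Ioo 0 d.r₀, ∀ i, cN d i r * (ell m k u r i * ell m k u r i)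
      ≤ C * (1 + d.r₀) * (6 * W) ^ 2 := by
    intro r hr i
    have hr0 := hr.1
    obtain ⟨a1, a2, a3⟩ := hA r (Ioo_subset_Icc_self hr)
    obtain ⟨b1, b2, b3⟩ := hB r (Ioo_subset_Icc_self hr)
    obtain ⟨e1, e2, e3⟩ := hE r (Ioo_subset_Icc_self hr)
    have quot : ∀ f : ℝ → ℝ, |f r| ≤ T * r → ∀ n : ℤ, |(n : ℝ) / r * f r| ≤ |(n : ℝ)| * T := by
      intro f hf n
      rw [abs_mul, abs_div, abs_of_pos hr0, div_mul_eq_mul_div, div_le_iff₀ hr0]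
      calc |(n : ℝ)| * |f r| ≤ |(n : ℝ)| * (T * r) := by gcongr
        _ = _ := by ring
    have hξ : |u.ξ r| ≤ T * r := (a3 z1).trans (by gcongr; linarith)
    have hζ : |u.ζ r| ≤ T * r := (e3 z3).trans (by gcongr; linarith)
    have kk : ∀ x : ℝ, |x| ≤ T → |(k : ℝ) * x| ≤ W := fun x hx => by
      rw [abs_mul]; exact le_trans (by gcongr) tk
    have q1 : |deriv u.ξ r| ≤ W := by linarith
    have q2 : |u.ξ r / r| ≤ W := by
      have := quot u.ξ hξ 1
      simp only [Int.cast_one, abs_one, one_mul] at this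
      rw [one_div, inv_mul_eq_div] at this
      linarith
    have q3 : |(m : ℝ) / r * u.ζ r| ≤ W := (quot u.ζ hζ m).trans tm
    have q4 : |(k : ℝ) * u.η r| ≤ W := kk _ (by linarith)
    have q5 : |deriv u.ζ r| ≤ W := by linarith
    have q6 : |u.ζ r / r| ≤ W := by
      have := quot u.ζ hζ 1
      simp only [Int.cast_one, abs_one, one_mul] at this
      rw [one_div, inv_mul_eq_div] at this
      linarith
    have q7 : |(m : ℝ) / r * u.ξ r| ≤ W := (quot u.ξ hξ m).trans tm
    have q8 : |deriv u.η r| ≤ W := by linarith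
    have q9 : |(k : ℝ) * u.ξ r| ≤ W := kk _ (by linarith)
    have q10 : |(m : ℝ) / r * u.η r| ≤ W := by
      by_cases hm : m = 0
      · rw [hm]; simpa using hW0
      · exact (quot u.η ((b3 (z2 hm)).trans (by gcongr; linarith)) m).trans tm
    have q11 : |(k : ℝ) * u.ζ r| ≤ W := kk _ (by linarith)
    have q12 : |u.ξ r| ≤ W := by linarith
    have q13 : |u.η r| ≤ W := by linarith
    have q14 : |u.ζ r| ≤ W := by linarith
    have q15 : |(k : ℝ) * r * u.η r| ≤ W := by
      rw [mul_right_comm, abs_mul, abs_mul, abs_of_pos hr0, hW]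
      have : |u.η r| ≤ T := by linarith
      gcongr
      · linarith [abs_nonneg (m : ℝ)]
      · linarith [hr.2]
    have q16 : |r * deriv u.ξ r| ≤ W := by
      rw [abs_mul, abs_of_pos hr0, mul_comm, hW]
      have h5 : |deriv u.ξ r| ≤ T := by linarith
      have : |deriv u.ξ r| ≤ (1 + |(m : ℝ)| + |(k : ℝ)|) * T := by
        nlinarith [mul_nonneg (abs_nonneg (m : ℝ)) hT0, mul_nonneg (abs_nonneg (k : ℝ)) hT0]
      gcongr
      linarith [hr.2]
    have hell : |ell m k u r i| ≤ 6 * W :=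
      abs_ell_le q1 q2 q3 q4 q5 q6 q7 q8 q9 q10 q11 q12 q13 q14 q15 q16 i
    have hw : wt r i ≤ 1 + d.r₀ := by
      have h1 : r ≤ 1 + d.r₀ := by linarith [hr.2]
      have h2 : 1 ≤ 1 + d.r₀ := by linarith
      fin_cases i <;> first | exact h1 | exact h2
    have h3 : ell m k u r i * ell m k u r i ≤ (6 * W) ^ 2 := by
      rw [← sq]; exact sq_le_sq' (abs_le.1 hell).1 (abs_le.1 hell).2
    calc cN d i r * (ell m k u r i * ell m k u r i)
        ≤ (C * (1 + d.r₀)) * (ell m k u r i * ell m k u r i) := by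
          refine mul_le_mul_of_nonneg_right ?_ (mul_self_nonneg _)
          exact (le_abs_self _).trans ((hC i r hr).trans (by gcongr))
      _ ≤ _ := by gcongr
  have l : ∀ f : ℝ → ℝ, ContDiff ℝ ∞ f → LAC d.r₀ f := fun f hf =>
    LAC.of_contDiffOn (hf.of_le (by exact_mod_cast le_top)).contDiffOn
  refine FiniteNorm.of_normSq hd (l _ h1) (l _ h2) (l _ h3) ?_
  calc d.normSq m k u ≤ ∫⁻ _ in Ioo 0 d.r₀, ENNReal.ofReal (∑ _i : Fin 11, C * (1 + d.r₀) * (6 * W) ^ 2) := by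
        refine setLIntegral_mono measurable_const fun r hr => ENNReal.ofReal_le_ofReal ?_
        rw [normDensity_eq]
        exact Finset.sum_le_sum fun i _ => key r hr i
    _ < ⊤ := by
        rw [setLIntegral_const, Real.volume_Ioo]
        exact ENNReal.mul_lt_top ENNReal.ofReal_lt_top ENNReal.ofReal_lt_top

lemma contDiff_comb {f g : ℝ → ℝ} (hf : ContDiff ℝ ∞ f) (hg : ContDiff ℝ ∞ g) (a b : ℝ) :
    ContDiff ℝ ∞ (fun r => a * f r + b * g r) :=
  (contDiff_const.mul hf).add (contDiff_const.mul hg)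

lemma goodCore_X (hd : d.Admissible) (k : ℤ) : GoodCore d 0 k Data.CoreX where
  comb φ ψ := by
    rintro ⟨a1, a2, a3, a4, a5⟩ ⟨b1, b2, b3, b4, b5⟩ a b
    exact ⟨contDiff_comb a1 b1 a b, contDiff_comb a2 b2 a b, contDiff_comb a3 b3 a b,
      by simp [Profile.comb, a4, b4], by simp [Profile.comb, a5, b5]⟩
  finite φ := fun ⟨a1, a2, a3, a4, a5⟩ =>
    finiteNorm_of_smooth hd a1 a2 a3 a4 (fun h => absurd rfl h) a5
  test φ h1 h2 h3 z1 _ z3 := ⟨h1, h2, h3, z1, z3⟩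

lemma goodCore_Y (hd : d.Admissible) (m k : ℤ) : GoodCore d m k Data.CoreY where
  comb φ ψ := by
    rintro ⟨a1, a2, a3, a4, a5, a6⟩ ⟨b1, b2, b3, b4, b5, b6⟩ a b
    exact ⟨contDiff_comb a1 b1 a b, contDiff_comb a2 b2 a b, contDiff_comb a3 b3 a b,
      by simp [Profile.comb, a4, b4], by simp [Profile.comb, a5, b5],
      by simp [Profile.comb, a6, b6]⟩
  finite φ := fun ⟨a1, a2, a3, a4, a5, a6⟩ =>
    finiteNorm_of_smooth hd a1 a2 a3 a4 (fun _ => a5) a6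
  test φ h1 h2 h3 z1 z2 z3 := ⟨h1, h2, h3, z1, z2, z3⟩

section Completion

variable {core : Profile → Prop} (hcore : GoodCore d m k core)
include hcore

lemma GoodCore.finiteNorm (hd : d.Admissible) (hu : d.MemCompletion core m k u) :
    FiniteNorm d m k u := by
  obtain ⟨l1, l2, l3, h⟩ := hu
  obtain ⟨φ, hφ, hlt⟩ := h 1 one_pos
  have hF := hcore.finite φ hφ
  have h1 : LAC d.r₀ u.ξ := l1
  have h2 : LAC d.r₀ u.η := l2
  have h3 : LAC d.r₀ u.ζ := l3
  have hs : FiniteNorm d m k (u.sub φ) := FiniteNorm.of_normSq hd (h1.sub hF.lac_ξ)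
    (h2.sub hF.lac_η) (h3.sub hF.lac_ζ) (hlt.trans_le le_top)
  rw [u.eq_comb_sub φ]
  exact (hs.comb hd hF 1 1).1

lemma GoodCore.memCompletion_iff (hd : d.Admissible) :
    d.MemCompletion core m k u ↔ FiniteNorm d m k u ∧
      ∀ e > 0, ∃ φ, core φ ∧ nrm d m k (Profile.comb 1 (-1) u φ) < e := by
  constructor
  · intro hu
    have hF := hcore.finiteNorm hd hu
    refine ⟨hF, fun e he => ?_⟩
    obtain ⟨φ, hφ, hlt⟩ := hu.2.2.2 (ENNReal.ofReal e) (ENNReal.ofReal_pos.2 he)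
    refine ⟨φ, hφ, ?_⟩
    rw [Profile.sub_eq_comb, normSq_eq hd (hF.comb hd (hcore.finite φ hφ) 1 (-1)).1,
      ENNReal.ofReal_lt_ofReal_iff he] at hlt
    exact hlt
  · rintro ⟨hF, h⟩
    refine ⟨hF.lac_ξ, hF.lac_η, hF.lac_ζ, fun e he => ?_⟩
    obtain ⟨q, hq0, hqe⟩ := ENNReal.lt_iff_exists_nnreal_btwn.1 he
    have hq : (0 : ℝ) < q := by exact_mod_cast hq0
    obtain ⟨φ, hφ, hlt⟩ := h q hq
    refine ⟨φ, hφ, lt_trans ?_ hqe⟩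
    rw [Profile.sub_eq_comb, normSq_eq hd (hF.comb hd (hcore.finite φ hφ) 1 (-1)).1]
    rw [← ENNReal.ofReal_coe_nnreal, ENNReal.ofReal_lt_ofReal_iff hq]
    exact hlt

lemma GoodCore.mem_of_core (hd : d.Admissible) (hu : core u) : d.MemCompletion core m k u := by
  rw [hcore.memCompletion_iff hd]
  refine ⟨hcore.finite u hu, fun e he => ⟨u, hu, ?_⟩⟩
  have h := hcore.finite u hu
  have h0 : Profile.comb 1 (-1) u u = Profile.comb 0 0 u u :=
    Profile.ext' (fun r => by simp [Profile.comb]) (fun r => by simp [Profile.comb])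
      (fun r => by simp [Profile.comb])
  have h2 := (h.comb hd h 0 0).2
  rw [h0]
  refine lt_of_le_of_lt h2 ?_
  simpa using he

/-- The completion is closed under norm limits; this keeps the limit of a minimizing sequence
admissible. -/
lemma GoodCore.mem_of_approx (hd : d.Admissible) (hu : FiniteNorm d m k u)
    (h : ∀ e > 0, ∃ w, d.MemCompletion core m k w ∧ nrm d m k (Profile.comb 1 (-1) u w) < e) :
    d.MemCompletion core m k u := by
  rw [hcore.memCompletion_iff hd]
  refine ⟨hu, fun e he => ?_⟩
  obtain ⟨w, hw, h1⟩ := h (e / 4) (by positivity)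
  obtain ⟨hwF, h2⟩ := (hcore.memCompletion_iff hd).1 hw
  obtain ⟨φ, hφ, h3⟩ := h2 (e / 4) (by positivity)
  refine ⟨φ, hφ, ?_⟩
  have e1 : Profile.comb 1 (-1) u φ
      = Profile.comb 1 1 (Profile.comb 1 (-1) u w) (Profile.comb 1 (-1) w φ) :=
    Profile.ext' (fun r => by simp [Profile.comb]) (fun r => by simp [Profile.comb])
      (fun r => by simp [Profile.comb])
  rw [e1]
  have := ((hu.comb hd hwF 1 (-1)).1.comb hd (hwF.comb hd (hcore.finite φ hφ) 1 (-1)).1 1 1).2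
  linarith

lemma GoodCore.mem_comb (hd : d.Admissible) (hu : d.MemCompletion core m k u)
    (hv : d.MemCompletion core m k v) (a b : ℝ) :
    d.MemCompletion core m k (Profile.comb a b u v) := by
  obtain ⟨hu1, hu2⟩ := (hcore.memCompletion_iff hd).1 hu
  obtain ⟨hv1, hv2⟩ := (hcore.memCompletion_iff hd).1 hv
  rw [hcore.memCompletion_iff hd]
  refine ⟨(hu1.comb hd hv1 a b).1, fun e he => ?_⟩
  set A := 2 * a ^ 2 + 2 * b ^ 2 + 1 with hA
  have hA0 : 0 < A := by positivity
  obtain ⟨φ, hφ, h1⟩ := hu2 (e / A) (by positivity)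
  obtain ⟨ψ, hψ, h2⟩ := hv2 (e / A) (by positivity)
  refine ⟨_, hcore.comb φ ψ hφ hψ a b, ?_⟩
  have e1 : Profile.comb 1 (-1) (Profile.comb a b u v) (Profile.comb a b φ ψ)
      = Profile.comb a b (Profile.comb 1 (-1) u φ) (Profile.comb 1 (-1) v ψ) :=
    Profile.ext' (fun r => by simp [Profile.comb]; ring) (fun r => by simp [Profile.comb]; ring)
      (fun r => by simp [Profile.comb]; ring)
  rw [e1]
  have h3 := ((hu1.comb hd (hcore.finite φ hφ) 1 (-1)).1.comb hd
    (hv1.comb hd (hcore.finite ψ hψ) 1 (-1)).1 a b).2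
  have h4 : 2 * a ^ 2 * nrm d m k (Profile.comb 1 (-1) u φ) ≤ 2 * a ^ 2 * (e / A) := by gcongr
  have h5 : 2 * b ^ 2 * nrm d m k (Profile.comb 1 (-1) v ψ) ≤ 2 * b ^ 2 * (e / A) := by gcongr
  have h6 : (2 * a ^ 2 + 2 * b ^ 2) * (e / A) < e := by
    calc (2 * a ^ 2 + 2 * b ^ 2) * (e / A) < A * (e / A) := by
          have : 0 < e / A := by positivity
          gcongr
          rw [hA]; linarith
      _ = e := by field_simp
  linarith

end Completion

end ZPinch

/-! ### Compactness, completeness and existence of minimizers. -/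

namespace ZPinch

variable {d : Data} {m k : ℤ} {u v : Profile} {c c' : Fin 11 → ℝ → ℝ} {τ : ℝ}

/-- The form `qf` with a boundary term. -/
noncomputable def gf (d : Data) (m k : ℤ) (c : Fin 11 → ℝ → ℝ) (τ : ℝ) (u v : Profile) : ℝ :=
  qf d.r₀ m k c u v + τ * (u.ξ d.r₀ * v.ξ d.r₀)

lemma gf_comb (hd : d.Admissible) (hc : Adm d.r₀ c) (hu : FiniteNorm d m k u)
    (hv : FiniteNorm d m k v) (a b : ℝ) :
    gf d m k c τ (Profile.comb a b u v) (Profile.comb a b u v)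
      = a ^ 2 * gf d m k c τ u u + 2 * a * b * gf d m k c τ u v + b ^ 2 * gf d m k c τ v v := by
  rw [gf, qf_comb hd hc hu hv, gf, gf, gf]
  simp only [Profile.comb]
  ring

lemma gf_add_smul (hd : d.Admissible) (hc : Adm d.r₀ c) (hc' : Adm d.r₀ c') (s : ℝ)
    (hu : FiniteNorm d m k u) (hv : FiniteNorm d m k v) :
    gf d m k (fun i r => c i r + s * c' i r) τ u v
      = gf d m k c τ u v + s * qf d.r₀ m k c' u v := by
  rw [gf, qf_add_smul hd hc hc' s hu hv, gf]
  ring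

/-- The boundary term is harmless because the norm controls the trace `ξ(r₀)`, through
`exists_energy_le` and `Energetic.mul_sq_le`. -/
lemma exists_gf_le (hd : d.Admissible) (hc : Adm d.r₀ c) (τ : ℝ) (m k : ℤ) :
    ∃ K, 0 ≤ K ∧ ∀ u, FiniteNorm d m k u → |gf d m k c τ u u| ≤ K * nrm d m k u := by
  obtain ⟨K, hK0, hK⟩ := exists_qf_le hd hc m k
  obtain ⟨E, hE0, hE⟩ := exists_energy_le hd m k
  have hR := hd.r₀_pos
  refine ⟨K + |τ| * (3 * E / d.r₀), by positivity, fun u hu => ?_⟩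
  obtain ⟨⟨h1, -, -⟩, h2, -, -⟩ := hE u hu
  have h3 := h1.mul_sq_le hR (x := d.r₀) ⟨hR, le_rfl⟩
  have h4 : u.ξ d.r₀ * u.ξ d.r₀ ≤ 3 * E / d.r₀ * nrm d m k u := by
    rw [div_mul_eq_mul_div, le_div_iff₀ hR]; linarith
  calc |gf d m k c τ u u| ≤ |qf d.r₀ m k c u u| + |τ| * (u.ξ d.r₀ * u.ξ d.r₀) := by
        refine (abs_add_le _ _).trans (le_of_eq ?_)
        rw [abs_mul, abs_mul_self]
    _ ≤ K * nrm d m k u + |τ| * (3 * E / d.r₀ * nrm d m k u) := by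
        have := hK u hu
        gcongr
    _ = _ := by ring

/-- For a nonnegative form this bounds the value at a difference by the values at the two profiles,
and so gives strong convergence of minimizing sequences without weak compactness. -/
lemma gf_parallelogram (hd : d.Admissible) (hc : Adm d.r₀ c) (hu : FiniteNorm d m k u)
    (hv : FiniteNorm d m k v) :
    gf d m k c τ (Profile.comb 1 (-1) u v) (Profile.comb 1 (-1) u v)
      + gf d m k c τ (Profile.comb 1 1 u v) (Profile.comb 1 1 u v)
      = 2 * gf d m k c τ u u + 2 * gf d m k c τ v v := by
  rw [gf_comb hd hc hu hv, gf_comb hd hc hu hv]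
  ring

lemma gf_scale (hd : d.Admissible) (hc : Adm d.r₀ c) (hu : FiniteNorm d m k u) (a : ℝ) :
    gf d m k c τ (Profile.comb a 0 u u) (Profile.comb a 0 u u) = a ^ 2 * gf d m k c τ u u := by
  rw [gf_comb hd hc hu hu]
  ring

lemma gf_zero : gf d m k c 0 u v = qf d.r₀ m k c u v := by rw [gf]; ring

/-- Sequences bounded in the norm have subsequences that are Cauchy with respect to `J`. -/
lemma exists_subseq_cauchy_J (hd : d.Admissible) {u : ℕ → Profile} (hu : ∀ n, FiniteNorm d m k (u n))
    {M : ℝ} (hM : ∀ n, nrm d m k (u n) ≤ M) :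
    ∃ φ : ℕ → ℕ, StrictMono φ ∧ Tendsto (fun p : ℕ × ℕ => qf d.r₀ m k (cJ d)
      (Profile.comb 1 (-1) (u (φ p.1)) (u (φ p.2))) (Profile.comb 1 (-1) (u (φ p.1)) (u (φ p.2))))
      (atTop ×ˢ atTop) (𝓝 0) := by
  have hR := hd.r₀_pos
  obtain ⟨K, hK0, hK⟩ := exists_energy_le hd m k
  set H := K * M with hH
  have hb : ∀ n, energy d.r₀ (u n).ξ ≤ H ∧ energy d.r₀ (u n).η ≤ H ∧ energy d.r₀ (u n).ζ ≤ H := by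
    intro n
    obtain ⟨-, h1, h2, h3⟩ := hK _ (hu n)
    have h4 : K * nrm d m k (u n) ≤ H := by have := hM n; rw [hH]; gcongr
    exact ⟨h1.trans h4, h2.trans h4, h3.trans h4⟩
  have hen := fun n => (hK _ (hu n)).1
  obtain ⟨φ₁, hφ₁, g₁, hg₁⟩ := exists_subseq_tendsto hR (f := fun n => (u n).ξ)
    (fun n => (hen n).1) (fun n => (hb n).1)
  obtain ⟨φ₂, hφ₂, g₂, hg₂⟩ := exists_subseq_tendsto hR (f := fun n => (u (φ₁ n)).η)
    (fun n => (hen _).2.1) (fun n => (hb _).2.1)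
  obtain ⟨φ₃, hφ₃, g₃, hg₃⟩ := exists_subseq_tendsto hR (f := fun n => (u (φ₁ (φ₂ n))).ζ)
    (fun n => (hen _).2.2) (fun n => (hb _).2.2)
  set φ := fun n => φ₁ (φ₂ (φ₃ n)) with hφ
  have h23 : Tendsto (fun n => φ₂ (φ₃ n)) atTop atTop := hφ₂.tendsto_atTop.comp hφ₃.tendsto_atTop
  have l1 : ∀ x ∈ Ioc 0 d.r₀, Tendsto (fun n => (u (φ n)).ξ x) atTop (𝓝 (g₁ x)) :=
    fun x hx => (hg₁ x hx).comp h23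
  have l2 : ∀ x ∈ Ioc 0 d.r₀, Tendsto (fun n => (u (φ n)).η x) atTop (𝓝 (g₂ x)) :=
    fun x hx => (hg₂ x hx).comp hφ₃.tendsto_atTop
  have l3 : ∀ x ∈ Ioc 0 d.r₀, Tendsto (fun n => (u (φ n)).ζ x) atTop (𝓝 (g₃ x)) := hg₃
  refine ⟨φ, fun a b hab => hφ₁ (hφ₂ (hφ₃ hab)), ?_⟩
  obtain ⟨Cρ, hCρ0, hCρ⟩ := hd.exists_rho_bound
  -- The weight `r` of `J` compensates the possible growth of the squares at the axis. The
  -- differences are then uniformly bounded, `12 = 2 · 3 + 2 · 3`, and dominated convergence applies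
  -- with a constant.
  have hpt : ∀ f : ℕ → ℝ → ℝ, (∀ n, Energetic d.r₀ (f n)) → (∀ n, energy d.r₀ (f n) ≤ H) →
      ∀ a b, ∀ x ∈ Ioc 0 d.r₀, x * (f a x - f b x) ^ 2 ≤ 12 * H := by
    intro f hf hfb a b x hx
    have h1 := (hf a).mul_sq_le hR hx
    have h2 := (hf b).mul_sq_le hR hx
    have h3 := hfb a
    have h4 := hfb b
    have h5 := mul_le_mul_of_nonneg_left (sub_sq_le_two (f a x) (f b x)) hx.1.le
    nlinarith
  have hzero : (0 : ℝ) = ∫ _ in Ioo 0 d.r₀, (0 : ℝ) := by simp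
  rw [hzero]
  refine tendsto_integral_filter_of_dominated_convergence (fun _ => Cρ * (36 * H)) ?_ ?_
    (integrable_const _) ?_
  · refine Eventually.of_forall fun p => ?_
    have hF := ((hu (φ p.1)).comb hd (hu (φ p.2)) 1 (-1)).1
    exact ((Adm.cJ hd).integrable hd hF hF).aestronglyMeasurable
  · refine Eventually.of_forall fun p => ?_
    filter_upwards [ae_restrict_mem measurableSet_Ioo] with r hr
    have hr' := Ioo_subset_Ioc_self hr
    have hρ := hd.rho_nonneg (Ioo_subset_Icc_self hr)
    have h1 := hpt (fun n => (u n).ξ) (fun n => (hen n).1) (fun n => (hb n).1) (φ p.1) (φ p.2) r hr'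
    have h2 := hpt (fun n => (u n).η) (fun n => (hen n).2.1) (fun n => (hb n).2.1) (φ p.1) (φ p.2) r hr'
    have h3 := hpt (fun n => (u n).ζ) (fun n => (hen n).2.2) (fun n => (hb n).2.2) (φ p.1) (φ p.2) r hr'
    have hr0 := hr.1
    rw [cJ_sum, Real.norm_of_nonneg (by positivity)]
    simp only [Profile.comb, one_mul, neg_one_mul, ← sub_eq_add_neg]
    calc _ = d.rho r * (r * ((u (φ p.1)).ξ r - (u (φ p.2)).ξ r) ^ 2
          + r * ((u (φ p.1)).η r - (u (φ p.2)).η r) ^ 2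
          + r * ((u (φ p.1)).ζ r - (u (φ p.2)).ζ r) ^ 2) := by ring
      _ ≤ Cρ * (36 * H) := by
          have := hCρ r (Ioo_subset_Icc_self hr)
          gcongr
          linarith
  · filter_upwards [ae_restrict_mem measurableSet_Ioo] with r hr
    have hr' := Ioo_subset_Ioc_self hr
    have hdiff : ∀ (f : ℕ → ℝ) (g : ℝ), Tendsto f atTop (𝓝 g) →
        Tendsto (fun p : ℕ × ℕ => (1 * f p.1 + (-1) * f p.2) ^ 2) (atTop ×ˢ atTop) (𝓝 0) := by
      intro f g hfg
      have h1 : Tendsto (fun p : ℕ × ℕ => f p.1) (atTop ×ˢ atTop) (𝓝 g) := hfg.comp tendsto_fst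
      have h2 : Tendsto (fun p : ℕ × ℕ => f p.2) (atTop ×ˢ atTop) (𝓝 g) := hfg.comp tendsto_snd
      have := ((h1.const_mul 1).add (h2.const_mul (-1))).pow 2
      simpa using this
    simp only [cJ_sum, Profile.comb]
    have := (((hdiff _ _ (l1 r hr')).add (hdiff _ _ (l2 r hr'))).add
      (hdiff _ _ (l3 r hr'))).const_mul (d.rho r * r)
    simpa using this

/-- Completeness of the space of finite norm. -/
lemma exists_limit_profile (hd : d.Admissible) {u : ℕ → Profile} (hu : ∀ n, FiniteNorm d m k (u n))
    (hc : Tendsto (fun p : ℕ × ℕ => nrm d m k (Profile.comb 1 (-1) (u p.1) (u p.2)))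
      (atTop ×ˢ atTop) (𝓝 0)) :
    ∃ w, FiniteNorm d m k w ∧
      Tendsto (fun n => nrm d m k (Profile.comb 1 (-1) w (u n))) atTop (𝓝 0) := by
  have hR := hd.r₀_pos
  obtain ⟨K, hK0, hK⟩ := exists_energy_le hd m k
  have hen := fun n => (hK _ (hu n)).1
  have hcau : ∀ e > 0, ∃ N, ∀ n ≥ N, ∀ l ≥ N, nrm d m k (Profile.comb 1 (-1) (u n) (u l)) < e := by
    intro e he
    have h1 := hc.eventually_lt_const he
    rw [prod_atTop_atTop_eq, eventually_atTop] at h1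
    obtain ⟨⟨a, b⟩, hab⟩ := h1
    exact ⟨max a b, fun n hn l hl => hab (n, l) ⟨(le_max_left _ _).trans hn, (le_max_right _ _).trans hl⟩⟩
  have hcauE : ∀ e > 0, ∃ N, ∀ n ≥ N, ∀ l ≥ N,
      energy d.r₀ (fun r => (u n).ξ r - (u l).ξ r) ≤ e ∧
      energy d.r₀ (fun r => (u n).η r - (u l).η r) ≤ e ∧
      energy d.r₀ (fun r => (u n).ζ r - (u l).ζ r) ≤ e := by
    intro e he
    obtain ⟨N, hN⟩ := hcau (e / K) (by positivity)
    refine ⟨N, fun n hn l hl => ?_⟩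
    obtain ⟨-, h1, h2, h3⟩ := hK _ ((hu n).comb hd (hu l) 1 (-1)).1
    have h4 : K * nrm d m k (Profile.comb 1 (-1) (u n) (u l)) ≤ e := by
      have := (hN n hn l hl).le
      calc _ ≤ K * (e / K) := by gcongr
        _ = e := by field_simp
    simp only [Profile.comb, one_mul, neg_one_mul, ← sub_eq_add_neg] at h1 h2 h3 h4
    exact ⟨h1.trans h4, h2.trans h4, h3.trans h4⟩
  obtain ⟨g₁, lg₁, hg₁, φ₁, hφ₁, hd₁⟩ := exists_limit hR (f := fun n => (u n).ξ) (fun n => (hen n).1)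
    (fun e he => by
      obtain ⟨N, hN⟩ := hcauE e he
      exact ⟨N, fun n hn l hl => (hN n hn l hl).1⟩)
  obtain ⟨g₂, lg₂, hg₂, φ₂, hφ₂, hd₂⟩ := exists_limit hR (f := fun n => (u (φ₁ n)).η)
    (fun n => (hen _).2.1)
    (fun e he => by
      obtain ⟨N, hN⟩ := hcauE e he
      exact ⟨N, fun n hn l hl =>
        (hN _ (hn.trans (hφ₁.id_le n)) _ (hl.trans (hφ₁.id_le l))).2.1⟩)
  obtain ⟨g₃, lg₃, hg₃, φ₃, hφ₃, hd₃⟩ := exists_limit hR (f := fun n => (u (φ₁ (φ₂ n))).ζ)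
    (fun n => (hen _).2.2)
    (fun e he => by
      obtain ⟨N, hN⟩ := hcauE e he
      exact ⟨N, fun n hn l hl =>
        (hN _ (hn.trans ((hφ₂.id_le n).trans (hφ₁.id_le _))) _
          (hl.trans ((hφ₂.id_le l).trans (hφ₁.id_le _)))).2.2⟩)
  set φ := fun n => φ₁ (φ₂ (φ₃ n)) with hφ
  have hφm : StrictMono φ := fun a b hab => hφ₁ (hφ₂ (hφ₃ hab))
  set w : Profile := ⟨g₁, g₂, g₃⟩ with hw
  have t23 : Tendsto (fun n => φ₂ (φ₃ n)) atTop atTop := hφ₂.tendsto_atTop.comp hφ₃.tendsto_atTop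
  have hell : ∀ᵐ r ∂(vol d.r₀), ∀ i, Tendsto (fun n => ell m k (u (φ n)) r i) atTop
      (𝓝 (ell m k w r i)) := by
    filter_upwards [hd₁, hd₂, hd₃, ae_restrict_mem measurableSet_Ioo] with r a1 a2 a3 hr
    have hr' := Ioo_subset_Ioc_self hr
    have b1 : Tendsto (fun n => (u (φ n)).ξ r) atTop (𝓝 (g₁ r)) :=
      (hg₁ r hr').comp (hφ₁.tendsto_atTop.comp t23)
    have b2 : Tendsto (fun n => (u (φ n)).η r) atTop (𝓝 (g₂ r)) := (hg₂ r hr').comp t23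
    have b3 : Tendsto (fun n => (u (φ n)).ζ r) atTop (𝓝 (g₃ r)) :=
      (hg₃ r hr').comp hφ₃.tendsto_atTop
    have c1 : Tendsto (fun n => deriv (u (φ n)).ξ r) atTop (𝓝 (deriv g₁ r)) := a1.comp t23
    have c2 : Tendsto (fun n => deriv (u (φ n)).η r) atTop (𝓝 (deriv g₂ r)) :=
      a2.comp hφ₃.tendsto_atTop
    have c3 : Tendsto (fun n => deriv (u (φ n)).ζ r) atTop (𝓝 (deriv g₃ r)) := a3
    intro i
    match i with
    | 0 => exact (((c1.const_mul (-2)).add (b1.div_const r)).add (b3.const_mul (m / r))).sub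
            (b2.const_mul (k : ℝ))
    | 1 => exact ((c1.sub ((b1.const_mul 2).div_const r)).sub (b3.const_mul (2 * m / r))).sub
            (b2.const_mul (k : ℝ))
    | 2 => exact ((c1.add (b1.div_const r)).add (b3.const_mul (m / r))).add
            (b2.const_mul (2 * k : ℝ))
    | 3 => exact (c3.neg.add (b3.div_const r)).add (b1.const_mul (m / r))
    | 4 => exact c2.add (b1.const_mul (k : ℝ))
    | 5 => exact (b2.const_mul (m / r)).sub (b3.const_mul (k : ℝ))
    | 6 => exact ((c1.add (b1.div_const r)).add (b3.const_mul (m / r))).sub (b2.const_mul (k : ℝ))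
    | 7 => exact b1
    | 8 => exact b2
    | 9 => exact b3
    | 10 => exact ((b2.const_mul (k * r : ℝ)).add b1).sub (c1.const_mul r)
  -- Fatou's lemma: along the subsequence all the linear forms converge almost everywhere. The
  -- Cauchy property then yields both finiteness of the norm of the limit and convergence in norm.
  have hfat : ∀ l, d.normSq m k (Profile.comb 1 (-1) w (u l))
      ≤ liminf (fun n => d.normSq m k (Profile.comb 1 (-1) (u (φ n)) (u l))) atTop := by
    intro l
    have hlim : ∀ᵐ r ∂(vol d.r₀), Tendsto (fun n => ENNReal.ofReal
        (d.normDensity m k (Profile.comb 1 (-1) (u (φ n)) (u l)) r)) atTop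
        (𝓝 (ENNReal.ofReal (d.normDensity m k (Profile.comb 1 (-1) w (u l)) r))) := by
      have hall : ∀ᵐ r ∂(vol d.r₀), ∀ n i, ell m k (Profile.comb 1 (-1) (u (φ n)) (u l)) r i
          = 1 * ell m k (u (φ n)) r i + (-1) * ell m k (u l) r i :=
        ae_all_iff.2 fun n => ae_ell_comb (hu (φ n)).lac_ξ (hu (φ n)).lac_η (hu (φ n)).lac_ζ
          (hu l).lac_ξ (hu l).lac_η (hu l).lac_ζ 1 (-1)
      filter_upwards [hell, hall, ae_ell_comb (m := m) (k := k) (u := w) (v := u l) lg₁ lg₂ lg₃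
        (hu l).lac_ξ (hu l).lac_η (hu l).lac_ζ 1 (-1)] with r h1 h2 h3
      refine (ENNReal.continuous_ofReal.tendsto _).comp ?_
      simp only [normDensity_eq, h2, h3]
      refine tendsto_finsetSum _ fun i _ => ?_
      have := ((h1 i).const_mul 1).add_const ((-1) * ell m k (u l) r i)
      exact (this.mul this).const_mul _
    calc d.normSq m k (Profile.comb 1 (-1) w (u l))
        = ∫⁻ r in Ioo 0 d.r₀, liminf (fun n => ENNReal.ofReal
          (d.normDensity m k (Profile.comb 1 (-1) (u (φ n)) (u l)) r)) atTop := by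
          refine lintegral_congr_ae ?_
          filter_upwards [hlim] with r hr using hr.liminf_eq.symm
      _ ≤ _ := lintegral_liminf_le' fun n =>
          ((hu (φ n)).comb hd (hu l) 1 (-1)).1.int.aestronglyMeasurable.aemeasurable.ennreal_ofReal
  have hsmall : ∀ e > 0, ∃ N, ∀ l ≥ N,
      d.normSq m k (Profile.comb 1 (-1) w (u l)) ≤ ENNReal.ofReal e := by
    intro e he
    obtain ⟨N, hN⟩ := hcau e he
    refine ⟨N, fun l hl => (hfat l).trans ?_⟩
    refine liminf_le_of_frequently_le' (Eventually.frequently ?_)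
    filter_upwards [eventually_ge_atTop N] with n hn
    rw [normSq_eq hd ((hu (φ n)).comb hd (hu l) 1 (-1)).1]
    exact ENNReal.ofReal_le_ofReal (hN _ (hn.trans (hφm.id_le n)) l hl).le
  have hwl : ∀ l, FiniteNorm d m k (Profile.comb 1 (-1) w (u l)) → FiniteNorm d m k w := by
    intro l hl
    have := (hl.comb hd (hu l) 1 1).1
    have e : Profile.comb 1 1 (Profile.comb 1 (-1) w (u l)) (u l) = w :=
      Profile.ext' (fun r => by simp [Profile.comb]) (fun r => by simp [Profile.comb])
        (fun r => by simp [Profile.comb])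
    rwa [e] at this
  have hwF : FiniteNorm d m k w := by
    obtain ⟨N, hN⟩ := hsmall 1 one_pos
    exact hwl N (FiniteNorm.of_normSq hd ((lg₁.const_mul 1).add ((hu N).lac_ξ.const_mul (-1)))
      ((lg₂.const_mul 1).add ((hu N).lac_η.const_mul (-1)))
      ((lg₃.const_mul 1).add ((hu N).lac_ζ.const_mul (-1)))
      ((hN N le_rfl).trans_lt ENNReal.ofReal_lt_top))
  refine ⟨w, hwF, ?_⟩
  rw [Metric.tendsto_atTop]
  intro e he
  obtain ⟨N, hN⟩ := hsmall (e / 2) (by positivity)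
  refine ⟨N, fun l hl => ?_⟩
  have h1 := hN l hl
  rw [normSq_eq hd (hwF.comb hd (hu l) 1 (-1)).1, ENNReal.ofReal_le_ofReal_iff (by positivity)] at h1
  rw [Real.dist_eq, sub_zero, abs_of_nonneg (nrm_nonneg hd)]
  linarith

section Minimizer

variable {core : Profile → Prop} (hcore : GoodCore d m k core)
include hcore

/-- Existence of minimizers of coercive quadratic forms under the constraint `J = 1`. -/
theorem GoodCore.exists_minimizer (hd : d.Admissible) (hc : Adm d.r₀ c) {κ C : ℝ}
    (hκ : 0 < κ)
    (hcoer : ∀ u, FiniteNorm d m k u → κ * nrm d m k u ≤ gf d m k c τ u u + C * qf d.r₀ m k (cJ d) u u)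
    (hne : ∃ v, d.MemCompletion core m k v ∧ qf d.r₀ m k (cJ d) v v ≠ 0) :
    ∃ w, d.MemCompletion core m k w ∧ qf d.r₀ m k (cJ d) w w = 1 ∧
      ∀ v, d.MemCompletion core m k v →
        gf d m k c τ w w * qf d.r₀ m k (cJ d) v v ≤ gf d m k c τ v v := by
  have hJ := Adm.cJ hd
  have fin := fun v (hv : d.MemCompletion core m k v) => hcore.finiteNorm hd hv
  have jscale : ∀ v, FiniteNorm d m k v → ∀ a, qf d.r₀ m k (cJ d) (Profile.comb a 0 v v)
      (Profile.comb a 0 v v) = a ^ 2 * qf d.r₀ m k (cJ d) v v := fun v hv a => by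
    rw [← gf_zero, gf_scale hd hJ hv, gf_zero]
  set S : Set ℝ := {x | ∃ v, d.MemCompletion core m k v ∧ qf d.r₀ m k (cJ d) v v = 1 ∧
    x = gf d m k c τ v v} with hS
  have norml : ∀ v, d.MemCompletion core m k v → 0 < qf d.r₀ m k (cJ d) v v →
      gf d m k c τ v v / qf d.r₀ m k (cJ d) v v ∈ S := by
    intro v hv h0
    set j := qf d.r₀ m k (cJ d) v v with hj
    have hs : (1 / √j) ^ 2 = 1 / j := by rw [div_pow, one_pow, Real.sq_sqrt h0.le]
    refine ⟨Profile.comb (1 / √j) 0 v v, hcore.mem_comb hd hv hv _ _, ?_, ?_⟩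
    · rw [jscale v (fin v hv), hs, ← hj]; field_simp
    · rw [gf_scale hd hc (fin v hv), hs]; ring
  have hbdd : BddBelow S := by
    refine ⟨-C, ?_⟩
    rintro x ⟨v, hv, hj, rfl⟩
    have h1 := hcoer v (fin v hv)
    have h2 := mul_nonneg hκ.le (nrm_nonneg (m := m) (k := k) (u := v) hd)
    rw [hj] at h1
    linarith
  have hSne : S.Nonempty := by
    obtain ⟨v, hv, hj⟩ := hne
    exact ⟨_, norml v hv (lt_of_le_of_ne (qf_cJ_nonneg hd) (Ne.symm hj))⟩
  set l := sInf S with hl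
  -- the nonnegative form
  set N : Profile → ℝ := fun v => gf d m k c τ v v - l * qf d.r₀ m k (cJ d) v v with hN
  have hc' : Adm d.r₀ (fun i r => c i r + (-l) * cJ d i r) := hc.add_smul hJ (-l)
  have hNgf : ∀ v, FiniteNorm d m k v → N v = gf d m k (fun i r => c i r + (-l) * cJ d i r) τ v v := by
    intro v hv
    rw [gf_add_smul hd hc hJ (-l) hv hv, hN]; ring
  have hN0 : ∀ v, d.MemCompletion core m k v → 0 ≤ N v := by
    intro v hv
    rcases eq_or_lt_of_le (qf_cJ_nonneg (m := m) (k := k) (u := v) hd) with h | h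
    · have h1 := hcoer v (fin v hv)
      have h2 := mul_nonneg hκ.le (nrm_nonneg (m := m) (k := k) (u := v) hd)
      simp only [hN]
      rw [← h] at h1 ⊢
      linarith
    · have h1 : l ≤ _ := csInf_le hbdd (norml v hv h)
      rw [le_div_iff₀ h] at h1
      simp only [hN]; linarith
  -- The parallelogram identity for `N`, with the nonnegative value at the sum dropped.
  have hNsub : ∀ a b, d.MemCompletion core m k a → d.MemCompletion core m k b →
      N (Profile.comb 1 (-1) a b) ≤ 2 * N a + 2 * N b := by
    intro a b ha hb
    have h1 := gf_parallelogram (τ := τ) hd hc' (fin a ha) (fin b hb)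
    have h2 := hN0 _ (hcore.mem_comb hd ha hb 1 1)
    rw [← hNgf _ (fin a ha), ← hNgf _ (fin b hb), ← hNgf _ ((fin a ha).comb hd (fin b hb) 1 1).1,
      ← hNgf _ ((fin a ha).comb hd (fin b hb) 1 (-1)).1] at h1
    linarith
  -- a minimizing sequence
  obtain ⟨x, -, hx, hxS⟩ := exists_seq_tendsto_sInf hSne hbdd
  choose v hv hvj hvx using hxS
  have hNv : Tendsto (fun n => N (v n)) atTop (𝓝 0) := by
    have : (fun n => N (v n)) = fun n => x n - l := by
      ext n; simp only [hN]; rw [hvj, ← hvx, mul_one]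
    rw [this]
    simpa only [hl, sub_self] using hx.sub_const (sInf S)
  obtain ⟨X, hX⟩ := hx.bddAbove_range
  have hvM : ∀ n, nrm d m k (v n) ≤ (X + C) / κ := by
    intro n
    have h1 := hcoer _ (fin _ (hv n))
    have h2 : x n ≤ X := hX ⟨n, rfl⟩
    rw [le_div_iff₀ hκ, mul_comm]
    rw [hvj, ← hvx] at h1
    linarith
  obtain ⟨φ, hφ, hφJ⟩ := exists_subseq_cauchy_J hd (fun n => fin _ (hv n)) hvM
  have hNφ : Tendsto (fun n => N (v (φ n))) atTop (𝓝 0) := hNv.comp hφ.tendsto_atTop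
  -- On differences `N` tends to zero by `hNsub` and `J` by compactness; coercivity turns this into
  -- the Cauchy property in norm.
  have hcau : Tendsto (fun p : ℕ × ℕ => nrm d m k (Profile.comb 1 (-1) (v (φ p.1)) (v (φ p.2))))
      (atTop ×ˢ atTop) (𝓝 0) := by
    have hup : Tendsto (fun p : ℕ × ℕ => (1 / κ) * ((2 * N (v (φ p.1)) + 2 * N (v (φ p.2)))
        + (|l| + C) * qf d.r₀ m k (cJ d) (Profile.comb 1 (-1) (v (φ p.1)) (v (φ p.2)))
          (Profile.comb 1 (-1) (v (φ p.1)) (v (φ p.2))))) (atTop ×ˢ atTop) (𝓝 0) := by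
      have := ((((hNφ.comp tendsto_fst).const_mul 2).add ((hNφ.comp tendsto_snd).const_mul 2)).add
        (hφJ.const_mul (|l| + C))).const_mul (1 / κ)
      simpa using this
    refine squeeze_zero (fun p => nrm_nonneg hd) (fun p => ?_) hup
    have h1 := hcoer _ ((fin _ (hv (φ p.1))).comb hd (fin _ (hv (φ p.2))) 1 (-1)).1
    have h2 := hNsub _ _ (hv (φ p.1)) (hv (φ p.2))
    simp only [hN] at h2 ⊢
    set j := qf d.r₀ m k (cJ d) (Profile.comb 1 (-1) (v (φ p.1)) (v (φ p.2)))
      (Profile.comb 1 (-1) (v (φ p.1)) (v (φ p.2)))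
    have h3 : 0 ≤ j := qf_cJ_nonneg hd
    have h4 : l * j ≤ |l| * j := mul_le_mul_of_nonneg_right (le_abs_self l) h3
    rw [one_div, inv_mul_eq_div, le_div_iff₀ hκ]
    linarith
  obtain ⟨w, hwF, hwlim⟩ := exists_limit_profile hd (fun n => fin _ (hv (φ n))) hcau
  have hw : d.MemCompletion core m k w := by
    refine hcore.mem_of_approx hd hwF fun e he => ?_
    obtain ⟨n, hn⟩ := (hwlim.eventually_lt_const he).exists
    exact ⟨_, hv (φ n), hn⟩
  have hdec : ∀ n, w = Profile.comb 1 (-1) (v (φ n)) (Profile.comb (-1) 1 w (v (φ n))) := fun n =>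
    Profile.ext' (fun r => by simp [Profile.comb]) (fun r => by simp [Profile.comb])
      (fun r => by simp [Profile.comb])
  have hneg : ∀ n, Profile.comb (-1) 1 w (v (φ n))
      = Profile.comb (-1) 0 (Profile.comb 1 (-1) w (v (φ n))) (Profile.comb 1 (-1) w (v (φ n))) :=
    fun n => Profile.ext' (fun r => by simp [Profile.comb, add_comm])
      (fun r => by simp [Profile.comb, add_comm]) (fun r => by simp [Profile.comb, add_comm])
  have hdF : ∀ n, FiniteNorm d m k (Profile.comb 1 (-1) w (v (φ n))) := fun n =>
    (hwF.comb hd (fin _ (hv (φ n))) 1 (-1)).1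
  -- Writing `w = v_n - (v_n - w)` gives `N w ≤ 2 N(v_n) + 2 N(v_n - w)`, and both terms tend to
  -- zero.
  have hNw : N w ≤ 0 := by
    obtain ⟨K, hK0, hK⟩ := exists_gf_le hd hc' τ m k
    have hlim : Tendsto (fun n => 2 * N (v (φ n)) + 2 * (K * nrm d m k (Profile.comb 1 (-1) w (v (φ n)))))
        atTop (𝓝 0) := by
      simpa using (hNφ.const_mul 2).add ((hwlim.const_mul K).const_mul 2)
    refine ge_of_tendsto hlim (Eventually.of_forall fun n => ?_)
    have h1 := hNsub _ _ (hv (φ n)) (hcore.mem_comb hd hw (hv (φ n)) (-1) 1)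
    rw [← hdec n, hneg n, hNgf _ ((hdF n).comb hd (hdF n) (-1) 0).1, gf_scale hd hc' (hdF n)] at h1
    have h2 := (le_abs_self _).trans (hK _ (hdF n))
    linarith
  -- As `v_n = w - (w - v_n)` and `J(v_n) = 1`, the parallelogram identity for `J` gives `1 ≤ 2 J(w)
  -- + 2 J(w - v_n)`, whose last term is below `1/2` for suitable `n`.
  have hjw : 0 < qf d.r₀ m k (cJ d) w w := by
    obtain ⟨K, hK0, hK⟩ := exists_qf_le hd hJ m k
    have hlim : Tendsto (fun n => K * nrm d m k (Profile.comb 1 (-1) w (v (φ n)))) atTop (𝓝 0) := by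
      simpa using hwlim.const_mul K
    obtain ⟨n, hn⟩ := (hlim.eventually_lt_const (show (0 : ℝ) < 1 / 4 by norm_num)).exists
    have h1 := (le_abs_self _).trans (hK _ (hdF n))
    have e : v (φ n) = Profile.comb 1 (-1) w (Profile.comb 1 (-1) w (v (φ n))) :=
      Profile.ext' (fun r => by simp [Profile.comb]) (fun r => by simp [Profile.comb])
        (fun r => by simp [Profile.comb])
    have h2 := gf_parallelogram (τ := 0) hd hJ hwF (hdF n)
    rw [← e, gf_zero, gf_zero, gf_zero, gf_zero, hvj] at h2
    have h3 := qf_cJ_nonneg (m := m) (k := k)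
      (u := Profile.comb 1 1 w (Profile.comb 1 (-1) w (v (φ n)))) hd
    linarith
  set j := qf d.r₀ m k (cJ d) w w with hj
  have hs : (1 / √j) ^ 2 = 1 / j := by rw [div_pow, one_pow, Real.sq_sqrt hjw.le]
  refine ⟨Profile.comb (1 / √j) 0 w w, hcore.mem_comb hd hw hw _ _, ?_, fun v hv => ?_⟩
  · rw [jscale w hwF, hs, ← hj]; field_simp
  · rw [gf_scale hd hc hwF, hs]
    have h1 := hN0 v hv
    simp only [hN] at h1 hNw
    have h2 : 1 / j * gf d m k c τ w w ≤ l := by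
      rw [one_div, inv_mul_eq_div, div_le_iff₀ hjw]; linarith
    have h3 := mul_le_mul_of_nonneg_right h2 (qf_cJ_nonneg (m := m) (k := k) (u := v) hd)
    linarith

end Minimizer

end ZPinch

/-! ### One-dimensional regularity and the lemma of du Bois-Reymond. -/

namespace ZPinch

section OneDim

variable {R : ℝ}

lemma ae_vol_of_forall {P : ℝ → Prop} (hR : 0 < R)
    (h : ∀ a ∈ Ioo 0 R, ∀ᵐ r : ℝ, r ∈ Icc a R → P r) : ∀ᵐ r ∂(vol R), P r := by
  rw [ae_restrict_iff' measurableSet_Ioo]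
  have hmem : ∀ n : ℕ, R / (n + 2) ∈ Ioo 0 R := fun n => by
    refine ⟨by positivity, ?_⟩
    rw [div_lt_iff₀ (by positivity)]
    nlinarith [show (0 : ℝ) ≤ n from n.cast_nonneg]
  filter_upwards [ae_all_iff.2 fun n => h _ (hmem n)] with r hr hr'
  obtain ⟨n, hn⟩ := exists_nat_gt (R / r)
  refine hr n ⟨?_, hr'.2.le⟩
  have h0 := hr'.1
  rw [div_lt_iff₀ h0] at hn
  rw [div_le_iff₀ (by positivity)]
  nlinarith

/-- Functions integrable on every `(a, R)`, `0 < a < R`. -/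
def LI (R : ℝ) (f : ℝ → ℝ) : Prop := ∀ a ∈ Ioo 0 R, IntervalIntegrable f volume a R

lemma Icc_subset_Ioc_of_mem {a : ℝ} (ha : a ∈ Ioo 0 R) : uIcc a R ⊆ Ioc 0 R := by
  rw [uIcc_of_le ha.2.le]
  exact fun x hx => ⟨ha.1.trans_le hx.1, hx.2⟩

namespace LI

variable {f g : ℝ → ℝ}

lemma of_continuousOn (hf : ContinuousOn f (Ioc 0 R)) : LI R f := fun _ ha =>
  (hf.mono (Icc_subset_Ioc_of_mem ha)).intervalIntegrable

lemma add (hf : LI R f) (hg : LI R g) : LI R (fun r => f r + g r) := fun a ha =>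
  (hf a ha).add (hg a ha)

lemma continuousOn_mul (hg : ContinuousOn g (Ioc 0 R)) (hf : LI R f) : LI R (fun r => g r * f r) :=
  fun a ha => (hf a ha).continuousOn_mul (hg.mono (Icc_subset_Ioc_of_mem ha))

lemma of_deriv (hf : LAC R f) : LI R (deriv f) := fun _ ha =>
  hf.intervalIntegrable_deriv ha.1 ha.2.le le_rfl

lemma lac_integral (hf : LI R f) : LAC R (fun r => ∫ x in r..R, f x) := by
  intro a ha
  have h := ((hf a ha).absolutelyContinuousOnInterval_intervalIntegral
    (c := R) right_mem_uIcc)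
  have h2 : LAC R (fun r => (-1) * ∫ x in R..r, f x) := LAC.const_mul (-1) fun a ha =>
    (hf a ha).absolutelyContinuousOnInterval_intervalIntegral (c := R) right_mem_uIcc
  have e : (fun r => ∫ x in r..R, f x) = fun r => (-1) * ∫ x in R..r, f x := by
    ext r
    rw [intervalIntegral.integral_symm, neg_one_mul]
  rw [e]
  exact h2 a ha

lemma ae_deriv_integral (hR : 0 < R) (hf : LI R f) :
    ∀ᵐ r ∂(vol R), deriv (fun r => ∫ x in r..R, f x) r = -f r := by
  refine ae_vol_of_forall hR fun a ha => ?_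
  filter_upwards [(hf a ha).ae_hasDerivAt_integral] with r hr hr'
  have h := (hr (by rwa [uIcc_of_le ha.2.le]) R right_mem_uIcc).neg
  have e : (fun r => ∫ x in r..R, f x) = -fun r => ∫ x in R..r, f x := by
    ext r
    simp only [Pi.neg_apply]
    rw [intervalIntegral.integral_symm]
  rw [e]
  exact h.deriv

end LI

/-- A locally absolutely continuous function with continuous derivative is continuously
differentiable. -/
lemma LAC.hasDerivWithinAt {f X : ℝ → ℝ} (hf : LAC R f) (hX : ContinuousOn X (Ioc 0 R))
    (h : ∀ᵐ r ∂(vol R), deriv f r = X r) {r : ℝ} (hr : r ∈ Ioc 0 R) :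
    HasDerivWithinAt f (X r) (Ioc 0 R) r := by
  have hR : 0 < R := hr.1.trans_le hr.2
  set a := r / 2 with ha
  have ha0 : a ∈ Ioo 0 R := ⟨by linarith [hr.1], by linarith [hr.1, hr.2]⟩
  have hr' : r ∈ Icc a R := ⟨by linarith [hr.1], hr.2⟩
  have hXc : ContinuousOn X (Icc a R) := hX.mono fun x hx => ⟨ha0.1.trans_le hx.1, hx.2⟩
  have hi : HasDerivWithinAt (fun y => ∫ x in a..y, X x) (X r) (Icc a R) r := by
    have : Fact (r ∈ Icc a R) := ⟨hr'⟩
    refine intervalIntegral.integral_hasDerivWithinAt_right ?_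
      (hXc.stronglyMeasurableAtFilter_nhdsWithin measurableSet_Icc r) (hXc r hr')
    exact (hXc.mono (by rw [uIcc_of_le hr'.1]; exact Icc_subset_Icc_right hr'.2)).intervalIntegrable
  have he : ∀ y ∈ Icc a R, f y = f a + ∫ x in a..y, X x := by
    intro y hy
    rw [← integral_congr_vol h ha0.1.le hy.1 hy.2, hf.integral_deriv ha0.1 hy.1 hy.2]
    ring
  have h1 : HasDerivWithinAt f (X r) (Icc a R) r :=
    (hi.const_add (f a)).congr he (he r hr')
  refine h1.mono_of_mem_nhdsWithin ?_
  have : Ioi a ∩ Ioc 0 R ⊆ Icc a R := fun x hx => ⟨le_of_lt hx.1, hx.2.2⟩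
  exact mem_of_superset (inter_mem (mem_nhdsWithin_of_mem_nhds (Ioi_mem_nhds (by linarith [hr.1])))
    self_mem_nhdsWithin) this

lemma contDiffOn_succ_of_hasDerivWithinAt {f X : ℝ → ℝ} {n : ℕ}
    (h : ∀ r ∈ Ioc 0 R, HasDerivWithinAt f (X r) (Ioc 0 R) r) (hX : ContDiffOn ℝ n X (Ioc 0 R)) :
    ContDiffOn ℝ (n + 1 : ℕ) f (Ioc 0 R) := by
  have hu : UniqueDiffOn ℝ (Ioc 0 R) := uniqueDiffOn_Ioc 0 R
  rw [show ((n + 1 : ℕ) : WithTop ℕ∞) = (n : WithTop ℕ∞) + 1 by push_cast; rfl,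
    contDiffOn_succ_iff_derivWithin hu]
  refine ⟨fun r hr => (h r hr).differentiableWithinAt, by simp, ?_⟩
  exact hX.congr fun r hr => (h r hr).derivWithin (hu r hr)

/-- The lemma of du Bois-Reymond with a natural boundary condition. -/
lemma duBoisReymond (hR : 0 < R) {F G : ℝ → ℝ} {T : ℝ} (hF : LI R F) (hG : LI R G)
    (h : ∀ φ : ℝ → ℝ, ContDiff ℝ ∞ φ → (∃ a ∈ Ioo 0 R, ∀ r ≤ a, φ r = 0) →
      (∫ r in Ioo 0 R, (F r * deriv φ r + G r * φ r)) + T * φ R = 0) :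
    ∀ᵐ r ∂(vol R), F r = -T - ∫ x in r..R, G x := by
  set P : ℝ → ℝ := fun r => ∫ x in r..R, G x with hP
  have hPL : LAC R P := hG.lac_integral
  have hH : LI R (fun r => F r + (T + P r)) :=
    hF.add (LI.of_continuousOn (continuousOn_const.add hPL.continuousOn))
  have hloc : LocallyIntegrableOn (fun r => F r + (T + P r)) (Ioo 0 R) := by
    intro x hx
    have hx2 : x / 2 ∈ Ioo 0 R := ⟨by linarith [hx.1], by linarith [hx.1, hx.2]⟩
    refine ⟨Ioc (x / 2) R, mem_nhdsWithin_of_mem_nhds (Ioc_mem_nhds (by linarith [hx.1]) hx.2), ?_⟩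
    exact (intervalIntegrable_iff_integrableOn_Ioc_of_le hx2.2.le).1 (hH _ hx2)
  rw [ae_restrict_iff' measurableSet_Ioo]
  suffices hψ : ∀ ψ : ℝ → ℝ, ContDiff ℝ ∞ ψ → HasCompactSupport ψ → tsupport ψ ⊆ Ioo 0 R →
      ∫ x, ψ x • (F x + (T + P x)) = 0 by
    filter_upwards [isOpen_Ioo.ae_eq_zero_of_integral_contDiff_smul_eq_zero hloc hψ] with r hr hr'
    have := hr hr'
    simp only [hP] at this
    linarith
  intro ψ hψ hψc hψs
  obtain ⟨a, ha, haψ⟩ : ∃ a ∈ Ioo 0 R, ∀ r ≤ a, ψ r = 0 := by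
    rcases (tsupport ψ).eq_empty_or_nonempty with h0 | h0
    · exact ⟨R / 2, ⟨by linarith, by linarith⟩, fun r _ => image_eq_zero_of_notMem_tsupport (by simp [h0])⟩
    · obtain ⟨a, ha, hmin⟩ := hψc.exists_isLeast h0
      have ha' := hψs ha
      refine ⟨a / 2, ⟨by linarith [ha'.1], by linarith [ha'.1, ha'.2]⟩, fun r hr => ?_⟩
      refine image_eq_zero_of_notMem_tsupport fun hmem => ?_
      have := hmin hmem
      linarith [ha'.1]
  -- The primitive vanishes near the axis but not necessarily at `R`, so `T` enters. Hence `F + T +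
  -- ∫ G` is orthogonal to every `ψ`, not only to those of mean zero, and no free constant is left.
  set φ : ℝ → ℝ := fun r => ∫ x in (0 : ℝ)..r, ψ x with hφ
  have hφd : ∀ r, HasDerivAt φ (ψ r) r := fun r =>
    intervalIntegral.integral_hasDerivAt_right (hψ.continuous.intervalIntegrable _ _)
      (hψ.continuous.stronglyMeasurableAtFilter _ _) hψ.continuous.continuousAt
  have hφ' : deriv φ = ψ := funext fun r => (hφd r).deriv
  have hφs : ContDiff ℝ ∞ φ := by
    rw [contDiff_infty_iff_deriv, hφ']
    exact ⟨fun r => (hφd r).differentiableAt, hψ⟩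
  have hφ0 : ∀ r ≤ a, φ r = 0 := by
    intro r hr
    have : ∫ x in (0 : ℝ)..r, ψ x = ∫ x in (0 : ℝ)..r, (0 : ℝ) := by
      refine intervalIntegral.integral_congr fun x hx => haψ x ?_
      rw [uIcc, mem_Icc] at hx
      exact hx.2.trans (sup_le ha.1.le hr)
    rw [hφ]
    simp only [this, intervalIntegral.integral_zero]
  have h1 := h φ hφs ⟨a, ha, hφ0⟩
  rw [hφ'] at h1
  have toI : ∀ g : ℝ → ℝ, (∀ r ≤ a, g r = 0) → ∫ r in Ioo 0 R, g r = ∫ r in a..R, g r := by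
    intro g hg
    rw [intervalIntegral.integral_of_le ha.2.le, integral_Ioc_eq_integral_Ioo]
    refine (setIntegral_eq_of_subset_of_forall_sdiff_eq_zero measurableSet_Ioo
      (Ioo_subset_Ioo_left ha.1.le) fun x hx => hg x ?_)
    by_contra hlt
    exact hx.2 ⟨not_le.1 hlt, hx.1.2⟩
  rw [toI _ fun r hr => by rw [haψ r hr, hφ0 r hr]; ring] at h1
  have hall : ∫ x, ψ x • (F x + (T + P x)) = ∫ r in a..R, ψ r * (F r + (T + P r)) := by
    rw [← toI _ fun r hr => by rw [haψ r hr, zero_mul]]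
    refine (setIntegral_eq_integral_of_forall_compl_eq_zero fun x hx => ?_).symm
    rw [image_eq_zero_of_notMem_tsupport fun hm => hx (hψs hm), zero_smul]
  rw [hall]
  have hψc' : ∀ s : Set ℝ, ContinuousOn ψ s := fun s => hψ.continuous.continuousOn
  have iF : IntervalIntegrable (fun r => F r * ψ r) volume a R := (hF a ha).mul_continuousOn (hψc' _)
  have iG : IntervalIntegrable (fun r => G r * φ r) volume a R :=
    (hG a ha).mul_continuousOn hφs.continuous.continuousOn
  have hPc := hPL.continuousOn.mono (Icc_subset_Ioc_of_mem ha)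
  have iP : IntervalIntegrable (fun r => P r * ψ r) volume a R :=
    (hPc.mul (hψc' _)).intervalIntegrable
  have iT : IntervalIntegrable (fun r => T * ψ r) volume a R :=
    (hψ.continuous.const_mul T |>.intervalIntegrable _ _)
  have e1 : ∫ r in a..R, ψ r * (F r + (T + P r))
      = (∫ r in a..R, F r * ψ r) + ((∫ r in a..R, T * ψ r) + ∫ r in a..R, P r * ψ r) := by
    rw [← intervalIntegral.integral_add iT iP, ← intervalIntegral.integral_add iF (iT.add iP)]
    exact intervalIntegral.integral_congr fun r _ => by ring
  have e2 : ∫ r in a..R, T * ψ r = T * φ R := by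
    rw [intervalIntegral.integral_const_mul, intervalIntegral.integral_eq_sub_of_hasDerivAt
      (fun r _ => hφd r) (hψ.continuous.intervalIntegrable _ _), hφ0 a le_rfl, sub_zero]
  have e3 : ∫ r in a..R, P r * ψ r = ∫ r in a..R, G r * φ r := by
    have h3 := (hPL a ha).integral_mul_deriv_eq_deriv_mul
      (g := φ) ((LAC.of_contDiffOn (hφs.of_le (by exact_mod_cast le_top)).contDiffOn) a ha)
    rw [hφ', hφ0 a le_rfl] at h3
    have h4 : ∫ r in a..R, deriv P r * φ r = ∫ r in a..R, -(G r * φ r) := by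
      refine integral_congr_vol (R := R) ?_ ha.1.le ha.2.le le_rfl
      filter_upwards [hG.ae_deriv_integral hR] with r hr
      rw [hr]; ring
    have h5 : P R = 0 := by simp [hP]
    rw [h3, h4, h5, intervalIntegral.integral_neg]
    ring
  have e4 : ∫ r in a..R, (F r * ψ r + G r * φ r)
      = (∫ r in a..R, F r * ψ r) + ∫ r in a..R, G r * φ r := intervalIntegral.integral_add iF iG
  rw [e1, e2, e3]
  rw [e4] at h1
  linarith

end OneDim

end ZPinch

/-! ### Euler–Lagrange equations and regularity up to the interface. -/

namespace ZPinch

variable {d : Data} {m k : ℤ} {c : Fin 11 → ℝ → ℝ} {τ : ℝ}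

/-- The first variation vanishes at a zero of a nonnegative form. -/
lemma GoodCore.first_variation {core : Profile → Prop} (hcore : GoodCore d m k core)
    (hd : d.Admissible) (hc : Adm d.r₀ c) {w : Profile} (hw : d.MemCompletion core m k w)
    (h0 : gf d m k c τ w w = 0) (hmin : ∀ v, d.MemCompletion core m k v → 0 ≤ gf d m k c τ v v)
    {v : Profile} (hv : d.MemCompletion core m k v) : gf d m k c τ w v = 0 := by
  set B := gf d m k c τ w v with hB
  set V := gf d m k c τ v v with hV
  have hV0 : 0 ≤ V := hmin v hv
  -- The step `-B / (V + 1)` replaces the optimal `-B / V`, so that `V = 0` needs no separate case;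
  -- the form then equals `-B² (V + 2) / (V + 1)²`.
  have h := hmin _ (hcore.mem_comb hd hw hv 1 (-B / (V + 1)))
  rw [gf_comb hd hc (hcore.finiteNorm hd hw) (hcore.finiteNorm hd hv), h0, ← hB, ← hV] at h
  have e : 1 ^ 2 * 0 + 2 * 1 * (-B / (V + 1)) * B + (-B / (V + 1)) ^ 2 * V
      = -(B ^ 2 * (V + 2) / (V + 1) ^ 2) := by field_simp; ring
  rw [e] at h
  have h2 : B ^ 2 * (V + 2) / (V + 1) ^ 2 ≤ 0 := by linarith
  by_contra hne
  have : 0 < B ^ 2 * (V + 2) / (V + 1) ^ 2 := by positivity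
  linarith

/-- The square of the azimuthal field. -/
noncomputable def Data.Bsq (d : Data) (r : ℝ) : ℝ := d.B r ^ 2

/-- Conjugate momentum of `ξ`; `v` stands for the derivative of `w`. -/
noncomputable def flux1 (d : Data) (m k : ℤ) (a b : ℝ) (w v : Profile) (r : ℝ) : ℝ :=
  a * (4 / 3 * (r * v.ξ r) - 2 / 3 * (w.ξ r + m * w.ζ r - k * (r * w.η r)))
    + (b + d.γ * d.p r) * (r * v.ξ r + w.ξ r + m * w.ζ r - k * (r * w.η r))
    - d.Bsq r * (k * (r * w.η r) + w.ξ r - r * v.ξ r)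

/-- Conjugate momentum of `η`. -/
noncomputable def flux2 (k : ℤ) (a : ℝ) (w v : Profile) (r : ℝ) : ℝ :=
  a * (r * (v.η r + k * w.ξ r))

/-- Conjugate momentum of `ζ`. -/
noncomputable def flux3 (m : ℤ) (a : ℝ) (w v : Profile) (r : ℝ) : ℝ :=
  a * (r * v.ζ r - w.ζ r - m * w.ξ r)

/-- Force dual to `ξ`. -/
noncomputable def src1 (d : Data) (m k : ℤ) (a b l : ℝ) (w v : Profile) (r : ℝ) : ℝ :=
  a * (4 / 3 * ((w.ξ r + m * w.ζ r) / r) - 2 / 3 * (v.ξ r - k * w.η r)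
      + m * (-v.ζ r + (w.ζ r + m * w.ξ r) / r) + k * (r * (v.η r + k * w.ξ r)))
    + (b + d.γ * d.p r) * (v.ξ r + (w.ξ r + m * w.ζ r) / r - k * w.η r)
    + (2 * d.dp r + m ^ 2 * d.Bsq r / r) * w.ξ r
    + d.Bsq r * (k * w.η r + w.ξ r / r - v.ξ r) - l * (d.rho r * (r * w.ξ r))

/-- Force dual to `η`. -/
noncomputable def src2 (d : Data) (m k : ℤ) (a b l : ℝ) (w v : Profile) (r : ℝ) : ℝ :=
  a * (k * (4 / 3 * (k * (r * w.η r)) + 2 / 3 * (r * v.ξ r + w.ξ r + m * w.ζ r))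
      + m * (m * w.η r / r - k * w.ζ r))
    - k * (b + d.γ * d.p r) * (r * v.ξ r + w.ξ r + m * w.ζ r - k * (r * w.η r))
    + m ^ 2 * d.Bsq r / r * w.η r + k * d.Bsq r * (k * (r * w.η r) + w.ξ r - r * v.ξ r)
    - l * (d.rho r * (r * w.η r))

/-- Force dual to `ζ`. -/
noncomputable def src3 (d : Data) (m k : ℤ) (a b l : ℝ) (w v : Profile) (r : ℝ) : ℝ :=
  a * (m * (4 / 3 * ((w.ξ r + m * w.ζ r) / r) - 2 / 3 * (v.ξ r - k * w.η r))
      + (-v.ζ r + (w.ζ r + m * w.ξ r) / r) - k * (m * w.η r - k * (r * w.ζ r)))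
    + m * (b + d.γ * d.p r) * (v.ξ r + (w.ξ r + m * w.ζ r) / r - k * w.η r)
    - l * (d.rho r * (r * w.ζ r))

/-- The profile of the derivatives. -/
noncomputable def Profile.D (w : Profile) : Profile := ⟨deriv w.ξ, deriv w.η, deriv w.ζ⟩

/-- The coefficients of the second variation. -/
noncomputable def cE (d : Data) (m : ℤ) (s l : ℝ) : Fin 11 → ℝ → ℝ :=
  fun i r => (cI d m i r + s * cD d.ε d.δ i r) + (-l) * cJ d i r

lemma Adm.cE (hd : d.Admissible) (m : ℤ) (s l : ℝ) : Adm d.r₀ (cE d m s l) :=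
  ((Adm.cI hd m).add_smul (Adm.cD d hd.ε_pos.le hd.δ_pos.le) s).add_smul (Adm.cJ hd) (-l)

/-- This identity determines the formulas for fluxes and sources: the flux is the coefficient of
`φ'` and the source that of `φ`, so that the Euler–Lagrange equations read `flux' = src`. -/
lemma cE_sum (s l : ℝ) (w φ : Profile) {r : ℝ} (hr : r ≠ 0) :
    ∑ i, cE d m s l i r * (ell m k w r i * ell m k φ r i)
      = (flux1 d m k (s * d.ε) (s * d.δ) w w.D r * deriv φ.ξ r
          + src1 d m k (s * d.ε) (s * d.δ) l w w.D r * φ.ξ r)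
        + (flux2 k (s * d.ε) w w.D r * deriv φ.η r
          + src2 d m k (s * d.ε) (s * d.δ) l w w.D r * φ.η r)
        + (flux3 m (s * d.ε) w w.D r * deriv φ.ζ r
          + src3 d m k (s * d.ε) (s * d.δ) l w w.D r * φ.ζ r) := by
  simp only [Fin.sum_univ_succ, Fin.sum_univ_zero, cE]
  simp [cI, cD, cJ, ell, flux1, flux2, flux3, src1, src2, src3, Profile.D, Data.Bsq]
  field_simp
  ring

section Regularity

variable {R : ℝ} {f g : ℝ → ℝ}

lemma Bsq_contDiffOn (hd : d.Admissible) : ContDiffOn ℝ 1 d.Bsq (Ioc 0 d.r₀) := hd.contDiffOn_B_sq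

lemma ContDiffOn.div_id {n : WithTop ℕ∞} (hf : ContDiffOn ℝ n f (Ioc 0 R)) :
    ContDiffOn ℝ n (fun r => f r / r) (Ioc 0 R) :=
  hf.div contDiffOn_id fun _ hr => hr.1.ne'

lemma ContinuousOn.div_id (hf : ContinuousOn f (Ioc 0 R)) :
    ContinuousOn (fun r => f r / r) (Ioc 0 R) :=
  hf.div continuousOn_id fun _ hr => hr.1.ne'

end Regularity

lemma continuousOn_src (hd : d.Admissible) (a b l : ℝ) {w v : Profile}
    (h1 : ContinuousOn w.ξ (Ioc 0 d.r₀)) (h2 : ContinuousOn w.η (Ioc 0 d.r₀))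
    (h3 : ContinuousOn w.ζ (Ioc 0 d.r₀)) (g1 : ContinuousOn v.ξ (Ioc 0 d.r₀))
    (g2 : ContinuousOn v.η (Ioc 0 d.r₀)) (g3 : ContinuousOn v.ζ (Ioc 0 d.r₀)) :
    ContinuousOn (src1 d m k a b l w v) (Ioc 0 d.r₀) ∧
      ContinuousOn (src2 d m k a b l w v) (Ioc 0 d.r₀) ∧
      ContinuousOn (src3 d m k a b l w v) (Ioc 0 d.r₀) := by
  have hB := (Bsq_contDiffOn hd).continuousOn
  have hp := hd.contDiffOn_p.continuousOn
  have hdp := hd.continuousOn_dp.mono Ioc_subset_Icc_self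
  have hρ := hd.continuousOn_rho.mono Ioc_subset_Icc_self
  have e1 : ContinuousOn (fun r => (w.ξ r + m * w.ζ r) / r) (Ioc 0 d.r₀) :=
    ContinuousOn.div_id (by fun_prop)
  have e2 : ContinuousOn (fun r => (w.ζ r + m * w.ξ r) / r) (Ioc 0 d.r₀) :=
    ContinuousOn.div_id (by fun_prop)
  have e3 : ContinuousOn (fun r => m ^ 2 * d.Bsq r / r) (Ioc 0 d.r₀) :=
    ContinuousOn.div_id (by fun_prop)
  have e4 : ContinuousOn (fun r => w.ξ r / r) (Ioc 0 d.r₀) := ContinuousOn.div_id h1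
  have e5 : ContinuousOn (fun r => m * w.η r / r) (Ioc 0 d.r₀) := ContinuousOn.div_id (by fun_prop)
  unfold src1 src2 src3
  refine ⟨?_, ?_, ?_⟩ <;> fun_prop

end ZPinch

namespace ZPinch

variable {d : Data} {m k : ℤ}

lemma LI_src (hd : d.Admissible) (a b l : ℝ) {w : Profile} (h1 : LAC d.r₀ w.ξ) (h2 : LAC d.r₀ w.η)
    (h3 : LAC d.r₀ w.ζ) :
    LI d.r₀ (src1 d m k a b l w w.D) ∧ LI d.r₀ (src2 d m k a b l w w.D) ∧
      LI d.r₀ (src3 d m k a b l w w.D) := by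
  have hB := (Bsq_contDiffOn hd).continuousOn
  have hp := hd.contDiffOn_p.continuousOn
  have c0 : ContinuousOn (fun _ : ℝ => (0 : ℝ)) (Ioc 0 d.r₀) := continuousOn_const
  -- Zero in place of the derivatives isolates the continuous part of the sources; the remainder
  -- consists of continuous coefficients times locally integrable derivatives.
  obtain ⟨s1, s2, s3⟩ := continuousOn_src (m := m) (k := k) (v := ⟨fun _ => 0, fun _ => 0, fun _ => 0⟩)
    hd a b l h1.continuousOn h2.continuousOn h3.continuousOn c0 c0 c0
  have d1 := LI.of_deriv h1
  have d2 := LI.of_deriv h2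
  have d3 := LI.of_deriv h3
  refine ⟨?_, ?_, ?_⟩
  · have := (((LI.of_continuousOn s1).add (LI.continuousOn_mul
      (g := fun r => -2 / 3 * a + (b + d.γ * d.p r) - d.Bsq r) (by fun_prop) d1)).add
      (LI.continuousOn_mul (g := fun r => a * k * r) (by fun_prop) d2)).add
      (LI.continuousOn_mul (g := fun _ => -a * m) (by fun_prop) d3)
    convert this using 1
    ext r
    simp only [src1, Profile.D]
    ring
  · have := (LI.of_continuousOn s2).add (LI.continuousOn_mul
      (g := fun r => a * k * (2 / 3) * r - k * (b + d.γ * d.p r) * r - k * d.Bsq r * r)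
      (by fun_prop) d1)
    convert this using 1
    ext r
    simp only [src2, Profile.D]
    ring
  · have := ((LI.of_continuousOn s3).add (LI.continuousOn_mul
      (g := fun r => -2 / 3 * a * m + m * (b + d.γ * d.p r)) (by fun_prop) d1)).add
      (LI.continuousOn_mul (g := fun _ => -a) (by fun_prop) d3)
    convert this using 1
    ext r
    simp only [src3, Profile.D]
    ring

lemma LI_flux (hd : d.Admissible) (a b : ℝ) {w : Profile} (h1 : LAC d.r₀ w.ξ) (h2 : LAC d.r₀ w.η)
    (h3 : LAC d.r₀ w.ζ) :
    LI d.r₀ (flux1 d m k a b w w.D) ∧ LI d.r₀ (flux2 k a w w.D) ∧ LI d.r₀ (flux3 m a w w.D) := by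
  have hB := (Bsq_contDiffOn hd).continuousOn
  have hp := hd.contDiffOn_p.continuousOn
  have c1 := h1.continuousOn
  have c2 := h2.continuousOn
  have c3 := h3.continuousOn
  refine ⟨?_, ?_, ?_⟩
  · have := (LI.of_continuousOn (R := d.r₀) (f := flux1 d m k a b w ⟨fun _ => 0, fun _ => 0, fun _ => 0⟩)
      (by unfold flux1; fun_prop)).add (LI.continuousOn_mul
      (g := fun r => (4 / 3 * a + (b + d.γ * d.p r) + d.Bsq r) * r) (by fun_prop) (LI.of_deriv h1))
    convert this using 1
    ext r
    simp only [flux1, Profile.D]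
    ring
  · have := (LI.of_continuousOn (R := d.r₀) (f := flux2 k a w ⟨fun _ => 0, fun _ => 0, fun _ => 0⟩)
      (by unfold flux2; fun_prop)).add (LI.continuousOn_mul
      (g := fun r => a * r) (by fun_prop) (LI.of_deriv h2))
    convert this using 1
    ext r
    simp only [flux2, Profile.D]
    ring
  · have := (LI.of_continuousOn (R := d.r₀) (f := flux3 m a w ⟨fun _ => 0, fun _ => 0, fun _ => 0⟩)
      (by unfold flux3; fun_prop)).add (LI.continuousOn_mul
      (g := fun r => a * r) (by fun_prop) (LI.of_deriv h3))
    convert this using 1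
    ext r
    simp only [flux3, Profile.D]
    ring

/-- The Euler–Lagrange equations in integrated form, for almost every radius. -/
lemma GoodCore.ae_flux_eq {core : Profile → Prop} (hcore : GoodCore d m k core) (hd : d.Admissible)
    {s l τ : ℝ} {w : Profile} (hw : FiniteNorm d m k w)
    (hweak : ∀ φ, core φ → gf d m k (cE d m s l) τ w φ = 0) :
    (∀ᵐ r ∂(vol d.r₀), flux1 d m k (s * d.ε) (s * d.δ) w w.D r
      = -(τ * w.ξ d.r₀) - ∫ x in r..d.r₀, src1 d m k (s * d.ε) (s * d.δ) l w w.D x) ∧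
    (∀ᵐ r ∂(vol d.r₀), flux2 k (s * d.ε) w w.D r
      = -0 - ∫ x in r..d.r₀, src2 d m k (s * d.ε) (s * d.δ) l w w.D x) ∧
    (∀ᵐ r ∂(vol d.r₀), flux3 m (s * d.ε) w w.D r
      = -0 - ∫ x in r..d.r₀, src3 d m k (s * d.ε) (s * d.δ) l w w.D x) := by
  have hR := hd.r₀_pos
  obtain ⟨F1, F2, F3⟩ := LI_flux (m := m) (k := k) hd (s * d.ε) (s * d.δ) hw.lac_ξ hw.lac_η hw.lac_ζ
  obtain ⟨S1, S2, S3⟩ := LI_src (m := m) (k := k) hd (s * d.ε) (s * d.δ) l hw.lac_ξ hw.lac_η hw.lac_ζ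
  have z : ContDiff ℝ ∞ (fun _ : ℝ => (0 : ℝ)) := contDiff_const
  have hzero : ∀ (φ : ℝ → ℝ), (∃ a ∈ Ioo 0 d.r₀, ∀ r ≤ a, φ r = 0) → φ 0 = 0 := by
    rintro φ ⟨a, ha, h⟩
    exact h 0 ha.1.le
  refine ⟨?_, ?_, ?_⟩
  · refine duBoisReymond hR F1 S1 fun φ hφ h0 => ?_
    have h := hweak ⟨φ, fun _ => 0, fun _ => 0⟩ (hcore.test _ hφ z z (hzero φ h0) rfl rfl)
    rw [gf, qf] at h
    refine Eq.trans ?_ h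
    congr 1
    · refine setIntegral_congr_fun measurableSet_Ioo fun r hr => ?_
      simp only [cE_sum s l w _ hr.1.ne', deriv_const']
      ring
    · ring
  · refine duBoisReymond hR F2 S2 fun φ hφ h0 => ?_
    have h := hweak ⟨fun _ => 0, φ, fun _ => 0⟩ (hcore.test _ z hφ z rfl (hzero φ h0) rfl)
    rw [gf, qf] at h
    refine Eq.trans ?_ h
    congr 1
    · refine setIntegral_congr_fun measurableSet_Ioo fun r hr => ?_
      simp only [cE_sum s l w _ hr.1.ne', deriv_const']
      ring
    · ring
  · refine duBoisReymond hR F3 S3 fun φ hφ h0 => ?_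
    have h := hweak ⟨fun _ => 0, fun _ => 0, φ⟩ (hcore.test _ z z hφ rfl rfl (hzero φ h0))
    rw [gf, qf] at h
    refine Eq.trans ?_ h
    congr 1
    · refine setIntegral_congr_fun measurableSet_Ioo fun r hr => ?_
      simp only [cE_sum s l w _ hr.1.ne', deriv_const']
      ring
    · ring

/-- A profile with classical derivative `X` which solves the Euler–Lagrange system. -/
structure ELSystem (d : Data) (m k : ℤ) (s l τ : ℝ) (w X : Profile) : Prop where
  dξ : ∀ r ∈ Ioc 0 d.r₀, HasDerivWithinAt w.ξ (X.ξ r) (Ioc 0 d.r₀) r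
  dη : ∀ r ∈ Ioc 0 d.r₀, HasDerivWithinAt w.η (X.η r) (Ioc 0 d.r₀) r
  dζ : ∀ r ∈ Ioc 0 d.r₀, HasDerivWithinAt w.ζ (X.ζ r) (Ioc 0 d.r₀) r
  cξ : ContDiffOn ℝ 1 X.ξ (Ioc 0 d.r₀)
  cη : ContDiffOn ℝ 1 X.η (Ioc 0 d.r₀)
  cζ : ContDiffOn ℝ 1 X.ζ (Ioc 0 d.r₀)
  eq1 : ∀ r ∈ Ioc 0 d.r₀, HasDerivWithinAt (flux1 d m k (s * d.ε) (s * d.δ) w X)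
    (src1 d m k (s * d.ε) (s * d.δ) l w X r) (Ioc 0 d.r₀) r
  eq2 : ∀ r ∈ Ioc 0 d.r₀, HasDerivWithinAt (flux2 k (s * d.ε) w X)
    (src2 d m k (s * d.ε) (s * d.δ) l w X r) (Ioc 0 d.r₀) r
  eq3 : ∀ r ∈ Ioc 0 d.r₀, HasDerivWithinAt (flux3 m (s * d.ε) w X)
    (src3 d m k (s * d.ε) (s * d.δ) l w X r) (Ioc 0 d.r₀) r
  bc1 : flux1 d m k (s * d.ε) (s * d.δ) w X d.r₀ = -(τ * w.ξ d.r₀)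
  bc2 : flux2 k (s * d.ε) w X d.r₀ = 0
  bc3 : flux3 m (s * d.ε) w X d.r₀ = 0

set_option maxHeartbeats 1000000 in
/-- Regularity of weak solutions up to the interface. -/
theorem GoodCore.exists_ELSystem {core : Profile → Prop} (hcore : GoodCore d m k core)
    (hd : d.Admissible) {s l τ : ℝ} (hs : 0 < s) {w : Profile} (hw : FiniteNorm d m k w)
    (hweak : ∀ φ, core φ → gf d m k (cE d m s l) τ w φ = 0) :
    ∃ X, ELSystem d m k s l τ w X := by
  have hR := hd.r₀_pos
  have hγ := hd.γ_pos
  have hε := hd.ε_pos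
  have hδ := hd.δ_pos
  obtain ⟨A1, A2, A3⟩ := hcore.ae_flux_eq hd hw hweak
  obtain ⟨S1, S2, S3⟩ := LI_src (m := m) (k := k) hd (s * d.ε) (s * d.δ) l hw.lac_ξ hw.lac_η hw.lac_ζ
  set a := s * d.ε with ha
  set b := s * d.δ with hb
  have ha0 : 0 < a := by positivity
  have hb0 : 0 < b := by positivity
  have l1 := hw.lac_ξ
  have l2 := hw.lac_η
  have l3 := hw.lac_ζ
  set Φ₁ : ℝ → ℝ := fun r => -(τ * w.ξ d.r₀) - ∫ x in r..d.r₀, src1 d m k a b l w w.D x with hΦ₁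
  set Φ₂ : ℝ → ℝ := fun r => -0 - ∫ x in r..d.r₀, src2 d m k a b l w w.D x with hΦ₂
  set Φ₃ : ℝ → ℝ := fun r => -0 - ∫ x in r..d.r₀, src3 d m k a b l w w.D x with hΦ₃
  have Lc : ∀ x : ℝ, LAC d.r₀ fun _ => x := fun x => LAC.of_contDiffOn contDiffOn_const
  have L1 : LAC d.r₀ Φ₁ := (Lc _).sub S1.lac_integral
  have L2 : LAC d.r₀ Φ₂ := (Lc _).sub S2.lac_integral
  have L3 : LAC d.r₀ Φ₃ := (Lc _).sub S3.lac_integral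
  -- In `flux1` the derivative `ξ'` has the coefficient `r q`, while `η'` and `ζ'` have the purely
  -- viscous coefficient `a r` in their fluxes. All are positive on `(0, r₀]`, interface included,
  -- so the flux equations can be solved for the derivatives; the solution is `X`.
  set q : ℝ → ℝ := fun r => 4 / 3 * a + (b + d.γ * d.p r) + d.Bsq r with hq
  have hq0 : ∀ r ∈ Ioc 0 d.r₀, 0 < q r := fun r hr => by
    have h1 := hd.p_nonneg r (Ioc_subset_Icc_self hr)
    have h2 : 0 ≤ d.Bsq r := sq_nonneg _
    simp only [hq]; positivity
  set X : Profile := ⟨fun r => (Φ₁ r + d.Bsq r * (k * (r * w.η r) + w.ξ r)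
      + a * (2 / 3 * (w.ξ r + m * w.ζ r - k * (r * w.η r)))
      - (b + d.γ * d.p r) * (w.ξ r + m * w.ζ r - k * (r * w.η r))) / q r / r,
    fun r => Φ₂ r / a / r - k * w.ξ r,
    fun r => (Φ₃ r / a + (w.ζ r + m * w.ξ r)) / r⟩ with hX
  have fl1 : ∀ r ∈ Ioc 0 d.r₀, flux1 d m k a b w X r = Φ₁ r := fun r hr => by
    have := (hq0 r hr).ne'
    have hr0 := hr.1.ne'
    have e : r * X.ξ r * q r = Φ₁ r + d.Bsq r * (k * (r * w.η r) + w.ξ r)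
      + a * (2 / 3 * (w.ξ r + m * w.ζ r - k * (r * w.η r)))
      - (b + d.γ * d.p r) * (w.ξ r + m * w.ζ r - k * (r * w.η r)) := by
      simp only [hX]; field_simp
    simp only [flux1]
    simp only [hq] at e
    linarith
  have fl2 : ∀ r ∈ Ioc 0 d.r₀, flux2 k a w X r = Φ₂ r := fun r hr => by
    have hr0 := hr.1.ne'
    simp only [flux2, hX]; field_simp; ring
  have fl3 : ∀ r ∈ Ioc 0 d.r₀, flux3 m a w X r = Φ₃ r := fun r hr => by
    have hr0 := hr.1.ne'
    simp only [flux3, hX]; field_simp; ring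
  have ae1 : ∀ᵐ r ∂(vol d.r₀), deriv w.ξ r = X.ξ r := by
    filter_upwards [A1, ae_restrict_mem measurableSet_Ioo] with r h1 hr
    have hr' := Ioo_subset_Ioc_self hr
    have h2 := (fl1 r hr').trans h1.symm
    simp only [flux1, Profile.D] at h2
    have h3 : r * q r * (X.ξ r - deriv w.ξ r) = 0 := by simp only [hq]; linarith
    have h4 : r * q r ≠ 0 := mul_ne_zero hr.1.ne' (hq0 r hr').ne'
    have := (mul_eq_zero.1 h3).resolve_left h4
    linarith
  have ae2 : ∀ᵐ r ∂(vol d.r₀), deriv w.η r = X.η r := by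
    filter_upwards [A2, ae_restrict_mem measurableSet_Ioo] with r h1 hr
    have h2 := (fl2 r (Ioo_subset_Ioc_self hr)).trans h1.symm
    simp only [flux2, Profile.D] at h2
    have h3 : a * r * (X.η r - deriv w.η r) = 0 := by linarith
    have := (mul_eq_zero.1 h3).resolve_left (mul_ne_zero ha0.ne' hr.1.ne')
    linarith
  have ae3 : ∀ᵐ r ∂(vol d.r₀), deriv w.ζ r = X.ζ r := by
    filter_upwards [A3, ae_restrict_mem measurableSet_Ioo] with r h1 hr
    have h2 := (fl3 r (Ioo_subset_Ioc_self hr)).trans h1.symm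
    simp only [flux3, Profile.D] at h2
    have h3 : a * r * (X.ζ r - deriv w.ζ r) = 0 := by linarith
    have := (mul_eq_zero.1 h3).resolve_left (mul_ne_zero ha0.ne' hr.1.ne')
    linarith
  have hB := Bsq_contDiffOn hd
  have hp := hd.contDiffOn_p
  -- Bootstrap, run twice. For `n = 0`, continuity of the primitives `Φ` makes `X` continuous, so
  -- `w` is `C¹` and the sources are continuous. Then `Φ` is `C¹`, and `n = 1` gives `X ∈ C¹`, that
  -- is `w ∈ C²`.
  have smooth : ∀ n : WithTop ℕ∞, n ≤ 1 → ContDiffOn ℝ n w.ξ (Ioc 0 d.r₀) →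
      ContDiffOn ℝ n w.η (Ioc 0 d.r₀) → ContDiffOn ℝ n w.ζ (Ioc 0 d.r₀) →
      ContDiffOn ℝ n Φ₁ (Ioc 0 d.r₀) → ContDiffOn ℝ n Φ₂ (Ioc 0 d.r₀) →
      ContDiffOn ℝ n Φ₃ (Ioc 0 d.r₀) → ContDiffOn ℝ n X.ξ (Ioc 0 d.r₀) ∧
      ContDiffOn ℝ n X.η (Ioc 0 d.r₀) ∧ ContDiffOn ℝ n X.ζ (Ioc 0 d.r₀) := by
    intro n hn h1 h2 h3 p1 p2 p3
    have hB' := hB.of_le hn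
    have hp' := hp.of_le hn
    refine ⟨ContDiffOn.div_id (ContDiffOn.div ?_ ?_ fun r hr => (hq0 r hr).ne'), ?_,
      ContDiffOn.div_id ?_⟩
    · fun_prop
    · simp only [hq]; fun_prop
    · exact (ContDiffOn.div_id (p2.div_const a)).sub (contDiffOn_const.mul h1)
    · fun_prop
  have toC : ∀ {f : ℝ → ℝ}, ContinuousOn f (Ioc 0 d.r₀) → ContDiffOn ℝ 0 f (Ioc 0 d.r₀) :=
    fun hf => contDiffOn_zero.2 hf
  obtain ⟨x1, x2, x3⟩ := smooth 0 zero_le_one (toC l1.continuousOn) (toC l2.continuousOn)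
    (toC l3.continuousOn) (toC L1.continuousOn) (toC L2.continuousOn) (toC L3.continuousOn)
  have dξ := fun r (hr : r ∈ Ioc 0 d.r₀) => l1.hasDerivWithinAt x1.continuousOn ae1 hr
  have dη := fun r (hr : r ∈ Ioc 0 d.r₀) => l2.hasDerivWithinAt x2.continuousOn ae2 hr
  have dζ := fun r (hr : r ∈ Ioc 0 d.r₀) => l3.hasDerivWithinAt x3.continuousOn ae3 hr
  have C1 : ∀ {f g : ℝ → ℝ}, (∀ r ∈ Ioc 0 d.r₀, HasDerivWithinAt f (g r) (Ioc 0 d.r₀) r) →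
      ContinuousOn g (Ioc 0 d.r₀) → ContDiffOn ℝ 1 f (Ioc 0 d.r₀) := fun h hg => by
    simpa using contDiffOn_succ_of_hasDerivWithinAt (n := 0) h (by simpa using toC hg)
  obtain ⟨s1, s2, s3⟩ := continuousOn_src (m := m) (k := k) hd a b l l1.continuousOn l2.continuousOn
    l3.continuousOn x1.continuousOn x2.continuousOn x3.continuousOn
  have dsub : ∀ (T : ℝ) (g : ℝ → ℝ), LI d.r₀ g → ∀ᵐ r ∂(vol d.r₀),
      deriv (fun r => T - ∫ x in r..d.r₀, g x) r = g r := fun T g hg => by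
    filter_upwards [hg.ae_deriv_integral hR, hg.lac_integral.ae_differentiableAt] with r h1 h2
    rw [(h2.hasDerivAt.const_sub T).deriv, h1, neg_neg]
  have dΦ₁ : ∀ r ∈ Ioc 0 d.r₀, HasDerivWithinAt Φ₁ (src1 d m k a b l w X r) (Ioc 0 d.r₀) r := by
    refine fun r hr => L1.hasDerivWithinAt s1 ?_ hr
    filter_upwards [dsub (-(τ * w.ξ d.r₀)) _ S1, ae1, ae2, ae3] with r h0 h1 h2 h3
    rw [hΦ₁, h0]
    simp only [src1, Profile.D, h1, h2, h3]
  have dΦ₂ : ∀ r ∈ Ioc 0 d.r₀, HasDerivWithinAt Φ₂ (src2 d m k a b l w X r) (Ioc 0 d.r₀) r := by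
    refine fun r hr => L2.hasDerivWithinAt s2 ?_ hr
    filter_upwards [dsub (-0) _ S2, ae1, ae2, ae3] with r h0 h1 h2 h3
    rw [hΦ₂, h0]
    simp only [src2, Profile.D, h1]
  have dΦ₃ : ∀ r ∈ Ioc 0 d.r₀, HasDerivWithinAt Φ₃ (src3 d m k a b l w X r) (Ioc 0 d.r₀) r := by
    refine fun r hr => L3.hasDerivWithinAt s3 ?_ hr
    filter_upwards [dsub (-0) _ S3, ae1, ae2, ae3] with r h0 h1 h2 h3
    rw [hΦ₃, h0]
    simp only [src3, Profile.D, h1, h3]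
  obtain ⟨y1, y2, y3⟩ := smooth 1 le_rfl (C1 dξ x1.continuousOn) (C1 dη x2.continuousOn)
    (C1 dζ x3.continuousOn) (C1 dΦ₁ s1) (C1 dΦ₂ s2) (C1 dΦ₃ s3)
  have hRm : d.r₀ ∈ Ioc 0 d.r₀ := ⟨hR, le_rfl⟩
  exact ⟨X, {
    dξ := dξ, dη := dη, dζ := dζ, cξ := y1, cη := y2, cζ := y3
    eq1 := fun r hr => (dΦ₁ r hr).congr fl1 (fl1 r hr)
    eq2 := fun r hr => (dΦ₂ r hr).congr fl2 (fl2 r hr)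
    eq3 := fun r hr => (dΦ₃ r hr).congr fl3 (fl3 r hr)
    bc1 := by rw [fl1 _ hRm, hΦ₁]; simp
    bc2 := by rw [fl2 _ hRm, hΦ₂]; simp
    bc3 := by rw [fl3 _ hRm, hΦ₃]; simp }⟩

end ZPinch

/-! ### From the Euler–Lagrange system to growing modes. -/

namespace ZPinch

variable {d : Data} {m k : ℤ} {s l τ : ℝ} {w X : Profile}

namespace ELSystem

section Classical

lemma hasDerivAt_of_Ioc {R : ℝ} {f : ℝ → ℝ} {f' r : ℝ} (h : HasDerivWithinAt f f' (Ioc 0 R) r)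
    (hr : r ∈ Ioo 0 R) : HasDerivAt f f' r := h.hasDerivAt (Ioc_mem_nhds hr.1 hr.2)

lemma hasDerivAt_of_contDiffOn {R : ℝ} {f : ℝ → ℝ} {r : ℝ} (h : ContDiffOn ℝ 1 f (Ioc 0 R))
    (hr : r ∈ Ioo 0 R) : HasDerivAt f (deriv f r) r :=
  ((h.contDiffAt (Ioc_mem_nhds hr.1 hr.2)).differentiableAt (by norm_num)).hasDerivAt

lemma deriv_id_mul {R : ℝ} {f g : ℝ → ℝ} (h : ∀ r ∈ Ioc 0 R, HasDerivWithinAt f (g r) (Ioc 0 R) r)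
    {r : ℝ} (hr : r ∈ Ioo 0 R) : deriv (fun y => y * f y) r = f r + r * g r := by
  have := (hasDerivAt_id' r).fun_mul (hasDerivAt_of_Ioc (h r (Ioo_subset_Ioc_self hr)) hr)
  rw [this.deriv]; ring

lemma deriv_eventuallyEq {R : ℝ} {f g : ℝ → ℝ} (h : ∀ r ∈ Ioc 0 R, HasDerivWithinAt f (g r) (Ioc 0 R) r)
    {r : ℝ} (hr : r ∈ Ioo 0 R) : deriv f =ᶠ[𝓝 r] g := by
  filter_upwards [Ioo_mem_nhds hr.1 hr.2] with x hx
  exact (hasDerivAt_of_Ioc (h x (Ioo_subset_Ioc_self hx)) hx).deriv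

variable (hX : ELSystem d m k s l τ w X) {r : ℝ} (hr : r ∈ Ioo 0 d.r₀)
include hX hr

/-- Up to the factor `r` this is `flux1' = src1`. The force balance for `(B²)'` is what matches
`2p'ξ` in the source with `r (B²/r²)' ξ` in the operator. -/
lemma row1 (hd : d.Admissible) : d.ideal1 m k w r + s * Data.visc1 d.ε d.δ m k w r = -l * (d.rho r * w.ξ r) := by
  have hr' := Ioo_subset_Ioc_self hr
  have hr0 : r ≠ 0 := hr.1.ne'
  have h1 := hasDerivAt_of_Ioc (hX.dξ r hr') hr
  have h2 := hasDerivAt_of_Ioc (hX.dη r hr') hr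
  have h3 := hasDerivAt_of_Ioc (hX.dζ r hr') hr
  have x1 := hasDerivAt_of_contDiffOn hX.cξ hr
  have hp := hd.hasDerivAt_p hr
  have hB : HasDerivAt d.Bsq (-2 * d.dp r - 2 * d.Bsq r / r) r := hd.hasDerivAt_B_sq hr
  have hid := hasDerivAt_id' r
  have e1 : HasDerivAt (flux1 d m k (s * d.ε) (s * d.δ) w X) _ r :=
    (((((hid.fun_mul x1).const_mul (4 / 3)).fun_sub
      (((h1.fun_add (h3.const_mul (m : ℝ))).fun_sub ((hid.fun_mul h2).const_mul (k : ℝ))).const_mul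
        (2 / 3))).const_mul (s * d.ε)).fun_add
    (((hp.const_mul d.γ).const_add (s * d.δ)).fun_mul
      ((((hid.fun_mul x1).fun_add h1).fun_add (h3.const_mul (m : ℝ))).fun_sub
        ((hid.fun_mul h2).const_mul (k : ℝ))))).fun_sub
    (hB.fun_mul ((((hid.fun_mul h2).const_mul (k : ℝ)).fun_add h1).fun_sub (hid.fun_mul x1)))
  have e := e1.unique (hasDerivAt_of_Ioc (hX.eq1 r hr') hr)
  have he : (fun x => (d.γ * d.p x + d.B x ^ 2) / x * deriv (fun y => y * w.ξ y) x) =ᶠ[𝓝 r]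
      fun x => (d.γ * d.p x + d.Bsq x) / x * (w.ξ x + x * X.ξ x) := by
    filter_upwards [Ioo_mem_nhds hr.1 hr.2] with x hx
    rw [deriv_id_mul hX.dξ hx]
    rfl
  have D1 := he.deriv_eq.trans ((((hp.const_mul d.γ).fun_add hB).fun_div hid hr0).fun_mul
    (h1.fun_add (hid.fun_mul x1))).deriv
  have D2 : deriv (fun x => d.B x ^ 2 / x ^ 2) r = _ :=
    (hB.fun_div (hid.fun_pow 2) (pow_ne_zero 2 hr0)).deriv
  have D3 : deriv (fun x => k * (d.γ * d.p x + d.B x ^ 2) * w.η x) r = _ :=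
    ((((hp.const_mul d.γ).fun_add hB).const_mul (k : ℝ)).fun_mul h2).deriv
  have D4 : deriv (fun x => m / x * (d.γ * d.p x) * w.ζ x) r = _ :=
    ((((hasDerivAt_const r (m : ℝ)).fun_div hid hr0).fun_mul (hp.const_mul d.γ)).fun_mul h3).deriv
  have V1 : deriv (deriv w.ξ) r = deriv X.ξ r := (deriv_eventuallyEq hX.dξ hr).deriv_eq
  have V2 : deriv (fun x => w.ξ x / x) r = _ := (h1.fun_div hid hr0).deriv
  have V3 : deriv (fun x => m / x * w.ζ x) r = _ :=
    (((hasDerivAt_const r (m : ℝ)).fun_div hid hr0).fun_mul h3).deriv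
  unfold Data.ideal1 Data.visc1
  rw [D1, D2, D3, D4, V1, V2, V3, h2.deriv]
  rw [show d.B r ^ 2 = d.Bsq r from rfl]
  rw [← sub_eq_zero] at e ⊢
  rw [← mul_right_inj' hr0, mul_zero]
  refine Eq.trans ?_ e
  simp only [src1, Nat.cast_ofNat, Nat.add_one_sub_one, pow_one]
  field_simp
  ring

lemma row2 : d.ideal2 m k w r + s * Data.visc2 d.ε d.δ m k w r = -l * (d.rho r * w.η r) := by
  have hr' := Ioo_subset_Ioc_self hr
  have hr0 : r ≠ 0 := hr.1.ne'
  have h1 := hasDerivAt_of_Ioc (hX.dξ r hr') hr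
  have h2 := hasDerivAt_of_Ioc (hX.dη r hr') hr
  have x2 := hasDerivAt_of_contDiffOn hX.cη hr
  have hid := hasDerivAt_id' r
  have e1 : HasDerivAt (flux2 k (s * d.ε) w X) _ r :=
    (hid.fun_mul (x2.fun_add (h1.const_mul (k : ℝ)))).const_mul (s * d.ε)
  have e := e1.unique (hasDerivAt_of_Ioc (hX.eq2 r hr') hr)
  have V1 : deriv (deriv w.η) r = deriv X.η r := (deriv_eventuallyEq hX.dη hr).deriv_eq
  unfold Data.ideal2 Data.visc2
  rw [V1, h2.deriv, h1.deriv, deriv_id_mul hX.dξ hr, show d.B r ^ 2 = d.Bsq r from rfl]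
  rw [← sub_eq_zero] at e ⊢
  rw [← mul_right_inj' hr0, mul_zero]
  refine Eq.trans ?_ e
  simp only [src2]
  field_simp
  ring

lemma row3 : d.ideal3 m k w r + s * Data.visc3 d.ε d.δ m k w r = -l * (d.rho r * w.ζ r) := by
  have hr' := Ioo_subset_Ioc_self hr
  have hr0 : r ≠ 0 := hr.1.ne'
  have h1 := hasDerivAt_of_Ioc (hX.dξ r hr') hr
  have h3 := hasDerivAt_of_Ioc (hX.dζ r hr') hr
  have x3 := hasDerivAt_of_contDiffOn hX.cζ hr
  have hid := hasDerivAt_id' r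
  have e1 : HasDerivAt (flux3 m (s * d.ε) w X) _ r :=
    (((hid.fun_mul x3).fun_sub h3).fun_sub (h1.const_mul (m : ℝ))).const_mul (s * d.ε)
  have e := e1.unique (hasDerivAt_of_Ioc (hX.eq3 r hr') hr)
  have V1 : deriv (deriv w.ζ) r = deriv X.ζ r := (deriv_eventuallyEq hX.dζ hr).deriv_eq
  have V2 : deriv (fun x => w.ζ x / x) r = _ := (h3.fun_div hid hr0).deriv
  unfold Data.ideal3 Data.visc3
  rw [V1, V2, h1.deriv, deriv_id_mul hX.dξ hr]
  rw [← sub_eq_zero] at e ⊢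
  rw [← mul_right_inj' hr0, mul_zero]
  refine Eq.trans ?_ e
  simp only [src3]
  field_simp
  ring

end Classical

end ELSystem

section Scale

variable (c : ℝ) (r : ℝ)

lemma ideal1_scale : d.ideal1 m k (w.scale c) r = c * d.ideal1 m k w r := by
  have e0 : (fun y => y * (w.scale c).ξ y) = fun y => c * (y * w.ξ y) := by
    ext y; simp only [Profile.scale]; ring
  have e1 : (fun x => (d.γ * d.p x + d.B x ^ 2) / x * deriv (fun y => y * (w.scale c).ξ y) x)
      = fun x => c * ((d.γ * d.p x + d.B x ^ 2) / x * deriv (fun y => y * w.ξ y) x) := by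
    ext x; rw [e0, deriv_const_mul_real]; ring
  have e2 : (fun x => k * (d.γ * d.p x + d.B x ^ 2) * (w.scale c).η x)
      = fun x => c * (k * (d.γ * d.p x + d.B x ^ 2) * w.η x) := by
    ext x; simp only [Profile.scale]; ring
  have e3 : (fun x => m / x * (d.γ * d.p x) * (w.scale c).ζ x)
      = fun x => c * (m / x * (d.γ * d.p x) * w.ζ x) := by
    ext x; simp only [Profile.scale]; ring
  unfold Data.ideal1
  rw [e1, e2, e3, deriv_const_mul_real, deriv_const_mul_real, deriv_const_mul_real]
  simp only [Profile.scale]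
  ring

lemma ideal2_scale : d.ideal2 m k (w.scale c) r = c * d.ideal2 m k w r := by
  have e0 : (fun y => y * (w.scale c).ξ y) = fun y => c * (y * w.ξ y) := by
    ext y; simp only [Profile.scale]; ring
  unfold Data.ideal2
  rw [e0, deriv_const_mul_real]
  simp only [Profile.scale]
  ring

lemma ideal3_scale : d.ideal3 m k (w.scale c) r = c * d.ideal3 m k w r := by
  have e0 : (fun y => y * (w.scale c).ξ y) = fun y => c * (y * w.ξ y) := by
    ext y; simp only [Profile.scale]; ring
  unfold Data.ideal3
  rw [e0, deriv_const_mul_real]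
  simp only [Profile.scale]
  ring

variable (a b : ℝ)

lemma deriv_scale_ξ : deriv (w.scale c).ξ = fun r => c * deriv w.ξ r :=
  funext fun r => deriv_const_mul_real c _ r

lemma deriv_scale_η : deriv (w.scale c).η = fun r => c * deriv w.η r :=
  funext fun r => deriv_const_mul_real c _ r

lemma deriv_scale_ζ : deriv (w.scale c).ζ = fun r => c * deriv w.ζ r :=
  funext fun r => deriv_const_mul_real c _ r

lemma visc1_scale : Data.visc1 a b m k (w.scale c) r = c * Data.visc1 a b m k w r := by
  have e1 : (fun x => (w.scale c).ξ x / x) = fun x => c * (w.ξ x / x) := by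
    ext x; simp only [Profile.scale]; ring
  have e2 : (fun x => m / x * (w.scale c).ζ x) = fun x => c * (m / x * w.ζ x) := by
    ext x; simp only [Profile.scale]; ring
  unfold Data.visc1
  rw [e1, e2, deriv_scale_ξ, deriv_scale_η, deriv_const_mul_real, deriv_const_mul_real,
    deriv_const_mul_real]
  simp only [Profile.scale]
  ring

lemma visc2_scale : Data.visc2 a b m k (w.scale c) r = c * Data.visc2 a b m k w r := by
  unfold Data.visc2
  rw [deriv_scale_ξ, deriv_scale_η, deriv_const_mul_real]
  simp only [Profile.scale]
  ring

lemma visc3_scale : Data.visc3 a b m k (w.scale c) r = c * Data.visc3 a b m k w r := by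
  have e1 : (fun x => (w.scale c).ζ x / x) = fun x => c * (w.ζ x / x) := by
    ext x; simp only [Profile.scale]; ring
  unfold Data.visc3
  rw [e1, deriv_scale_ξ, deriv_scale_ζ, deriv_const_mul_real, deriv_const_mul_real]
  simp only [Profile.scale]
  ring

lemma dt_scale (g : ℝ → ℝ) (hg : ∀ t, HasDerivAt g (s * g t) t) (t : ℝ) :
    Profile.dt (fun t => w.scale (g t)) t = w.scale (s * g t) :=
  Profile.ext' (fun r => ((hg t).mul_const (w.ξ r)).deriv) (fun r => ((hg t).mul_const (w.η r)).deriv)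
    (fun r => ((hg t).mul_const (w.ζ r)).deriv)

end Scale

lemma ELSystem.c2 (hX : ELSystem d m k s l τ w X) : d.C2Profile w :=
  ⟨by simpa using contDiffOn_succ_of_hasDerivWithinAt (n := 1) hX.dξ (by simpa using hX.cξ),
    by simpa using contDiffOn_succ_of_hasDerivWithinAt (n := 1) hX.dη (by simpa using hX.cη),
    by simpa using contDiffOn_succ_of_hasDerivWithinAt (n := 1) hX.dζ (by simpa using hX.cζ)⟩

lemma C2Profile_scale (h : d.C2Profile w) (c : ℝ) : d.C2Profile (w.scale c) :=
  ⟨contDiffOn_const.mul h.1, contDiffOn_const.mul h.2.1, contDiffOn_const.mul h.2.2⟩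

lemma dIn_const_mul (hd : d.Admissible) {f : ℝ → ℝ} {f' : ℝ}
    (h : HasDerivWithinAt f f' (Ioc 0 d.r₀) d.r₀) (c : ℝ) : d.dIn (fun r => c * f r) = c * f' :=
  (h.const_mul c).derivWithin (uniqueDiffOn_Ioc 0 d.r₀ _ ⟨hd.r₀_pos, le_rfl⟩)

/-- Solutions of the Euler–Lagrange system give exponentially growing modes. -/
theorem ELSystem.isModeSolution (hd : d.Admissible) (hX : ELSystem d m k s (-s ^ 2) τ w X)
    {Q : ℝ → ℝ} (hQ : ContDiffOn ℝ 2 Q (Icc d.r₀ d.R))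
    (hQe : ∀ r ∈ Ioo d.r₀ d.R,
      deriv (fun x => x / (m ^ 2 + k ^ 2 * x ^ 2) * deriv (fun y => y * Q y) x) r - Q r = 0)
    (hQw : Q d.R = 0) (hQn : m * d.Bhat d.r₀ * w.ξ d.r₀ = d.r₀ * Q d.r₀)
    (hτ : τ * w.ξ d.r₀ = d.Bhat d.r₀ * d.QthetaAtInterface m k Q * d.r₀) :
    d.IsModeSolution m k (fun t => w.scale (Real.exp (s * t))) (fun t r => Real.exp (s * t) * Q r) := by
  have hR := hd.r₀_pos
  have hexp : ∀ t, HasDerivAt (fun t => Real.exp (s * t)) (s * Real.exp (s * t)) t := fun t => by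
    have := ((hasDerivAt_id' t).const_mul s).exp
    rwa [mul_one, mul_comm] at this
  have hexp2 : ∀ t, HasDerivAt (fun t => s * Real.exp (s * t)) (s * (s * Real.exp (s * t))) t :=
    fun t => (hexp t).const_mul s
  have hdt : Profile.dt (fun t => w.scale (Real.exp (s * t)))
      = fun t => w.scale (s * Real.exp (s * t)) := funext fun t => dt_scale _ hexp t
  have hdtt : ∀ t, Profile.dt (fun t => w.scale (s * Real.exp (s * t))) t
      = w.scale (s * (s * Real.exp (s * t))) := fun t => dt_scale _ hexp2 t
  have hsm : ContDiff ℝ 2 (fun t : ℝ => Real.exp (s * t)) := by fun_prop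
  have hRm : d.r₀ ∈ Ioc 0 d.r₀ := ⟨hR, le_rfl⟩
  have i1 := fun c => dIn_const_mul hd (hX.dξ _ hRm) c
  have i2 := fun c => dIn_const_mul hd (hX.dη _ hRm) c
  have i3 := fun c => dIn_const_mul hd (hX.dζ _ hRm) c
  have b1 := hX.bc1
  have b2 := hX.bc2
  have b3 := hX.bc3
  have hBhat : d.Bhat d.r₀ = d.B d.r₀ := by rw [Data.Bhat]; field_simp
  refine ⟨fun t => C2Profile_scale hX.c2 _, fun t => ?_, fun t => contDiffOn_const.mul hQ,
    fun r hr => ⟨hsm.mul contDiff_const, hsm.mul contDiff_const, hsm.mul contDiff_const⟩,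
    fun t r hr => ?_, fun t r hr => ?_, fun t r hr => ?_, fun t r hr => ?_, fun t => ?_, fun t => ?_,
    fun t => ?_, fun t => ?_, fun t => ?_⟩
  · rw [hdt]; exact C2Profile_scale hX.c2 _
  -- The velocity is `s` and the acceleration `s²` times the displacement. The first supplies the
  -- factor `s` in the modified viscosities, the second matches the eigenvalue `-s²`.
  · rw [hdt, hdtt, ideal1_scale, visc1_scale]
    have := hX.row1 hr hd
    simp only [Profile.scale]
    linear_combination Real.exp (s * t) * this
  · rw [hdt, hdtt, ideal2_scale, visc2_scale]
    have := hX.row2 hr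
    simp only [Profile.scale]
    linear_combination Real.exp (s * t) * this
  · rw [hdt, hdtt, ideal3_scale, visc3_scale]
    have := hX.row3 hr
    simp only [Profile.scale]
    linear_combination Real.exp (s * t) * this
  · have e : (fun x => x / (m ^ 2 + k ^ 2 * x ^ 2) * deriv (fun y => y * (Real.exp (s * t) * Q y)) x)
        = fun x => Real.exp (s * t) *
          (x / (m ^ 2 + k ^ 2 * x ^ 2) * deriv (fun y => y * Q y) x) := by
      ext x
      rw [show (fun y => y * (Real.exp (s * t) * Q y)) = fun y => Real.exp (s * t) * (y * Q y) from
        funext fun y => by ring, deriv_const_mul_real]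
      ring
    rw [e, deriv_const_mul_real]
    linear_combination Real.exp (s * t) * hQe r hr
  · simp [hQw]
  · simp only [Profile.scale]
    linear_combination Real.exp (s * t) * hQn
  · have hQt : d.QthetaAtInterface m k (fun r => Real.exp (s * t) * Q r)
        = Real.exp (s * t) * d.QthetaAtInterface m k Q := by
      unfold Data.QthetaAtInterface
      rw [show (fun y => y * (Real.exp (s * t) * Q y)) = fun y => Real.exp (s * t) * (y * Q y) from
        funext fun y => by ring, derivWithin_const_mul_field]
      ring
    rw [hdt, hQt]
    simp only [Profile.scale, i1]
    -- Since `p(r₀) = 0`, the natural condition `flux1 = -τ ξ` is the normal stress balance, with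
    -- the vacuum stress expressed through `τ` by `hτ`.
    simp only [flux1, hd.p_r₀, Data.Bsq] at b1
    linear_combination (-Real.exp (s * t)) * b1 + Real.exp (s * t) * hτ
  · rw [hdt]
    simp only [Profile.scale, i3]
    simp only [flux3] at b3
    linear_combination (-Real.exp (s * t)) * b3
  · rw [hdt]
    simp only [Profile.scale, i2]
    simp only [flux2] at b2
    linear_combination (Real.exp (s * t)) * b2

end ZPinch

namespace ZPinch

/-! ### Minima of linear pencils -/

section Pencil

variable {P : Type*} {I D : P → ℝ} {L : ℝ → ℝ}

/-- `L s` is the minimum of `I + s D`, for every `s > 0`. -/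
structure IsPencilMin (I D : P → ℝ) (L : ℝ → ℝ) : Prop where
  le : ∀ s, 0 < s → ∀ u, L s ≤ I u + s * D u
  attained : ∀ s, 0 < s → ∃ u, L s = I u + s * D u

namespace IsPencilMin

variable (h : IsPencilMin I D L)
include h

/-- An infimum of affine functions of `s`. Concavity on the open half-line then gives local
Lipschitz continuity at no further cost. -/
lemma concaveOn : ConcaveOn ℝ (Ioi 0) L := by
  refine ⟨convex_Ioi 0, fun s hs t ht a b ha hb hab => ?_⟩
  obtain ⟨u, hu⟩ := h.attained (a • s + b • t) ((convex_Ioi (0 : ℝ)) hs ht ha hb hab)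
  rw [hu]
  simp only [smul_eq_mul]
  have h1 := mul_le_mul_of_nonneg_left (h.le s hs u) ha
  have h2 := mul_le_mul_of_nonneg_left (h.le t ht u) hb
  have h3 : I u = a * I u + b * I u := by rw [← add_mul, hab, one_mul]
  linarith

lemma locallyLipschitzOn : LocallyLipschitzOn (Ioi 0) L := h.concaveOn.locallyLipschitzOn isOpen_Ioi

lemma continuousOn : ContinuousOn L (Ioi 0) := h.locallyLipschitzOn.continuousOn

/-- The minimizer at the larger parameter is a competitor at the smaller one, and its energy there
is strictly lower by the dissipated amount. -/
lemma strictMonoOn (hpos : ∀ s, 0 < s → ∀ u, L s = I u + s * D u → 0 < D u) :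
    StrictMonoOn L (Ioi 0) := by
  intro s hs t ht hst
  obtain ⟨u, hu⟩ := h.attained t ht
  have h1 := h.le s hs u
  have h2 := mul_lt_mul_of_pos_right hst (hpos t ht u hu)
  linarith

lemma lower_bound {C c : ℝ} (hI : ∀ u, -C ≤ I u) (hD : ∀ u, c ≤ D u) {s : ℝ} (hs : 0 < s) :
    -C + s * c ≤ L s := by
  obtain ⟨u, hu⟩ := h.attained s hs
  rw [hu]
  exact add_le_add (hI u) (mul_le_mul_of_nonneg_left (hD u) hs.le)

end IsPencilMin

/-- The fixed point becomes a zero of the increasing function `s² + L s`; negativity of `L s` is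
then automatic. -/
lemma isFixedRate_iff {s : ℝ} : IsFixedRate L s ↔ 0 < s ∧ s ^ 2 + L s = 0 := by
  constructor
  · rintro ⟨h1, h2, h3⟩
    refine ⟨h1, ?_⟩
    conv_lhs => rw [h3]
    rw [Real.sq_sqrt (by linarith), ← h3]
    ring
  · rintro ⟨h1, h2⟩
    have h3 : -L s = s ^ 2 := by linarith
    refine ⟨h1, by nlinarith, ?_⟩
    rw [h3, Real.sqrt_sq h1.le]

lemma existsUnique_isFixedRate (hc : ContinuousOn L (Ioi 0)) (hm : StrictMonoOn L (Ioi 0)) {C : ℝ}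
    (hC : ∀ s, 0 < s → -C ≤ L s) (hneg : ∃ s, 0 < s ∧ L s < 0) : ∃! s, IsFixedRate L s := by
  obtain ⟨s₀, hs₀, hL⟩ := hneg
  have hf : StrictMonoOn (fun s => s ^ 2 + L s) (Ioi 0) := fun s hs t ht hst =>
    add_lt_add (pow_lt_pow_left₀ hst (le_of_lt hs) two_ne_zero) (hm hs ht hst)
  have hfc : ContinuousOn (fun s => s ^ 2 + L s) (Ioi 0) := (continuousOn_pow 2).add hc
  -- By monotonicity of `L` this choice gives `a² + L a ≤ -L s₀ / 4 + L s₀ < 0`.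
  set a := min s₀ (√(-L s₀) / 2) with ha
  have hq : 0 < √(-L s₀) := Real.sqrt_pos.2 (by linarith)
  have ha0 : 0 < a := lt_min hs₀ (by linarith)
  have hq2 : √(-L s₀) ^ 2 = -L s₀ := Real.sq_sqrt (by linarith)
  have hfa : a ^ 2 + L a < 0 := by
    have h1 : L a ≤ L s₀ := hm.monotoneOn ha0 hs₀ (min_le_left _ _)
    have h2 : a ≤ √(-L s₀) / 2 := min_le_right _ _
    nlinarith
  -- Now `b² > |C| ≥ -L b`, so the function is positive at `b`.
  set b := a + |C| + 1 with hb
  have hb0 : 0 < b := by positivity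
  have hfb : 0 < b ^ 2 + L b := by
    have h1 := hC b hb0
    have h2 := le_abs_self C
    have h3 := abs_nonneg C
    nlinarith
  have hab : a ≤ b := by rw [hb]; linarith [abs_nonneg C]
  obtain ⟨s, hs, hs0⟩ := intermediate_value_Icc hab
    (hfc.mono fun x hx => lt_of_lt_of_le ha0 hx.1) ⟨hfa.le, hfb.le⟩
  have hsp : 0 < s := lt_of_lt_of_le ha0 hs.1
  refine ⟨s, isFixedRate_iff.2 ⟨hsp, hs0⟩, fun t ht => ?_⟩
  obtain ⟨ht0, ht1⟩ := isFixedRate_iff.1 ht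
  exact hf.injOn ht0 hsp (ht1.trans hs0.symm)

end Pencil

/-! ### Profiles without dissipation -/

lemma integral_pos_of_pos_on {R a b : ℝ} {f : ℝ → ℝ} (hf : Integrable f (vol R))
    (h0 : ∀ r ∈ Ioo 0 R, 0 ≤ f r) (ha : 0 ≤ a) (hab : a < b) (hb : b ≤ R)
    (hpos : ∀ r ∈ Ioo a b, 0 < f r) : 0 < ∫ r in Ioo 0 R, f r := by
  have hae : 0 ≤ᵐ[volume.restrict (Ioo 0 R)] f :=
    (ae_restrict_mem measurableSet_Ioo).mono fun r hr => h0 r hr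
  rw [integral_pos_iff_support_of_nonneg_ae hae hf]
  have hsub : Ioo a b ⊆ Function.support f := fun r hr => (hpos r hr).ne'
  have hsub' : Ioo a b ⊆ Ioo 0 R := Ioo_subset_Ioo ha hb
  refine lt_of_lt_of_le ?_ (measure_mono hsub)
  rw [Measure.restrict_apply measurableSet_Ioo, inter_eq_left.2 hsub', Real.volume_Ioo]
  exact ENNReal.ofReal_pos.2 (by linarith)

variable {d : Data} {m k : ℤ} {u : Profile}

lemma cD_sum (a b r : ℝ) : ∑ i, cD a b i r * (ell m k u r i * ell m k u r i)
    = (a * (2 / 9 * (-2 * deriv u.ξ r + u.ξ r / r + m / r * u.ζ r - k * u.η r) ^ 2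
    + 2 / 9 * (deriv u.ξ r - 2 * u.ξ r / r - 2 * m / r * u.ζ r - k * u.η r) ^ 2
    + 2 / 9 * (deriv u.ξ r + u.ξ r / r + m / r * u.ζ r + 2 * k * u.η r) ^ 2
    + (-deriv u.ζ r + u.ζ r / r + m / r * u.ξ r) ^ 2
    + (deriv u.η r + k * u.ξ r) ^ 2
    + (m / r * u.η r - k * u.ζ r) ^ 2)
  + b * (deriv u.ξ r + u.ξ r / r + m / r * u.ζ r - k * u.η r) ^ 2) * r := by
  simp only [cD, ell, Fin.sum_univ_succ, Fin.sum_univ_zero]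
  simp
  ring

/-- All squares in `D` vanish. The third form minus the divergence is `3kη`, and the divergence
minus the first form is `3ξ'`. Vanishing of the divergence itself comes from the bulk viscosity,
since the first three forms add up to zero and describe only the trace-free part. -/
lemma strain_eq_zero (hd : d.Admissible) (hu : FiniteNorm d m k u)
    (h : qf d.r₀ m k (cD d.ε d.δ) u u = 0) : ∀ᵐ r ∂(vol d.r₀),
      k * u.η r = 0 ∧ u.ξ r + m * u.ζ r = 0 ∧ m * u.η r = k * r * u.ζ r ∧ deriv u.ξ r = 0 ∧
        r * deriv u.ζ r = u.ζ r + m * u.ξ r := by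
  have hε := hd.ε_pos
  have hδ := hd.δ_pos
  have hc := Adm.cD d hε.le hδ.le
  have h1 := (setIntegral_eq_zero_iff_of_nonneg_ae ?_ (hc.integrable hd hu hu)).1 h
  · filter_upwards [h1, ae_restrict_mem measurableSet_Ioo] with r hr hr'
    rw [cD_sum] at hr
    have hr0 : 0 < r := hr'.1
    generalize deriv u.ξ r = x', deriv u.η r = y', deriv u.ζ r = z', u.ξ r = x, u.η r = y,
      u.ζ r = z at hr
    simp only [Pi.zero_apply, mul_eq_zero, hr0.ne', or_false] at hr
    have hsq : ∀ t : ℝ, 0 ≤ d.ε * t ^ 2 ∧ 0 ≤ d.δ * t ^ 2 := fun t => ⟨by positivity, by positivity⟩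
    have key : ∀ t : ℝ, d.ε * t ^ 2 ≤ 0 → t = 0 := fun t ht => by
      have := hsq t
      have h2 : d.ε * t ^ 2 = 0 := le_antisymm ht this.1
      simpa [hε.ne'] using h2
    have key' : ∀ t : ℝ, d.δ * t ^ 2 ≤ 0 → t = 0 := fun t ht => by
      have := hsq t
      have h2 : d.δ * t ^ 2 = 0 := le_antisymm ht this.2
      simpa [hδ.ne'] using h2
    have p1 := hsq (-2 * x' + x / r + m / r * z - k * y)
    have p2 := hsq (x' - 2 * x / r - 2 * m / r * z - k * y)
    have p3 := hsq (x' + x / r + m / r * z + 2 * k * y)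
    have p4 := hsq (-z' + z / r + m / r * x)
    have p5 := hsq (y' + k * x)
    have p6 := hsq (m / r * y - k * z)
    have p7 := hsq (x' + x / r + m / r * z - k * y)
    have e1 := key (-2 * x' + x / r + m / r * z - k * y) (by linarith)
    have e3 := key (x' + x / r + m / r * z + 2 * k * y) (by linarith)
    have e4 := key (-z' + z / r + m / r * x) (by linarith)
    have e6 := key (m / r * y - k * z) (by linarith)
    have e7 := key' (x' + x / r + m / r * z - k * y) (by linarith)
    have f1 : k * y = 0 := by linarith
    have f2 : x' = 0 := by linarith
    refine ⟨f1, ?_, ?_, f2, ?_⟩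
    · have : x / r + m / r * z = 0 := by linarith
      field_simp at this
      linarith
    · field_simp at e6
      linarith
    · field_simp at e4
      linarith
  · filter_upwards [ae_restrict_mem measurableSet_Ioo] with r hr
    rw [cD_sum]
    have := hr.1
    simp only [Pi.zero_apply]
    positivity

lemma qf_cJ_eq_zero_of_ae (h : ∀ᵐ r ∂(vol d.r₀), u.ξ r = 0 ∧ u.η r = 0 ∧ u.ζ r = 0) :
    qf d.r₀ m k (cJ d) u u = 0 := by
  rw [qf]
  refine integral_eq_zero_of_ae ?_
  filter_upwards [h] with r hr
  rw [cJ_sum, hr.1, hr.2.1, hr.2.2]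
  simp

lemma eqOn_of_ae_eq_vol {R : ℝ} {f g : ℝ → ℝ} (hf : ContinuousOn f (Ioc 0 R)) (hg : ContinuousOn g (Ioc 0 R))
    (h : ∀ᵐ r ∂(vol R), f r = g r) : ∀ r ∈ Ioc 0 R, f r = g r := by
  have h1 : ∀ᵐ r ∂(volume.restrict (Ioc 0 R)), f r = g r := by
    rw [← restrict_Ioo_eq_restrict_Ioc]
    exact h
  have h2 := (Measure.eqOn_Ioc_of_ae_eq (μ := volume) h1 hf hg)
  exact h2

/-- A profile without dissipation vanishes, or is a translation and `|m| = 1`, `k = 0`. -/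
lemma rigid (hd : d.Admissible) (hmk : m ≠ 0 ∨ k ≠ 0) (hu : FiniteNorm d m k u)
    (h : qf d.r₀ m k (cD d.ε d.δ) u u = 0) (hJ : qf d.r₀ m k (cJ d) u u ≠ 0) :
    (|m| = 1 ∧ k = 0) ∧ u.ξ d.r₀ ≠ 0 ∧
      ∀ r ∈ Ioc 0 d.r₀, u.ξ r = u.ξ d.r₀ ∧ u.η r = 0 ∧ u.ζ r = -m * u.ξ d.r₀ := by
  have hR := hd.r₀_pos
  have hs := strain_eq_zero hd hu h
  have hpos : ∀ᵐ r ∂(vol d.r₀), 0 < r := (ae_restrict_mem measurableSet_Ioo).mono fun r hr => hr.1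
  -- If `k ≠ 0`, then `kη = 0` removes `η`, next `mη = k r ζ` removes `ζ`, and `ξ + mζ = 0` removes
  -- `ξ`, against `J ≠ 0`.
  have hk : k = 0 := by
    by_contra hk
    have hk' : (k : ℝ) ≠ 0 := by exact_mod_cast hk
    refine hJ (qf_cJ_eq_zero_of_ae ?_)
    filter_upwards [hs, hpos] with r h5 hr
    obtain ⟨h1, h2, h3, -, -⟩ := h5
    have e1 : u.η r = 0 := by simpa [hk'] using h1
    have e2 : u.ζ r = 0 := by
      rw [e1, mul_zero] at h3
      simpa [hk', hr.ne'] using h3.symm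
    rw [e2, mul_zero, add_zero] at h2
    exact ⟨h2, e1, e2⟩
  have hm : m ≠ 0 := by tauto
  have hm' : (m : ℝ) ≠ 0 := by exact_mod_cast hm
  have cξ := hu.lac_ξ.continuousOn
  have cη := hu.lac_η.continuousOn
  have cζ := hu.lac_ζ.continuousOn
  have g1 : ∀ r ∈ Ioc 0 d.r₀, u.ζ r = -(1 / m) * u.ξ r := by
    refine eqOn_of_ae_eq_vol cζ (continuousOn_const.mul cξ) ?_
    filter_upwards [hs] with r h5
    have h2 := h5.2.1
    field_simp
    linarith
  have g2 : ∀ r ∈ Ioc 0 d.r₀, u.η r = 0 := by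
    refine eqOn_of_ae_eq_vol cη continuousOn_const ?_
    filter_upwards [hs] with r h5
    have h3 := h5.2.2.1
    rw [hk] at h3
    simpa [hm'] using h3
  have hc : ∀ r ∈ Ioc 0 d.r₀, u.ξ r = u.ξ d.r₀ := by
    intro r hr
    have h1 := hu.lac_ξ.integral_deriv hr.1 hr.2 le_rfl
    have h2 : ∫ x in r..d.r₀, deriv u.ξ x = ∫ x in r..d.r₀, (0 : ℝ) :=
      integral_congr_vol (hs.mono fun x hx => hx.2.2.2.1) hr.1.le hr.2 le_rfl
    rw [h2] at h1
    simp at h1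
    linarith
  -- With `ξ' = 0` and `ζ = -ξ/m`, also `ζ' = 0`; the last strain equation becomes `ζ = -mξ`, and
  -- comparison with `ξ + mζ = 0` leaves `(m² - 1) ξ = 0`.
  have hm2 : ∀ᵐ r ∂(vol d.r₀), ((m : ℝ) ^ 2 - 1) * u.ξ r = 0 := by
    filter_upwards [hs, ae_restrict_mem measurableSet_Ioo] with r h7 hr
    obtain ⟨-, h2, -, h4, h5⟩ := h7
    have e : u.ζ =ᶠ[𝓝 r] fun r => -(1 / m) * u.ξ r := by
      filter_upwards [Ioo_mem_nhds hr.1 hr.2] with x hx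
      exact g1 x (Ioo_subset_Ioc_self hx)
    rw [e.deriv_eq, deriv_const_mul_real, h4] at h5
    have h6 : u.ζ r = -m * u.ξ r := by linarith
    rw [h6] at h2
    linarith
  have hξ0 : u.ξ d.r₀ ≠ 0 := by
    intro h0
    refine hJ (qf_cJ_eq_zero_of_ae ?_)
    filter_upwards [ae_restrict_mem measurableSet_Ioo] with r hr
    have hr' := Ioo_subset_Ioc_self hr
    refine ⟨(hc r hr').trans h0, g2 r hr', ?_⟩
    rw [g1 r hr', hc r hr', h0, mul_zero]
  have hcol : ∀ r ∈ Ioc 0 d.r₀, ((m : ℝ) ^ 2 - 1) * u.ξ r = 0 :=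
    eqOn_of_ae_eq_vol (continuousOn_const.mul cξ) continuousOn_const hm2
  have hm1 : (m : ℝ) ^ 2 = 1 := by
    have := hcol d.r₀ ⟨hR, le_rfl⟩
    have h3 := (mul_eq_zero.1 this).resolve_right hξ0
    linarith
  refine ⟨⟨?_, hk⟩, hξ0, fun r hr => ⟨hc r hr, g2 r hr, ?_⟩⟩
  · have h3 : m ^ 2 = 1 := by exact_mod_cast hm1
    rw [← sq_abs] at h3
    nlinarith [abs_nonneg m]
  · rw [g1 r hr, hc r hr]
    field_simp
    linear_combination hm1

end ZPinch

namespace ZPinch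

/-! ### Test profiles -/

lemma exists_bump {a b : ℝ} (hab : a < b) : ∃ χ : ℝ → ℝ, ContDiff ℝ ∞ χ ∧
    (∀ r, r ∉ Ioo a b → χ r = 0) ∧ ∀ r ∈ Ioo a b, 0 < χ r := by
  let f : ContDiffBump ((a + b) / 2) := ⟨(b - a) / 4, (b - a) / 2, by linarith, by linarith⟩
  have hball : Metric.ball ((a + b) / 2) f.rOut = Ioo a b := by
    rw [Real.ball_eq_Ioo]
    congr 1 <;> simp only [f] <;> ring
  refine ⟨f, f.contDiff, fun r hr => ?_, fun r hr => ?_⟩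
  · rw [← Function.notMem_support, f.support_eq, hball]
    exact hr
  · exact f.pos_of_mem_ball (hball ▸ hr)

/-- The end points `a` and `b` are included; there the derivative is read off from the side on which
the function vanishes. -/
lemma deriv_eq_zero_of_notMem {a b : ℝ} {χ : ℝ → ℝ} (h : ∀ r, r ∉ Ioo a b → χ r = 0)
    (hχ : ContDiff ℝ ∞ χ) {r : ℝ} (hr : r ∉ Ioo a b) : deriv χ r = 0 := by
  have h0 : χ r = 0 := h r hr
  have hd := (hχ.differentiable (by simp)) r
  rcases not_and_or.1 hr with h1 | h1
  · have h2 : HasDerivWithinAt χ 0 (Iic r) r := by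
      refine (hasDerivWithinAt_const r (Iic r) (0 : ℝ)).congr (fun x hx => h x fun hx' => ?_) h0
      exact h1 (hx'.1.trans_le hx)
    exact (uniqueDiffOn_Iic r r self_mem_Iic).eq_deriv _ hd.hasDerivAt.hasDerivWithinAt h2
  · have h2 : HasDerivWithinAt χ 0 (Ici r) r := by
      refine (hasDerivWithinAt_const r (Ici r) (0 : ℝ)).congr (fun x hx => h x fun hx' => ?_) h0
      exact h1 (lt_of_le_of_lt hx hx'.2)
    exact (uniqueDiffOn_Ici r r self_mem_Ici).eq_deriv _ hd.hasDerivAt.hasDerivWithinAt h2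

variable {d : Data} {m k : ℤ} {core : Profile → Prop}

lemma GoodCore.exists_J_ne_zero (hcore : GoodCore d m k core) (hd : d.Admissible) :
    ∃ v, d.MemCompletion core m k v ∧ qf d.r₀ m k (cJ d) v v ≠ 0 := by
  have hR := hd.r₀_pos
  obtain ⟨χ, hχ, h0, hp⟩ := exists_bump hR
  have hv : core ⟨χ, fun _ => 0, fun _ => 0⟩ := hcore.test _ hχ contDiff_const contDiff_const
    (h0 0 fun h => lt_irrefl _ h.1) rfl rfl
  refine ⟨_, hcore.mem_of_core hd hv, ne_of_gt ?_⟩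
  have hF := hcore.finite _ hv
  refine integral_pos_of_pos_on ((Adm.cJ hd).integrable hd hF hF) (fun r hr => ?_) le_rfl hR le_rfl
    fun r hr => ?_
  · rw [cJ_sum]
    have h1 := hd.rho_nonneg (Ioo_subset_Icc_self hr)
    have h2 := hr.1
    positivity
  · rw [cJ_sum]
    have h1 := hd.rho_pos (Ioo_subset_Ico_self hr)
    have h2 := hr.1
    have h3 := hp r hr
    positivity

/-- The plasma is unstable with respect to some profile that vanishes near the axis if `m = 0`. -/
lemma exists_neg_of_m_eq_zero (hd : d.Admissible) (hk : k ≠ 0) (hcore : GoodCore d 0 k core) :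
    ∃ v, d.MemCompletion core 0 k v ∧ qf d.r₀ 0 k (cI d 0) v v < 0 := by
  have hR := hd.r₀_pos
  have hγ := hd.γ_pos
  have hk' : (k : ℝ) ≠ 0 := by exact_mod_cast hk
  -- The constant `r₀ / (4γ)` gives `2γp ≤ -(r₀/2) p'`, which is below `-r p'` for `r > r₀/2`.
  obtain ⟨a, ha, hlt⟩ := hd.eventually_p_lt (e := d.r₀ / (4 * d.γ)) (by positivity)
  set a' := max a (d.r₀ / 2) with ha'
  have ha'R : a' < d.r₀ := max_lt ha.2 (by linarith)
  have ha'0 : 0 < a' := lt_max_of_lt_left ha.1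
  obtain ⟨χ, hχ, h0, hp⟩ := exists_bump ha'R
  have hχ' : ContDiff ℝ ∞ (deriv χ) := (contDiff_infty_iff_deriv.1 hχ).2
  -- The choice of `η` cancels the magnetic square `k r η + ξ - r ξ'`, and the divergence becomes
  -- `2χ`. The energy density is then `2 r χ² (2γp + r p')`, negative near `r₀`.
  set v : Profile := ⟨fun r => r * χ r, fun r => r * deriv χ r / k, fun _ => 0⟩ with hv
  have hvc : core v := hcore.test _ (contDiff_id.mul hχ) ((contDiff_id.mul hχ').div_const _)
    contDiff_const (by simp [hv]) (by simp [hv]) rfl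
  have hder : ∀ r, deriv v.ξ r = χ r + r * deriv χ r := fun r => by
    have := (hasDerivAt_id' r).fun_mul ((hχ.differentiable (by simp)) r).hasDerivAt
    rw [show v.ξ = fun r => r * χ r from rfl, this.deriv]
    ring
  have hF := hcore.finite _ hvc
  refine ⟨v, hcore.mem_of_core hd hvc, ?_⟩
  have hI := (Adm.cI hd 0).integrable hd hF hF
  have hval : ∀ r ∈ Ioo 0 d.r₀, ∑ i, cI d 0 i r * (ell 0 k v r i * ell 0 k v r i)
      = 2 * r * χ r ^ 2 * (2 * d.γ * d.p r + d.dp r * r) := fun r hr => by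
    have hr0 : r ≠ 0 := hr.1.ne'
    rw [cI_sum, hder]
    simp only [hv]
    push_cast
    field_simp
    ring
  have hneg : ∀ r ∈ Ioo a' d.r₀, 2 * d.γ * d.p r + d.dp r * r < 0 := fun r hr => by
    obtain ⟨h1, h2⟩ := hlt r ⟨(le_max_left _ _).trans_lt hr.1, hr.2⟩
    have h3 : d.r₀ / 2 < r := (le_max_right _ _).trans_lt hr.1
    have h4 := mul_le_mul_of_nonneg_left h2 (by positivity : 0 ≤ 2 * d.γ)
    have h5 : 2 * d.γ * (d.r₀ / (4 * d.γ) * -d.dp r) = d.r₀ / 2 * -d.dp r := by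
      field_simp
      ring
    nlinarith
  have key : 0 < ∫ r in Ioo 0 d.r₀, -∑ i, cI d 0 i r * (ell 0 k v r i * ell 0 k v r i) := by
    refine integral_pos_of_pos_on hI.neg (fun r hr => ?_) ha'0.le ha'R le_rfl fun r hr => ?_
    · rw [hval r hr]
      by_cases h : r ∈ Ioo a' d.r₀
      · have h1 := hneg r h
        have h2 : 0 ≤ 2 * r * χ r ^ 2 := by have := hr.1; positivity
        nlinarith
      · rw [h0 r h]
        simp
    · rw [hval r ⟨ha'0.trans hr.1, hr.2⟩]
      have h1 := hneg r hr
      have h2 : 0 < 2 * r * χ r ^ 2 := by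
        have := ha'0.trans hr.1
        have := hp r hr
        positivity
      nlinarith
  rw [integral_neg] at key
  rw [qf]
  linarith

/-- Under the local instability condition, the plasma is unstable with respect to interior
profiles for all large `|k|`. -/
lemma exists_neg_of_local (hd : d.Admissible) (hm : m ≠ 0)
    (hcore : ∀ k, GoodCore d m k core)
    (hloc : ∃ r ∈ Ioo 0 d.r₀, 2 * d.dp r + m ^ 2 * d.B r ^ 2 / r < 0) :
    ∃ K : ℕ, ∀ k : ℤ, (K : ℤ) ≤ |k| → ∃ v, d.MemCompletion core m k v ∧ v.ξ d.r₀ = 0 ∧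
      qf d.r₀ m k (cI d m) v v < 0 := by
  have hR := hd.r₀_pos
  have hm' : (m : ℝ) ≠ 0 := by exact_mod_cast hm
  have hm2 : 0 < (m : ℝ) ^ 2 := by positivity
  obtain ⟨x, hx, hlt⟩ := hloc
  set g : ℝ → ℝ := fun r => 2 * d.dp r + m ^ 2 * d.B r ^ 2 / r with hg
  have hBc : ContinuousOn (fun r => d.B r ^ 2) (Ioo 0 d.r₀) :=
    hd.continuousOn_B_sq.mono Ioo_subset_Ioc_self
  have hdpc : ContinuousOn d.dp (Ioo 0 d.r₀) := hd.continuousOn_dp.mono Ioo_subset_Icc_self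
  have hgc : ContinuousOn g (Ioo 0 d.r₀) :=
    (continuousOn_const.mul hdpc).add
      ((continuousOn_const.mul hBc).div continuousOn_id fun r hr => hr.1.ne')
  have hev : ∀ᶠ r in 𝓝 x, g r < 0 ∧ r ∈ Ioo 0 d.r₀ :=
    (((hgc x hx).continuousAt (Ioo_mem_nhds hx.1 hx.2)).eventually (Iio_mem_nhds hlt)).and
      (Ioo_mem_nhds hx.1 hx.2)
  obtain ⟨e, he, hball⟩ := Metric.eventually_nhds_iff_ball.1 hev
  rw [Real.ball_eq_Ioo] at hball
  set a := x - e / 2 with ha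
  set b := x + e / 2 with hb
  have hsub : ∀ r ∈ Icc a b, g r < 0 ∧ r ∈ Ioo 0 d.r₀ := fun r hr =>
    hball r ⟨by linarith [hr.1], by linarith [hr.2]⟩
  have hab : a < b := by rw [ha, hb]; linarith
  have ha0 : 0 < a := (hsub a ⟨le_rfl, hab.le⟩).2.1
  have hbR : b < d.r₀ := (hsub b ⟨hab.le, le_rfl⟩).2.2
  obtain ⟨χ, hχ, h0, hp⟩ := exists_bump hab
  have hχ' : ContDiff ℝ ∞ (deriv χ) := (contDiff_infty_iff_deriv.1 hχ).2
  have h0' : ∀ r, r ∉ Ioo a b → deriv χ r = 0 := fun r hr => deriv_eq_zero_of_notMem h0 hχ hr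
  set F : ℝ → ℝ := fun r => m ^ 2 * d.B r ^ 2 * r * deriv χ r ^ 2 with hF
  set G : ℝ → ℝ := fun r => -(g r * (r * χ r) ^ 2) with hG
  have hint : ∀ f : ℝ → ℝ, ContinuousOn f (Ioo 0 d.r₀) → (∀ r, r ∉ Ioo a b → f r = 0) →
      Integrable f (vol d.r₀) := fun f hf hf0 => by
    have h1 : IntegrableOn f (Icc a b) := (hf.mono fun r hr => (hsub r hr).2).integrableOn_Icc
    have h2 : Integrable f volume := by
      refine (integrableOn_iff_integrable_of_support_subset fun r hr => ?_).1 h1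
      by_contra hr'
      exact hr (hf0 r fun h => hr' (Ioo_subset_Icc_self h))
    exact h2.integrableOn
  have hcχ : Continuous χ := hχ.continuous
  have hcχ' : Continuous (deriv χ) := hχ'.continuous
  have hFi : Integrable F (vol d.r₀) := hint F
    (((continuousOn_const.mul hBc).mul continuousOn_id).mul (hcχ'.pow 2).continuousOn)
    fun r hr => by simp [hF, h0' r hr]
  have hGi : Integrable G (vol d.r₀) := hint G
    (hgc.mul ((continuous_id.mul hcχ).pow 2).continuousOn).neg
    fun r hr => by simp [hG, h0 r hr]
  have hGpos : 0 < ∫ r in Ioo 0 d.r₀, G r := by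
    refine integral_pos_of_pos_on hGi (fun r hr => ?_) ha0.le hab hbR.le fun r hr => ?_
    · by_cases h : r ∈ Ioo a b
      · have h1 := (hsub r (Ioo_subset_Icc_self h)).1
        simp only [hG]
        nlinarith [sq_nonneg (r * χ r)]
      · simp [hG, h0 r h]
    · have h1 := (hsub r (Ioo_subset_Icc_self hr)).1
      have h2 : 0 < (r * χ r) ^ 2 := by
        have := ha0.trans hr.1
        have := hp r hr
        positivity
      simp only [hG]
      nlinarith
  set A := ∫ r in Ioo 0 d.r₀, F r with hA
  set B := ∫ r in Ioo 0 d.r₀, G r with hB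
  obtain ⟨K, hK⟩ := exists_nat_gt (A / B)
  -- The maximum with `1` ensures `k ≠ 0` and `k² ≥ |k|`, hence `k² > A / B`.
  refine ⟨max K 1, fun k hk => ?_⟩
  have hkK : (max K 1 : ℕ) ≤ |(k : ℝ)| := by
    have : ((max K 1 : ℕ) : ℝ) ≤ ((|k| : ℤ) : ℝ) := by exact_mod_cast hk
    simpa using this
  have hk1 : 1 ≤ |(k : ℝ)| := le_trans (by exact_mod_cast le_max_right K 1) hkK
  have hkK' : (K : ℝ) ≤ |(k : ℝ)| := le_trans (by exact_mod_cast le_max_left K 1) hkK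
  have hk2 : A / B < (k : ℝ) ^ 2 := by
    rw [← sq_abs]
    nlinarith
  have hk2' : 0 < (k : ℝ) ^ 2 := by rw [← sq_abs]; positivity
  have hden : ∀ r : ℝ, (m : ℝ) ^ 2 + k ^ 2 * r ^ 2 ≠ 0 := fun r => by positivity
  -- For `ξ = rχ` this `η` minimizes the two magnetic squares pointwise, leaving `m² B² r χ'² · r² /
  -- (m² + k² r²) ≤ F / k²`; `ζ` is then chosen to make the divergence zero. For large `|k|` only
  -- the destabilizing term `-G` counts.
  set η : ℝ → ℝ := fun r => k * r ^ 3 * deriv χ r / (m ^ 2 + k ^ 2 * r ^ 2) with hη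
  set v : Profile := ⟨fun r => r * χ r, η,
    fun r => -(1 / m) * (2 * r * χ r + r ^ 2 * deriv χ r - k * r * η r)⟩ with hv
  have hηs : ContDiff ℝ ∞ η := ContDiff.div (by fun_prop) (by fun_prop) hden
  have hvc : core v := (hcore k).test _ (contDiff_id.mul hχ) hηs
    (by simp only [hv]; fun_prop) (by simp [hv]) (by simp [hv, hη]) (by simp [hv])
  have hder : ∀ r, deriv v.ξ r = χ r + r * deriv χ r := fun r => by
    have := (hasDerivAt_id' r).fun_mul ((hχ.differentiable (by simp)) r).hasDerivAt
    rw [show v.ξ = fun r => r * χ r from rfl, this.deriv]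
    ring
  have hFv := (hcore k).finite _ hvc
  refine ⟨v, (hcore k).mem_of_core hd hvc, ?_, ?_⟩
  · simp [hv, h0 d.r₀ fun h => lt_asymm hbR h.2]
  have hval : ∀ r ∈ Ioo 0 d.r₀, ∑ i, cI d m i r * (ell m k v r i * ell m k v r i)
      ≤ F r / k ^ 2 - G r := fun r hr => by
    have hr0 : 0 < r := hr.1
    have e1 : deriv v.ξ r + v.ξ r / r + m / r * v.ζ r - k * v.η r = 0 := by
      rw [hder]
      simp only [hv]
      field_simp
      ring
    have e2 : m ^ 2 * d.B r ^ 2 / r * v.η r ^ 2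
        + d.B r ^ 2 / r * (k * r * v.η r + v.ξ r - r * deriv v.ξ r) ^ 2
        = m ^ 2 * d.B r ^ 2 * r * deriv χ r ^ 2 * (r ^ 2 / (m ^ 2 + k ^ 2 * r ^ 2)) := by
      rw [hder]
      simp only [hv, hη]
      have := hden r
      field_simp
      ring
    have e3 : r ^ 2 / ((m : ℝ) ^ 2 + k ^ 2 * r ^ 2) ≤ 1 / k ^ 2 := by
      rw [div_le_div_iff₀ (by positivity) hk2']
      nlinarith
    have e4 := mul_le_mul_of_nonneg_left e3
      (by positivity : 0 ≤ m ^ 2 * d.B r ^ 2 * r * deriv χ r ^ 2)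
    rw [cI_sum, e1]
    have e5 : (2 * d.dp r + m ^ 2 * d.B r ^ 2 / r) * v.ξ r ^ 2 = -G r := by
      simp only [hG, hv, hg]
      ring
    have e6 : F r / k ^ 2 = m ^ 2 * d.B r ^ 2 * r * deriv χ r ^ 2 * (1 / k ^ 2) := by
      simp only [hF]
      ring
    rw [e5, e6]
    linarith
  have hFG : Integrable (fun r => F r / (k : ℝ) ^ 2 - G r) (vol d.r₀) := (hFi.div_const _).sub hGi
  calc qf d.r₀ m k (cI d m) v v ≤ ∫ r in Ioo 0 d.r₀, (F r / k ^ 2 - G r) :=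
        setIntegral_mono_on ((Adm.cI hd m).integrable hd hFv hFv)
          hFG measurableSet_Ioo hval
    _ = A / k ^ 2 - B := by
        rw [integral_sub (hFi.div_const _) hGi, integral_div]
    _ < 0 := by
        rw [div_lt_iff₀ hGpos] at hk2
        rw [sub_neg, div_lt_iff₀ hk2']
        linarith

end ZPinch

namespace ZPinch

/-! ### The vacuum field -/

section ODE

variable {a R : ℝ} {c e : ℝ → ℝ}

/-- Planar linear systems with vanishing diagonal have global solutions. -/
lemma exists_linear_system (haR : a ≤ R) (hc : ContinuousOn c (Icc a R))
    (he : ContinuousOn e (Icc a R)) :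
    ∃ q v : ℝ → ℝ, q R = 0 ∧ v R = -1 ∧
      (∀ r ∈ Icc a R, HasDerivWithinAt q (c r * v r) (Icc a R) r) ∧
      ∀ r ∈ Icc a R, HasDerivWithinAt v (e r * q r) (Icc a R) r := by
  obtain ⟨C₁, hC₁⟩ := isCompact_Icc.exists_bound_of_continuousOn hc
  obtain ⟨C₂, hC₂⟩ := isCompact_Icc.exists_bound_of_continuousOn he
  set M : ℝ := max (max C₁ C₂) 0 with hM
  have hM0 : 0 ≤ M := le_max_right _ _
  have hcM : ∀ r ∈ Icc a R, |c r| ≤ M := fun r hr =>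
    (hC₁ r hr).trans ((le_max_left _ _).trans (le_max_left _ _))
  have heM : ∀ r ∈ Icc a R, |e r| ≤ M := fun r hr =>
    (hC₂ r hr).trans ((le_max_right _ _).trans (le_max_left _ _))
  set N : ℝ := Real.exp (M * (R - a)) with hN
  have hN0 : 0 < N := Real.exp_pos _
  -- Truncation at height `N` bounds the right-hand side by `M N`, so a single application of
  -- Picard–Lindelöf covers the whole interval. That the truncation is inactive is shown afterwards.
  set cl : ℝ → ℝ := fun y => max (-N) (min N y) with hcl
  have cl_le : ∀ y, |cl y| ≤ N := fun y =>
    abs_le.2 ⟨le_max_left _ _, max_le (by linarith) (min_le_left _ _)⟩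
  have cl_abs : ∀ y, |cl y| ≤ |y| := fun y => by
    rw [abs_le]
    constructor
    · rcases le_total N y with h | h
      · exact (neg_nonpos.2 (abs_nonneg y)).trans ((hN0.le.trans (min_eq_left h).ge).trans
          (le_max_right _ _))
      · refine le_trans ?_ (le_max_right _ _)
        rw [min_eq_right h]
        exact neg_abs_le y
    · exact max_le (by linarith [abs_nonneg y]) ((min_le_right _ _).trans (le_abs_self y))
  have cl_lip : ∀ x y, |cl x - cl y| ≤ |x - y| := fun x y =>
    (((abs_max_sub_max_le_max (-N) (min N x) (-N) (min N y)).trans (by simp)).trans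
      (abs_min_sub_min_le_max N x N y)).trans (by simp)
  have cl_eq : ∀ y, |y| ≤ N → cl y = y := fun y hy => by
    rw [abs_le] at hy
    simp only [hcl]
    rw [min_eq_right hy.2, max_eq_right hy.1]
  let F : ℝ → ℝ × ℝ → ℝ × ℝ := fun t x => (c t * cl x.2, e t * cl x.1)
  have hPL : IsPicardLindelof F (⟨R, right_mem_Icc.2 haR⟩ : Icc a R) (0, -1)
      ⟨M * N * (R - a), mul_nonneg (by positivity) (by linarith)⟩ 0 ⟨M * N, by positivity⟩
      ⟨M, hM0⟩ := by
    refine ⟨fun t ht => ?_, fun x _ => ?_, fun t ht x _ => ?_, ?_⟩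
    · refine (LipschitzWith.of_dist_le_mul fun x y => ?_).lipschitzOnWith
      rw [Prod.dist_eq, Prod.dist_eq]
      simp only [Real.dist_eq, F, ← mul_sub, abs_mul]
      have h1 := mul_le_mul (hcM t ht) (cl_lip x.2 y.2) (abs_nonneg _) hM0
      have h2 := mul_le_mul (heM t ht) (cl_lip x.1 y.1) (abs_nonneg _) hM0
      exact max_le (h1.trans (mul_le_mul_of_nonneg_left (le_max_right _ _) hM0))
        (h2.trans (mul_le_mul_of_nonneg_left (le_max_left _ _) hM0))
    · exact (hc.mul continuousOn_const).prodMk (he.mul continuousOn_const)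
    · rw [Prod.norm_def]
      simp only [Real.norm_eq_abs, F, abs_mul]
      exact max_le (mul_le_mul (hcM t ht) (cl_le _) (abs_nonneg _) hM0)
        (mul_le_mul (heM t ht) (cl_le _) (abs_nonneg _) hM0)
    · have h1 : max (R - R) (R - a) = R - a := max_eq_right (by linarith)
      have h2 : M * N * max (R - R) (R - a) ≤ M * N * (R - a) - 0 := by rw [h1, sub_zero]
      exact h2
  obtain ⟨α, hα0, hα⟩ := hPL.exists_eq_forall_mem_Icc_hasDerivWithinAt₀
  have hq : ∀ r ∈ Icc a R, HasDerivWithinAt (fun t => (α t).1) (c r * cl (α r).2) (Icc a R) r :=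
    fun r hr => (hα r hr).fst
  have hv : ∀ r ∈ Icc a R, HasDerivWithinAt (fun t => (α t).2) (e r * cl (α r).1) (Icc a R) r :=
    fun r hr => (hα r hr).snd
  set q := fun t => (α t).1 with hqdef
  set v := fun t => (α t).2 with hvdef
  have hqR : q R = 0 := by
    have := congrArg Prod.fst hα0
    exact this
  have hvR : v R = -1 := by
    have := congrArg Prod.snd hα0
    exact this
  -- A Gronwall estimate backwards from `R`, where the data `(0, -1)` have norm one. It uses only
  -- `|cl y| ≤ |y|` and bounds the solution by exactly `N`.
  have hmono : MonotoneOn (fun r => Real.exp (2 * M * r) * (q r ^ 2 + v r ^ 2)) (Icc a R) := by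
    have hder : ∀ r ∈ Icc a R, HasDerivWithinAt
        (fun r => Real.exp (2 * M * r) * (q r ^ 2 + v r ^ 2))
        (Real.exp (2 * M * r) * (2 * M * (q r ^ 2 + v r ^ 2)
          + (2 * q r * (c r * cl (v r)) + 2 * v r * (e r * cl (q r))))) (Icc a R) r := by
      intro r hr
      have h1 := (((hasDerivAt_id' r).const_mul (2 * M)).exp).hasDerivWithinAt (s := Icc a R)
      have h2 := h1.fun_mul (((hq r hr).fun_pow 2).fun_add ((hv r hr).fun_pow 2))
      refine h2.congr_deriv ?_
      simp only [Nat.cast_ofNat, Nat.add_one_sub_one, pow_one]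
      ring
    refine monotoneOn_of_hasDerivWithinAt_nonneg (convex_Icc a R)
      (fun r hr => (hder r hr).continuousWithinAt)
      (fun r hr => (hder r (interior_subset hr)).mono interior_subset) fun r hr => ?_
    have hr' := interior_subset hr
    refine mul_nonneg (Real.exp_pos _).le ?_
    have h1 : |q r * (c r * cl (v r))| ≤ |q r| * (M * |v r|) := by
      rw [abs_mul, abs_mul]
      exact mul_le_mul_of_nonneg_left (mul_le_mul (hcM r hr') (cl_abs _) (abs_nonneg _) hM0)
        (abs_nonneg _)
    have h2 : |v r * (e r * cl (q r))| ≤ |v r| * (M * |q r|) := by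
      rw [abs_mul, abs_mul]
      exact mul_le_mul_of_nonneg_left (mul_le_mul (heM r hr') (cl_abs _) (abs_nonneg _) hM0)
        (abs_nonneg _)
    have h3 := (abs_le.1 h1).1
    have h4 := (abs_le.1 h2).1
    have h5 : 0 ≤ M * (|q r| - |v r|) ^ 2 := by positivity
    have h6 := sq_abs (q r)
    have h7 := sq_abs (v r)
    nlinarith
  have hbd : ∀ r ∈ Icc a R, q r ^ 2 + v r ^ 2 ≤ N ^ 2 := by
    intro r hr
    have h1 := hmono hr (right_mem_Icc.2 haR) hr.2
    simp only [hqR, hvR] at h1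
    have h2 : q r ^ 2 + v r ^ 2 ≤ Real.exp (2 * M * R - 2 * M * r) := by
      rw [Real.exp_sub, le_div_iff₀ (Real.exp_pos _)]
      linarith
    refine h2.trans ?_
    rw [hN, ← Real.exp_nat_mul]
    refine Real.exp_le_exp.2 ?_
    have := mul_le_mul_of_nonneg_left hr.1 hM0
    push_cast
    linarith
  have hqN : ∀ r ∈ Icc a R, |q r| ≤ N := fun r hr =>
    abs_le_of_sq_le_sq (by linarith [hbd r hr, sq_nonneg (v r)]) hN0.le
  have hvN : ∀ r ∈ Icc a R, |v r| ≤ N := fun r hr =>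
    abs_le_of_sq_le_sq (by linarith [hbd r hr, sq_nonneg (q r)]) hN0.le
  refine ⟨q, v, hqR, hvR, fun r hr => ?_, fun r hr => ?_⟩
  · have := hq r hr
    rwa [cl_eq _ (hvN r hr)] at this
  · have := hv r hr
    rwa [cl_eq _ (hqN r hr)] at this

/-- The fundamental vacuum solution: `q` is `r Q̂_r`, normalised at the interface, and `v` is its
conjugate momentum. -/
structure VacuumPair (a R : ℝ) (c : ℝ → ℝ) (q v : ℝ → ℝ) : Prop where
  dq : ∀ r ∈ Icc a R, HasDerivWithinAt q (c r * v r) (Icc a R) r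
  dv : ∀ r ∈ Icc a R, HasDerivWithinAt v (q r / r) (Icc a R) r
  q_R : q R = 0
  q_a : q a = 1
  v_R : v R ≠ 0
  v_a : v a ≤ 0

lemma exists_vacuumPair (ha : 0 < a) (haR : a < R) (hc : ContinuousOn c (Icc a R))
    (hc0 : ∀ r ∈ Icc a R, 0 < c r) : ∃ q v, VacuumPair a R c q v := by
  have hR := ha.trans haR
  have hinv : ContinuousOn (fun r : ℝ => 1 / r) (Icc a R) :=
    continuousOn_const.div continuousOn_id fun r hr => (ha.trans_le hr.1).ne'
  obtain ⟨q, v, hqR, hvR, hq, hv⟩ := exists_linear_system haR.le hc hinv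
  have hder : ∀ r ∈ Icc a R, HasDerivWithinAt (fun r => q r * v r)
      (c r * v r ^ 2 + q r ^ 2 / r) (Icc a R) r := fun r hr =>
    ((hq r hr).fun_mul (hv r hr)).congr_deriv (by ring)
  have hcont : ContinuousOn (fun r => q r * v r) (Icc a R) :=
    fun r hr => (hder r hr).continuousWithinAt
  have hmono : MonotoneOn (fun r => q r * v r) (Icc a R) := by
    refine monotoneOn_of_hasDerivWithinAt_nonneg (convex_Icc a R) hcont
      (fun r hr => (hder r (interior_subset hr)).mono interior_subset) fun r hr => ?_
    have hr' := interior_subset hr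
    have h1 := hc0 r hr'
    have h2 := ha.trans_le hr'.1
    positivity
  have hle : q a * v a ≤ 0 := by
    have := hmono (left_mem_Icc.2 haR.le) (right_mem_Icc.2 haR.le) haR.le
    simpa [hqR] using this
  -- If `q a = 0`, the monotone product `q v` vanishes at both ends, hence identically, whereas its
  -- derivative at `R` is `c R > 0`.
  have hqa : q a ≠ 0 := by
    intro h0
    have hz : ∀ r ∈ Icc a R, q r * v r = 0 := fun r hr => by
      have h1 := hmono (left_mem_Icc.2 haR.le) hr hr.1
      have h2 := hmono hr (right_mem_Icc.2 haR.le) hr.2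
      simp only [h0, hqR, zero_mul] at h1 h2
      exact le_antisymm h2 h1
    have hRm := right_mem_Icc.2 haR.le
    have h1 : HasDerivWithinAt (fun r => q r * v r) 0 (Icc a R) R :=
      (hasDerivWithinAt_const R (Icc a R) (0 : ℝ)).congr hz (hz R hRm)
    have h2 := (uniqueDiffOn_Icc haR R hRm).eq_deriv _ (hder R hRm) h1
    rw [hvR, hqR] at h2
    have h3 := hc0 R hRm
    norm_num at h2
    linarith
  refine ⟨fun r => q r / q a, fun r => v r / q a, fun r hr => ?_, fun r hr => ?_, ?_, ?_, ?_, ?_⟩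
  · exact ((hq r hr).div_const (q a)).congr_deriv (by ring)
  · exact ((hv r hr).div_const (q a)).congr_deriv (by ring)
  · simp [hqR]
  · exact div_self hqa
  · simp [hvR, hqa]
  · have h1 : v a / q a = q a * v a / q a ^ 2 := by field_simp
    rw [h1]
    exact div_nonpos_of_nonpos_of_nonneg hle (sq_nonneg _)

namespace VacuumPair

variable {q v : ℝ → ℝ} (h : VacuumPair a R c q v)
include h

lemma continuousOn_q : ContinuousOn q (Icc a R) := fun r hr => (h.dq r hr).continuousWithinAt

lemma contDiffOn_v (ha : 0 < a) (haR : a < R) : ContDiffOn ℝ 1 v (Icc a R) := by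
  have h1 : ContDiffOn ℝ (0 + 1) v (Icc a R) := by
    rw [contDiffOn_succ_iff_derivWithin (uniqueDiffOn_Icc haR)]
    refine ⟨fun r hr => (h.dv r hr).differentiableWithinAt, by simp, ?_⟩
    rw [contDiffOn_zero]
    refine (h.continuousOn_q.div continuousOn_id fun r hr => (ha.trans_le hr.1).ne').congr
      fun r hr => (h.dv r hr).derivWithin (uniqueDiffOn_Icc haR r hr)
  simpa using h1

lemma contDiffOn_q (ha : 0 < a) (haR : a < R) (hc : ContDiffOn ℝ 1 c (Icc a R)) :
    ContDiffOn ℝ 2 q (Icc a R) := by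
  have h1 : ContDiffOn ℝ (1 + 1) q (Icc a R) := by
    rw [contDiffOn_succ_iff_derivWithin (uniqueDiffOn_Icc haR)]
    refine ⟨fun r hr => (h.dq r hr).differentiableWithinAt, by simp, ?_⟩
    exact (hc.mul (h.contDiffOn_v ha haR)).congr
      fun r hr => (h.dq r hr).derivWithin (uniqueDiffOn_Icc haR r hr)
  norm_num at h1
  exact h1

/-- For `c = 1 / r` the logarithmic derivative at the interface is not `-1`. -/
lemma v_a_ne (ha : 0 < a) (haR : a < R) (hc : ∀ r ∈ Icc a R, c r = 1 / r) : v a ≠ -1 := by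
  intro hva
  -- For `c = 1/r` the sum satisfies `(q + v)' = (q + v)/r`, so `(q + v)/r` is constant. If `v a =
  -- -1`, the constant is zero, and `q R = 0` forces `v R = 0`.
  have hder : ∀ r ∈ Icc a R, HasDerivWithinAt (fun r => (q r + v r) / r) 0 (Icc a R) r := by
    intro r hr
    have hr0 : r ≠ 0 := (ha.trans_le hr.1).ne'
    refine (((h.dq r hr).fun_add (h.dv r hr)).fun_div (hasDerivAt_id' r).hasDerivWithinAt hr0).congr_deriv ?_
    rw [hc r hr]
    field_simp
    ring
  have hconst := constant_of_derivWithin_zero (f := fun r => (q r + v r) / r) (a := a) (b := R)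
    (fun r hr => (hder r hr).differentiableWithinAt)
    (fun r hr => (hder r (Ico_subset_Icc_self hr)).derivWithin
      (uniqueDiffOn_Icc haR r (Ico_subset_Icc_self hr))) R (right_mem_Icc.2 haR.le)
  simp only [h.q_R, h.q_a, hva] at hconst
  have hR := (ha.trans haR).ne'
  refine h.v_R ?_
  field_simp at hconst
  simpa [ha.ne'] using hconst

end VacuumPair

end ODE

end ZPinch

namespace ZPinch

variable {d : Data} {m k : ℤ} {q v Q : ℝ → ℝ}

/-- The vacuum part of the energy. -/
noncomputable def vacuumEnergy (d : Data) (m k : ℤ) (Q : ℝ → ℝ) : ℝ :=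
  ∫ r in Ioo d.r₀ d.R,
    (Q r ^ 2 + 1 / (m ^ 2 + k ^ 2 * r ^ 2) * deriv (fun x => x * Q x) r ^ 2) * r

/-- Coefficient of the vacuum equation. -/
noncomputable def vacCoeff (m k : ℤ) (r : ℝ) : ℝ := (m ^ 2 + k ^ 2 * r ^ 2) / r

lemma vacCoeff_contDiffOn (hd : d.Admissible) : ContDiffOn ℝ 1 (vacCoeff m k) (Icc d.r₀ d.R) := by
  unfold vacCoeff
  refine ContDiffOn.div (by fun_prop) contDiffOn_id fun r hr => (hd.r₀_pos.trans_le hr.1).ne'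

lemma vacDen_pos (hm : m ≠ 0) (r : ℝ) : 0 < (m : ℝ) ^ 2 + k ^ 2 * r ^ 2 := by
  have hm' : (m : ℝ) ≠ 0 := by exact_mod_cast hm
  positivity

lemma integrable_vacuumEnergy (hd : d.Admissible) (hm : m ≠ 0) (hQ : d.MemH1Vac Q) :
    IntegrableOn (fun r => (Q r ^ 2 + 1 / (m ^ 2 + k ^ 2 * r ^ 2) *
      deriv (fun x => x * Q x) r ^ 2) * r) (Ioo d.r₀ d.R) := by
  obtain ⟨hac, h1, h2⟩ := hQ
  have hR : 0 < d.R := hd.r₀_pos.trans hd.r₀_lt_R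
  have hm1 : (1 : ℝ) ≤ m ^ 2 := by
    have : (1 : ℤ) ≤ m ^ 2 := Int.one_le_abs (pow_ne_zero 2 hm) |>.trans_eq (abs_of_nonneg (sq_nonneg m))
    exact_mod_cast this
  have hdom : IntegrableOn (fun r => (3 * d.R) * Q r ^ 2 + (2 * d.R ^ 3) * deriv Q r ^ 2)
      (Ioo d.r₀ d.R) := (h1.integrable_sq.const_mul _).add (h2.integrable_sq.const_mul _)
  have hmeas : AEStronglyMeasurable (fun r => (Q r ^ 2 + 1 / (m ^ 2 + k ^ 2 * r ^ 2) *
      deriv (fun x => x * Q x) r ^ 2) * r) (volume.restrict (Ioo d.r₀ d.R)) := by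
    have a1 : Measurable (fun r : ℝ => 1 / ((m : ℝ) ^ 2 + k ^ 2 * r ^ 2)) := by fun_prop
    have a2 : Measurable (fun r => deriv (fun x => x * Q x) r ^ 2) := (measurable_deriv _).pow_const 2
    exact (((h1.aestronglyMeasurable.pow 2)).add (a1.mul a2).aestronglyMeasurable).mul
      measurable_id.aestronglyMeasurable
  refine hdom.mono' hmeas ?_
  have hdiff := ae_restrict_of_ae (s := Ioo d.r₀ d.R) hac.ae_differentiableAt
  filter_upwards [hdiff, ae_restrict_mem measurableSet_Ioo] with r hr hr'
  have hr0 : 0 < r := hd.r₀_pos.trans hr'.1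
  have hQr := hr (by rw [uIcc_of_le hd.r₀_lt_R.le]; exact Ioo_subset_Icc_self hr')
  have e : deriv (fun x => x * Q x) r = Q r + r * deriv Q r := by
    rw [((hasDerivAt_id' r).fun_mul hQr.hasDerivAt).deriv]
    ring
  have hpos := vacDen_pos (k := k) hm r
  have e1 : 1 / ((m : ℝ) ^ 2 + k ^ 2 * r ^ 2) ≤ 1 := by
    rw [div_le_one hpos]
    nlinarith [sq_nonneg ((k : ℝ) * r)]
  have e2 : (Q r + r * deriv Q r) ^ 2 ≤ 2 * Q r ^ 2 + 2 * (d.R ^ 2 * deriv Q r ^ 2) := by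
    have : (r * deriv Q r) ^ 2 ≤ d.R ^ 2 * deriv Q r ^ 2 := by
      rw [mul_pow]
      exact mul_le_mul_of_nonneg_right (pow_le_pow_left₀ hr0.le hr'.2.le 2) (sq_nonneg _)
    nlinarith [sq_nonneg (Q r - r * deriv Q r)]
  rw [e, Real.norm_of_nonneg (by positivity)]
  have e3 : 1 / ((m : ℝ) ^ 2 + k ^ 2 * r ^ 2) * (Q r + r * deriv Q r) ^ 2
      ≤ 2 * Q r ^ 2 + 2 * (d.R ^ 2 * deriv Q r ^ 2) :=
    (mul_le_of_le_one_left (sq_nonneg _) e1).trans e2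
  calc _ ≤ (Q r ^ 2 + (2 * Q r ^ 2 + 2 * (d.R ^ 2 * deriv Q r ^ 2))) * d.R := by
        refine mul_le_mul (by linarith) hr'.2.le hr0.le (by positivity)
    _ = _ := by ring

/-- A calibration argument: `Φ = 2β (rQ) v - β² q v` has increment `-v(r₀) β²` over the vacuum, and
the energy density minus `Φ'` is a sum of two squares, both zero when `rQ = βq`. -/
lemma VacuumPair.le_vacuumEnergy (hd : d.Admissible) (hm : m ≠ 0)
    (h : VacuumPair d.r₀ d.R (vacCoeff m k) q v) (hQ : d.MemH1Vac Q) (hQR : Q d.R = 0) :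
    -v d.r₀ * (d.r₀ * Q d.r₀) ^ 2 ≤ vacuumEnergy d m k Q := by
  have hr₀ := hd.r₀_pos
  have hlt := hd.r₀_lt_R
  have hac := hQ.1
  set β := d.r₀ * Q d.r₀ with hβ
  have hcq := h.contDiffOn_q hr₀ hlt (vacCoeff_contDiffOn hd)
  have hcv := h.contDiffOn_v hr₀ hlt
  have hu : uIcc d.r₀ d.R = Icc d.r₀ d.R := uIcc_of_le hlt.le
  have acv : AbsolutelyContinuousOnInterval v d.r₀ d.R :=
    ContDiffOn.absolutelyContinuousOnInterval (by rwa [hu])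
  have acq : AbsolutelyContinuousOnInterval q d.r₀ d.R :=
    ContDiffOn.absolutelyContinuousOnInterval (by rw [hu]; exact hcq.of_le (by norm_num))
  have acid : AbsolutelyContinuousOnInterval (fun x : ℝ => x) d.r₀ d.R :=
    ContDiffOn.absolutelyContinuousOnInterval contDiffOn_id
  have acΦ := ((((acid.fun_mul hac).fun_mul acv).const_mul (2 * β)).fun_sub
    ((acq.fun_mul acv).const_mul (β ^ 2)))
  have hint := acΦ.integral_deriv_eq_sub
  have hi := acΦ.intervalIntegrable_deriv
  rw [intervalIntegral.integral_of_le hlt.le, integral_Ioc_eq_integral_Ioo] at hint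
  rw [intervalIntegrable_iff_integrableOn_Ioo_of_le hlt.le] at hi
  have hval : -v d.r₀ * β ^ 2 = 2 * β * (d.R * Q d.R * v d.R) - β ^ 2 * (q d.R * v d.R)
      - (2 * β * (d.r₀ * Q d.r₀ * v d.r₀) - β ^ 2 * (q d.r₀ * v d.r₀)) := by
    rw [hQR, h.q_R, h.q_a, ← hβ]
    ring
  rw [hval]
  refine hint.symm.le.trans ?_
  refine integral_mono_ae hi (integrable_vacuumEnergy hd hm hQ) ?_
  have hdiff := ae_restrict_of_ae (s := Ioo d.r₀ d.R) hac.ae_differentiableAt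
  filter_upwards [hdiff, ae_restrict_mem measurableSet_Ioo] with r hr hr'
  have hr0 : 0 < r := hr₀.trans hr'.1
  have hrc := Ioo_subset_Icc_self hr'
  have hn := Icc_mem_nhds hr'.1 hr'.2
  have hQr := (hr (by rw [hu]; exact hrc)).hasDerivAt
  have hq' := (h.dq r hrc).hasDerivAt hn
  have hv' := (h.dv r hrc).hasDerivAt hn
  have hp' := (hasDerivAt_id' r).fun_mul hQr
  have hpos := vacDen_pos (k := k) hm r
  rw [(((hp'.fun_mul hv').const_mul (2 * β)).fun_sub ((hq'.fun_mul hv').const_mul (β ^ 2))).deriv,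
    hp'.deriv]
  generalize 1 * Q r + r * deriv Q r = p'
  rw [vacCoeff]
  have e1 : (Q r ^ 2 + 1 / (m ^ 2 + k ^ 2 * r ^ 2) * p' ^ 2) * r
      - (2 * β * (p' * v r + r * Q r * (q r / r))
        - β ^ 2 * ((m ^ 2 + k ^ 2 * r ^ 2) / r * v r * v r + q r * (q r / r)))
      = (r * Q r - β * q r) ^ 2 / r
        + (p' - β * ((m ^ 2 + k ^ 2 * r ^ 2) / r * v r)) ^ 2 * r / (m ^ 2 + k ^ 2 * r ^ 2) := by
    field_simp
    ring
  have e2 : 0 ≤ (r * Q r - β * q r) ^ 2 / r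
        + (p' - β * ((m ^ 2 + k ^ 2 * r ^ 2) / r * v r)) ^ 2 * r / (m ^ 2 + k ^ 2 * r ^ 2) := by
    positivity
  linarith

lemma memLp_of_continuousOn {a b : ℝ} {f g : ℝ → ℝ} (hg : ContinuousOn g (Icc a b))
    (hfg : ∀ r ∈ Ioo a b, f r = g r) : MemLp f 2 (volume.restrict (Ioo a b)) := by
  obtain ⟨C, hC⟩ := isCompact_Icc.exists_bound_of_continuousOn hg
  have h1 : AEStronglyMeasurable g (volume.restrict (Ioo a b)) :=
    (hg.mono Ioo_subset_Icc_self).aestronglyMeasurable measurableSet_Ioo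
  have h2 : g =ᵐ[volume.restrict (Ioo a b)] f :=
    (ae_restrict_mem measurableSet_Ioo).mono fun r hr => (hfg r hr).symm
  refine (MemLp.of_bound h1 C ?_).ae_eq h2
  exact (ae_restrict_mem measurableSet_Ioo).mono fun r hr => hC r (Ioo_subset_Icc_self hr)

/-- The field generated by the vacuum pair. -/
lemma VacuumPair.exists_field (hd : d.Admissible) (hm : m ≠ 0)
    (h : VacuumPair d.r₀ d.R (vacCoeff m k) q v) (β : ℝ) :
    ∃ Q, d.MemH1Vac Q ∧ ContDiffOn ℝ 2 Q (Icc d.r₀ d.R) ∧ Q d.R = 0 ∧ d.r₀ * Q d.r₀ = β ∧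
      vacuumEnergy d m k Q = -v d.r₀ * β ^ 2 ∧
      (∀ r ∈ Ioo d.r₀ d.R,
        deriv (fun x => x / (m ^ 2 + k ^ 2 * x ^ 2) * deriv (fun y => y * Q y) x) r - Q r = 0) ∧
      d.QthetaAtInterface m k Q = -v d.r₀ * m * β / d.r₀ := by
  have hr₀ := hd.r₀_pos
  have hlt := hd.r₀_lt_R
  have hcq := h.contDiffOn_q hr₀ hlt (vacCoeff_contDiffOn hd)
  have hcv := h.contDiffOn_v hr₀ hlt
  have hne : ∀ r ∈ Icc d.r₀ d.R, r ≠ 0 := fun r hr => (hr₀.trans_le hr.1).ne'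
  have hu : uIcc d.r₀ d.R = Icc d.r₀ d.R := uIcc_of_le hlt.le
  set Q : ℝ → ℝ := fun r => β * q r / r with hQ
  have hQ2 : ContDiffOn ℝ 2 Q (Icc d.r₀ d.R) := (contDiffOn_const.mul hcq).div contDiffOn_id hne
  have hdp : ∀ r ∈ Icc d.r₀ d.R, HasDerivWithinAt (fun y => y * Q y) (β * (vacCoeff m k r * v r))
      (Icc d.r₀ d.R) r := fun r hr => by
    refine ((h.dq r hr).const_mul β).congr (fun y hy => ?_) ?_
    · have := hne y hy
      simp only [hQ]
      field_simp
    · have := hne r hr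
      simp only [hQ]
      field_simp
  have hdp' : ∀ r ∈ Ioo d.r₀ d.R, deriv (fun y => y * Q y) r = β * (vacCoeff m k r * v r) :=
    fun r hr => ((hdp r (Ioo_subset_Icc_self hr)).hasDerivAt (Icc_mem_nhds hr.1 hr.2)).deriv
  refine ⟨Q, ⟨?_, ?_, ?_⟩, hQ2, ?_, ?_, ?_, fun r hr => ?_, ?_⟩
  · exact ContDiffOn.absolutelyContinuousOnInterval (by rw [hu]; exact hQ2.of_le (by norm_num))
  · exact memLp_of_continuousOn hQ2.continuousOn fun r _ => rfl
  · refine memLp_of_continuousOn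
      (hQ2.continuousOn_derivWithin (uniqueDiffOn_Icc hlt) (by norm_num)) fun r hr => ?_
    rw [derivWithin_of_mem_nhds (Icc_mem_nhds hr.1 hr.2)]
  · simp [hQ, h.q_R]
  · simp only [hQ, h.q_a]
    field_simp
  · have acv : AbsolutelyContinuousOnInterval v d.r₀ d.R :=
      ContDiffOn.absolutelyContinuousOnInterval (by rwa [hu])
    have acq : AbsolutelyContinuousOnInterval q d.r₀ d.R :=
      ContDiffOn.absolutelyContinuousOnInterval (by rw [hu]; exact hcq.of_le (by norm_num))
    have acΦ := (acq.fun_mul acv).const_mul (β ^ 2)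
    have hint := acΦ.integral_deriv_eq_sub
    rw [intervalIntegral.integral_of_le hlt.le, integral_Ioc_eq_integral_Ioo] at hint
    have hval : -v d.r₀ * β ^ 2 = β ^ 2 * (q d.R * v d.R) - β ^ 2 * (q d.r₀ * v d.r₀) := by
      rw [h.q_R, h.q_a]
      ring
    rw [hval]
    refine Eq.trans ?_ hint
    refine setIntegral_congr_fun measurableSet_Ioo fun r hr => ?_
    have hrc := Ioo_subset_Icc_self hr
    have hn := Icc_mem_nhds hr.1 hr.2
    have hr0 := hne r hrc
    have hpos := vacDen_pos (k := k) hm r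
    have e := ((((h.dq r hrc).hasDerivAt hn).fun_mul ((h.dv r hrc).hasDerivAt hn)).const_mul
      (β ^ 2)).deriv
    simp only [hdp' r hr]
    refine Eq.trans ?_ e.symm
    simp only [hQ, vacCoeff]
    field_simp
    ring
  · have he : (fun x => x / (m ^ 2 + k ^ 2 * x ^ 2) * deriv (fun y => y * Q y) x)
        =ᶠ[𝓝 r] fun x => β * v x := by
      filter_upwards [Ioo_mem_nhds hr.1 hr.2] with x hx
      rw [hdp' x hx, vacCoeff]
      have hpos := vacDen_pos (k := k) hm x
      have := hne x (Ioo_subset_Icc_self hx)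
      field_simp
    rw [he.deriv_eq, (((h.dv r (Ioo_subset_Icc_self hr)).hasDerivAt
      (Icc_mem_nhds hr.1 hr.2)).const_mul β).deriv]
    simp only [hQ]
    ring
  · have hl := left_mem_Icc.2 hlt.le
    rw [Data.QthetaAtInterface, (hdp d.r₀ hl).derivWithin (uniqueDiffOn_Icc hlt _ hl), vacCoeff]
    have hpos := vacDen_pos (k := k) hm d.r₀
    field_simp

/-- Everything that is used about the vacuum: minimal energy for given boundary values. -/
lemma exists_vacuum (hd : d.Admissible) (hm : m ≠ 0) (k : ℤ) : ∃ θ : ℝ, 0 ≤ θ ∧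
    (|m| = 1 ∧ k = 0 → θ ≠ 1) ∧
    (∀ Q, d.MemH1Vac Q → Q d.R = 0 → θ * (d.r₀ * Q d.r₀) ^ 2 ≤ vacuumEnergy d m k Q) ∧
    ∀ β, ∃ Q, d.MemH1Vac Q ∧ ContDiffOn ℝ 2 Q (Icc d.r₀ d.R) ∧ Q d.R = 0 ∧ d.r₀ * Q d.r₀ = β ∧
      vacuumEnergy d m k Q = θ * β ^ 2 ∧
      (∀ r ∈ Ioo d.r₀ d.R,
        deriv (fun x => x / (m ^ 2 + k ^ 2 * x ^ 2) * deriv (fun y => y * Q y) x) r - Q r = 0) ∧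
      d.QthetaAtInterface m k Q = θ * m * β / d.r₀ := by
  have hr₀ := hd.r₀_pos
  obtain ⟨q, v, h⟩ := exists_vacuumPair hr₀ hd.r₀_lt_R
    (vacCoeff_contDiffOn (m := m) (k := k) hd).continuousOn fun r hr =>
      div_pos (vacDen_pos hm r) (hr₀.trans_le hr.1)
  refine ⟨-v d.r₀, by linarith [h.v_a], ?_, fun Q hQ hQR => h.le_vacuumEnergy hd hm hQ hQR,
    h.exists_field hd hm⟩
  rintro ⟨h1, h2⟩ h3
  refine h.v_a_ne hr₀ hd.r₀_lt_R (fun r _ => ?_) (by linarith)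
  have h4 : (m : ℝ) ^ 2 = 1 := by
    rw [← sq_abs, ← Int.cast_abs, h1]
    norm_num
  rw [vacCoeff, h2, h4]
  simp

end ZPinch

/-! ### Ground states of the pencil and the energies expressed by it. -/

namespace ZPinch

variable {d : Data} {m k : ℤ} {core : Profile → Prop} {τ s : ℝ} {L : ℝ → ℝ} {u w : Profile}

/-- The energy with viscosities `s ε`, `s δ` and boundary weight `τ`. -/
noncomputable def pencil (d : Data) (m k : ℤ) (τ s : ℝ) (u : Profile) : ℝ :=
  gf d m k (cI d m) τ u u + s * qf d.r₀ m k (cD d.ε d.δ) u u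

/-- `L s` is the lowest eigenvalue of the pencil. -/
structure IsGround (d : Data) (m k : ℤ) (core : Profile → Prop) (τ : ℝ) (L : ℝ → ℝ) : Prop where
  le : ∀ s, 0 < s → ∀ u, d.MemCompletion core m k u →
    L s * qf d.r₀ m k (cJ d) u u ≤ pencil d m k τ s u
  attained : ∀ s, 0 < s → ∃ w, d.MemCompletion core m k w ∧ qf d.r₀ m k (cJ d) w w = 1 ∧
    pencil d m k τ s w = L s

lemma pencil_eq (hd : d.Admissible) (hu : FiniteNorm d m k u) (s : ℝ) :
    gf d m k (fun i r => cI d m i r + s * cD d.ε d.δ i r) τ u u = pencil d m k τ s u :=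
  gf_add_smul hd (Adm.cI hd m) (Adm.cD d hd.ε_pos.le hd.δ_pos.le) s hu hu

lemma gf_cE (hd : d.Admissible) (hu : FiniteNorm d m k u) (s l : ℝ) :
    gf d m k (cE d m s l) τ u u = pencil d m k τ s u - l * qf d.r₀ m k (cJ d) u u := by
  refine (gf_add_smul hd ((Adm.cI hd m).add_smul (Adm.cD d hd.ε_pos.le hd.δ_pos.le) s)
    (Adm.cJ hd) (-l) hu hu).trans ?_
  rw [pencil_eq hd hu]
  ring

lemma pencil_scale (hd : d.Admissible) (hu : FiniteNorm d m k u) (s c : ℝ) :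
    pencil d m k τ s (Profile.comb c 0 u u) = c ^ 2 * pencil d m k τ s u := by
  have hF := (hu.comb hd hu c 0).1
  rw [← pencil_eq hd hF, ← pencil_eq hd hu]
  exact gf_scale hd ((Adm.cI hd m).add_smul (Adm.cD d hd.ε_pos.le hd.δ_pos.le) s) hu c

theorem GoodCore.exists_isGround (hcore : GoodCore d m k core) (hd : d.Admissible) (hτ : 0 ≤ τ) :
    ∃ L, IsGround d m k core τ L := by
  have hcD := Adm.cD d hd.ε_pos.le hd.δ_pos.le
  obtain ⟨κ, hκ, hnrm⟩ := exists_nrm_le hd hd.ε_pos hd.δ_pos m k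
  obtain ⟨C, hC, hlow⟩ := exists_lower_bound hd m k
  have key : ∀ s, 0 < s → ∃ w, d.MemCompletion core m k w ∧ qf d.r₀ m k (cJ d) w w = 1 ∧
      ∀ u, d.MemCompletion core m k u →
        pencil d m k τ s w * qf d.r₀ m k (cJ d) u u ≤ pencil d m k τ s u := by
    intro s hs
    -- The constant `C` compensates the ideal energy, and `s` is added because the dissipation
    -- controls the norm only together with `J`. The boundary term is dropped by `τ ≥ 0`.
    have hcoer : ∀ u, FiniteNorm d m k u → s * κ * nrm d m k u
        ≤ gf d m k (fun i r => cI d m i r + s * cD d.ε d.δ i r) τ u u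
          + (C + s) * qf d.r₀ m k (cJ d) u u := fun u hu => by
      rw [pencil_eq hd hu, pencil, gf]
      have h1 := mul_le_mul_of_nonneg_left (hnrm u hu) hs.le
      have h2 := hlow u hu
      have h3 : 0 ≤ τ * (u.ξ d.r₀ * u.ξ d.r₀) := mul_nonneg hτ (mul_self_nonneg _)
      linarith
    obtain ⟨w, hw, hJ, hmin⟩ := hcore.exists_minimizer hd ((Adm.cI hd m).add_smul hcD s)
      (mul_pos hs hκ) hcoer (hcore.exists_J_ne_zero hd)
    refine ⟨w, hw, hJ, fun u hu => ?_⟩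
    have := hmin u hu
    rwa [pencil_eq hd (hcore.finiteNorm hd hw), pencil_eq hd (hcore.finiteNorm hd hu)] at this
  have : Nonempty Profile := ⟨⟨fun _ => 0, fun _ => 0, fun _ => 0⟩⟩
  choose! W hW hJ hmin using key
  exact ⟨fun s => pencil d m k τ s (W s), hmin, fun s hs => ⟨W s, hW s hs, hJ s hs, rfl⟩⟩

lemma GoodCore.exists_ideal_bound (hcore : GoodCore d m k core) (hd : d.Admissible) (hτ : 0 ≤ τ) :
    ∃ C : ℝ, ∀ u : {u : Profile // d.MemCompletion core m k u ∧ qf d.r₀ m k (cJ d) u u = 1},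
      -C ≤ gf d m k (cI d m) τ u.1 u.1 := by
  obtain ⟨C, hC, hlow⟩ := exists_lower_bound hd m k
  refine ⟨C, fun u => ?_⟩
  have h1 := hlow u.1 (hcore.finiteNorm hd u.2.1)
  have h3 : 0 ≤ τ * (u.1.ξ d.r₀ * u.1.ξ d.r₀) := mul_nonneg hτ (mul_self_nonneg _)
  rw [u.2.2] at h1
  rw [gf]
  linarith

namespace IsGround

variable (hL : IsGround d m k core τ L)
include hL

lemma congr {L' : ℝ → ℝ} (h : ∀ s, 0 < s → L' s = L s) : IsGround d m k core τ L' :=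
  ⟨fun s hs u hu => by rw [h s hs]; exact hL.le s hs u hu,
    fun s hs => by rw [h s hs]; exact hL.attained s hs⟩

lemma isPencilMin : IsPencilMin
    (P := {u : Profile // d.MemCompletion core m k u ∧ qf d.r₀ m k (cJ d) u u = 1})
    (fun u => gf d m k (cI d m) τ u.1 u.1) (fun u => qf d.r₀ m k (cD d.ε d.δ) u.1 u.1) L where
  le s hs u := by
    have := hL.le s hs u.1 u.2.1
    rwa [u.2.2, mul_one] at this
  attained s hs := by
    obtain ⟨w, hw, hJ, h⟩ := hL.attained s hs
    exact ⟨⟨w, hw, hJ⟩, h.symm⟩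

lemma exists_ELSystem (hcore : GoodCore d m k core) (hd : d.Admissible) (hs : 0 < s)
    (hw : d.MemCompletion core m k w)
    (hE : pencil d m k τ s w = L s * qf d.r₀ m k (cJ d) w w) :
    ∃ X, ELSystem d m k s (L s) τ w X := by
  have hwF := hcore.finiteNorm hd hw
  refine hcore.exists_ELSystem hd hs hwF fun φ hφ => ?_
  refine hcore.first_variation hd (Adm.cE hd m s (L s)) hw ?_ (fun v hv => ?_)
    (hcore.mem_of_core hd hφ)
  · rw [gf_cE hd hwF, hE, sub_self]
  · rw [gf_cE hd (hcore.finiteNorm hd hv)]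
    exact sub_nonneg.2 (hL.le s hs v hv)

/-- Minimizers dissipate. -/
lemma dissipation_pos (hcore : GoodCore d m k core) (hd : d.Admissible) (hmk : m ≠ 0 ∨ k ≠ 0)
    (hτ : |m| = 1 ∧ k = 0 → τ ≠ d.B d.r₀ ^ 2) (hs : 0 < s) (hw : d.MemCompletion core m k w)
    (hJ : qf d.r₀ m k (cJ d) w w = 1) (hE : pencil d m k τ s w = L s) :
    0 < qf d.r₀ m k (cD d.ε d.δ) w w := by
  refine lt_of_le_of_ne (qf_cD_nonneg hd.ε_pos.le hd.δ_pos.le) fun h0 => ?_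
  have hwF := hcore.finiteNorm hd hw
  -- Without dissipation the minimizer is a translation. Being a minimizer, it satisfies the natural
  -- boundary condition, which for `ξ' = 0`, `η = 0`, `ζ = -mξ`, `m² = 1` reduces to `τ = B(r₀)²`.
  obtain ⟨hmk1, hξ, hr⟩ := rigid hd hmk hwF h0.symm (by rw [hJ]; exact one_ne_zero)
  obtain ⟨X, hX⟩ := hL.exists_ELSystem hcore hd hs hw (by rw [hE, hJ, mul_one])
  have hR : d.r₀ ∈ Ioc 0 d.r₀ := ⟨hd.r₀_pos, le_rfl⟩
  obtain ⟨-, hη, hζ⟩ := hr d.r₀ hR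
  have hX0 : X.ξ d.r₀ = 0 := by
    have h1 : HasDerivWithinAt w.ξ 0 (Ioc 0 d.r₀) d.r₀ :=
      (hasDerivWithinAt_const d.r₀ _ (w.ξ d.r₀)).congr (fun r hr' => (hr r hr').1) rfl
    exact (uniqueDiffOn_Ioc 0 d.r₀ _ hR).eq_deriv _ (hX.dξ _ hR) h1
  have hm2 : (m : ℝ) ^ 2 = 1 := by
    rw [← sq_abs, ← Int.cast_abs, hmk1.1]
    norm_num
  have hb := hX.bc1
  simp only [flux1, hX0, hη, hζ, hmk1.2, Data.Bsq, hd.p_r₀] at hb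
  refine hτ hmk1 (mul_right_cancel₀ hξ ?_)
  push_cast at hb
  linear_combination hb + (s * d.δ - 2 / 3 * (s * d.ε)) * w.ξ d.r₀ * hm2

lemma strictMonoOn (hcore : GoodCore d m k core) (hd : d.Admissible) (hmk : m ≠ 0 ∨ k ≠ 0)
    (hτ : |m| = 1 ∧ k = 0 → τ ≠ d.B d.r₀ ^ 2) : StrictMonoOn L (Ioi 0) :=
  hL.isPencilMin.strictMonoOn fun _ hs u hu =>
    hL.dissipation_pos hcore hd hmk hτ hs u.2.1 u.2.2 hu.symm

/-- The dissipation alone attains its minimum on `J = 1`; outside the exceptional mode there is no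
admissible rigid motion, so this minimum is positive and serves as the slope. -/
lemma exists_linear_lower_bound (hcore : GoodCore d m k core) (hd : d.Admissible) (hτ : 0 ≤ τ)
    (hmk : m ≠ 0 ∨ k ≠ 0) (hne : ¬(|m| = 1 ∧ k = 0)) :
    ∃ c : ℝ, 0 < c ∧ ∃ C : ℝ, ∀ s, 0 < s → -C + s * c ≤ L s := by
  have hcD := Adm.cD d hd.ε_pos.le hd.δ_pos.le
  obtain ⟨C, hC⟩ := hcore.exists_ideal_bound hd hτ
  obtain ⟨κ, hκ, hnrm⟩ := exists_nrm_le hd hd.ε_pos hd.δ_pos m k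
  obtain ⟨w, hw, hJ, hmin⟩ := hcore.exists_minimizer (κ := κ) (C := 1) (τ := 0) hd hcD hκ
    (fun u hu => by rw [gf_zero, one_mul]; exact hnrm u hu) (hcore.exists_J_ne_zero hd)
  simp only [gf_zero] at hmin
  have hpos : 0 < qf d.r₀ m k (cD d.ε d.δ) w w := by
    refine lt_of_le_of_ne (qf_cD_nonneg hd.ε_pos.le hd.δ_pos.le) fun h0 => hne ?_
    exact (rigid hd hmk (hcore.finiteNorm hd hw) h0.symm (by rw [hJ]; exact one_ne_zero)).1
  refine ⟨_, hpos, C, fun s hs => hL.isPencilMin.lower_bound hC (fun u => ?_) hs⟩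
  have := hmin u.1 u.2.1
  rwa [u.2.2, mul_one] at this

lemma exists_neg (hd : d.Admissible)
    (h : ∃ u, d.MemCompletion core m k u ∧ gf d m k (cI d m) τ u u < 0) :
    ∃ s, 0 < s ∧ L s < 0 := by
  obtain ⟨u, hu, hneg⟩ := h
  set D := qf d.r₀ m k (cD d.ε d.δ) u u with hD
  have hD0 : 0 ≤ D := qf_cD_nonneg hd.ε_pos.le hd.δ_pos.le
  set I := gf d m k (cI d m) τ u u with hI
  -- Small enough for `I + s D < 0`; the `1` covers the case `D = 0`.
  have hs : 0 < -I / (D + 1) := div_pos (by linarith) (by linarith)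
  refine ⟨-I / (D + 1), hs, ?_⟩
  have h1 := hL.le _ hs u hu
  rw [pencil, ← hD, ← hI] at h1
  have h2 : -I / (D + 1) * D < -I := by
    rw [div_mul_eq_mul_div, div_lt_iff₀ (by linarith)]
    nlinarith
  have h3 : 0 ≤ qf d.r₀ m k (cJ d) u u := qf_cJ_nonneg hd
  by_contra! h4
  have := mul_nonneg h4 h3
  linarith

lemma existsUnique (hcore : GoodCore d m k core) (hd : d.Admissible) (hmk : m ≠ 0 ∨ k ≠ 0)
    (hτ0 : 0 ≤ τ) (hτ : |m| = 1 ∧ k = 0 → τ ≠ d.B d.r₀ ^ 2) (hneg : ∃ s, 0 < s ∧ L s < 0) :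
    ∃! s, IsFixedRate L s := by
  obtain ⟨C, hC⟩ := hcore.exists_ideal_bound hd hτ0
  refine existsUnique_isFixedRate hL.isPencilMin.continuousOn (hL.strictMonoOn hcore hd hmk hτ)
    (C := C) (fun s hs => ?_) hneg
  have := hL.isPencilMin.lower_bound hC (c := 0)
    (fun u => qf_cD_nonneg hd.ε_pos.le hd.δ_pos.le) hs
  linarith

/-- A ground state with prescribed normalisation. -/
lemma exists_normalized (hcore : GoodCore d m k core) (hd : d.Admissible) (hs : 0 < s) {a : ℝ}
    (ha : 0 ≤ a) : ∃ w, d.MemCompletion core m k w ∧ qf d.r₀ m k (cJ d) w w = a ∧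
      pencil d m k τ s w = L s * a := by
  obtain ⟨w, hw, hJ, hE⟩ := hL.attained s hs
  have hwF := hcore.finiteNorm hd hw
  refine ⟨Profile.comb (√a) 0 w w, hcore.mem_comb hd hw hw _ _, ?_, ?_⟩
  · rw [← gf_zero, gf_scale hd (Adm.cJ hd) hwF, gf_zero, hJ, Real.sq_sqrt ha, mul_one]
  · rw [pencil_scale hd hwF, hE, Real.sq_sqrt ha, mul_comm]

end IsGround

/-! ### The energies in terms of the pencil -/

lemma J_eq : d.J u = 2 * Real.pi ^ 2 * qf d.r₀ m k (cJ d) u u := by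
  rw [Data.J, qf]
  simp only [cJ_sum]
  congr 2
  ext r
  ring

lemma integral_viscDensity (s : ℝ) : ∫ r in Ioo 0 d.r₀, Data.viscDensity (s * d.ε) (s * d.δ) m k u r
    = s * qf d.r₀ m k (cD d.ε d.δ) u u := by
  rw [qf, ← integral_const_mul]
  congr 1
  ext r
  rw [cD_sum, Data.viscDensity]
  ring

lemma ae_deriv_id_mul (hu : FiniteNorm d m k u) :
    ∀ᵐ r ∂(vol d.r₀), 0 < r ∧ deriv (fun x => x * u.ξ x) r = u.ξ r + r * deriv u.ξ r := by
  filter_upwards [hu.lac_ξ.ae_differentiableAt, ae_restrict_mem measurableSet_Ioo] with r h hr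
  refine ⟨hr.1, ?_⟩
  rw [((hasDerivAt_id' r).fun_mul h.hasDerivAt).deriv]
  ring

lemma E0_eq (hu : FiniteNorm d 0 k u) (s : ℝ) :
    d.E0 k s u = 2 * Real.pi ^ 2 * pencil d 0 k 0 s u := by
  rw [Data.E0, integral_viscDensity, pencil, gf_zero, mul_add]
  congr 2
  refine integral_congr_ae ?_
  filter_upwards [ae_deriv_id_mul hu] with r ⟨hr, h⟩
  rw [h, cI_sum]
  push_cast
  field_simp
  ring

/-- Pointwise, the square with weight `m² + k² r²` and the `(ξ - rξ')²` term recombine into `m² B²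
η² / r` and `B² (krη + ξ - rξ')² / r`. The integrals may be separated because the `ξ²` term is
integrable by itself and the other two are nonnegative with integrable sum. -/
lemma Em_eq (hd : d.Admissible) (hm : m ≠ 0) (hu : FiniteNorm d m k u) (s : ℝ) (Q : ℝ → ℝ) :
    d.Em m k s u Q = 2 * Real.pi ^ 2 * (pencil d m k 0 s u + vacuumEnergy d m k Q) := by
  set f₃ : ℝ → ℝ := fun r =>
    m ^ 2 * d.B r ^ 2 / (r * (m ^ 2 + k ^ 2 * r ^ 2)) * (u.ξ r - r * deriv u.ξ r) ^ 2 with hf₃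
  set f₄ : ℝ → ℝ := fun r => (2 * d.dp r + m ^ 2 * d.B r ^ 2 / r) * u.ξ r ^ 2 with hf₄
  set f₁ : ℝ → ℝ := fun r => ((m ^ 2 + k ^ 2 * r ^ 2)
            * (d.B r / r * u.η r
                + (-k * d.B r * deriv (fun x => x * u.ξ x) r + 2 * k * d.B r * u.ξ r)
                    / (m ^ 2 + k ^ 2 * r ^ 2)) ^ 2
          + d.γ * d.p r
            * (1 / r * deriv (fun x => x * u.ξ x) r - k * u.η r + m * u.ζ r / r) ^ 2) * r with hf₁
  set F : ℝ → ℝ := fun r => ∑ i, cI d m i r * (ell m k u r i * ell m k u r i) with hF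
  have hFi : Integrable F (vol d.r₀) := (Adm.cI hd m).integrable hd hu hu
  have hsum : ∀ᵐ r ∂(vol d.r₀), F r = f₁ r + f₃ r + f₄ r := by
    filter_upwards [ae_deriv_id_mul hu] with r hr
    obtain ⟨hr, h⟩ := hr
    have hpos := vacDen_pos (k := k) hm r
    simp only [hF, hf₁, hf₃, hf₄, cI_sum, h]
    field_simp
    ring
  have h4i : Integrable f₄ (vol d.r₀) := by
    have hA : Adm d.r₀ (fun i r => if i = 7 then cI d m i r else 0) := by
      obtain ⟨C, hC0, hC⟩ := (Adm.cI hd m).bdd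
      refine ⟨fun i => ?_, C, hC0, fun i r hr => ?_⟩
      · by_cases h : i = 7
        · simp only [h, if_true]
          exact (Adm.cI hd m).meas 7
        · simp only [h, if_false]
          exact aestronglyMeasurable_const
      · by_cases h : i = 7
        · simp only [h, if_true]
          exact hC 7 r hr
        · simp only [h, if_false, abs_zero]
          exact mul_nonneg hC0 (wt_nonneg hr.1.le i)
    refine (hA.integrable hd hu hu).congr (Eventually.of_forall fun r => ?_)
    simp only [ite_mul, zero_mul, Finset.sum_ite_eq', Finset.mem_univ, if_true]
    simp only [hf₄, pow_two (u.ξ r)]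
    rfl
  have hpos1 : ∀ r ∈ Ioo 0 d.r₀, 0 ≤ f₁ r ∧ 0 ≤ f₃ r := fun r hr => by
    have h1 := hr.1
    have h2 := hd.p_nonneg r (Ioo_subset_Icc_self hr)
    have h3 := hd.γ_pos
    have hpos := vacDen_pos (k := k) hm r
    exact ⟨by simp only [hf₁]; positivity, by simp only [hf₃]; positivity⟩
  have h3i : Integrable f₃ (vol d.r₀) := by
    refine (hFi.sub h4i).mono' ?_ ?_
    · have c1 : ContinuousOn (fun r => m ^ 2 * d.B r ^ 2 / (r * ((m : ℝ) ^ 2 + k ^ 2 * r ^ 2)))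
          (Ioo 0 d.r₀) := by
        refine (continuousOn_const.mul (hd.continuousOn_B_sq.mono Ioo_subset_Ioc_self)).div
          (by fun_prop) fun r hr => ?_
        exact (mul_pos hr.1 (vacDen_pos hm r)).ne'
      exact (c1.aestronglyMeasurable measurableSet_Ioo).mul
        ((hu.lac_ξ.aestronglyMeasurable.sub (measurable_id.mul
          (measurable_deriv _)).aestronglyMeasurable).pow 2)
    · filter_upwards [hsum, ae_restrict_mem measurableSet_Ioo] with r h hr
      obtain ⟨h1, h3⟩ := hpos1 r hr
      rw [Real.norm_of_nonneg h3, Pi.sub_apply, h]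
      linarith
  have h1i : Integrable f₁ (vol d.r₀) := by
    refine ((hFi.sub h4i).sub h3i).congr ?_
    filter_upwards [hsum] with r h
    simp only [Pi.sub_apply, h]
    ring
  have hI : qf d.r₀ m k (cI d m) u u
      = (∫ r in Ioo 0 d.r₀, f₁ r) + (∫ r in Ioo 0 d.r₀, f₃ r) + ∫ r in Ioo 0 d.r₀, f₄ r := by
    have h13 : Integrable (fun r => f₁ r + f₃ r) (vol d.r₀) := h1i.add h3i
    rw [qf, ← integral_add h1i h3i, ← integral_add h13 h4i]
    exact integral_congr_ae hsum
  rw [Data.Em, integral_viscDensity, pencil, gf_zero, hI, vacuumEnergy]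
  ring

end ZPinch

namespace ZPinch

variable {d : Data} {m k : ℤ} {s : ℝ}

lemma two_pi_sq_pos : 0 < 2 * Real.pi ^ 2 := by positivity

/-! ### The case `m = 0` -/

lemma isLeast_quotients0 (hd : d.Admissible) {L : ℝ → ℝ} (hL : IsGround d 0 k Data.CoreX 0 L)
    (hs : 0 < s) : IsLeast (d.quotients0 k s) (L s) := by
  have hcore := goodCore_X hd k
  have hπ := two_pi_sq_pos
  constructor
  · obtain ⟨w, hw, hJ, hE⟩ := hL.attained s hs
    refine ⟨w, hw, ?_, ?_⟩
    · rw [J_eq (m := 0) (k := k), hJ, mul_one]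
      exact hπ.ne'
    · rw [J_eq (m := 0) (k := k), hJ, E0_eq (hcore.finiteNorm hd hw), hE]
      field_simp
  · rintro x ⟨u, hu, hJ, rfl⟩
    rw [J_eq (m := 0) (k := k)] at hJ ⊢
    have hpos : 0 < qf d.r₀ 0 k (cJ d) u u :=
      lt_of_le_of_ne (qf_cJ_nonneg hd) fun h => hJ (by rw [← h, mul_zero])
    rw [E0_eq (hcore.finiteNorm hd hu), mul_div_mul_left _ _ hπ.ne', le_div_iff₀ hpos]
    exact hL.le s hs u hu

lemma isGround_lam0 (hd : d.Admissible) (k : ℤ) : IsGround d 0 k Data.CoreX 0 (d.lam0 k) := by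
  obtain ⟨L, hL⟩ := (goodCore_X hd k).exists_isGround hd le_rfl
  exact hL.congr fun s hs => (isLeast_quotients0 hd hL hs).csInf_eq

lemma exists_mode_zero (hd : d.Admissible) (hfix : IsFixedRate (d.lam0 k) s) :
    ∃ w : Profile, d.MemX k w ∧ d.J w = 1 ∧ d.E0 k s w = d.lam0 k s ∧
      d.IsModeSolution 0 k (fun t => Profile.scale (Real.exp (s * t)) w) (fun _ _ => 0) := by
  have hcore := goodCore_X hd k
  have hL := isGround_lam0 hd k
  have hπ := two_pi_sq_pos
  obtain ⟨hs, hs2⟩ := isFixedRate_iff.1 hfix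
  -- The constraint functional carries the factor `2π²`, so `J = 1` means that its quadratic form
  -- equals `(2π²)⁻¹`.
  obtain ⟨w, hw, hJ, hE⟩ := hL.exists_normalized hcore hd hs (inv_nonneg.2 hπ.le)
  obtain ⟨X, hX⟩ := hL.exists_ELSystem hcore hd hs hw (by rw [hE, hJ])
  rw [show d.lam0 k s = -s ^ 2 by linarith] at hX
  refine ⟨w, hw, ?_, ?_, ?_⟩
  · rw [J_eq (m := 0) (k := k), hJ, mul_inv_cancel₀ hπ.ne']
  · rw [E0_eq (hcore.finiteNorm hd hw), hE]
    field_simp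
  · have := hX.isModeSolution hd (Q := fun _ => 0) contDiffOn_const (fun r _ => by simp) rfl
      (by simp) (by simp [Data.QthetaAtInterface])
    simpa using this

/-! ### The case `m ≠ 0` -/

lemma Bhat_r₀ (hd : d.Admissible) : d.Bhat d.r₀ = d.B d.r₀ := by
  have := hd.r₀_pos
  rw [Data.Bhat]
  field_simp

lemma pencil_add (τ s : ℝ) (u : Profile) :
    pencil d m k τ s u = pencil d m k 0 s u + τ * u.ξ d.r₀ ^ 2 := by
  simp only [pencil, gf]
  ring

/-- The boundary weight equivalent to the vacuum field of minimal energy. -/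
structure IsVacuumWeight (d : Data) (m k : ℤ) (τ : ℝ) : Prop where
  nonneg : 0 ≤ τ
  ne : |m| = 1 ∧ k = 0 → τ ≠ d.B d.r₀ ^ 2
  le : ∀ (x : ℝ) Q, d.MemH1Vac Q → Q d.R = 0 → m * d.Bhat d.r₀ * x = d.r₀ * Q d.r₀ →
    τ * x ^ 2 ≤ vacuumEnergy d m k Q
  exists_field : ∀ x : ℝ, ∃ Q, d.MemH1Vac Q ∧ ContDiffOn ℝ 2 Q (Icc d.r₀ d.R) ∧ Q d.R = 0 ∧
    m * d.Bhat d.r₀ * x = d.r₀ * Q d.r₀ ∧ vacuumEnergy d m k Q = τ * x ^ 2 ∧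
    (∀ r ∈ Ioo d.r₀ d.R,
      deriv (fun x => x / (m ^ 2 + k ^ 2 * x ^ 2) * deriv (fun y => y * Q y) x) r - Q r = 0) ∧
    τ * x = d.Bhat d.r₀ * d.QthetaAtInterface m k Q * d.r₀

/-- The interface condition prescribes `r₀ Q̂_r(r₀) = m B(r₀) ξ(r₀)`, whence `τ = θ (m B(r₀))²`. In
the exceptional mode `m² = 1` and `B(r₀) ≠ 0`, so `θ ≠ 1` becomes `τ ≠ B(r₀)²`. -/
lemma exists_isVacuumWeight (hd : d.Admissible) (hm : m ≠ 0) (k : ℤ) :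
    ∃ τ, IsVacuumWeight d m k τ := by
  have hr₀ := hd.r₀_pos
  obtain ⟨θ, h0, h1, h2, h3⟩ := exists_vacuum hd hm k
  refine ⟨θ * (m * d.B d.r₀) ^ 2, by positivity, fun h => ?_, fun x Q hQ hQR hb => ?_, fun x => ?_⟩
  · have hm2 : (m : ℝ) ^ 2 = 1 := by
      rw [← sq_abs, ← Int.cast_abs, h.1]
      norm_num
    have hB := hd.B_sq_r₀_pos
    intro h4
    refine h1 h (mul_right_cancel₀ hB.ne' ?_)
    rw [mul_pow, hm2] at h4
    linarith
  · have := h2 Q hQ hQR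
    rw [← hb, Bhat_r₀ hd] at this
    calc _ = θ * (m * d.B d.r₀ * x) ^ 2 := by ring
      _ ≤ _ := this
  · obtain ⟨Q, q1, q2, q3, q4, q5, q6, q7⟩ := h3 (m * d.Bhat d.r₀ * x)
    refine ⟨Q, q1, q2, q3, q4.symm, ?_, q6, ?_⟩
    · rw [q5, Bhat_r₀ hd]
      ring
    · rw [q7, Bhat_r₀ hd]
      field_simp

variable {τ : ℝ}

lemma exists_memA2 (hd : d.Admissible) (hm : m ≠ 0) (hτ : IsVacuumWeight d m k τ) {L : ℝ → ℝ}
    (hL : IsGround d m k Data.CoreY τ L) (hs : 0 < s) : ∃ (w : Profile) (Q : ℝ → ℝ),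
      d.MemA2 m k w Q ∧ d.Em m k s w Q = L s ∧
      pencil d m k τ s w = L s * qf d.r₀ m k (cJ d) w w ∧ ContDiffOn ℝ 2 Q (Icc d.r₀ d.R) ∧
      (∀ r ∈ Ioo d.r₀ d.R,
        deriv (fun x => x / (m ^ 2 + k ^ 2 * x ^ 2) * deriv (fun y => y * Q y) x) r - Q r = 0) ∧
      τ * w.ξ d.r₀ = d.Bhat d.r₀ * d.QthetaAtInterface m k Q * d.r₀ := by
  have hcore := goodCore_Y hd m k
  have hπ := two_pi_sq_pos
  obtain ⟨w, hw, hJ, hE⟩ := hL.exists_normalized hcore hd hs (inv_nonneg.2 hπ.le)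
  obtain ⟨Q, q1, q2, q3, q4, q5, q6, q7⟩ := hτ.exists_field (w.ξ d.r₀)
  refine ⟨w, Q, ⟨hw, q1, ?_, q4, q3⟩, ?_, by rw [hE, hJ], q2, q6, q7⟩
  · rw [J_eq (m := m) (k := k), hJ, mul_inv_cancel₀ hπ.ne']
  · rw [Em_eq hd hm (hcore.finiteNorm hd hw), q5, ← pencil_add, hE]
    field_simp

/-- For a given plasma profile the least vacuum energy is `τ ξ(r₀)²` and is attained, so minimizing
over both unknowns amounts to minimizing the pencil with boundary weight `τ`. -/
lemma isLeast_energies (hd : d.Admissible) (hm : m ≠ 0) (hτ : IsVacuumWeight d m k τ) {L : ℝ → ℝ}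
    (hL : IsGround d m k Data.CoreY τ L) (hs : 0 < s) : IsLeast (d.energies m k s) (L s) := by
  have hcore := goodCore_Y hd m k
  have hπ := two_pi_sq_pos
  constructor
  · obtain ⟨w, Q, h1, h2, -⟩ := exists_memA2 hd hm hτ hL hs
    exact ⟨w, Q, h1, h2.symm⟩
  · rintro x ⟨u, Q, ⟨hu, hQ, hJ, hb, hQR⟩, rfl⟩
    rw [J_eq (m := m) (k := k)] at hJ
    rw [Em_eq hd hm (hcore.finiteNorm hd hu)]
    have h1 := hL.le s hs u hu
    have h2 := hτ.le _ Q hQ hQR hb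
    rw [pencil_add] at h1
    calc L s = 2 * Real.pi ^ 2 * (L s * qf d.r₀ m k (cJ d) u u) := by
          linear_combination (-L s) * hJ
      _ ≤ _ := mul_le_mul_of_nonneg_left (by linarith) hπ.le

lemma isGround_lam (hd : d.Admissible) (hm : m ≠ 0) (hτ : IsVacuumWeight d m k τ) :
    IsGround d m k Data.CoreY τ (d.lam m k) := by
  obtain ⟨L, hL⟩ := (goodCore_Y hd m k).exists_isGround hd hτ.nonneg
  exact hL.congr fun s hs => (isLeast_energies hd hm hτ hL hs).csInf_eq

lemma exists_mode (hd : d.Admissible) (hm : m ≠ 0) (hfix : IsFixedRate (d.lam m k) s) :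
    ∃ (w : Profile) (Q : ℝ → ℝ), d.MemA2 m k w Q ∧ d.Em m k s w Q = d.lam m k s ∧
      d.IsModeSolution m k (fun t => Profile.scale (Real.exp (s * t)) w)
        (fun t r => Real.exp (s * t) * Q r) := by
  have hcore := goodCore_Y hd m k
  obtain ⟨τ, hτ⟩ := exists_isVacuumWeight hd hm k
  have hL := isGround_lam hd hm hτ
  obtain ⟨hs, hs2⟩ := isFixedRate_iff.1 hfix
  obtain ⟨w, Q, h1, h2, h3, h4, h5, h6⟩ := exists_memA2 hd hm hτ hL hs
  obtain ⟨X, hX⟩ := hL.exists_ELSystem hcore hd hs h1.1 h3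
  rw [show d.lam m k s = -s ^ 2 by linarith] at hX
  exact ⟨w, Q, h1, h2, hX.isModeSolution hd h4 h5 h1.2.2.2.2 h1.2.2.2.1 h6⟩

end ZPinch

theorem proposition3p7 (d : ZPinch.Data) (hd : d.Admissible) :
    -- the case `m = 0`
    (∀ k : ℤ, k ≠ 0 →
      (∀ s : ℝ, 0 < s → IsGLB (d.quotients0 k s) (d.lam0 k s)) ∧
      LocallyLipschitzOn (Set.Ioi 0) (d.lam0 k) ∧
      ContinuousOn (d.lam0 k) (Set.Ioi 0) ∧
      StrictMonoOn (d.lam0 k) (Set.Ioi 0) ∧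
      (∃ C₂ : ℝ, 0 < C₂ ∧ ∃ C : ℝ, ∀ s : ℝ, 0 < s → -C + s * C₂ ≤ d.lam0 k s) ∧
      (∃! s : ℝ, ZPinch.IsFixedRate (d.lam0 k) s) ∧
      (∀ s : ℝ, ZPinch.IsFixedRate (d.lam0 k) s →
        ∃ w : ZPinch.Profile, d.MemX k w ∧ d.J w = 1 ∧ d.E0 k s w = d.lam0 k s ∧
          d.IsModeSolution 0 k (fun t => ZPinch.Profile.scale (Real.exp (s * t)) w)
            (fun _ _ => 0))) ∧
    -- the case `m ≠ 0`
    (∀ m k : ℤ, m ≠ 0 →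
      (∀ s : ℝ, 0 < s → IsGLB (d.energies m k s) (d.lam m k s)) ∧
      LocallyLipschitzOn (Set.Ioi 0) (d.lam m k) ∧
      ContinuousOn (d.lam m k) (Set.Ioi 0) ∧
      StrictMonoOn (d.lam m k) (Set.Ioi 0) ∧
      (¬ (|m| = 1 ∧ k = 0) →
        ∃ C₃ : ℝ, 0 < C₃ ∧ ∃ C : ℝ, ∀ s : ℝ, 0 < s → -C + s * C₃ ≤ d.lam m k s) ∧
      ((∃ s : ℝ, 0 < s ∧ d.lam m k s < 0) → ∃! s : ℝ, ZPinch.IsFixedRate (d.lam m k) s) ∧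
      (∀ s : ℝ, ZPinch.IsFixedRate (d.lam m k) s →
        ∃ (w : ZPinch.Profile) (Q : ℝ → ℝ), d.MemA2 m k w Q ∧ d.Em m k s w Q = d.lam m k s ∧
          d.IsModeSolution m k (fun t => ZPinch.Profile.scale (Real.exp (s * t)) w)
            (fun t r => Real.exp (s * t) * Q r))) ∧
    -- the instability condition for `m ≠ 0`
    (∀ m : ℤ, m ≠ 0 →
      (∃ r ∈ Set.Ioo 0 d.r₀, 2 * d.dp r + m ^ 2 * d.B r ^ 2 / r < 0) →
      ∃ K : ℕ, ∀ k : ℤ, (K : ℤ) ≤ |k| → ∃! s : ℝ, ZPinch.IsFixedRate (d.lam m k) s) := by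
  refine ⟨fun k hk => ?_, fun m k hm => ?_, fun m hm hloc => ?_⟩
  · have hcore := ZPinch.goodCore_X hd k
    have hL := ZPinch.isGround_lam0 hd k
    have hτ : |(0 : ℤ)| = 1 ∧ k = 0 → (0 : ℝ) ≠ d.B d.r₀ ^ 2 := fun h => absurd h.2 hk
    refine ⟨fun s hs => ?_, hL.isPencilMin.locallyLipschitzOn, hL.isPencilMin.continuousOn,
      hL.strictMonoOn hcore hd (Or.inr hk) hτ,
      hL.exists_linear_lower_bound hcore hd le_rfl (Or.inr hk) fun h => hk h.2,
      hL.existsUnique hcore hd (Or.inr hk) le_rfl hτ (hL.exists_neg hd ?_),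
      fun s hs => ZPinch.exists_mode_zero hd hs⟩
    · exact (ZPinch.isLeast_quotients0 hd hL hs).isGLB
    · obtain ⟨v, hv, hneg⟩ := ZPinch.exists_neg_of_m_eq_zero hd hk hcore
      exact ⟨v, hv, by rwa [ZPinch.gf_zero]⟩
  · have hcore := ZPinch.goodCore_Y hd m k
    obtain ⟨τ, hτ⟩ := ZPinch.exists_isVacuumWeight hd hm k
    have hL := ZPinch.isGround_lam hd hm hτ
    exact ⟨fun s hs => (ZPinch.isLeast_energies hd hm hτ hL hs).isGLB,
      hL.isPencilMin.locallyLipschitzOn, hL.isPencilMin.continuousOn,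
      hL.strictMonoOn hcore hd (Or.inl hm) hτ.ne,
      hL.exists_linear_lower_bound hcore hd hτ.nonneg (Or.inl hm),
      hL.existsUnique hcore hd (Or.inl hm) hτ.nonneg hτ.ne,
      fun s hs => ZPinch.exists_mode hd hm hs⟩
  · obtain ⟨K, hK⟩ := ZPinch.exists_neg_of_local hd hm (ZPinch.goodCore_Y hd m) hloc
    refine ⟨K, fun k hk => ?_⟩
    obtain ⟨v, hv, hv0, hneg⟩ := hK k hk
    obtain ⟨τ, hτ⟩ := ZPinch.exists_isVacuumWeight hd hm k
    have hL := ZPinch.isGround_lam hd hm hτ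
    refine hL.existsUnique (ZPinch.goodCore_Y hd m k) hd (Or.inl hm) hτ.nonneg hτ.ne
      (hL.exists_neg hd ⟨v, hv, ?_⟩)
    -- The trial profile vanishes at the interface, so the vacuum contributes nothing.
    rw [ZPinch.gf, hv0]
    simpa using hneg
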